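/- **Signature and terms.** For all $i,j,k\in\mathbb N$ and every name $f$ from a countably infinite alphabet there is a function symbol $f^{i,j,k}$ of arity $i+j+k$. An $\mathrm{OL}^+$ is an ortholattice $(A,\wedge,\vee,\neg,\bot,\top)$ in which every $f^{i,j,k}$ is interpreted by an operation that is arbitrary in its first $i$ arguments, monotone in the next $j$ arguments and antimonotone in the last $k$ arguments. Let $\mathcal T$ be the set of terms in these operations over variables $x_0,x_1,\dots$. Write $S\sim T$ if $S=T$ holds in every $\mathrm{OL}^+$ under every assignment of the variables. Let $|T|$ be the number of nodes of the tree $T$ that are not negation signs (so that $x$ and $\neg x$ both have size $1$), and $\|T\|$ the number of all its nodes. A *normal form function* is a map $F:\mathcal T\to\mathcal T$ such that for all $S,T\in\mathcal T$: (i) $F(S)\sim S$; (ii) if $S\sim T$, then $F(S)$ and $F(T)$ are syntactically the same term; (iii) there is no $T'\sim F(S)$ with $|T'|<|F(S)|$. **Pseudo-negation-normal form.** Let $\mathcal N\subset\mathcal T$ be the set of terms in which $\neg$ stands only directly above variables and function symbols. For $S,T\in\mathcal N$ write $S\le_{\mathrm{BL}}T$ if $S\le T$ holds in all bounded lattices with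 function symbols when $\neg x$ is read as a new variable $x'$ and $\neg f(\dots)$ as $\bar f(\dots)$, where $\bar f$ is a new function symbol with the monotone and antimonotone arguments of $f$ exchanged, and nothing is assumed that relates $x'$ to $x$ or $\bar f$ to $f$. "Dually" means with $\vee,\wedge$, with $\top,\bot$ and with $\le_{\mathrm{BL}},\ge_{\mathrm{BL}}$ exchanged. All four maps below act through function symbols (and their negations), for example $\beta(\neg f(T_1,\dots))=\neg f(\beta(T_1),\dots)$, and fix $x$, $\neg x$, $\bot$, $\top$ otherwise. In the definitions of $\zeta$ and $\eta$ a disjunction is written as $T=T_1\vee\dots\vee T_m$ with $m\ge2$ where no $T_i$ is a disjunction, whatever its bracketing; $\bigvee(U_1,\dots,U_p)$ denotes $U_1\vee(U_2\vee(\dots\vee U_p))$; likewise for conjunctions. * $\delta:\mathcal T\to\mathcal N$ moves negations inwards: it commutes with $\vee$ and $\wedge$; $\delta(\neg\neg T)=\delta(T)$, $\delta(\neg(S\vee T))=\delta(\neg S)\wedge\delta(\neg T)$, $\delta(\neg(S\wedge T))=\delta(\neg S)\vee\delta(\neg T)$, $\delta(\neg\bot)=\top$, $\delta(\neg\top)=\bot$.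 * $\beta(S\vee T)=\top$ if $\delta(\neg\beta(S))\le_{\mathrm{BL}}\beta(S)\vee\beta(T)$ or $\delta(\neg\beta(T))\le_{\mathrm{BL}}\beta(S)\vee\beta(T)$, and $\beta(S\vee T)=\beta(S)\vee\beta(T)$ otherwise; dually for $\wedge$. * $\zeta(T_1\vee\dots\vee T_m)=\bigvee(\mathrm{acc})$, where $T'_i=\zeta(T_i)$, $T'=\bigvee(T'_1,\dots,T'_m)$ and $\mathrm{acc}$ is obtained from the list $T'_1,\dots,T'_m$ by applying the following as long as possible: split a member that is a disjunction into its disjuncts, and replace a member that is a conjunction with a conjunct $C\le_{\mathrm{BL}}T'$ by the first such $C$; dually for $\wedge$. * $\eta(T_1\vee\dots\vee T_m)=\bigvee(\mathrm{anti})$, where $T'_i=\eta(T_i)$ and $\mathrm{anti}$ consists of those $T'_i$ for which there is no $j$ with $T'_i\le_{\mathrm{BL}}T'_j$ and ($T'_j\not\le_{\mathrm{BL}}T'_i$ or $i>j$), sorted lexicographically by their prefix notations, where a term is written as a list of natural numbers, $x_r\mapsto(0,r)$, $\bot\mapsto(1)$, $\top\mapsto(2)$, $\neg\mapsto3$, $\wedge\mapsto4$,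 $\vee\mapsto5$ and $f^{i,j,k}\mapsto(6,f,i,j,k)$, each operator followed by its arguments (names $f$ being numbered by $\mathbb N$); dually for $\wedge$. **Machine model.** Random access machine with uniform cost: finitely many registers and finitely many arrays of natural numbers, initially $0$ apart from the input; assignments of constants, addition, truncated subtraction, indirect load and store, sequencing, `if` and `while` tests for non-zero registers; every elementary instruction and every test costs one step. Terms are given and returned in the prefix notation above, one number per cell, together with its length. **Theorem.** The function $\eta\circ\zeta\circ\beta\circ\delta:\mathcal T\to\mathcal T$ is a normal form function for $\mathrm{OL}^+$, and it is computable in quadratic time: there are a single program and a constant $C$ such that on every term $T\in\mathcal T$ the program halts with output $\eta(\zeta(\beta(\delta(T))))$ after at most $C\,\|T\|^2$ steps. -/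

import Mathlib

namespace OrthoPlus

/-! ### Signature and terms -/

/-- The variance of a function symbol in one of its arguments. -/
inductive Variance where
  | invariant
  | covariant
  | contravariant

/-- The opposite variance. -/
def Variance.opposite : Variance → Variance
  | .invariant => .invariant
  | .covariant => .contravariant
  | .contravariant => .covariant

/-- The relation that a variance imposes between an old and a new argument. -/
def Variance.Rel {A : Type} [LE A] : Variance → A → A → Prop
  | .invariant, x, y => x = y
  | .covariant, x, y => x ≤ y
  | .contravariant, x, y => y ≤ x

/-- A function symbol `f^{i,j,k}`: a name from an infinite alphabet (coded by `ℕ`), invariant in its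
first `i` arguments, covariant in the next `j`, contravariant in the last `k`. -/
structure FunSym where
  name : ℕ
  i : ℕ
  j : ℕ
  k : ℕ

/-- The arity `i + j + k` of `f^{i,j,k}`. -/
def FunSym.arity (f : FunSym) : ℕ := f.i + f.j + f.k

/-- The variance of `f^{i,j,k}` in its argument number `a` (counted from `0`). -/
def FunSym.variance (f : FunSym) (a : Fin f.arity) : Variance :=
  if a.val < f.i then .invariant
  else if a.val < f.i + f.j then .covariant
  else .contravariant

/-- Terms over the signature of ortholattices with function symbols, with variables `x_0, x_1, …`. -/
inductive Term where
  | var (x : ℕ)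
  | bot
  | top
  | neg (t : Term)
  | meet (s t : Term)
  | join (s t : Term)
  | app (f : FunSym) (args : Fin f.arity → Term)

/-- The number of all nodes of a term, negations included. -/
def Term.nodes : Term → ℕ
  | .var _ => 1
  | .bot => 1
  | .top => 1
  | .neg t => t.nodes + 1
  | .meet s t => s.nodes + t.nodes + 1
  | .join s t => s.nodes + t.nodes + 1
  | .app _ args => (∑ a, (args a).nodes) + 1

/-- The size of a term: the number of its nodes, where negation signs are not counted. -/
def Term.size : Term → ℕ
  | .var _ => 1
  | .bot => 1
  | .top => 1
  | .neg t => t.size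
  | .meet s t => s.size + t.size + 1
  | .join s t => s.size + t.size + 1
  | .app _ args => (∑ a, (args a).size) + 1

/-- Prefix notation of a term as a list of natural numbers. -/
def Term.encode : Term → List ℕ
  | .var x => [0, x]
  | .bot => [1]
  | .top => [2]
  | .neg t => 3 :: t.encode
  | .meet s t => 4 :: (s.encode ++ t.encode)
  | .join s t => 5 :: (s.encode ++ t.encode)
  | .app f args => 6 :: f.name :: f.i :: f.j :: f.k :: (List.ofFn fun a => (args a).encode).flatten

/-! ### Ortholattices with monotonic and antimonotonic functions -/

/-- Ortholattices in which every function symbol is interpreted by an operation of its variance. -/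
class OLPlus (A : Type) extends Lattice A, BoundedOrder A, Compl A where
  neg_neg : ∀ x : A, xᶜᶜ = x
  sup_neg : ∀ x : A, x ⊔ xᶜ = ⊤
  inf_neg : ∀ x : A, x ⊓ xᶜ = ⊥
  neg_sup : ∀ x y : A, (x ⊔ y)ᶜ = xᶜ ⊓ yᶜ
  neg_inf : ∀ x y : A, (x ⊓ y)ᶜ = xᶜ ⊔ yᶜ
  interp : (f : FunSym) → (Fin f.arity → A) → A
  interp_le : ∀ (f : FunSym) (x y : Fin f.arity → A),
    (∀ a, (f.variance a).Rel (x a) (y a)) → interp f x ≤ interp f y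

/-- The value of a term under an assignment of the variables. -/
def Term.eval {A : Type} [OLPlus A] (v : ℕ → A) : Term → A
  | .var x => v x
  | .bot => ⊥
  | .top => ⊤
  | .neg t => (t.eval v)ᶜ
  | .meet s t => s.eval v ⊓ t.eval v
  | .join s t => s.eval v ⊔ t.eval v
  | .app f args => OLPlus.interp f fun a => (args a).eval v

/-- Equivalence of terms: `s = t` holds in all algebras of the class, under all assignments.
(There are only countably many terms, so the free algebra already lives in `Type`.) -/
def Equivalent (s t : Term) : Prop :=
  ∀ (A : Type) [OLPlus A] (v : ℕ → A), s.eval v = t.eval v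

/-- A term is in minimal form if no equivalent term is smaller. -/
def IsMinimalForm (t : Term) : Prop :=
  ¬ ∃ u : Term, u.size < t.size ∧ Equivalent u t

/-- Normal form functions for ortholattices with functions. The equality in `eq_of_equivalent` is
syntactic equality. -/
structure IsNormalFormFunction (F : Term → Term) : Prop where
  equivalent : ∀ s, Equivalent (F s) s
  eq_of_equivalent : ∀ s t, Equivalent s t → F s = F t
  minimal : ∀ s, IsMinimalForm (F s)

/-! ### Terms in pseudo-negation-normal form -/

/-- Terms over bounded lattices with, for each function symbol `F`, a second symbol `F̄` of the
opposite monotonicity, and with variables `x` and `x'`. `lit true x` is `x` and `lit false x` is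
`x'`; `app true F` is `F` and `app false F` is `F̄`. -/
inductive NTerm where
  | lit (pos : Bool) (x : ℕ)
  | bot
  | top
  | meet (s t : NTerm)
  | join (s t : NTerm)
  | app (pos : Bool) (f : FunSym) (args : Fin f.arity → NTerm)

/-- The reading of such a term as an ortholattice term: `x'` is `¬ x` and `F̄(…)` is `¬ F(…)`. -/
def NTerm.toTerm : NTerm → Term
  | .lit true x => .var x
  | .lit false x => .neg (.var x)
  | .bot => .bot
  | .top => .top
  | .meet s t => .meet s.toTerm t.toTerm
  | .join s t => .join s.toTerm t.toTerm
  | .app true f args => .app f fun a => (args a).toTerm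
  | .app false f args => .neg (.app f fun a => (args a).toTerm)

/-- The number of nodes. -/
def NTerm.size : NTerm → ℕ
  | .lit _ _ => 1
  | .bot => 1
  | .top => 1
  | .meet s t => s.size + t.size + 1
  | .join s t => s.size + t.size + 1
  | .app _ _ args => (∑ a, (args a).size) + 1

/-- Bounded lattices with operations `F` and `F̄` of opposite monotonicity. -/
class BLPlusBar (A : Type) extends Lattice A, BoundedOrder A where
  interp : Bool → (f : FunSym) → (Fin f.arity → A) → A
  interp_le : ∀ (f : FunSym) (x y : Fin f.arity → A),
    (∀ a, (f.variance a).Rel (x a) (y a)) → interp true f x ≤ interp true f y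
  interp_bar_le : ∀ (f : FunSym) (x y : Fin f.arity → A),
    (∀ a, (f.variance a).opposite.Rel (x a) (y a)) → interp false f x ≤ interp false f y

/-- The value of a term, where `x` and `x'` are unrelated variables. -/
def NTerm.eval {A : Type} [BLPlusBar A] (v : Bool → ℕ → A) : NTerm → A
  | .lit b x => v b x
  | .bot => ⊥
  | .top => ⊤
  | .meet s t => s.eval v ⊓ t.eval v
  | .join s t => s.eval v ⊔ t.eval v
  | .app b f args => BLPlusBar.interp b f fun a => (args a).eval v

/-- `s ≤ t` holds in all bounded lattices with functions, under all assignments. -/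
def BLe (s t : NTerm) : Prop :=
  ∀ (A : Type) [BLPlusBar A] (v : Bool → ℕ → A), s.eval v ≤ t.eval v

/-! ### The map δ -/

/-- `deltaAux true t` is `δ(t)` and `deltaAux false t` is `δ(¬ t)`. -/
def deltaAux : Bool → Term → NTerm
  | b, .var x => .lit b x
  | true, .bot => .bot
  | false, .bot => .top
  | true, .top => .top
  | false, .top => .bot
  | b, .neg t => deltaAux (!b) t
  | true, .meet s t => .meet (deltaAux true s) (deltaAux true t)
  | false, .meet s t => .join (deltaAux false s) (deltaAux false t)
  | true, .join s t => .join (deltaAux true s) (deltaAux true t)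
  | false, .join s t => .meet (deltaAux false s) (deltaAux false t)
  | b, .app f args => .app b f fun a => deltaAux true (args a)

/-- Pseudo-negation-normal form. -/
def delta (t : Term) : NTerm := deltaAux true t

/-! ### The map β -/

open Classical in
/-- Replaces disjunctions that contain complementary parts by `⊤`, and dually. -/
noncomputable def beta : NTerm → NTerm
  | .lit b x => .lit b x
  | .bot => .bot
  | .top => .top
  | .app b f args => .app b f fun a => beta (args a)
  | .join s t =>
      if BLe (delta (.neg (beta s).toTerm)) (.join (beta s) (beta t)) ∨
          BLe (delta (.neg (beta t).toTerm)) (.join (beta s) (beta t))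
      then .top
      else .join (beta s) (beta t)
  | .meet s t =>
      if BLe (.meet (beta s) (beta t)) (delta (.neg (beta s).toTerm)) ∨
          BLe (.meet (beta s) (beta t)) (delta (.neg (beta t).toTerm))
      then .bot
      else .meet (beta s) (beta t)

/-! ### Disjunctions and conjunctions of several terms -/

/-- `T_1, …, T_m` for `T = T_1 ∨ … ∨ T_m`, where no `T_i` is a disjunction. -/
def NTerm.disjuncts : NTerm → List NTerm
  | .join s t => s.disjuncts ++ t.disjuncts
  | t => [t]

/-- `T_1, …, T_m` for `T = T_1 ∧ … ∧ T_m`, where no `T_i` is a conjunction. -/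
def NTerm.conjuncts : NTerm → List NTerm
  | .meet s t => s.conjuncts ++ t.conjuncts
  | t => [t]

/-- `T_1 ∨ (T_2 ∨ (… ∨ T_m))`. -/
def bigJoin : List NTerm → NTerm
  | [] => .bot
  | [t] => t
  | t :: u :: l => .join t (bigJoin (u :: l))

/-- `T_1 ∧ (T_2 ∧ (… ∧ T_m))`. -/
def bigMeet : List NTerm → NTerm
  | [] => .top
  | [t] => t
  | t :: u :: l => .meet t (bigMeet (u :: l))

theorem size_le_of_mem_disjuncts (t : NTerm) : ∀ u ∈ t.disjuncts, u.size ≤ t.size := by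
  induction t with
  | join s t ihs iht =>
    intro u hu
    simp only [NTerm.disjuncts, List.mem_append] at hu
    simp only [NTerm.size]
    rcases hu with hu | hu
    · have := ihs u hu
      omega
    · have := iht u hu
      omega
  | _ => simp [NTerm.disjuncts]

theorem size_le_of_mem_conjuncts (t : NTerm) : ∀ u ∈ t.conjuncts, u.size ≤ t.size := by
  induction t with
  | meet s t ihs iht =>
    intro u hu
    simp only [NTerm.conjuncts, List.mem_append] at hu
    simp only [NTerm.size]
    rcases hu with hu | hu
    · have := ihs u hu
      omega
    · have := iht u hu
      omega
  | _ => simp [NTerm.conjuncts]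

theorem size_lt_of_mem_disjuncts_join {s t u : NTerm} (hu : u ∈ (NTerm.join s t).disjuncts) :
    u.size < (NTerm.join s t).size := by
  simp only [NTerm.disjuncts, List.mem_append] at hu
  simp only [NTerm.size]
  rcases hu with hu | hu
  · have := size_le_of_mem_disjuncts s u hu
    omega
  · have := size_le_of_mem_disjuncts t u hu
    omega

theorem size_lt_of_mem_conjuncts_meet {s t u : NTerm} (hu : u ∈ (NTerm.meet s t).conjuncts) :
    u.size < (NTerm.meet s t).size := by
  simp only [NTerm.conjuncts, List.mem_append] at hu
  simp only [NTerm.size]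
  rcases hu with hu | hu
  · have := size_le_of_mem_conjuncts s u hu
    omega
  · have := size_le_of_mem_conjuncts t u hu
    omega

theorem size_arg_lt (b : Bool) (f : FunSym) (args : Fin f.arity → NTerm) (a : Fin f.arity) :
    (args a).size < (NTerm.app b f args).size := by
  have := Finset.single_le_sum (f := fun a => (args a).size) (fun _ _ => Nat.zero_le _)
    (Finset.mem_univ a)
  simp only [NTerm.size]
  exact Nat.lt_succ_of_le this

/-! ### The map ζ -/

open Classical in
/-- The terms that replace a disjunct `t` of a disjunction equivalent to `T`: a conjunction is
replaced by its first conjunct below `T`, as long as there is one; disjunctions are split. -/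
noncomputable def expandDisjunct (T : NTerm) : NTerm → List NTerm
  | .join s t => expandDisjunct T s ++ expandDisjunct T t
  | .meet s t =>
      match _h : (NTerm.meet s t).conjuncts.find? (fun c => decide (BLe c T)) with
      | some c => expandDisjunct T c
      | none => [.meet s t]
  | t => [t]
termination_by t => t.size
decreasing_by
  · simp only [NTerm.size]
    omega
  · simp only [NTerm.size]
    omega
  · exact size_lt_of_mem_conjuncts_meet (List.mem_of_find?_eq_some _h)

open Classical in
/-- The terms that replace a conjunct `t` of a conjunction equivalent to `T`: a disjunction is
replaced by its first disjunct above `T`, as long as there is one; conjunctions are split. -/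
noncomputable def expandConjunct (T : NTerm) : NTerm → List NTerm
  | .meet s t => expandConjunct T s ++ expandConjunct T t
  | .join s t =>
      match _h : (NTerm.join s t).disjuncts.find? (fun c => decide (BLe T c)) with
      | some c => expandConjunct T c
      | none => [.join s t]
  | t => [t]
termination_by t => t.size
decreasing_by
  · simp only [NTerm.size]
    omega
  · simp only [NTerm.size]
    omega
  · exact size_lt_of_mem_disjuncts_join (List.mem_of_find?_eq_some _h)

/-- `bigJoin` of the list of accepted terms, given the list of the simplified disjuncts. -/
noncomputable def zetaJoin (l : List NTerm) : NTerm :=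
  bigJoin (l.flatMap (expandDisjunct (bigJoin l)))

/-- `bigMeet` of the list of accepted terms, given the list of the simplified conjuncts. -/
noncomputable def zetaMeet (l : List NTerm) : NTerm :=
  bigMeet (l.flatMap (expandConjunct (bigMeet l)))

/-- Bottom-up replacement of disjuncts by their conjuncts, and dually. -/
noncomputable def zeta : NTerm → NTerm
  | .lit b x => .lit b x
  | .bot => .bot
  | .top => .top
  | .app b f args => .app b f fun a => zeta (args a)
  | .join s t => zetaJoin ((NTerm.join s t).disjuncts.attach.map fun u => zeta u.1)
  | .meet s t => zetaMeet ((NTerm.meet s t).conjuncts.attach.map fun u => zeta u.1)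
termination_by t => t.size
decreasing_by
  · exact size_arg_lt b f args a
  · exact size_lt_of_mem_disjuncts_join u.2
  · exact size_lt_of_mem_conjuncts_meet u.2

/-! ### The map η -/

/-- Sorting by the lexicographic order of the prefix notations. -/
def sortTerms (l : List NTerm) : List NTerm :=
  l.insertionSort fun s t => s.toTerm.encode ≤ t.toTerm.encode

open Classical in
/-- The members `T_i` of a list for which there is no `j` with `le T_i T_j` and
(not `le T_j T_i`, or `i > j`). -/
noncomputable def antichain (le : NTerm → NTerm → Prop) (l : List NTerm) : List NTerm :=
  ((List.finRange l.length).filter fun i =>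
    decide (¬ ∃ j : Fin l.length, le (l.get i) (l.get j) ∧
      (¬ le (l.get j) (l.get i) ∨ j < i))).map l.get

/-- Bottom-up removal of redundant disjuncts and conjuncts; the remaining ones are sorted. -/
noncomputable def eta : NTerm → NTerm
  | .lit b x => .lit b x
  | .bot => .bot
  | .top => .top
  | .app b f args => .app b f fun a => eta (args a)
  | .join s t => bigJoin (sortTerms (antichain BLe
      ((NTerm.join s t).disjuncts.attach.map fun u => eta u.1)))
  | .meet s t => bigMeet (sortTerms (antichain (fun x y => BLe y x)
      ((NTerm.meet s t).conjuncts.attach.map fun u => eta u.1)))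
termination_by t => t.size
decreasing_by
  · exact size_arg_lt b f args a
  · exact size_lt_of_mem_disjuncts_join u.2
  · exact size_lt_of_mem_conjuncts_meet u.2

/-! ### Random access machines with uniform cost -/

/-- Programs for a random access machine with registers `R[0], R[1], …` and memory arrays
`M[0], M[1], …`, all holding natural numbers. A program is a finite object, so it names only finitely
many registers and arrays; the cells of an array are addressed indirectly. -/
inductive Prog where
  /-- `R[x] := c` -/
  | const (x c : ℕ)
  /-- `R[x] := R[y] + R[z]` -/
  | add (x y z : ℕ)
  /-- `R[x] := max (R[y] - R[z]) 0` -/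
  | sub (x y z : ℕ)
  /-- `R[x] := M[a][R[y]]` -/
  | load (x a y : ℕ)
  /-- `M[a][R[y]] := R[x]` -/
  | store (a y x : ℕ)
  /-- `p; q` -/
  | seq (p q : Prog)
  /-- `if R[x] ≠ 0 then p else q` -/
  | ite (x : ℕ) (p q : Prog)
  /-- `while R[x] ≠ 0 do p` -/
  | loop (x : ℕ) (p : Prog)

/-- A configuration of the machine. -/
structure Config where
  reg : ℕ → ℕ
  mem : ℕ → ℕ → ℕ

/-- `R[x] := c`. -/
def Config.setReg (s : Config) (x c : ℕ) : Config :=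
  { s with reg := Function.update s.reg x c }

/-- `M[a][i] := c`. -/
def Config.setMem (s : Config) (a i c : ℕ) : Config :=
  { s with mem := Function.update s.mem a (Function.update (s.mem a) i c) }

/-- `Exec p s n s'`: started in `s`, the program `p` halts in `s'` after exactly `n` steps. Every
elementary instruction and every test takes one step. -/
inductive Exec : Prog → Config → ℕ → Config → Prop where
  | const (x c : ℕ) (s : Config) : Exec (.const x c) s 1 (s.setReg x c)
  | add (x y z : ℕ) (s : Config) : Exec (.add x y z) s 1 (s.setReg x (s.reg y + s.reg z))
  | sub (x y z : ℕ) (s : Config) : Exec (.sub x y z) s 1 (s.setReg x (s.reg y - s.reg z))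
  | load (x a y : ℕ) (s : Config) : Exec (.load x a y) s 1 (s.setReg x (s.mem a (s.reg y)))
  | store (a y x : ℕ) (s : Config) : Exec (.store a y x) s 1 (s.setMem a (s.reg y) (s.reg x))
  | seq {p q : Prog} {s₁ s₂ s₃ : Config} {m n : ℕ} :
      Exec p s₁ m s₂ → Exec q s₂ n s₃ → Exec (.seq p q) s₁ (m + n) s₃
  | ite_true {x : ℕ} {p q : Prog} {s s' : Config} {n : ℕ} :
      s.reg x ≠ 0 → Exec p s n s' → Exec (.ite x p q) s (n + 1) s'
  | ite_false {x : ℕ} {p q : Prog} {s s' : Config} {n : ℕ} :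
      s.reg x = 0 → Exec q s n s' → Exec (.ite x p q) s (n + 1) s'
  | loop_true {x : ℕ} {p : Prog} {s₁ s₂ s₃ : Config} {m n : ℕ} :
      s₁.reg x ≠ 0 → Exec p s₁ m s₂ → Exec (.loop x p) s₂ n s₃ →
      Exec (.loop x p) s₁ (m + n + 1) s₃
  | loop_false {x : ℕ} {p : Prog} {s : Config} :
      s.reg x = 0 → Exec (.loop x p) s 1 s

/-- The initial configuration: the input word is in `M[0]`, its length in `R[0]`, all other cells
hold `0`. -/
def Config.input (w : List ℕ) : Config where
  reg := fun x => if x = 0 then w.length else 0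
  mem := fun a i => if a = 0 then w.getD i 0 else 0

/-- The output word is in `M[1]`, and its length in `R[1]`. -/
def Config.HasOutput (s : Config) (w : List ℕ) : Prop :=
  s.reg 1 = w.length ∧ ∀ (i : ℕ) (h : i < w.length), s.mem 1 i = w[i]

/-- `F` is computed by one program that needs at most `C * n ^ 2` steps on each term with `n` nodes. -/
def ComputableInQuadraticTime (F : Term → Term) : Prop :=
  ∃ (p : Prog) (C : ℕ), ∀ t : Term, ∃ (n : ℕ) (s : Config),
    Exec p (Config.input t.encode) n s ∧ s.HasOutput (F t).encode ∧ n ≤ C * t.nodes ^ 2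

end OrthoPlus

namespace OrthoPlus

/-! ### The word problem for free bounded lattices with function symbols -/

/-! The algebraic half rests on cut elimination. In the free bounded lattice with function symbols,
`s ≤ t` is derivable in the calculus `Le`, which has no cut rule. The cut rule is admissible
(`Le.trans_aux`), so the calculus is sound and complete (`ble_iff`), and every inequality can be
inverted by its last rule, as in Whitman's solution of the word problem for lattices.

Negation acts on pseudo-negation-normal forms as the duality `NTerm.neg`. Call a term reduced if no
disjunction in it lies above the dual of one of its two sides, and dually. Inversion shows that a
reduced term above its own dual is `⊤` (`NTerm.Reduced.top_le_of_neg_le`). Hence the reduced terms,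
with the order of the free bounded lattice, are already an ortholattice: the complement is the dual,
the join is `betaJoin`, and anything above both `s` and its dual is `⊤`. In this algebra `FreeOL` a
term takes the class of its image under `β ∘ δ` as its value. So equivalent terms have images under
`β ∘ δ` that are equal in the free bounded lattice, and soundness of `δ` and `β` gives the converse.

What remains is a canonical form in free bounded lattices. The map `ζ` makes sure that no disjunct
is a conjunction with a conjunct below the whole disjunction, and dually (`ZN`). For such terms
Whitman's condition forces each disjunct of `s` below some disjunct of any equivalent disjunction
`t`. So the maximal disjuncts of `s` and `t` agree up to equivalence, and by induction their images
under `η` agree literally (`Equiv.eta_eq`). Sorting by the prefix notation removes the last freedom.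
Minimality then costs nothing: no map increases the size, so a smaller equivalent term would have a
normal form that is both the same and smaller.

The algorithmic half needs a description of `η ∘ ζ` that compares only subterms of the reduced input
and not terms built on the way. This is `canon_op`: the members of a join are found by descending in
the syntax tree (`descend`), testing against that join itself, and only afterwards are they
normalized. Uniqueness identifies the outcome with the bottom-up definition.

All comparisons between subterms and their duals are kept in a table of quadratic size. The input is
read from right to left with a stack, and each node receives a pair of numbers, for a term and its
dual. A new table cell follows from older cells by one rule of the calculus, in constant time apart
from function symbols, where the time is proportional to the arity. The arities sum to at most the
number of nodes, so the table is filled in quadratic time. The test in `β` reads this table. The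
tree given by `children` has at most as many nodes as the reduced term, because the sizes of the
children sum to less than the size of their parent (`sum_size_children_lt`). A node with `k`
children in a term of size `n` is then treated in time `O((k + 1) n)`, including the selection of
the antichain and sorting by counting smaller texts; the numbers `k` sum to less than `n`.
Correctness and running time are proved together, by Hoare triples with a step bound (`Tri`). -/

/-- Whether an argument of this variance has to increase when a symbol (`true`), or the complement of
a symbol (`false`), increases. -/
def Variance.Fwd : Bool → Variance → Prop
  | true, .contravariant => False
  | false, .covariant => False
  | _, _ => True

/-- Cut-free derivability of an inequality between terms. -/
inductive Le : NTerm → NTerm → Prop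
  | bot (t : NTerm) : Le .bot t
  | top (s : NTerm) : Le s .top
  | lit (b : Bool) (x : ℕ) : Le (.lit b x) (.lit b x)
  | join_left {a b t : NTerm} : Le a t → Le b t → Le (.join a b) t
  | meet_right {s a b : NTerm} : Le s a → Le s b → Le s (.meet a b)
  | meet_left₁ {a b t : NTerm} : Le a t → Le (.meet a b) t
  | meet_left₂ {a b t : NTerm} : Le b t → Le (.meet a b) t
  | join_right₁ {s a b : NTerm} : Le s a → Le s (.join a b)
  | join_right₂ {s a b : NTerm} : Le s b → Le s (.join a b)
  | app (p : Bool) (f : FunSym) {x y : Fin f.arity → NTerm} :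
      (∀ a, (f.variance a).Fwd p → Le (x a) (y a)) →
      (∀ a, (f.variance a).Fwd (!p) → Le (y a) (x a)) → Le (.app p f x) (.app p f y)

namespace Le

theorem refl (t : NTerm) : Le t t := by
  induction t with
  | lit b x => exact .lit b x
  | bot => exact .bot _
  | top => exact .top _
  | meet s t hs ht => exact .meet_right (.meet_left₁ hs) (.meet_left₂ ht)
  | join s t hs ht => exact .join_left (.join_right₁ hs) (.join_right₂ ht)
  | app b f x ih => exact .app b f (fun a _ => ih a) (fun a _ => ih a)

/-- Cut elimination. If the second derivation ends with a rule on the right, the cut moves into its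
premises; otherwise the last rule of the first derivation decides, and either the cut moves up or
both rules act on the same symbol. The measure is the total size of the three terms because
contravariant arguments exchange the two outer terms of a cut, and the total does not see this. -/
theorem trans_aux (n : ℕ) : ∀ s t u : NTerm, s.size + t.size + u.size ≤ n → Le s t → Le t u →
    Le s u := by
  induction n with
  | zero =>
    intro s t u h
    cases s <;> simp [NTerm.size] at h
  | succ n ih =>
    intro s t u h hst htu
    cases htu with
    | top => exact .top _
    | meet_right h₁ h₂ =>
      simp only [NTerm.size] at h
      exact .meet_right (ih _ _ _ (by omega) hst h₁) (ih _ _ _ (by omega) hst h₂)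
    | join_right₁ h₁ =>
      simp only [NTerm.size] at h
      exact .join_right₁ (ih _ _ _ (by omega) hst h₁)
    | join_right₂ h₁ =>
      simp only [NTerm.size] at h
      exact .join_right₂ (ih _ _ _ (by omega) hst h₁)
    | bot =>
      cases hst with
      | bot => exact .bot _
      | join_left h₁ h₂ =>
        simp only [NTerm.size] at h
        exact .join_left (ih _ _ _ (by simp [NTerm.size]; omega) h₁ (.bot _))
          (ih _ _ _ (by simp [NTerm.size]; omega) h₂ (.bot _))
      | meet_left₁ h₁ =>
        simp only [NTerm.size] at h
        exact .meet_left₁ (ih _ _ _ (by simp [NTerm.size]; omega) h₁ (.bot _))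
      | meet_left₂ h₁ =>
        simp only [NTerm.size] at h
        exact .meet_left₂ (ih _ _ _ (by simp [NTerm.size]; omega) h₁ (.bot _))
    | lit b x =>
      exact hst
    | join_left h₁ h₂ =>
      simp only [NTerm.size] at h
      cases hst with
      | bot => exact .bot _
      | join_left h₃ h₄ =>
        simp only [NTerm.size] at h
        exact .join_left (ih _ _ _ (by simp [NTerm.size]; omega) h₃ (.join_left h₁ h₂))
          (ih _ _ _ (by simp [NTerm.size]; omega) h₄ (.join_left h₁ h₂))
      | meet_left₁ h₃ =>
        simp only [NTerm.size] at h
        exact .meet_left₁ (ih _ _ _ (by simp [NTerm.size]; omega) h₃ (.join_left h₁ h₂))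
      | meet_left₂ h₃ =>
        simp only [NTerm.size] at h
        exact .meet_left₂ (ih _ _ _ (by simp [NTerm.size]; omega) h₃ (.join_left h₁ h₂))
      | join_right₁ h₃ => exact ih _ _ _ (by omega) h₃ h₁
      | join_right₂ h₃ => exact ih _ _ _ (by omega) h₃ h₂
    | meet_left₁ h₁ =>
      simp only [NTerm.size] at h
      cases hst with
      | bot => exact .bot _
      | join_left h₃ h₄ =>
        simp only [NTerm.size] at h
        exact .join_left (ih _ _ _ (by simp [NTerm.size]; omega) h₃ (.meet_left₁ h₁))
          (ih _ _ _ (by simp [NTerm.size]; omega) h₄ (.meet_left₁ h₁))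
      | meet_left₁ h₃ =>
        simp only [NTerm.size] at h
        exact .meet_left₁ (ih _ _ _ (by simp [NTerm.size]; omega) h₃ (.meet_left₁ h₁))
      | meet_left₂ h₃ =>
        simp only [NTerm.size] at h
        exact .meet_left₂ (ih _ _ _ (by simp [NTerm.size]; omega) h₃ (.meet_left₁ h₁))
      | meet_right h₃ h₄ => exact ih _ _ _ (by omega) h₃ h₁
    | meet_left₂ h₁ =>
      simp only [NTerm.size] at h
      cases hst with
      | bot => exact .bot _
      | join_left h₃ h₄ =>
        simp only [NTerm.size] at h
        exact .join_left (ih _ _ _ (by simp [NTerm.size]; omega) h₃ (.meet_left₂ h₁))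
          (ih _ _ _ (by simp [NTerm.size]; omega) h₄ (.meet_left₂ h₁))
      | meet_left₁ h₃ =>
        simp only [NTerm.size] at h
        exact .meet_left₁ (ih _ _ _ (by simp [NTerm.size]; omega) h₃ (.meet_left₂ h₁))
      | meet_left₂ h₃ =>
        simp only [NTerm.size] at h
        exact .meet_left₂ (ih _ _ _ (by simp [NTerm.size]; omega) h₃ (.meet_left₂ h₁))
      | meet_right h₃ h₄ => exact ih _ _ _ (by omega) h₄ h₁
    | app p f h₁ h₂ =>
      rename_i x y
      have hy := fun a => size_arg_lt p f x a
      have hz := fun a => size_arg_lt p f y a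
      cases hst with
      | bot => exact .bot _
      | join_left h₃ h₄ =>
        simp only [NTerm.size] at h
        exact .join_left (ih _ _ _ (by simp only [NTerm.size]; omega) h₃ (.app p f h₁ h₂))
          (ih _ _ _ (by simp only [NTerm.size]; omega) h₄ (.app p f h₁ h₂))
      | meet_left₁ h₃ =>
        simp only [NTerm.size] at h
        exact .meet_left₁ (ih _ _ _ (by simp only [NTerm.size]; omega) h₃ (.app p f h₁ h₂))
      | meet_left₂ h₃ =>
        simp only [NTerm.size] at h
        exact .meet_left₂ (ih _ _ _ (by simp only [NTerm.size]; omega) h₃ (.app p f h₁ h₂))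
      | app _ _ h₃ h₄ =>
        rename_i w
        have hw := fun a => size_arg_lt p f w a
        refine .app p f (fun a ha => ?_) (fun a ha => ?_)
        · have := hw a; have := hy a; have := hz a
          exact ih _ _ _ (by omega) (h₃ a ha) (h₁ a ha)
        · have := hw a; have := hy a; have := hz a
          exact ih _ _ _ (by omega) (h₂ a ha) (h₄ a ha)

theorem trans {s t u : NTerm} (hst : Le s t) (htu : Le t u) : Le s u :=
  trans_aux _ s t u le_rfl hst htu

theorem join_le_iff {a b t : NTerm} : Le (.join a b) t ↔ Le a t ∧ Le b t :=
  ⟨fun h => ⟨(join_right₁ (refl a)).trans h, (join_right₂ (refl b)).trans h⟩,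
    fun h => .join_left h.1 h.2⟩

theorem le_meet_iff {s a b : NTerm} : Le s (.meet a b) ↔ Le s a ∧ Le s b :=
  ⟨fun h => ⟨h.trans (meet_left₁ (refl a)), h.trans (meet_left₂ (refl b))⟩,
    fun h => .meet_right h.1 h.2⟩

end Le

instance : Preorder NTerm where
  le := Le
  le_refl := Le.refl
  le_trans _ _ _ := Le.trans

/-- The free bounded lattice with function symbols. -/
abbrev FreeBL : Type := Antisymmetrization NTerm (· ≤ ·)

/-- The class of a term in the free bounded lattice. -/
abbrev FreeBL.mk (t : NTerm) : FreeBL := toAntisymmetrization (· ≤ ·) t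

/-- A term in a class. -/
noncomputable abbrev FreeBL.out (x : FreeBL) : NTerm := ofAntisymmetrization (· ≤ ·) x

theorem FreeBL.le_iff {x y : FreeBL} : x ≤ y ↔ Le x.out y.out :=
  (ofAntisymmetrization_le_ofAntisymmetrization_iff (a := x) (b := y)).symm

theorem FreeBL.mk_le_mk {s t : NTerm} : FreeBL.mk s ≤ FreeBL.mk t ↔ Le s t :=
  toAntisymmetrization_le_toAntisymmetrization_iff

theorem FreeBL.mk_out (x : FreeBL) : FreeBL.mk x.out = x :=
  toAntisymmetrization_ofAntisymmetrization _ x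

theorem FreeBL.out_mk_le (t : NTerm) : Le (FreeBL.mk t).out t :=
  FreeBL.mk_le_mk.1 (FreeBL.mk_out _).le

theorem FreeBL.le_out_mk (t : NTerm) : Le t (FreeBL.mk t).out :=
  FreeBL.mk_le_mk.1 (FreeBL.mk_out _).ge

noncomputable instance : Lattice FreeBL where
  sup x y := FreeBL.mk (.join x.out y.out)
  le_sup_left x y := by
    conv_lhs => rw [← FreeBL.mk_out x]
    exact FreeBL.mk_le_mk.2 (.join_right₁ (.refl _))
  le_sup_right x y := by
    conv_lhs => rw [← FreeBL.mk_out y]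
    exact FreeBL.mk_le_mk.2 (.join_right₂ (.refl _))
  sup_le x y z hx hy := by
    rw [← FreeBL.mk_out z]
    exact FreeBL.mk_le_mk.2 (.join_left (FreeBL.le_iff.1 hx) (FreeBL.le_iff.1 hy))
  inf x y := FreeBL.mk (.meet x.out y.out)
  inf_le_left x y := by
    conv_rhs => rw [← FreeBL.mk_out x]
    exact FreeBL.mk_le_mk.2 (.meet_left₁ (.refl _))
  inf_le_right x y := by
    conv_rhs => rw [← FreeBL.mk_out y]
    exact FreeBL.mk_le_mk.2 (.meet_left₂ (.refl _))
  le_inf x y z hx hy := by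
    rw [← FreeBL.mk_out x]
    exact FreeBL.mk_le_mk.2 (.meet_right (FreeBL.le_iff.1 hx) (FreeBL.le_iff.1 hy))

instance : BoundedOrder FreeBL where
  top := FreeBL.mk .top
  bot := FreeBL.mk .bot
  le_top x := by
    rw [← FreeBL.mk_out x]
    exact FreeBL.mk_le_mk.2 (.top _)
  bot_le x := by
    rw [← FreeBL.mk_out x]
    exact FreeBL.mk_le_mk.2 (.bot _)

theorem Variance.Rel.le_of_fwd {A : Type} [Preorder A] {v : Variance} {x y : A}
    (h : v.Rel x y) (hv : v.Fwd true) : x ≤ y := by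
  cases v <;> simp_all [Variance.Rel, Variance.Fwd]

theorem Variance.Rel.ge_of_fwd {A : Type} [Preorder A] {v : Variance} {x y : A}
    (h : v.Rel x y) (hv : v.Fwd false) : y ≤ x := by
  cases v <;> simp_all [Variance.Rel, Variance.Fwd]

/-- An invariant argument demands both inequalities, so antisymmetry turns them into the equality
required by `Variance.Rel`. -/
theorem Variance.rel_of_fwd {A : Type} [PartialOrder A] {v : Variance} {x y : A}
    (h₁ : v.Fwd true → x ≤ y) (h₂ : v.Fwd false → y ≤ x) : v.Rel x y := by
  cases v
  · exact le_antisymm (h₁ trivial) (h₂ trivial)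
  · exact h₁ trivial
  · exact h₂ trivial

theorem Variance.opposite_fwd (v : Variance) (b : Bool) : v.opposite.Fwd b ↔ v.Fwd (!b) := by
  cases v <;> cases b <;> simp [Variance.opposite, Variance.Fwd]

/-- Equal classes have representatives comparable in both directions. This is exactly what both
families of premises of `Le.app` ask of an invariant argument. -/
noncomputable instance : BLPlusBar FreeBL where
  interp b f x := FreeBL.mk (.app b f fun a => (x a).out)
  interp_le f _ _ h := FreeBL.mk_le_mk.2 <|
    .app true f (fun a ha => FreeBL.le_iff.1 ((h a).le_of_fwd ha))
      (fun a ha => FreeBL.le_iff.1 ((h a).ge_of_fwd ha))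
  interp_bar_le f _ _ h := FreeBL.mk_le_mk.2 <|
    .app false f
      (fun a ha => FreeBL.le_iff.1 ((h a).le_of_fwd ((Variance.opposite_fwd _ _).2 ha)))
      (fun a ha => FreeBL.le_iff.1 ((h a).ge_of_fwd ((Variance.opposite_fwd _ _).2 ha)))

/-- Completeness of the calculus rests on this: under the assignment of the generators each term has
its own class as value, so an inequality valid in all algebras is derivable. -/
theorem FreeBL.eval_eq (t : NTerm) :
    t.eval (fun b x => FreeBL.mk (.lit b x)) = FreeBL.mk t := by
  induction t with
  | lit b x => rfl
  | bot => rfl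
  | top => rfl
  | meet s t hs ht =>
    rw [NTerm.eval, hs, ht]
    refine le_antisymm (FreeBL.mk_le_mk.2 ?_) (FreeBL.mk_le_mk.2 ?_)
    · exact .meet_right (.meet_left₁ (out_mk_le s)) (.meet_left₂ (out_mk_le t))
    · exact .meet_right (.meet_left₁ (le_out_mk s)) (.meet_left₂ (le_out_mk t))
  | join s t hs ht =>
    rw [NTerm.eval, hs, ht]
    refine le_antisymm (FreeBL.mk_le_mk.2 ?_) (FreeBL.mk_le_mk.2 ?_)
    · exact .join_left (.join_right₁ (out_mk_le s)) (.join_right₂ (out_mk_le t))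
    · exact .join_left (.join_right₁ (le_out_mk s)) (.join_right₂ (le_out_mk t))
  | app b f x ih =>
    simp only [NTerm.eval, ih]
    refine le_antisymm (FreeBL.mk_le_mk.2 ?_) (FreeBL.mk_le_mk.2 ?_)
    · exact .app b f (fun a _ => out_mk_le _) (fun a _ => le_out_mk _)
    · exact .app b f (fun a _ => le_out_mk _) (fun a _ => out_mk_le _)

theorem Le.eval_le {s t : NTerm} (h : Le s t) {A : Type} [BLPlusBar A] (v : Bool → ℕ → A) :
    s.eval v ≤ t.eval v := by
  induction h with
  | bot => exact bot_le
  | top => exact le_top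
  | lit => exact le_rfl
  | join_left _ _ h₁ h₂ => exact sup_le h₁ h₂
  | meet_right _ _ h₁ h₂ => exact le_inf h₁ h₂
  | meet_left₁ _ h => exact inf_le_left.trans h
  | meet_left₂ _ h => exact inf_le_right.trans h
  | join_right₁ _ h => exact le_trans h le_sup_left
  | join_right₂ _ h => exact le_trans h le_sup_right
  | app p f _ _ h₁ h₂ =>
    cases p
    · exact BLPlusBar.interp_bar_le f _ _ fun a => Variance.rel_of_fwd
        (fun ha => h₁ a ((Variance.opposite_fwd _ _).1 ha))
        (fun ha => h₂ a ((Variance.opposite_fwd _ _).1 ha))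
    · exact BLPlusBar.interp_le f _ _ fun a => Variance.rel_of_fwd (h₁ a) (h₂ a)

theorem ble_iff {s t : NTerm} : BLe s t ↔ Le s t := by
  refine ⟨fun h => ?_, fun h A _ v => h.eval_le v⟩
  have := h FreeBL fun b x => FreeBL.mk (.lit b x)
  rwa [FreeBL.eval_eq, FreeBL.eval_eq, FreeBL.mk_le_mk] at this

theorem ble_eq_le : BLe = Le := by
  funext s t
  exact propext ble_iff

/-! ### Duality -/

/-- The dual of a term, which reads as its negation. -/
def NTerm.neg : NTerm → NTerm
  | .lit b x => .lit (!b) x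
  | .bot => .top
  | .top => .bot
  | .meet s t => .join s.neg t.neg
  | .join s t => .meet s.neg t.neg
  | .app b f x => .app (!b) f x

@[simp] theorem NTerm.neg_neg (t : NTerm) : t.neg.neg = t := by
  induction t <;> simp_all [NTerm.neg]

@[simp] theorem NTerm.size_neg (t : NTerm) : t.neg.size = t.size := by
  induction t <;> simp_all [NTerm.neg, NTerm.size]

/-- The rules come in dual pairs, and the rule for function symbols is its own dual once its two
families of premises are exchanged. -/
theorem Le.neg {s t : NTerm} (h : Le s t) : Le t.neg s.neg := by
  induction h with
  | bot => exact .top _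
  | top => exact .bot _
  | lit => exact .lit _ _
  | join_left _ _ h₁ h₂ => exact .meet_right h₁ h₂
  | meet_right _ _ h₁ h₂ => exact .join_left h₁ h₂
  | meet_left₁ _ h => exact .join_right₁ h
  | meet_left₂ _ h => exact .join_right₂ h
  | join_right₁ _ h => exact .meet_left₁ h
  | join_right₂ _ h => exact .meet_left₂ h
  | app p f h₁ h₂ => exact .app _ f h₂ (by simpa using h₁)

theorem Le.neg_iff {s t : NTerm} : Le t.neg s.neg ↔ Le s t :=
  ⟨fun h => by simpa using h.neg, Le.neg⟩

theorem Le.le_neg_comm {s t : NTerm} : Le s t.neg ↔ Le t s.neg := by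
  rw [← Le.neg_iff, NTerm.neg_neg]

theorem Le.neg_le_comm {s t : NTerm} : Le s.neg t ↔ Le t.neg s := by
  rw [← Le.neg_iff, NTerm.neg_neg]

theorem deltaAux_neg (t : Term) : ∀ b, deltaAux (!b) t = (deltaAux b t).neg := by
  induction t with
  | neg t ih => intro b; cases b <;> simp [deltaAux, ← ih]
  | meet s t hs ht => intro b; cases b <;> simp [deltaAux, NTerm.neg, ← hs, ← ht]
  | join s t hs ht => intro b; cases b <;> simp [deltaAux, NTerm.neg, ← hs, ← ht]
  | _ => intro b; cases b <;> simp [deltaAux, NTerm.neg]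

theorem deltaAux_toTerm (t : NTerm) : deltaAux true t.toTerm = t := by
  induction t with
  | lit b x => cases b <;> simp [NTerm.toTerm, deltaAux]
  | app b f x ih => cases b <;> simp [NTerm.toTerm, deltaAux, ih]
  | _ => simp_all [NTerm.toTerm, deltaAux]

/-- Once a term is in pseudo-negation-normal form, `δ(¬ t)` is mere dualization. The side conditions
in the definition of `beta` thereby become conditions on `Le` and `NTerm.neg`. -/
theorem delta_neg_toTerm (t : NTerm) : delta (.neg t.toTerm) = t.neg := by
  rw [delta, deltaAux, Bool.not_true, ← Bool.not_true, deltaAux_neg, deltaAux_toTerm]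

/-- The join of two terms, or `⊤` if it contains complementary parts. -/
noncomputable def betaJoin (s t : NTerm) : NTerm :=
  open Classical in
  if Le s.neg (.join s t) ∨ Le t.neg (.join s t) then .top else .join s t

open Classical in
theorem beta_join (s t : NTerm) : beta (.join s t) = betaJoin (beta s) (beta t) := by
  rw [beta, betaJoin]
  exact if_congr (by simp only [delta_neg_toTerm, ble_iff]) rfl rfl

-- Everything about `β` on meets is reduced to joins by duality, so only `betaJoin` has to be
-- studied.
open Classical in
theorem beta_meet (s t : NTerm) :
    beta (.meet s t) = (betaJoin (beta s).neg (beta t).neg).neg := by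
  have h : ∀ u : NTerm, BLe (.meet (beta s) (beta t)) (delta (.neg u.toTerm)) ↔
      Le u (.join (beta s).neg (beta t).neg) := fun u => by
    rw [delta_neg_toTerm, ble_iff, Le.le_neg_comm]; rfl
  rw [beta, betaJoin, NTerm.neg_neg, NTerm.neg_neg, apply_ite NTerm.neg]
  exact if_congr (or_congr (h _) (h _)) rfl (by simp [NTerm.neg])

theorem beta_neg (t : NTerm) : beta t.neg = (beta t).neg := by
  induction t with
  | join s t hs ht => simp [NTerm.neg, beta_join, beta_meet, hs, ht]
  | meet s t hs ht => simp [NTerm.neg, beta_join, beta_meet, hs, ht]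
  | _ => simp [NTerm.neg, beta]


/-! ### The free ortholattice with function symbols -/

/-- No join contains complementary parts, and dually. -/
def NTerm.Reduced : NTerm → Prop
  | .lit _ _ => True
  | .bot => True
  | .top => True
  | .app _ _ x => ∀ a, (x a).Reduced
  | .join s t => s.Reduced ∧ t.Reduced ∧ ¬ Le s.neg (.join s t) ∧ ¬ Le t.neg (.join s t)
  | .meet s t => s.Reduced ∧ t.Reduced ∧ ¬ Le (.meet s t) s.neg ∧ ¬ Le (.meet s t) t.neg

theorem NTerm.Reduced.neg {t : NTerm} (h : t.Reduced) : t.neg.Reduced := by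
  induction t with
  | join s t hs ht =>
    refine ⟨hs h.1, ht h.2.1, fun h' => h.2.2.1 ?_, fun h' => h.2.2.2 ?_⟩
    · rw [← Le.neg_iff]; exact h'
    · rw [← Le.neg_iff]; exact h'
  | meet s t hs ht =>
    refine ⟨hs h.1, ht h.2.1, fun h' => h.2.2.1 ?_, fun h' => h.2.2.2 ?_⟩
    · rw [← Le.neg_iff]; exact h'
    · rw [← Le.neg_iff]; exact h'
  | _ => exact h

theorem NTerm.Reduced.betaJoin {s t : NTerm} (hs : s.Reduced) (ht : t.Reduced) :
    (betaJoin s t).Reduced := by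
  unfold OrthoPlus.betaJoin
  split
  · trivial
  · rename_i h
    rw [not_or] at h
    exact ⟨hs, ht, h.1, h.2⟩

theorem reduced_beta (t : NTerm) : (beta t).Reduced := by
  induction t with
  | join s t hs ht => rw [beta_join]; exact hs.betaJoin ht
  | meet s t hs ht => rw [beta_meet]; exact (hs.neg.betaJoin ht.neg).neg
  | app b f x ih => rw [beta]; exact ih
  | _ => simp [beta, NTerm.Reduced]

/-- A reduced term above its own negation is the top element. -/
theorem NTerm.Reduced.top_le_of_neg_le {u : NTerm} (hu : u.Reduced) (h : Le u.neg u) :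
    Le .top u := by
  induction u with
  | lit b x => cases b <;> cases h
  | bot => exact h
  | top => exact .refl _
  | meet a b ha hb =>
    have h' : Le (.join a.neg b.neg) (.meet a b) := h
    rw [Le.join_le_iff, Le.le_meet_iff, Le.le_meet_iff] at h'
    exact .meet_right (ha hu.1 h'.1.1) (hb hu.2.1 h'.2.2)
  | join a b ha hb =>
    exfalso
    -- Whitman's condition: only four rules can end a derivation of a meet below a join. The first
    -- two contradict reducedness at once, the other two after dualizing.
    have h' : Le (.meet a.neg b.neg) (.join a b) := h
    cases h' with
    | meet_left₁ h => exact hu.2.2.1 h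
    | meet_left₂ h => exact hu.2.2.2 h
    | join_right₁ h => exact hu.2.2.1 (by rw [Le.neg_le_comm]; exact h)
    | join_right₂ h => exact hu.2.2.2 (by rw [Le.neg_le_comm]; exact h)
  | app b f x ih => cases b <;> cases h

/-- Dualizing the first inequality gives `u.neg ≤ s.neg ≤ u`. This is the law of the excluded middle
among reduced terms. -/
theorem NTerm.Reduced.top_le {s u : NTerm} (hu : u.Reduced) (h : Le s u) (h' : Le s.neg u) :
    Le .top u :=
  hu.top_le_of_neg_le (h.neg.trans h')

theorem le_betaJoin_left (s t : NTerm) : Le s (betaJoin s t) := by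
  unfold betaJoin
  split
  · exact .top _
  · exact .join_right₁ (.refl _)

theorem le_betaJoin_right (s t : NTerm) : Le t (betaJoin s t) := by
  unfold betaJoin
  split
  · exact .top _
  · exact .join_right₂ (.refl _)

/-- Reducedness of the upper bound is essential: where `betaJoin` collapses to `⊤`, the bound lies
above a term and its dual, so it has to be `⊤` as well. -/
theorem betaJoin_le {s t u : NTerm} (hu : u.Reduced) (hs : Le s u) (ht : Le t u) :
    Le (betaJoin s t) u := by
  unfold betaJoin
  split
  · rename_i h
    rcases h with h | h
    · exact hu.top_le hs (h.trans (.join_left hs ht))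
    · exact hu.top_le ht (h.trans (.join_left hs ht))
  · exact .join_left hs ht

/-! ### The ortholattice of reduced terms. -/

/-- The preordered type of reduced terms. -/
abbrev RTerm : Type := {t : NTerm // t.Reduced}

/-- The free ortholattice with function symbols. -/
abbrev FreeOL : Type := Antisymmetrization RTerm (· ≤ ·)

namespace FreeOL

/-- The class of a reduced term. -/
abbrev mk (t : RTerm) : FreeOL := toAntisymmetrization (· ≤ ·) t

/-- A reduced term in a class. -/
noncomputable abbrev out (x : FreeOL) : RTerm := ofAntisymmetrization (· ≤ ·) x

theorem le_iff {x y : FreeOL} : x ≤ y ↔ Le x.out.1 y.out.1 :=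
  (ofAntisymmetrization_le_ofAntisymmetrization_iff (a := x) (b := y)).symm

theorem mk_le_mk {s t : RTerm} : mk s ≤ mk t ↔ Le s.1 t.1 :=
  toAntisymmetrization_le_toAntisymmetrization_iff

theorem mk_out (x : FreeOL) : mk x.out = x :=
  toAntisymmetrization_ofAntisymmetrization _ x

theorem out_mk_le (t : RTerm) : Le (mk t).out.1 t.1 := mk_le_mk.1 (mk_out _).le

theorem le_out_mk (t : RTerm) : Le t.1 (mk t).out.1 := mk_le_mk.1 (mk_out _).ge

theorem mk_le_iff {t : RTerm} {x : FreeOL} : mk t ≤ x ↔ Le t.1 x.out.1 := by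
  conv_lhs => rw [← mk_out x]
  exact mk_le_mk

theorem le_mk_iff {t : RTerm} {x : FreeOL} : x ≤ mk t ↔ Le x.out.1 t.1 := by
  conv_lhs => rw [← mk_out x]
  exact mk_le_mk

noncomputable instance : Lattice FreeOL where
  sup x y := mk ⟨betaJoin x.out.1 y.out.1, x.out.2.betaJoin y.out.2⟩
  le_sup_left _ _ := le_mk_iff.2 (le_betaJoin_left _ _)
  le_sup_right _ _ := le_mk_iff.2 (le_betaJoin_right _ _)
  sup_le _ _ z hx hy := mk_le_iff.2 (betaJoin_le z.out.2 (le_iff.1 hx) (le_iff.1 hy))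
  inf x y := mk ⟨(betaJoin x.out.1.neg y.out.1.neg).neg, (x.out.2.neg.betaJoin y.out.2.neg).neg⟩
  inf_le_left _ _ := mk_le_iff.2 (Le.neg_le_comm.1 (le_betaJoin_left _ _))
  inf_le_right _ _ := mk_le_iff.2 (Le.neg_le_comm.1 (le_betaJoin_right _ _))
  le_inf x _ _ hx hy := le_mk_iff.2 (Le.le_neg_comm.1
    (betaJoin_le x.out.2.neg (le_iff.1 hx).neg (le_iff.1 hy).neg))

instance : BoundedOrder FreeOL where
  top := mk ⟨.top, trivial⟩
  bot := mk ⟨.bot, trivial⟩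
  le_top _ := le_mk_iff.2 (.top _)
  bot_le _ := mk_le_iff.2 (.bot _)

noncomputable instance : Compl FreeOL where
  compl x := mk ⟨x.out.1.neg, x.out.2.neg⟩

theorem compl_le_compl {x y : FreeOL} (h : x ≤ y) : yᶜ ≤ xᶜ :=
  mk_le_mk.2 (le_iff.1 h).neg

theorem compl_mk (t : RTerm) : (mk t)ᶜ = mk ⟨t.1.neg, t.2.neg⟩ :=
  le_antisymm (mk_le_mk.2 (le_out_mk t).neg) (mk_le_mk.2 (out_mk_le t).neg)

protected theorem compl_compl (x : FreeOL) : xᶜᶜ = x := by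
  rw [← mk_out x, compl_mk, compl_mk]
  simp

theorem compl_sup' (x y : FreeOL) : (x ⊔ y)ᶜ = xᶜ ⊓ yᶜ := by
  refine le_antisymm (le_inf (compl_le_compl le_sup_left) (compl_le_compl le_sup_right)) ?_
  rw [← FreeOL.compl_compl (xᶜ ⊓ yᶜ)]
  refine compl_le_compl (sup_le ?_ ?_)
  · conv_lhs => rw [← FreeOL.compl_compl x]
    exact compl_le_compl inf_le_left
  · conv_lhs => rw [← FreeOL.compl_compl y]
    exact compl_le_compl inf_le_right

theorem sup_compl' (x : FreeOL) : x ⊔ xᶜ = ⊤ := by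
  refine top_le_iff.1 ?_
  have h₁ : x ≤ x ⊔ xᶜ := le_sup_left
  have h₂ : xᶜ ≤ x ⊔ xᶜ := le_sup_right
  exact mk_le_iff.2 ((x ⊔ xᶜ).out.2.top_le (le_iff.1 h₁) (mk_le_iff.1 h₂))

noncomputable instance : OLPlus FreeOL where
  neg_neg := FreeOL.compl_compl
  neg_sup := compl_sup'
  neg_inf x y := by
    rw [← FreeOL.compl_compl (xᶜ ⊔ yᶜ), compl_sup', FreeOL.compl_compl, FreeOL.compl_compl]
  sup_neg := sup_compl'
  inf_neg x := by
    have h : (xᶜ ⊔ xᶜᶜ)ᶜ = (⊤ : FreeOL)ᶜ := by rw [sup_compl']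
    rw [compl_sup', FreeOL.compl_compl] at h
    exact h.trans (compl_mk _)
  interp f x := mk ⟨.app true f fun a => (x a).out.1, fun a => (x a).out.2⟩
  interp_le f x y h := mk_le_mk.2 <|
    .app true f (fun a ha => le_iff.1 ((h a).le_of_fwd ha))
      (fun a ha => le_iff.1 ((h a).ge_of_fwd ha))

/-- The join of classes is defined through chosen representatives. Being a supremum, it can be
computed with any others. -/
theorem mk_sup_mk (s t : RTerm) :
    mk s ⊔ mk t = mk ⟨betaJoin s.1 t.1, s.2.betaJoin t.2⟩ :=
  le_antisymm (sup_le (mk_le_mk.2 (le_betaJoin_left _ _)) (mk_le_mk.2 (le_betaJoin_right _ _)))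
    (mk_le_iff.2 (betaJoin_le (mk s ⊔ mk t).out.2 (mk_le_iff.1 le_sup_left)
      (mk_le_iff.1 le_sup_right)))

/-- The reduced form of a term. -/
noncomputable def reduce (b : Bool) (t : Term) : RTerm := ⟨beta (deltaAux b t), reduced_beta _⟩

/-- In the free ortholattice, evaluation at the generators is `β ∘ δ`. This is why terms with the
same value in every algebra have comparable images under `β ∘ δ`. -/
theorem eval_eq (t : Term) :
    t.eval (fun x => mk ⟨.lit true x, trivial⟩) = mk (reduce true t) := by
  have hc : ∀ t, (mk (reduce true t))ᶜ = mk (reduce false t) := fun t => by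
    rw [compl_mk]
    congr 2
    simp only [reduce]
    rw [← beta_neg, ← deltaAux_neg]
    rfl
  induction t with
  | var x => simp [Term.eval, reduce, deltaAux, beta]
  | bot => simp only [Term.eval, reduce, deltaAux, beta]; rfl
  | top => simp only [Term.eval, reduce, deltaAux, beta]; rfl
  | neg t ih => rw [Term.eval, ih, hc]; simp [reduce, deltaAux]
  | join s t hs ht =>
    rw [Term.eval, hs, ht, mk_sup_mk]
    simp [reduce, deltaAux, beta_join]
  | meet s t hs ht =>
    -- A meet is treated as the complement of a join of complements.
    rw [Term.eval, hs, ht, ← FreeOL.compl_compl (_ ⊓ _), OLPlus.neg_inf, hc, hc, mk_sup_mk,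
      compl_mk]
    congr 2
    simp only [reduce, deltaAux, beta_meet, ← beta_neg, ← deltaAux_neg, Bool.not_true]
  | app f x ih =>
    simp only [Term.eval, ih]
    refine le_antisymm (mk_le_mk.2 ?_) (mk_le_mk.2 ?_)
    · simp only [reduce, deltaAux, beta]
      exact .app _ f (fun a _ => out_mk_le (reduce true (x a)))
        (fun a _ => le_out_mk (reduce true (x a)))
    · simp only [reduce, deltaAux, beta]
      exact .app _ f (fun a _ => le_out_mk (reduce true (x a)))
        (fun a _ => out_mk_le (reduce true (x a)))

end FreeOL

theorem Equivalent.le_beta_delta {s t : Term} (h : Equivalent s t) :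
    Le (beta (delta s)) (beta (delta t)) := by
  have := h FreeOL fun x => FreeOL.mk ⟨.lit true x, trivial⟩
  rw [FreeOL.eval_eq, FreeOL.eval_eq] at this
  exact FreeOL.mk_le_mk.1 this.le

/-! ### Soundness -/

theorem OLPlus.compl_le_compl {A : Type} [OLPlus A] {x y : A} (h : x ≤ y) : yᶜ ≤ xᶜ := by
  rw [← sup_eq_right.2 h, OLPlus.neg_sup]
  exact inf_le_left

theorem OLPlus.compl_bot {A : Type} [OLPlus A] : (⊥ : A)ᶜ = ⊤ := by
  rw [← OLPlus.sup_neg (⊥ : A), bot_sup_eq]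

theorem OLPlus.compl_top {A : Type} [OLPlus A] : (⊤ : A)ᶜ = ⊥ := by
  rw [← OLPlus.compl_bot, OLPlus.neg_neg]

theorem Variance.rel_of_opposite {A : Type} [LE A] {v : Variance} {x y : A}
    (h : v.opposite.Rel x y) : v.Rel y x := by
  cases v
  · exact Eq.symm h
  · exact h
  · exact h

/-- An ortholattice with functions, where `F̄` is the complement of `F`. -/
abbrev OLPlus.toBLPlusBar (A : Type) [OLPlus A] : BLPlusBar A where
  interp b f x := if b then OLPlus.interp f x else (OLPlus.interp f x)ᶜ
  interp_le := OLPlus.interp_le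
  interp_bar_le f x y h := OLPlus.compl_le_compl
    (OLPlus.interp_le f y x fun a => Variance.rel_of_opposite (h a))

/-- An ortholattice with functions is a bounded lattice with functions once `x'` and `F̄` are read
as complements, so whatever the lattice calculus derives holds in it. -/
theorem NTerm.eval_toTerm {A : Type} [OLPlus A] (v : ℕ → A) (t : NTerm) :
    t.toTerm.eval v =
      (letI := OLPlus.toBLPlusBar A
      t.eval fun b x => if b then v x else (v x)ᶜ) := by
  induction t with
  | lit b x => cases b <;> simp [NTerm.toTerm, Term.eval, NTerm.eval]
  | bot => rfl
  | top => rfl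
  | meet s t hs ht => simp only [NTerm.toTerm, Term.eval, NTerm.eval, hs, ht]
  | join s t hs ht => simp only [NTerm.toTerm, Term.eval, NTerm.eval, hs, ht]
  | app b f x ih =>
    cases b
    · simp only [NTerm.toTerm, Term.eval, NTerm.eval, ih]; rfl
    · simp only [NTerm.toTerm, Term.eval, NTerm.eval, ih]; rfl

theorem Le.eval_toTerm_le {s t : NTerm} (h : Le s t) {A : Type} [OLPlus A] (v : ℕ → A) :
    s.toTerm.eval v ≤ t.toTerm.eval v := by
  rw [NTerm.eval_toTerm, NTerm.eval_toTerm]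
  let := OLPlus.toBLPlusBar A
  exact h.eval_le _

theorem NTerm.eval_neg_toTerm {A : Type} [OLPlus A] (v : ℕ → A) (t : NTerm) :
    t.neg.toTerm.eval v = (t.toTerm.eval v)ᶜ := by
  induction t with
  | lit b x => cases b <;> simp [NTerm.neg, NTerm.toTerm, Term.eval, OLPlus.neg_neg]
  | bot => simp [NTerm.neg, NTerm.toTerm, Term.eval, OLPlus.compl_bot]
  | top => simp [NTerm.neg, NTerm.toTerm, Term.eval, OLPlus.compl_top]
  | meet s t hs ht => simp [NTerm.neg, NTerm.toTerm, Term.eval, hs, ht, OLPlus.neg_inf]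
  | join s t hs ht => simp [NTerm.neg, NTerm.toTerm, Term.eval, hs, ht, OLPlus.neg_sup]
  | app b f x ih => cases b <;> simp [NTerm.neg, NTerm.toTerm, Term.eval, OLPlus.neg_neg]

/-- If the dual of `s` is below `s ∨ t`, then `s ∨ t` is above both `s` and `¬ s`, and its value is
`⊤` anyway. -/
theorem eval_betaJoin {A : Type} [OLPlus A] (v : ℕ → A) (s t : NTerm) :
    (betaJoin s t).toTerm.eval v = s.toTerm.eval v ⊔ t.toTerm.eval v := by
  unfold betaJoin
  split
  · rename_i h
    symm
    refine top_le_iff.1 ?_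
    rcases h with h | h
    · rw [← OLPlus.sup_neg (s.toTerm.eval v), ← NTerm.eval_neg_toTerm]
      exact sup_le le_sup_left (h.eval_toTerm_le v)
    · rw [← OLPlus.sup_neg (t.toTerm.eval v), ← NTerm.eval_neg_toTerm]
      exact sup_le le_sup_right (h.eval_toTerm_le v)
  · rfl

theorem eval_beta {A : Type} [OLPlus A] (v : ℕ → A) (t : NTerm) :
    (beta t).toTerm.eval v = t.toTerm.eval v := by
  induction t with
  | join s t hs ht => rw [beta_join, eval_betaJoin, hs, ht]; rfl
  | meet s t hs ht =>
    rw [beta_meet, NTerm.eval_neg_toTerm, eval_betaJoin, NTerm.eval_neg_toTerm,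
      NTerm.eval_neg_toTerm, OLPlus.neg_sup, OLPlus.neg_neg, OLPlus.neg_neg, hs, ht]
    rfl
  | app b f x ih =>
    cases b <;> simp only [beta, NTerm.toTerm, Term.eval, ih]
  | _ => simp [beta]

theorem eval_deltaAux {A : Type} [OLPlus A] (v : ℕ → A) (t : Term) :
    (deltaAux true t).toTerm.eval v = t.eval v := by
  have hc : ∀ t, (deltaAux false t).toTerm.eval v = ((deltaAux true t).toTerm.eval v)ᶜ :=
    fun t => by rw [← NTerm.eval_neg_toTerm, ← deltaAux_neg]; rfl
  induction t with
  | neg t ih => simp [deltaAux, hc, ih, Term.eval]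
  | app f x ih => simp only [deltaAux, NTerm.toTerm, Term.eval, ih]
  | _ => simp_all [deltaAux, NTerm.toTerm, Term.eval]


/-! ### Joins and meets of several terms, uniformly -/

/-- `op true` is the join and `op false` is the meet. -/
def op : Bool → NTerm → NTerm → NTerm
  | true => .join
  | false => .meet

/-- The order for which `op d` is the join. -/
def LeD : Bool → NTerm → NTerm → Prop
  | true, s, t => Le s t
  | false, s, t => Le t s

/-- The members of an iterated `op d`. -/
def parts : Bool → NTerm → List NTerm
  | true => NTerm.disjuncts
  | false => NTerm.conjuncts

/-- The iterated `op d` of a list. -/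
def big : Bool → List NTerm → NTerm
  | true => bigJoin
  | false => bigMeet

/-- The outermost operation of the term is `op d`. -/
def IsOp (d : Bool) (t : NTerm) : Prop := ∃ a b, t = op d a b

theorem isOp_op (d : Bool) (a b : NTerm) : IsOp d (op d a b) := ⟨a, b, rfl⟩

theorem op_ne_op {d : Bool} {a b a' b' : NTerm} : op d a b ≠ op (!d) a' b' := by
  cases d <;> simp [op]

theorem not_isOp_op {d : Bool} {a b : NTerm} : ¬ IsOp d (op (!d) a b) :=
  fun ⟨_, _, h⟩ => op_ne_op h.symm

theorem not_isOp_not {d : Bool} {t : NTerm} (h : IsOp d t) : ¬ IsOp (!d) t := by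
  rintro ⟨a, b, rfl⟩
  exact not_isOp_op h

theorem op_inj {d d' : Bool} {a b a' b' : NTerm} (h : op d a b = op d' a' b') :
    d = d' ∧ a = a' ∧ b = b' := by
  cases d <;> cases d' <;> simp_all [op]

@[simp] theorem size_op (d : Bool) (a b : NTerm) : (op d a b).size = a.size + b.size + 1 := by
  cases d <;> rfl

namespace LeD

theorem refl (d : Bool) (t : NTerm) : LeD d t t := by
  cases d <;> exact Le.refl t

theorem trans {d : Bool} {s t u : NTerm} (h : LeD d s t) (h' : LeD d t u) : LeD d s u := by
  cases d
  · exact Le.trans h' h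
  · exact Le.trans h h'

theorem not_iff {d : Bool} {s t : NTerm} : LeD (!d) s t ↔ LeD d t s := by
  cases d <;> rfl

theorem op_le_iff {d : Bool} {a b t : NTerm} : LeD d (op d a b) t ↔ LeD d a t ∧ LeD d b t := by
  cases d
  · exact Le.le_meet_iff
  · exact Le.join_le_iff

theorem le_op_left (d : Bool) (a b : NTerm) : LeD d a (op d a b) := (op_le_iff.1 (refl _ _)).1

theorem le_op_right (d : Bool) (a b : NTerm) : LeD d b (op d a b) := (op_le_iff.1 (refl _ _)).2

/-- Inversion of the last rule. The fourth alternative is the rule for the least element of the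
order `LeD d`, which is `⊤` for `d = false`. -/
theorem whitman {d : Bool} {s a b : NTerm} (hs : ¬ IsOp d s) (h : LeD d s (op d a b)) :
    LeD d s a ∨ LeD d s b ∨
      (∃ p q, s = op (!d) p q ∧ (LeD d p (op d a b) ∨ LeD d q (op d a b))) ∨
      ∀ u, LeD d s u := by
  cases d
  · cases h with
    | top => exact .inr (.inr (.inr fun u => .top u))
    | meet_right => exact absurd (isOp_op false _ _) hs
    | meet_left₁ h => exact .inl h
    | meet_left₂ h => exact .inr (.inl h)
    | join_right₁ h => exact .inr (.inr (.inl ⟨_, _, rfl, .inl h⟩))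
    | join_right₂ h => exact .inr (.inr (.inl ⟨_, _, rfl, .inr h⟩))
  · cases h with
    | bot => exact .inr (.inr (.inr fun u => .bot u))
    | join_left => exact absurd (isOp_op true _ _) hs
    | join_right₁ h => exact .inl h
    | join_right₂ h => exact .inr (.inl h)
    | meet_left₁ h => exact .inr (.inr (.inl ⟨_, _, rfl, .inl h⟩))
    | meet_left₂ h => exact .inr (.inr (.inl ⟨_, _, rfl, .inr h⟩))

/-- The dual form of Whitman's condition. -/
theorem whitman_left {d : Bool} {p q v : NTerm} (hv : ¬ IsOp (!d) v)
    (h : LeD d (op (!d) p q) v) :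
    LeD d p v ∨ LeD d q v ∨
      ∃ a b, v = op d a b ∧ (LeD d (op (!d) p q) a ∨ LeD d (op (!d) p q) b) := by
  rcases whitman hv (not_iff.2 h) with h | h | ⟨a, b, h, h'⟩ | h
  · exact .inl (not_iff.1 h)
  · exact .inr (.inl (not_iff.1 h))
  · rw [Bool.not_not] at h
    exact .inr (.inr ⟨a, b, h, by rwa [not_iff, not_iff] at h'⟩)
  · exact .inl (not_iff.1 (h p))

end LeD

theorem parts_op (d : Bool) (a b : NTerm) : parts d (op d a b) = parts d a ++ parts d b := by
  cases d <;> rfl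

theorem parts_of_not {d : Bool} {t : NTerm} (h : ¬ IsOp d t) : parts d t = [t] := by
  cases d <;> cases t <;> first | rfl | exact absurd (isOp_op _ _ _) h

/-- Induction along the bracketing of an iterated `op d`, where everything with another outermost
symbol counts as an atom. -/
theorem NTerm.op_induction (d : Bool) {P : NTerm → Prop} (atom : ∀ t, ¬ IsOp d t → P t)
    (op : ∀ a b, P a → P b → P (op d a b)) (t : NTerm) : P t := by
  cases d
  · induction t with
    | meet a b ha hb => exact op a b ha hb
    | _ => exact atom _ (by rintro ⟨a, b, h⟩; cases h)
  · induction t with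
    | join a b ha hb => exact op a b ha hb
    | _ => exact atom _ (by rintro ⟨a, b, h⟩; cases h)

theorem not_isOp_of_mem_parts {d : Bool} {t u : NTerm} (h : u ∈ parts d t) : ¬ IsOp d u := by
  induction t using NTerm.op_induction d with
  | atom t ht =>
    rw [parts_of_not ht, List.mem_singleton] at h
    rwa [h]
  | op a b ha hb =>
    rw [parts_op, List.mem_append] at h
    exact h.elim ha hb

theorem parts_ne_nil (d : Bool) (t : NTerm) : parts d t ≠ [] := by
  induction t using NTerm.op_induction d with
  | atom t ht => simp [parts_of_not ht]
  | op a b ha hb => simp [parts_op, ha]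

theorem le_of_mem_parts {d : Bool} {t u : NTerm} (h : u ∈ parts d t) : LeD d u t := by
  induction t using NTerm.op_induction d with
  | atom t ht =>
    rw [parts_of_not ht, List.mem_singleton] at h
    rw [h]
    exact .refl _ _
  | op a b ha hb =>
    rw [parts_op, List.mem_append] at h
    rcases h with h | h
    · exact (ha h).trans (.le_op_left _ _ _)
    · exact (hb h).trans (.le_op_right _ _ _)

theorem le_iff_parts {d : Bool} {t u : NTerm} : LeD d t u ↔ ∀ v ∈ parts d t, LeD d v u := by
  induction t using NTerm.op_induction d with
  | atom t ht => simp [parts_of_not ht]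
  | op a b ha hb => simp [parts_op, LeD.op_le_iff, ha, hb, or_imp, forall_and]

/-- Joining `m` members takes `m - 1` operation signs. Adding `1` to every size makes the count
additive, and this is the form in which all size estimates are made. -/
theorem sum_size_parts (d : Bool) (t : NTerm) :
    ((parts d t).map fun u => u.size + 1).sum = t.size + 1 := by
  induction t using NTerm.op_induction d with
  | atom t ht => simp [parts_of_not ht]
  | op a b ha hb =>
    rw [parts_op, List.map_append, List.sum_append, ha, hb, size_op]
    omega

theorem size_le_of_mem_parts {d : Bool} {t u : NTerm} (h : u ∈ parts d t) : u.size ≤ t.size := by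
  cases d
  · exact size_le_of_mem_conjuncts t u h
  · exact size_le_of_mem_disjuncts t u h

theorem size_lt_of_mem_parts_op {d : Bool} {a b u : NTerm} (h : u ∈ parts d (op d a b)) :
    u.size < (op d a b).size := by
  cases d
  · exact size_lt_of_mem_conjuncts_meet h
  · exact size_lt_of_mem_disjuncts_join h

/-- Whitman's condition for operations with many arguments, independent of bracketing: the binary
condition is iterated along the members of `t` and, when `s` is of the opposite kind, along those of
`s`. -/
theorem exists_le_part {d : Bool} {s t : NTerm} (hs : ¬ IsOp d s) (h : LeD d s t) :
    (∃ m ∈ parts d t, LeD d s m) ∨ (IsOp (!d) s ∧ ∃ c ∈ parts (!d) s, LeD d c t) := by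
  induction s using NTerm.op_induction (!d) generalizing t with
  | atom s hs' =>
    induction t using NTerm.op_induction d with
    | atom t ht => exact .inl ⟨t, by simp [parts_of_not ht], h⟩
    | op a b ha hb =>
      left
      rcases LeD.whitman hs h with h | h | ⟨p, q, h, -⟩ | h
      · obtain ⟨m, hm, h⟩ := (ha h).resolve_right fun h => hs' h.1
        exact ⟨m, by simp [parts_op, hm], h⟩
      · obtain ⟨m, hm, h⟩ := (hb h).resolve_right fun h => hs' h.1
        exact ⟨m, by simp [parts_op, hm], h⟩
      · exact absurd ⟨p, q, h⟩ hs'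
      · obtain ⟨m, hm⟩ := List.exists_mem_of_ne_nil _ (parts_ne_nil d (op d a b))
        exact ⟨m, hm, h m⟩
  | op p q hp hq =>
    induction t using NTerm.op_induction d with
    | atom t ht => exact .inl ⟨t, by simp [parts_of_not ht], h⟩
    | op a b ha hb =>
      -- A side `r` of `s` that is below `t` either has the kind of `s`, and then the induction
      -- hypothesis applies, or is itself a member of `s`.
      have key : ∀ r, LeD d (op (!d) p q) r → r = p ∨ r = q →
          LeD d r (op d a b) → (∀ {t}, ¬ IsOp d r → LeD d r t →
            (∃ m ∈ parts d t, LeD d r m) ∨ (IsOp (!d) r ∧ ∃ c ∈ parts (!d) r, LeD d c t)) →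
          (∃ m ∈ parts d (op d a b), LeD d (op (!d) p q) m) ∨
            (IsOp (!d) (op (!d) p q) ∧ ∃ c ∈ parts (!d) (op (!d) p q), LeD d c (op d a b)) := by
        intro r hr hr' hle ih
        have hsub : ∀ c ∈ parts (!d) r, c ∈ parts (!d) (op (!d) p q) := by
          intro c hc
          rw [parts_op, List.mem_append]
          rcases hr' with rfl | rfl
          · exact .inl hc
          · exact .inr hc
        by_cases hro : IsOp (!d) r
        · have := not_isOp_not hro
          rw [Bool.not_not] at this
          rcases ih this hle with ⟨m, hm, h⟩ | ⟨-, c, hc, h⟩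
          · exact .inl ⟨m, hm, hr.trans h⟩
          · exact .inr ⟨isOp_op _ _ _, c, hsub c hc, h⟩
        · exact .inr ⟨isOp_op _ _ _, r, hsub r (by simp [parts_of_not hro]), hle⟩
      rcases LeD.whitman hs h with h | h | ⟨p', q', h, h'⟩ | h
      · rcases ha h with ⟨m, hm, h⟩ | ⟨ho, c, hc, h⟩
        · exact .inl ⟨m, by simp [parts_op, hm], h⟩
        · exact .inr ⟨ho, c, hc, h.trans (.le_op_left _ _ _)⟩
      · rcases hb h with ⟨m, hm, h⟩ | ⟨ho, c, hc, h⟩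
        · exact .inl ⟨m, by simp [parts_op, hm], h⟩
        · exact .inr ⟨ho, c, hc, h.trans (.le_op_right _ _ _)⟩
      · obtain ⟨-, rfl, rfl⟩ := op_inj h
        rcases h' with h' | h'
        · exact key p (LeD.not_iff.1 (.le_op_left _ _ _)) (.inl rfl) h' hp
        · exact key q (LeD.not_iff.1 (.le_op_right _ _ _)) (.inr rfl) h' hq
      · obtain ⟨m, hm⟩ := List.exists_mem_of_ne_nil _ (parts_ne_nil d (op d a b))
        exact .inl ⟨m, hm, h m⟩

theorem big_singleton (d : Bool) (t : NTerm) : big d [t] = t := by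
  cases d <;> rfl

theorem big_cons_cons (d : Bool) (t u : NTerm) (l : List NTerm) :
    big d (t :: u :: l) = op d t (big d (u :: l)) := by
  cases d <;> rfl

theorem big_le_iff {d : Bool} {l : List NTerm} (hl : l ≠ []) {u : NTerm} :
    LeD d (big d l) u ↔ ∀ m ∈ l, LeD d m u := by
  induction l with
  | nil => exact absurd rfl hl
  | cons t l ih =>
    cases l with
    | nil => simp [big_singleton]
    | cons u l => rw [big_cons_cons, LeD.op_le_iff, ih (by simp), List.forall_mem_cons (a := t)]

theorem le_big {d : Bool} {l : List NTerm} {m : NTerm} (h : m ∈ l) : LeD d m (big d l) :=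
  (big_le_iff (List.ne_nil_of_mem h)).1 (.refl _ _) m h

theorem size_big (d : Bool) {l : List NTerm} (hl : l ≠ []) :
    (big d l).size + 1 = (l.map fun u => u.size + 1).sum := by
  induction l with
  | nil => exact absurd rfl hl
  | cons t l ih =>
    cases l with
    | nil => simp [big_singleton]
    | cons u l =>
      have := ih (by simp)
      rw [big_cons_cons, List.map_cons, List.sum_cons, ← this, size_op]
      omega

theorem parts_big {d : Bool} {l : List NTerm} (hl : l ≠ []) (h : ∀ m ∈ l, ¬ IsOp d m) :
    parts d (big d l) = l := by
  induction l with
  | nil => exact absurd rfl hl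
  | cons t l ih =>
    cases l with
    | nil => rw [big_singleton, parts_of_not (h t (by simp))]
    | cons u l =>
      rw [big_cons_cons, parts_op, ih (by simp) fun m hm => h m (by simp [hm]),
        parts_of_not (h t (by simp))]
      rfl

/-! ### Antichains and sorting -/

section Antichain

variable {le : NTerm → NTerm → Prop}

theorem mem_of_mem_antichain {l : List NTerm} {x : NTerm} (h : x ∈ antichain le l) : x ∈ l := by
  simp only [antichain, List.mem_map] at h
  obtain ⟨i, -, rfl⟩ := h
  exact List.get_mem _ _

theorem pairwise_antichain (l : List NTerm) :
    (antichain le l).Pairwise fun x y => ¬ le x y ∧ ¬ le y x := by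
  rw [antichain, List.pairwise_map, List.pairwise_filter]
  refine (List.pairwise_lt_finRange l.length).imp ?_
  intro i j hij hi hj
  simp only [decide_eq_true_eq, not_exists, not_and, not_or, not_not] at hi hj
  -- If the later member were below the earlier one, it would have been discarded: as strictly
  -- smaller, or as equivalent with the larger index.
  have hj' : ¬ le (l.get j) (l.get i) := fun h => (hj i h).2 hij
  exact ⟨fun h => hj' (hi j h).1, hj'⟩

/-- The relation by which a member eliminates another is transitive and irreflexive, hence well
founded on finitely many indices. Following it from any member ends at a survivor. -/
theorem exists_le_antichain (hr : ∀ x, le x x) (ht : ∀ x y z, le x y → le y z → le x z)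
    {l : List NTerm} {x : NTerm} (hx : x ∈ l) : ∃ y ∈ antichain le l, le x y := by
  classical
  obtain ⟨i, rfl⟩ := List.get_of_mem hx
  let r : Fin l.length → Fin l.length → Prop := fun k j =>
    le (l.get j) (l.get k) ∧ (¬ le (l.get k) (l.get j) ∨ k < j)
  have hr_trans : ∀ a b c, r a b → r b c → r a c := by
    rintro a b c ⟨h₁, h₂⟩ ⟨h₃, h₄⟩
    refine ⟨ht _ _ _ h₃ h₁, ?_⟩
    by_contra hc
    rw [not_or, not_not] at hc
    have h₅ := ht _ _ _ hc.1 h₃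
    have h₆ := ht _ _ _ h₁ hc.1
    exact hc.2 ((h₂.resolve_left (not_not.2 h₅)).trans (h₄.resolve_left (not_not.2 h₆)))
  have hr_irrefl : ∀ a, ¬ r a a := by
    rintro a ⟨h₁, h₂ | h₂⟩
    · exact h₂ h₁
    · exact lt_irrefl _ h₂
  have hwf : WellFounded r := by
    have : Std.Irrefl r := ⟨hr_irrefl⟩
    have : IsTrans _ r := ⟨hr_trans⟩
    exact Finite.wellFounded_of_trans_of_irrefl r
  induction i using hwf.induction with
  | _ i ih =>
    by_cases h : ∃ j, le (l.get i) (l.get j) ∧ (¬ le (l.get j) (l.get i) ∨ j < i)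
    · obtain ⟨j, h₁, h₂⟩ := h
      obtain ⟨y, hy, hy'⟩ := ih j ⟨h₁, h₂⟩ (List.get_mem _ _)
      exact ⟨y, hy, ht _ _ _ h₁ hy'⟩
    · refine ⟨l.get i, ?_, hr _⟩
      rw [antichain, List.mem_map]
      exact ⟨i, List.mem_filter.2 ⟨List.mem_finRange _, by simpa using h⟩, rfl⟩

theorem antichain_sublist (l : List NTerm) : (antichain le l).Sublist l := by
  have h : (List.finRange l.length).map l.get = l := by simp
  conv_rhs => rw [← h]
  rw [antichain]
  exact List.filter_sublist.map _

end Antichain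

theorem toTerm_injective : Function.Injective NTerm.toTerm :=
  fun s t h => by rw [← deltaAux_toTerm s, h, deltaAux_toTerm]


/-! ### Prefix notation is injective -/

theorem flatten_ofFn_injective {n : ℕ} {x y : Fin n → Term}
    (h : ∀ a t l l', (x a).encode ++ l = Term.encode t ++ l' → x a = t ∧ l = l') {l l' : List ℕ}
    (he : (List.ofFn fun a => (x a).encode).flatten ++ l =
      (List.ofFn fun a => (y a).encode).flatten ++ l') : x = y ∧ l = l' := by
  induction n with
  | zero => exact ⟨funext fun a => a.elim0, by simpa using he⟩
  | succ n ih =>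
    simp only [List.ofFn_succ, List.flatten_cons, List.append_assoc] at he
    obtain ⟨h₀, he⟩ := h _ _ _ _ he
    obtain ⟨h₁, he⟩ := ih (x := fun a => x a.succ) (y := fun a => y a.succ)
      (fun a => h a.succ) he
    exact ⟨funext fun a => Fin.cases h₀ (fun a => congrFun h₁ a) a, he⟩

/-- Prefix notation is uniquely decodable. The trailing words are part of the statement so that the
induction passes from one argument to the next. -/
theorem encode_append_injective {s t : Term} {l l' : List ℕ}
    (h : s.encode ++ l = t.encode ++ l') : s = t ∧ l = l' := by
  induction s generalizing t l l' with
  | var x => cases t <;> simp_all [Term.encode]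
  | bot => cases t <;> simp_all [Term.encode]
  | top => cases t <;> simp_all [Term.encode]
  | neg s ih =>
    cases t <;> simp only [Term.encode, List.cons_append, List.cons.injEq] at h <;>
      first | (exact absurd h.1 (by decide)) | skip
    obtain ⟨rfl, h'⟩ := ih h.2
    exact ⟨rfl, h'⟩
  | meet s s' ih ih' =>
    cases t <;> simp only [Term.encode, List.cons_append, List.cons.injEq] at h <;>
      first | (exact absurd h.1 (by decide)) | skip
    rw [List.append_assoc, List.append_assoc] at h
    obtain ⟨rfl, h₁⟩ := ih h.2
    obtain ⟨rfl, h₂⟩ := ih' h₁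
    exact ⟨rfl, h₂⟩
  | join s s' ih ih' =>
    cases t <;> simp only [Term.encode, List.cons_append, List.cons.injEq] at h <;>
      first | (exact absurd h.1 (by decide)) | skip
    rw [List.append_assoc, List.append_assoc] at h
    obtain ⟨rfl, h₁⟩ := ih h.2
    obtain ⟨rfl, h₂⟩ := ih' h₁
    exact ⟨rfl, h₂⟩
  | app f x ih =>
    cases t with
    | app g y =>
      simp only [Term.encode, List.cons_append, List.cons.injEq, true_and] at h
      obtain ⟨h₁, h₂, h₃, h₄, h⟩ := h
      obtain ⟨n, i, j, k⟩ := f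
      obtain ⟨n', i', j', k'⟩ := g
      simp only at h₁ h₂ h₃ h₄
      subst h₁ h₂ h₃ h₄
      obtain ⟨rfl, h'⟩ := flatten_ofFn_injective (fun a t l l' h => ih a h) h
      exact ⟨rfl, h'⟩
    | _ =>
      simp only [Term.encode, List.cons_append, List.cons.injEq] at h
      exact absurd h.1 (by decide)

theorem encode_injective : Function.Injective Term.encode := fun s t h =>
  (encode_append_injective (l := []) (l' := []) (by simpa using h)).1

/-- The lexicographic order of the prefix notations. -/
abbrev TextLe (s t : NTerm) : Prop := s.toTerm.encode ≤ t.toTerm.encode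

instance : Std.Total TextLe := ⟨fun s t => le_total s.toTerm.encode t.toTerm.encode⟩

instance : IsTrans NTerm TextLe := ⟨fun _ _ _ h h' => le_trans (α := List ℕ) h h'⟩

instance : Std.Antisymm TextLe :=
  ⟨fun _ _ h h' => toTerm_injective (encode_injective (le_antisymm h h'))⟩

theorem sortTerms_perm (l : List NTerm) : (sortTerms l).Perm l := List.perm_insertionSort _ _

theorem pairwise_sortTerms (l : List NTerm) : (sortTerms l).Pairwise TextLe :=
  List.pairwise_insertionSort TextLe l

/-! ### The map η -/

/-- The sorted antichain of the maximal members of a list. -/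
noncomputable def sortedAntichain (d : Bool) (l : List NTerm) : List NTerm :=
  sortTerms (antichain (LeD d) l)

theorem eta_op (d : Bool) (a b : NTerm) :
    eta (op d a b) = big d (sortedAntichain d ((parts d (op d a b)).map eta)) := by
  cases d
  · simp only [op, eta, List.attach_map_val (f := eta), ble_eq_le]
    rfl
  · simp only [op, eta, List.attach_map_val (f := eta), ble_eq_le]
    rfl

theorem mem_of_mem_sortedAntichain {d : Bool} {l : List NTerm} {x : NTerm}
    (h : x ∈ sortedAntichain d l) : x ∈ l :=
  mem_of_mem_antichain ((sortTerms_perm _).mem_iff.1 h)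

theorem exists_le_sortedAntichain {d : Bool} {l : List NTerm} {x : NTerm} (h : x ∈ l) :
    ∃ y ∈ sortedAntichain d l, LeD d x y := by
  obtain ⟨y, hy, h⟩ := exists_le_antichain (LeD.refl d) (fun _ _ _ => LeD.trans) h
  exact ⟨y, (sortTerms_perm _).mem_iff.2 hy, h⟩

theorem sortedAntichain_ne_nil (d : Bool) {l : List NTerm} (h : l ≠ []) :
    sortedAntichain d l ≠ [] := by
  obtain ⟨x, hx⟩ := List.exists_mem_of_ne_nil l h
  obtain ⟨y, hy, -⟩ := exists_le_sortedAntichain (d := d) hx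
  exact List.ne_nil_of_mem hy

theorem eq_of_le_of_mem_sortedAntichain {d : Bool} {l : List NTerm} {x y : NTerm}
    (hx : x ∈ sortedAntichain d l) (hy : y ∈ sortedAntichain d l) (h : LeD d x y) : x = y := by
  have hx := (sortTerms_perm _).mem_iff.1 hx
  have hy := (sortTerms_perm _).mem_iff.1 hy
  by_contra hne
  have : Std.Symm fun x y => ¬ LeD d x y ∧ ¬ LeD d y x := ⟨fun _ _ h => ⟨h.2, h.1⟩⟩
  exact ((pairwise_antichain (le := LeD d) l).forall hx hy hne).1 h

theorem nodup_sortedAntichain (d : Bool) (l : List NTerm) : (sortedAntichain d l).Nodup :=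
  (sortTerms_perm _).nodup_iff.2
    ((pairwise_antichain (le := LeD d) l).imp fun h => by
      rintro rfl
      exact h.1 (.refl _ _))

/-- A list without repetitions, sorted by an antisymmetric order, is determined by its set of
members. -/
theorem sortedAntichain_eq {d : Bool} {l l' : List NTerm}
    (h : ∀ x, x ∈ sortedAntichain d l ↔ x ∈ sortedAntichain d l') :
    sortedAntichain d l = sortedAntichain d l' := by
  have hp := (List.perm_ext_iff_of_nodup (nodup_sortedAntichain d l)
    (nodup_sortedAntichain d l')).2 h
  exact hp.eq_of_pairwise' (r := TextLe) (pairwise_sortTerms _) (pairwise_sortTerms _)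

theorem big_sortedAntichain_le_iff {d : Bool} {l : List NTerm} (hl : l ≠ []) {u : NTerm} :
    LeD d (big d (sortedAntichain d l)) u ↔ ∀ m ∈ l, LeD d m u := by
  rw [big_le_iff (sortedAntichain_ne_nil d hl)]
  refine ⟨fun h m hm => ?_, fun h m hm => h m (mem_of_mem_sortedAntichain hm)⟩
  obtain ⟨y, hy, h'⟩ := exists_le_sortedAntichain (d := d) hm
  exact h'.trans (h y hy)

theorem sortedAntichain_sum_le (d : Bool) (l : List NTerm) :
    ((sortedAntichain d l).map fun u => u.size + 1).sum ≤ (l.map fun u => u.size + 1).sum := by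
  rw [sortedAntichain, ((sortTerms_perm _).map _).sum_eq]
  exact ((antichain_sublist l).map _).sum_le_sum (by simp)

/-! ### Equivalence and size under η. -/

/-- Equivalence of terms in bounded lattices. -/
def Equiv (s t : NTerm) : Prop := Le s t ∧ Le t s

namespace Equiv

theorem refl (t : NTerm) : Equiv t t := ⟨.refl t, .refl t⟩

theorem symm {s t : NTerm} (h : Equiv s t) : Equiv t s := ⟨h.2, h.1⟩

theorem trans {s t u : NTerm} (h : Equiv s t) (h' : Equiv t u) : Equiv s u :=
  ⟨h.1.trans h'.1, h'.2.trans h.2⟩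

theorem of_leD {d : Bool} {s t : NTerm} (h : LeD d s t) (h' : LeD d t s) : Equiv s t := by
  cases d
  · exact ⟨h', h⟩
  · exact ⟨h, h'⟩

theorem leD {s t : NTerm} (h : Equiv s t) (d : Bool) : LeD d s t := by
  cases d
  · exact h.2
  · exact h.1

theorem app {b : Bool} {f : FunSym} {x y : Fin f.arity → NTerm} (h : ∀ a, Equiv (x a) (y a)) :
    Equiv (.app b f x) (.app b f y) :=
  ⟨.app b f (fun a _ => (h a).1) fun a _ => (h a).2,
    .app b f (fun a _ => (h a).2) fun a _ => (h a).1⟩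

end Equiv

/-- A term is an iterated `op d` for some `d`, or the arguments of its outermost symbol are
arguments of a function symbol. -/
theorem NTerm.isOp_or (t : NTerm) : (∃ d a b, t = op d a b) ∨ ∀ d, ¬ IsOp d t := by
  cases t with
  | meet a b => exact .inl ⟨false, a, b, rfl⟩
  | join a b => exact .inl ⟨true, a, b, rfl⟩
  | _ => exact .inr fun d => by rintro ⟨a, b, h⟩; cases d <;> cases h

theorem eta_equiv (t : NTerm) : Equiv (eta t) t := by
  induction h : t.size using Nat.strong_induction_on generalizing t with
  | _ n ih =>
    subst h
    rcases t.isOp_or with ⟨d, a, b, rfl⟩ | h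
    · have hl : (parts d (op d a b)).map eta ≠ [] := by simp [parts_ne_nil]
      have key : ∀ u ∈ parts d (op d a b), Equiv (eta u) u := fun u hu =>
        ih _ (size_lt_of_mem_parts_op hu) u rfl
      rw [eta_op]
      refine .of_leD (d := d) ?_ ?_
      · rw [big_sortedAntichain_le_iff hl, List.forall_mem_map]
        exact fun u hu => ((key u hu).leD d).trans (le_of_mem_parts hu)
      · rw [le_iff_parts]
        exact fun u hu => ((key u hu).symm.leD d).trans
          ((big_sortedAntichain_le_iff hl).1 (.refl _ _) _ (List.mem_map_of_mem hu))
    · cases t with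
      | meet a b => exact absurd ⟨a, b, rfl⟩ (h false)
      | join a b => exact absurd ⟨a, b, rfl⟩ (h true)
      | app b f x => rw [eta]; exact .app fun a => ih _ (size_arg_lt b f x a) _ rfl
      | _ => rw [eta]; exact .refl _

theorem size_eta_le (t : NTerm) : (eta t).size ≤ t.size := by
  induction h : t.size using Nat.strong_induction_on generalizing t with
  | _ n ih =>
    subst h
    rcases t.isOp_or with ⟨d, a, b, rfl⟩ | h
    · have hl : (parts d (op d a b)).map eta ≠ [] := by simp [parts_ne_nil]
      have h₁ := size_big d (sortedAntichain_ne_nil d hl)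
      have h₂ := sortedAntichain_sum_le d ((parts d (op d a b)).map eta)
      have h₃ : (((parts d (op d a b)).map eta).map fun u => u.size + 1).sum ≤
          ((parts d (op d a b)).map fun u => u.size + 1).sum := by
        rw [List.map_map]
        exact List.sum_le_sum fun u hu =>
          Nat.succ_le_succ (ih _ (size_lt_of_mem_parts_op hu) u rfl)
      rw [sum_size_parts] at h₃
      rw [eta_op]
      omega
    · cases t with
      | meet a b => exact absurd ⟨a, b, rfl⟩ (h false)
      | join a b => exact absurd ⟨a, b, rfl⟩ (h true)
      | app b f x =>
        rw [eta, NTerm.size, NTerm.size]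
        exact Nat.succ_le_succ (Finset.sum_le_sum fun a _ => ih _ (size_arg_lt b f x a) _ rfl)
      | _ => rw [eta]

/-! ### Uniqueness -/

/-- No member of an iterated join is a meet with a member below the join, and dually. -/
inductive ZN : NTerm → Prop
  | lit (b : Bool) (x : ℕ) : ZN (.lit b x)
  | bot : ZN .bot
  | top : ZN .top
  | app (b : Bool) (f : FunSym) (x : Fin f.arity → NTerm) : (∀ a, ZN (x a)) → ZN (.app b f x)
  | op (d : Bool) (a b t : NTerm) : t = op d a b → (∀ u ∈ parts d t, ZN u) →
      (∀ u ∈ parts d t, IsOp (!d) u → ∀ c ∈ parts (!d) u, ¬ LeD d c t) → ZN t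

theorem ZN.op_inv {d : Bool} {a b : NTerm} (h : ZN (OrthoPlus.op d a b)) :
    (∀ u ∈ parts d (OrthoPlus.op d a b), ZN u) ∧
      ∀ u ∈ parts d (OrthoPlus.op d a b), IsOp (!d) u → ∀ c ∈ parts (!d) u,
        ¬ LeD d c (OrthoPlus.op d a b) := by
  generalize ht : OrthoPlus.op d a b = t at h
  cases h with
  | op d' a' b' _ h h₁ h₂ =>
    obtain ⟨rfl, -, -⟩ := op_inj (ht.trans h)
    exact ⟨h₁, h₂⟩
  | _ => cases d <;> simp [OrthoPlus.op] at ht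

theorem ZN.of_mem_parts {d : Bool} {t u : NTerm} (h : ZN t) (hu : u ∈ parts d t) : ZN u := by
  by_cases ht : IsOp d t
  · obtain ⟨a, b, rfl⟩ := ht
    exact h.op_inv.1 u hu
  · rw [parts_of_not ht, List.mem_singleton] at hu
    rwa [hu]

/-- When one member equals the whole join, the maximal members are all equivalent to the join. So
exactly one survives in the antichain, and `big` of a singleton adds no operation sign. -/
theorem eta_eq_of_not_proper {d : Bool} {a b u : NTerm} (hu : u ∈ parts d (op d a b))
    (h : LeD d (op d a b) u) : ∃ v ∈ parts d (op d a b), Equiv v (op d a b) ∧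
      eta v = eta (op d a b) := by
  have hl : (parts d (op d a b)).map eta ≠ [] := by simp [parts_ne_nil]
  obtain ⟨y, hy, huy⟩ := exists_le_sortedAntichain (d := d) (List.mem_map_of_mem (f := eta) hu)
  obtain ⟨v, hv, rfl⟩ := List.mem_map.1 (mem_of_mem_sortedAntichain hy)
  have h₁ : LeD d (op d a b) (eta v) := (h.trans ((eta_equiv u).symm.leD d)).trans huy
  refine ⟨v, hv, .of_leD (d := d) (le_of_mem_parts hv) (h₁.trans ((eta_equiv v).leD d)), ?_⟩
  have hall : ∀ x ∈ sortedAntichain d ((parts d (op d a b)).map eta), x = eta v := by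
    intro x hx
    obtain ⟨w, hw, rfl⟩ := List.mem_map.1 (mem_of_mem_sortedAntichain hx)
    exact eq_of_le_of_mem_sortedAntichain hx hy
      (((eta_equiv w).leD d).trans ((le_of_mem_parts hw).trans h₁))
  rw [eta_op]
  have hnd := nodup_sortedAntichain d ((parts d (op d a b)).map eta)
  generalize sortedAntichain d ((parts d (op d a b)).map eta) = A at *
  match A, hy, hall, hnd with
  | [x], _, hall, _ => rw [big_singleton, hall x (by simp)]
  | x :: x' :: A, _, hall, hnd =>
    have h₁ := hall x (by simp)
    have h₂ := hall x' (by simp)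
    simp [h₁, h₂] at hnd

/-- An iterated `op d` is not equivalent to one of its members. -/
def Proper (t : NTerm) : Prop := ∀ d, IsOp d t → ∀ u ∈ parts d t, ¬ LeD d t u

/-- By `exists_le_part`, an equivalence would make either a member of `s` equivalent to `s` or a
member of `t` equivalent to `t`. -/
theorem not_equiv_of_isOp {d : Bool} {s t : NTerm} (hs : IsOp d s) (ht : ¬ IsOp d t)
    (ps : Proper s) (pt : Proper t) : ¬ Equiv s t := by
  intro h
  rcases exists_le_part ht (h.symm.leD d) with ⟨m, hm, hle⟩ | ⟨ho, c, hc, hle⟩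
  · exact ps d hs m hm ((h.leD d).trans hle)
  · exact pt _ ho c hc (LeD.not_iff.2 (hle.trans (h.leD d)))

/-- A maximal member `u` of `s` is below a member of `t`, because `ZN` rules out the other
alternative of `exists_le_part`. That member is below a maximal `m'` of `t`, which is below a member
of `s` again. Maximality of `u` closes the circle, so `u` and `m'` are equivalent. -/
theorem mem_sortedAntichain_of_equiv {d : Bool} {s t : NTerm} (hs : ZN s) (os : IsOp d s)
    (h : Equiv s t) (h' : ∀ m ∈ parts d t, ∃ u ∈ parts d s, LeD d m u)
    (ih : ∀ u ∈ parts d s, ∀ m ∈ parts d t, Equiv u m → eta u = eta m) {x : NTerm}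
    (hx : x ∈ sortedAntichain d ((parts d s).map eta)) :
    x ∈ sortedAntichain d ((parts d t).map eta) := by
  obtain ⟨u, hu, rfl⟩ := List.mem_map.1 (mem_of_mem_sortedAntichain hx)
  have h₁ : ∃ m ∈ parts d t, LeD d u m := by
    rcases exists_le_part (not_isOp_of_mem_parts hu) ((le_of_mem_parts hu).trans (h.leD d)) with
      h | ⟨ho, c, hc, hle⟩
    · exact h
    · obtain ⟨a, b, rfl⟩ := os
      exact absurd (hle.trans (h.symm.leD d)) (hs.op_inv.2 u hu ho c hc)
  obtain ⟨m, hm, hum⟩ := h₁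
  obtain ⟨y, hy, hmy⟩ := exists_le_sortedAntichain (d := d) (List.mem_map_of_mem (f := eta) hm)
  obtain ⟨m', hm', rfl⟩ := List.mem_map.1 (mem_of_mem_sortedAntichain hy)
  obtain ⟨u', hu', hmu⟩ := h' m' hm'
  obtain ⟨z, hz, huz⟩ := exists_le_sortedAntichain (d := d) (List.mem_map_of_mem (f := eta) hu')
  have h₂ : LeD d u m' := hum.trans
    (((eta_equiv m).symm.leD d).trans (hmy.trans ((eta_equiv m').leD d)))
  have h₃ : LeD d m' z := hmu.trans (((eta_equiv u').symm.leD d).trans huz)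
  have h₄ : eta u = z := eq_of_le_of_mem_sortedAntichain hx hz
    (((eta_equiv u).leD d).trans (h₂.trans h₃))
  rw [ih u hu m' hm' (.of_leD h₂ (h₃.trans (h₄ ▸ (eta_equiv u).leD d)))]
  exact hy

theorem exists_part_of_equiv {d : Bool} {s t : NTerm} (ht : ZN t) (ot : IsOp d t)
    (h : Equiv s t) : ∀ m ∈ parts d t, ∃ u ∈ parts d s, LeD d m u := by
  intro m hm
  rcases exists_le_part (not_isOp_of_mem_parts hm)
    ((le_of_mem_parts hm).trans (h.symm.leD d)) with h' | ⟨ho, c, hc, hle⟩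
  · exact h'
  · obtain ⟨a, b, rfl⟩ := ot
    exact absurd (hle.trans (h.leD d)) (ht.op_inv.2 m hm ho c hc)

/-- Uniqueness of the normal form, by induction on the total size: improper terms are replaced by an
equivalent member, proper ones have the same outermost symbol, and then either the antichains or the
arguments agree. -/
theorem Equiv.eta_eq {s t : NTerm} (h : Equiv s t) (hs : ZN s) (ht : ZN t) : eta s = eta t := by
  induction hn : s.size + t.size using Nat.strong_induction_on generalizing s t with
  | _ n ih =>
    subst hn
    by_cases ps : Proper s
    swap
    -- A strictly smaller member that is equivalent to `s` and has the same image under `η` takes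
    -- the place of `s`.
    · simp only [Proper, not_forall, not_not] at ps
      obtain ⟨d, ⟨a, b, rfl⟩, u, hu, hle⟩ := ps
      obtain ⟨v, hv, hve, hvs⟩ := eta_eq_of_not_proper hu hle
      have := size_lt_of_mem_parts_op hv
      rw [← hvs]
      exact ih _ (by omega) (hve.trans h) (hs.of_mem_parts hv) ht rfl
    by_cases pt : Proper t
    swap
    · simp only [Proper, not_forall, not_not] at pt
      obtain ⟨d, ⟨a, b, rfl⟩, u, hu, hle⟩ := pt
      obtain ⟨v, hv, hve, hvs⟩ := eta_eq_of_not_proper hu hle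
      have := size_lt_of_mem_parts_op hv
      rw [← hvs]
      exact ih _ (by omega) (h.trans hve.symm) hs (ht.of_mem_parts hv) rfl
    rcases s.isOp_or with ⟨d, a, b, rfl⟩ | hs'
    · by_cases ot : IsOp d t
      · obtain ⟨a', b', rfl⟩ := ot
        have o₁ := isOp_op d a b
        have o₂ := isOp_op d a' b'
        have key : ∀ u ∈ parts d (op d a b), ∀ m ∈ parts d (op d a' b'), Equiv u m →
            eta u = eta m := fun u hu m hm he => by
          have := size_lt_of_mem_parts_op hu
          have := size_lt_of_mem_parts_op hm
          exact ih _ (by omega) he (hs.of_mem_parts hu) (ht.of_mem_parts hm) rfl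
        rw [eta_op, eta_op]
        refine congrArg _ (sortedAntichain_eq fun x => ⟨fun hx => ?_, fun hx => ?_⟩)
        · exact mem_sortedAntichain_of_equiv hs o₁ h (exists_part_of_equiv ht o₂ h) key hx
        · exact mem_sortedAntichain_of_equiv ht o₂ h.symm (exists_part_of_equiv hs o₁ h.symm)
            (fun u hu m hm he => (key m hm u hu he.symm).symm) hx
      · exact absurd h (not_equiv_of_isOp (isOp_op d a b) ot ps pt)
    · rcases t.isOp_or with ⟨d, a, b, rfl⟩ | ht'
      · exact absurd h.symm (not_equiv_of_isOp (isOp_op d a b) (hs' d) pt ps)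
      · obtain ⟨h₁, h₂⟩ := h
        cases h₁ with
        | bot => cases h₂ with
          | bot => rfl
          | join_left => exact absurd (isOp_op true _ _) (ht' true)
          | meet_left₁ => exact absurd (isOp_op false _ _) (ht' false)
          | meet_left₂ => exact absurd (isOp_op false _ _) (ht' false)
        | top => cases h₂ with
          | top => rfl
          | join_right₁ => exact absurd (isOp_op true _ _) (hs' true)
          | join_right₂ => exact absurd (isOp_op true _ _) (hs' true)
          | meet_right => exact absurd (isOp_op false _ _) (hs' false)
        | lit => rfl
        | join_left => exact absurd (isOp_op true _ _) (hs' true)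
        | meet_left₁ => exact absurd (isOp_op false _ _) (hs' false)
        | meet_left₂ => exact absurd (isOp_op false _ _) (hs' false)
        | join_right₁ => exact absurd (isOp_op true _ _) (ht' true)
        | join_right₂ => exact absurd (isOp_op true _ _) (ht' true)
        | meet_right => exact absurd (isOp_op false _ _) (ht' false)
        | app p f h₁ h₅ =>
          rename_i x y
          cases h₂ with
          | app _ _ h₃ h₄ =>
            cases hs with
            | op _ _ _ _ h => exact absurd ⟨_, _, h⟩ (hs' _)
            | app _ _ _ hx =>
              cases ht with
              | op _ _ _ _ h => exact absurd ⟨_, _, h⟩ (ht' _)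
              | app _ _ _ hy =>
                rw [eta, eta]
                congr 1
                funext a
                have := size_arg_lt p f x a
                have := size_arg_lt p f y a
                refine ih _ (by omega) ?_ (hx a) (hy a) rfl
                -- Every argument occurs in at least one family of premises. The derivations of the
                -- two opposite inequalities together make it an equivalence.
                have hv : (f.variance a).Fwd p ∨ (f.variance a).Fwd (!p) := by
                  cases p <;> cases f.variance a <;> simp [Variance.Fwd]
                exact hv.elim (fun hv => ⟨h₁ a hv, h₃ a hv⟩) fun hv => ⟨h₄ a hv, h₅ a hv⟩


/-! ### The map ζ -/

/-- The members of one side are members of the whole, and the side lies below the whole; so a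
conjunct excluded below the whole is excluded below the side. -/
theorem ZN.of_op {d : Bool} {a b r : NTerm} (h : ZN (OrthoPlus.op d a b)) (hr : r = a ∨ r = b) :
    ZN r := by
  have hsub : ∀ u ∈ parts d r, u ∈ parts d (OrthoPlus.op d a b) := by
    intro u hu
    rw [parts_op, List.mem_append]
    rcases hr with rfl | rfl
    · exact .inl hu
    · exact .inr hu
  have hle : LeD d r (OrthoPlus.op d a b) := by
    rcases hr with rfl | rfl
    · exact .le_op_left _ _ _
    · exact .le_op_right _ _ _
  by_cases ho : IsOp d r
  · obtain ⟨p, q, rfl⟩ := ho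
    exact .op d p q _ rfl (fun u hu => h.op_inv.1 u (hsub u hu)) fun u hu ho c hc h' =>
      h.op_inv.2 u (hsub u hu) ho c hc (h'.trans hle)
  · exact h.op_inv.1 r (hsub r (by simp [parts_of_not ho]))

theorem ZN.big {d : Bool} {l : List NTerm} (hl : l ≠ []) (h : ∀ w ∈ l, ZN w)
    (ho : ∀ w ∈ l, ¬ IsOp d w)
    (h' : ∀ w ∈ l, IsOp (!d) w → ∀ c ∈ parts (!d) w, ¬ LeD d c (OrthoPlus.big d l)) :
    ZN (OrthoPlus.big d l) := by
  match l, hl with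
  | [t], _ => rw [big_singleton]; exact h t (by simp)
  | t :: u :: l, hl =>
    refine .op d t (OrthoPlus.big d (u :: l)) _ (big_cons_cons _ _ _ _) ?_ ?_ <;>
      rwa [parts_big hl ho]

/-- The terms that replace a member `t` of an iterated `op d` equivalent to `T`. -/
noncomputable def expand (d : Bool) (T t : NTerm) : List NTerm :=
  if d then expandDisjunct T t else expandConjunct T t

theorem expand_op (d : Bool) (T a b : NTerm) :
    expand d T (op d a b) = expand d T a ++ expand d T b := by
  cases d
  · simp only [expand, op]
    exact expandConjunct.eq_1 T a b
  · simp only [expand, op]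
    exact expandDisjunct.eq_1 T a b

theorem expand_op_not (d : Bool) (T a b : NTerm) :
    (∃ c ∈ parts (!d) (op (!d) a b), LeD d c T ∧ expand d T (op (!d) a b) = expand d T c) ∨
      (expand d T (op (!d) a b) = [op (!d) a b] ∧
        ∀ c ∈ parts (!d) (op (!d) a b), ¬ LeD d c T) := by
  cases d
  · simp only [expand, op, parts, LeD, Bool.not_false, Bool.false_eq_true, ↓reduceIte]
    rw [expandConjunct]
    split
    · rename_i c h
      exact .inl ⟨c, List.mem_of_find?_eq_some h, by
        simpa [ble_iff] using List.find?_some h, rfl⟩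
    · rename_i h
      rw [List.find?_eq_none] at h
      exact .inr ⟨rfl, by simpa [ble_iff] using h⟩
  · simp only [expand, op, parts, LeD, Bool.not_true, ↓reduceIte]
    rw [expandDisjunct]
    split
    · rename_i c h
      exact .inl ⟨c, List.mem_of_find?_eq_some h, by
        simpa [ble_iff] using List.find?_some h, rfl⟩
    · rename_i h
      rw [List.find?_eq_none] at h
      exact .inr ⟨rfl, by simpa [ble_iff] using h⟩

theorem expand_atom (d : Bool) (T t : NTerm) (h : ∀ d, ¬ IsOp d t) : expand d T t = [t] := by
  cases t with
  | meet a b => exact absurd ⟨a, b, rfl⟩ (h false)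
  | join a b => exact absurd ⟨a, b, rfl⟩ (h true)
  | _ => cases d <;> simp [expand, expandConjunct, expandDisjunct]

/-- What is needed of a list of terms that replaces a member `t` of an iterated `op d`
equivalent to `T`. -/
structure IsExpansion (d : Bool) (T t : NTerm) (l : List NTerm) : Prop where
  ne_nil : l ≠ []
  not_isOp : ∀ w ∈ l, ¬ IsOp d w
  le : ∀ w ∈ l, LeD d w T
  le_of_forall : ∀ u, (∀ w ∈ l, LeD d w u) → LeD d t u
  sum_le : (l.map fun u => u.size + 1).sum ≤ t.size + 1

theorem IsExpansion.append {d : Bool} {T a b : NTerm} {l l' : List NTerm}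
    (h : IsExpansion d T a l) (h' : IsExpansion d T b l') :
    IsExpansion d T (op d a b) (l ++ l') where
  ne_nil := by simp [h.ne_nil]
  not_isOp w hw := (List.mem_append.1 hw).elim (h.not_isOp w) (h'.not_isOp w)
  le w hw := (List.mem_append.1 hw).elim (h.le w) (h'.le w)
  le_of_forall u hu := LeD.op_le_iff.2
    ⟨h.le_of_forall u fun w hw => hu w (List.mem_append_left _ hw),
      h'.le_of_forall u fun w hw => hu w (List.mem_append_right _ hw)⟩
  sum_le := by
    have := h.sum_le
    have := h'.sum_le
    rw [List.map_append, List.sum_append, size_op]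
    omega

theorem IsExpansion.of_le {d : Bool} {T c t : NTerm} {l : List NTerm} (h : IsExpansion d T c l)
    (hc : LeD d t c) (hs : c.size ≤ t.size) : IsExpansion d T t l :=
  ⟨h.ne_nil, h.not_isOp, h.le, fun u hu => hc.trans (h.le_of_forall u hu),
    h.sum_le.trans (Nat.succ_le_succ hs)⟩

theorem IsExpansion.singleton {d : Bool} {T t : NTerm} (ho : ¬ IsOp d t) (h : LeD d t T) :
    IsExpansion d T t [t] :=
  ⟨by simp, by simpa using ho, by simpa using h, fun u hu => hu t (by simp), by simp⟩

/-- The comparison of lengths at the end ensures that the result of `ζ` keeps at least two members,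
hence its outermost operation. -/
theorem IsExpansion.flatMap {d : Bool} {T : NTerm} {l : List NTerm} {g : NTerm → List NTerm}
    (hl : l ≠ []) (h : ∀ t ∈ l, IsExpansion d T t (g t)) :
    l.flatMap g ≠ [] ∧ (∀ w ∈ l.flatMap g, ¬ IsOp d w ∧ LeD d w T) ∧
      (∀ u, (∀ w ∈ l.flatMap g, LeD d w u) → ∀ t ∈ l, LeD d t u) ∧
      ((l.flatMap g).map fun u => u.size + 1).sum ≤ (l.map fun u => u.size + 1).sum ∧
      l.length ≤ (l.flatMap g).length := by
  refine ⟨?_, ?_, ?_, ?_, ?_⟩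
  · obtain ⟨t, ht⟩ := List.exists_mem_of_ne_nil l hl
    obtain ⟨w, hw⟩ := List.exists_mem_of_ne_nil _ (h t ht).ne_nil
    exact List.ne_nil_of_mem (List.mem_flatMap.2 ⟨t, ht, hw⟩)
  · intro w hw
    obtain ⟨t, ht, hw⟩ := List.mem_flatMap.1 hw
    exact ⟨(h t ht).not_isOp w hw, (h t ht).le w hw⟩
  · exact fun u hu t ht => (h t ht).le_of_forall u fun w hw =>
      hu w (List.mem_flatMap.2 ⟨t, ht, hw⟩)
  · clear hl
    induction l with
    | nil => simp
    | cons t l ih =>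
      have := (h t (by simp)).sum_le
      have := ih fun t ht => h t (by simp [ht])
      rw [List.flatMap_cons, List.map_append, List.sum_append, List.map_cons, List.sum_cons]
      omega
  · clear hl
    induction l with
    | nil => simp
    | cons t l ih =>
      have := List.length_pos_of_ne_nil (h t (by simp)).ne_nil
      have := ih fun t ht => h t (by simp [ht])
      rw [List.flatMap_cons, List.length_append, List.length_cons]
      omega

/-- Replacing a conjunction by a conjunct below `T` stays below `T`, only increases the member and
shortens it. The process stops exactly at members that no longer have such a conjunct. -/
theorem expand_spec (d : Bool) (T t : NTerm) (hT : LeD d t T) (ht : ZN t) :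
    IsExpansion d T t (expand d T t) ∧
      ∀ w ∈ expand d T t, ZN w ∧ (IsOp (!d) w → ∀ c ∈ parts (!d) w, ¬ LeD d c T) := by
  induction h : t.size using Nat.strong_induction_on generalizing t with
  | _ n ih =>
    subst h
    by_cases ho : IsOp d t
    · obtain ⟨a, b, rfl⟩ := ho
      rw [size_op] at ih
      rw [LeD.op_le_iff] at hT
      obtain ⟨h₁, h₂⟩ := ih _ (by omega) a hT.1 (ht.of_op (.inl rfl)) rfl
      obtain ⟨h₃, h₄⟩ := ih _ (by omega) b hT.2 (ht.of_op (.inr rfl)) rfl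
      rw [expand_op]
      exact ⟨h₁.append h₃, fun w hw => (List.mem_append.1 hw).elim (h₂ w) (h₄ w)⟩
    · rcases t.isOp_or with ⟨e, a, b, rfl⟩ | h
      · obtain rfl : e = !d := by
          cases e <;> cases d <;> first | rfl | exact absurd (isOp_op _ _ _) ho
        rcases expand_op_not d T a b with ⟨c, hc, hle, he⟩ | ⟨he, hc⟩
        · obtain ⟨h₁, h₂⟩ := ih _ (size_lt_of_mem_parts_op hc) c hle (ht.of_mem_parts hc) rfl
          rw [he]
          exact ⟨h₁.of_le (LeD.not_iff.1 (le_of_mem_parts hc)) (size_le_of_mem_parts hc), h₂⟩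
        · rw [he]
          exact ⟨.singleton ho hT, by simpa using ⟨ht, fun _ => hc⟩⟩
      · rw [expand_atom d T t h]
        exact ⟨.singleton ho hT, by simpa using ⟨ht, fun h' => absurd h' (h _)⟩⟩

theorem zeta_op (d : Bool) (a b : NTerm) : zeta (op d a b) =
    big d (((parts d (op d a b)).map zeta).flatMap
      (expand d (big d ((parts d (op d a b)).map zeta)))) := by
  cases d
  · simp only [op, zeta, List.attach_map_val (f := zeta)]
    rfl
  · simp only [op, zeta, List.attach_map_val (f := zeta)]
    rfl

theorem two_le_length_parts (d : Bool) (a b : NTerm) : 2 ≤ (parts d (op d a b)).length := by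
  have := List.length_pos_of_ne_nil (parts_ne_nil d a)
  have := List.length_pos_of_ne_nil (parts_ne_nil d b)
  rw [parts_op, List.length_append]
  omega

theorem isOp_big {d : Bool} {l : List NTerm} (h : 2 ≤ l.length) : IsOp d (big d l) := by
  match l, h with
  | t :: u :: l, _ =>
    rw [big_cons_cons]
    exact isOp_op _ _ _

theorem zeta_atom {t : NTerm} (h : ∀ d, ¬ IsOp d t) :
    (∃ b f x, t = .app b f x ∧ zeta t = .app b f fun a => zeta (x a)) ∨
      (ZN t ∧ zeta t = t) := by
  cases t with
  | meet a b => exact absurd ⟨a, b, rfl⟩ (h false)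
  | join a b => exact absurd ⟨a, b, rfl⟩ (h true)
  | app b f x => exact .inl ⟨b, f, x, rfl, by rw [zeta]⟩
  | lit b x => exact .inr ⟨.lit _ _, by rw [zeta]⟩
  | bot => exact .inr ⟨.bot, by rw [zeta]⟩
  | top => exact .inr ⟨.top, by rw [zeta]⟩

/-- Besides `ZN`, equivalence and size, the outermost operation is preserved; `canon_op` needs this
to know that the members of a join do not turn into joins. -/
theorem zeta_spec (t : NTerm) : ZN (zeta t) ∧ Equiv (zeta t) t ∧ (zeta t).size ≤ t.size ∧
    ∀ d, IsOp d (zeta t) ↔ IsOp d t := by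
  induction h : t.size using Nat.strong_induction_on generalizing t with
  | _ n ih =>
    subst h
    rcases t.isOp_or with ⟨d, a, b, rfl⟩ | h
    · have hl : (parts d (op d a b)).map zeta ≠ [] := by simp [parts_ne_nil]
      have key : ∀ u ∈ parts d (op d a b), _ := fun u hu =>
        ih _ (size_lt_of_mem_parts_op hu) u rfl
      have h₀ : ∀ u ∈ (parts d (op d a b)).map zeta, ZN u := by
        rw [List.forall_mem_map]
        exact fun u hu => (key u hu).1
      have hexp : ∀ u ∈ (parts d (op d a b)).map zeta, _ := fun u hu =>
        expand_spec d (big d ((parts d (op d a b)).map zeta)) u (le_big hu) (h₀ u hu)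
      obtain ⟨h₁, h₂, h₃, h₄, h₅⟩ := IsExpansion.flatMap hl fun u hu => (hexp u hu).1
      have h₆ := fun u hu => (hexp u hu).2
      have hT : Equiv (big d ((parts d (op d a b)).map zeta)) (op d a b) := by
        refine .of_leD (d := d) ?_ ?_
        · rw [big_le_iff hl, List.forall_mem_map]
          exact fun u hu => ((key u hu).2.1.leD d).trans (le_of_mem_parts hu)
        · rw [le_iff_parts]
          exact fun u hu => ((key u hu).2.1.symm.leD d).trans (le_big (List.mem_map_of_mem hu))
      have hz := zeta_op d a b
      rw [List.length_map] at h₅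
      have hsum : (((parts d (op d a b)).map zeta).map fun u => u.size + 1).sum ≤
          (op d a b).size + 1 := by
        rw [← sum_size_parts d, List.map_map]
        exact List.sum_le_sum fun u hu => Nat.succ_le_succ (key u hu).2.2.1
      generalize big d ((parts d (op d a b)).map zeta) = T at *
      have hT' : Equiv (zeta (op d a b)) T := by
        rw [hz]
        refine .of_leD (d := d) ?_ ?_
        · rw [big_le_iff h₁]
          exact fun w hw => (h₂ w hw).2
        · refine (hT.leD d).trans ?_
          rw [le_iff_parts]
          intro u hu
          exact ((key u hu).2.1.symm.leD d).trans
            (h₃ _ (fun w hw => le_big hw) _ (List.mem_map_of_mem hu))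
      have hop : IsOp d (zeta (op d a b)) := by
        rw [hz]
        exact isOp_big ((two_le_length_parts d a b).trans h₅)
      refine ⟨?_, hT'.trans hT, ?_, fun e => ?_⟩
      · have hmem : ∀ w ∈ ((parts d (op d a b)).map zeta).flatMap (expand d T), ZN w ∧
            (IsOp (!d) w → ∀ c ∈ parts (!d) w, ¬ LeD d c T) := fun w hw => by
          obtain ⟨u, hu, hw⟩ := List.mem_flatMap.1 hw
          exact h₆ u hu w hw
        rw [hz] at hT' ⊢
        exact .big h₁ (fun w hw => (hmem w hw).1) (fun w hw => (h₂ w hw).1)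
          -- The members were tested against `T`, whereas `ZN` refers to the new disjunction; the
          -- two are equivalent.
          fun w hw ho c hc hle => (hmem w hw).2 ho c hc (hle.trans (hT'.leD d))
      · have := size_big d h₁
        rw [hz]
        omega
      · by_cases he : e = d
        · subst he
          exact iff_of_true hop (isOp_op _ _ _)
        · obtain rfl : e = !d := by cases e <;> cases d <;> simp_all
          exact iff_of_false (not_isOp_not hop) (not_isOp_not (isOp_op d a b))
    · rcases zeta_atom h with ⟨b, f, x, rfl, hz⟩ | ⟨h₁, h₂⟩
      · have key := fun a => ih _ (size_arg_lt b f x a) _ rfl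
        rw [hz]
        refine ⟨.app _ _ _ fun a => (key a).1, .app fun a => (key a).2.1, ?_, fun d => ?_⟩
        · simp only [NTerm.size]
          exact Nat.succ_le_succ (Finset.sum_le_sum fun a _ => (key a).2.2.1)
        · refine iff_of_false ?_ (h d)
          rintro ⟨a, b, h⟩
          cases d <;> cases h
      · rw [h₂]
        exact ⟨h₁, .refl _, le_rfl, fun _ => Iff.rfl⟩

/-! ### The normal form -/

/-- The normal form of a term over bounded lattices. -/
noncomputable def canon (t : NTerm) : NTerm := eta (zeta t)

theorem canon_equiv (t : NTerm) : Equiv (canon t) t :=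
  (eta_equiv _).trans (zeta_spec t).2.1

theorem Equiv.canon_eq {s t : NTerm} (h : Equiv s t) : canon s = canon t :=
  ((zeta_spec s).2.1.trans (h.trans (zeta_spec t).2.1.symm)).eta_eq (zeta_spec s).1 (zeta_spec t).1

theorem size_canon_le (t : NTerm) : (canon t).size ≤ t.size :=
  (size_eta_le _).trans (zeta_spec t).2.2.1

theorem size_beta_le (t : NTerm) : (beta t).size ≤ t.size := by
  have hj : ∀ s t, (betaJoin s t).size ≤ s.size + t.size + 1 := fun s t => by
    unfold betaJoin
    split
    · simp [NTerm.size]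
    · simp [NTerm.size]
  induction t with
  | join s t hs ht =>
    have := hj (beta s) (beta t)
    rw [beta_join, NTerm.size]
    omega
  | meet s t hs ht =>
    have := hj (beta s).neg (beta t).neg
    rw [NTerm.size_neg, NTerm.size_neg] at this
    rw [beta_meet, NTerm.size_neg, NTerm.size]
    omega
  | app b f x ih =>
    rw [beta, NTerm.size, NTerm.size]
    exact Nat.succ_le_succ (Finset.sum_le_sum fun a _ => ih a)
  | _ => simp [beta]

theorem size_deltaAux (t : Term) : ∀ b, (deltaAux b t).size = t.size := by
  induction t with
  | neg t ih => intro b; rw [deltaAux, ih, Term.size]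
  | _ => intro b; cases b <;> simp_all [deltaAux, NTerm.size, Term.size]

theorem size_toTerm (t : NTerm) : t.toTerm.size = t.size := by
  induction t with
  | lit b x => cases b <;> simp [NTerm.toTerm, Term.size, NTerm.size]
  | app b f x ih => cases b <;> simp [NTerm.toTerm, Term.size, NTerm.size, ih]
  | _ => simp_all [NTerm.toTerm, Term.size, NTerm.size]

theorem isNormalFormFunction_canon :
    IsNormalFormFunction fun t => (canon (beta (delta t))).toTerm := by
  have heq : ∀ s, Equivalent (canon (beta (delta s))).toTerm s := fun s A _ v => by
    rw [← eval_deltaAux v s]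
    have h := canon_equiv (beta (delta s))
    exact (le_antisymm (h.1.eval_toTerm_le v) (h.2.eval_toTerm_le v)).trans (eval_beta v _)
  have huniq : ∀ s t, Equivalent s t →
      (canon (beta (delta s))).toTerm = (canon (beta (delta t))).toTerm := fun s t h => by
    have h' : Equivalent t s := fun A _ v => (h A v).symm
    rw [Equiv.canon_eq ⟨h.le_beta_delta, h'.le_beta_delta⟩]
  refine ⟨heq, huniq, ?_⟩
  rintro s ⟨u, hu, h⟩
  -- A smaller equivalent term `u` has the same normal form as `s`. But the normal form of `u` is no
  -- larger than `u`, a contradiction.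
  rw [← huniq u s fun A _ v => (h A v).trans (heq s A v), size_toTerm] at hu
  have h₁ := size_canon_le (beta (delta u))
  have h₂ := size_beta_le (delta u)
  have h₃ : (delta u).size = u.size := size_deltaAux u true
  omega


/-! ### A top-down description of the normal form -/

open Classical in
/-- The members that replace a member of an iterated `op d` with value `T`, found by going down in
the syntax tree. -/
noncomputable def descend (d : Bool) (T : NTerm) : NTerm → List NTerm
  | .meet a b =>
      if d then
        if LeD d a T then descend d T a
        else if LeD d b T then descend d T b
        else [.meet a b]
      else descend d T a ++ descend d T b
  | .join a b =>
      if d then descend d T a ++ descend d T b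
      else
        if LeD d a T then descend d T a
        else if LeD d b T then descend d T b
        else [.join a b]
  | t => [t]

theorem descend_op (d : Bool) (T a b : NTerm) :
    descend d T (op d a b) = descend d T a ++ descend d T b := by
  cases d <;> simp [op, descend]

open Classical in
theorem descend_op_not (d : Bool) (T a b : NTerm) :
    descend d T (op (!d) a b) =
      if LeD d a T then descend d T a
      else if LeD d b T then descend d T b
      else [op (!d) a b] := by
  cases d <;> simp [op, descend]

theorem descend_atom (d : Bool) (T t : NTerm) (h : ∀ d, ¬ IsOp d t) : descend d T t = [t] := by
  cases t with
  | meet a b => exact absurd ⟨a, b, rfl⟩ (h false)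
  | join a b => exact absurd ⟨a, b, rfl⟩ (h true)
  | _ => simp [descend]

/-- A member left at the end is only known to have neither of its two sides below `T`. This is
weaker than the condition in `ZN`, which speaks of all conjuncts after simplification; `canon_op`
bridges the gap. -/
theorem descend_spec (d : Bool) (T t : NTerm) (hT : LeD d t T) :
    IsExpansion d T t (descend d T t) ∧
      ∀ w ∈ descend d T t, ∀ p q, w = op (!d) p q → ¬ LeD d p T ∧ ¬ LeD d q T := by
  induction h : t.size using Nat.strong_induction_on generalizing t with
  | _ n ih =>
    subst h
    by_cases ho : IsOp d t
    · obtain ⟨a, b, rfl⟩ := ho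
      rw [size_op] at ih
      rw [LeD.op_le_iff] at hT
      obtain ⟨h₁, h₂⟩ := ih _ (by omega) a hT.1 rfl
      obtain ⟨h₃, h₄⟩ := ih _ (by omega) b hT.2 rfl
      rw [descend_op]
      exact ⟨h₁.append h₃, fun w hw => (List.mem_append.1 hw).elim (h₂ w) (h₄ w)⟩
    · rcases t.isOp_or with ⟨e, a, b, rfl⟩ | h
      · obtain rfl : e = !d := by
          cases e <;> cases d <;> first | rfl | exact absurd (isOp_op _ _ _) ho
        rw [size_op] at ih
        rw [descend_op_not]
        split_ifs with ha hb
        · obtain ⟨h₁, h₂⟩ := ih _ (by omega) a ha rfl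
          exact ⟨h₁.of_le (LeD.not_iff.1 (.le_op_left _ _ _)) (by rw [size_op]; omega), h₂⟩
        · obtain ⟨h₁, h₂⟩ := ih _ (by omega) b hb rfl
          exact ⟨h₁.of_le (LeD.not_iff.1 (.le_op_right _ _ _)) (by rw [size_op]; omega), h₂⟩
        · refine ⟨.singleton ho hT, ?_⟩
          intro w hw p q h
          rw [List.mem_singleton.1 hw] at h
          obtain ⟨-, rfl, rfl⟩ := op_inj h
          exact ⟨ha, hb⟩
      · rw [descend_atom d T t h]
        refine ⟨.singleton ho hT, ?_⟩
        intro w hw p q h'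
        rw [List.mem_singleton.1 hw] at h'
        exact absurd ⟨p, q, h'⟩ (h _)

/-- The members of a join or meet, and the arguments of a function symbol. -/
noncomputable def children : NTerm → List NTerm
  | .meet a b => descend false (.meet a b) a ++ descend false (.meet a b) b
  | .join a b => descend true (.join a b) a ++ descend true (.join a b) b
  | .app _ _ x => List.ofFn x
  | _ => []

theorem children_op (d : Bool) (a b : NTerm) :
    children (op d a b) = descend d (op d a b) (op d a b) := by
  rw [descend_op]
  cases d <;> rfl

theorem two_le_length_children (d : Bool) (a b : NTerm) : 2 ≤ (children (op d a b)).length := by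
  have h₁ := List.length_pos_of_ne_nil
    (descend_spec d (op d a b) a (.le_op_left _ _ _)).1.ne_nil
  have h₂ := List.length_pos_of_ne_nil
    (descend_spec d (op d a b) b (.le_op_right _ _ _)).1.ne_nil
  rw [children_op, descend_op, List.length_append]
  omega

/-- This bounds the number of nodes of the tree of children, and all amortized costs of the later
phases, by the size of the term. -/
theorem sum_size_children_lt (t : NTerm) : ((children t).map NTerm.size).sum < t.size := by
  rcases t.isOp_or with ⟨d, a, b, rfl⟩ | h
  · have h₁ := (descend_spec d (op d a b) (op d a b) (.refl _ _)).1.sum_le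
    have h₂ := two_le_length_children d a b
    rw [← children_op, List.sum_map_add] at h₁
    -- Each child contributes an additional `1` to the sum; with at least two children the estimate
    -- becomes strict.
    simp only [List.map_const', List.sum_replicate, smul_eq_mul, mul_one] at h₁
    omega
  · cases t with
    | meet a b => exact absurd ⟨a, b, rfl⟩ (h false)
    | join a b => exact absurd ⟨a, b, rfl⟩ (h true)
    | app b f x => simp [children, NTerm.size, List.sum_ofFn, Function.comp_def]
    | _ => simp [children, NTerm.size]

/-- Whitman's condition from the other side, iterated along the members of `c`. It is what turns
knowledge about the two sides `p`, `q` into knowledge about conjuncts of a simplified term. -/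
theorem exists_part_of_op_not_le {d : Bool} {p q c : NTerm} (hc : ¬ IsOp (!d) c)
    (h : LeD d (op (!d) p q) c) :
    LeD d p c ∨ LeD d q c ∨ (IsOp d c ∧ ∃ m ∈ parts d c, LeD d (op (!d) p q) m) := by
  induction c using NTerm.op_induction d with
  | atom c hc' =>
    rcases LeD.whitman_left hc h with h | h | ⟨a, b, h, -⟩
    · exact .inl h
    · exact .inr (.inl h)
    · exact absurd ⟨a, b, h⟩ hc'
  | op a b ha hb =>
    have key : ∀ r, (∀ m ∈ parts d r, m ∈ parts d (op d a b)) → LeD d r (op d a b) →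
        (¬ IsOp (!d) r → LeD d (op (!d) p q) r → LeD d p r ∨ LeD d q r ∨
          (IsOp d r ∧ ∃ m ∈ parts d r, LeD d (op (!d) p q) m)) → LeD d (op (!d) p q) r →
        LeD d p (op d a b) ∨ LeD d q (op d a b) ∨ (IsOp d (op d a b) ∧
          ∃ m ∈ parts d (op d a b), LeD d (op (!d) p q) m) := by
      intro r hsub hle ih hr
      by_cases ho : IsOp d r
      · rcases ih (not_isOp_not ho) hr with h | h | ⟨-, m, hm, h⟩
        · exact .inl (h.trans hle)
        · exact .inr (.inl (h.trans hle))
        · exact .inr (.inr ⟨isOp_op _ _ _, m, hsub m hm, h⟩)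
      · exact .inr (.inr ⟨isOp_op _ _ _, r, hsub r (by simp [parts_of_not ho]), hr⟩)
    rcases LeD.whitman_left hc h with h | h | ⟨a', b', h, h'⟩
    · exact .inl h
    · exact .inr (.inl h)
    · obtain ⟨-, rfl, rfl⟩ := op_inj h
      rcases h' with h' | h'
      · exact key a (fun m hm => by simp [parts_op, hm]) (.le_op_left _ _ _) ha h'
      · exact key b (fun m hm => by simp [parts_op, hm]) (.le_op_right _ _ _) hb h'

/-- Simplifying the children found by descent gives a term that is equivalent to `ζ` of the whole
and satisfies `ZN`. By uniqueness `η` cannot tell the two apart. Only comparisons between subterms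
of the given term are involved in finding these children, which is what makes a precomputed table
sufficient. -/
theorem canon_op (d : Bool) (a b : NTerm) : canon (op d a b) =
    big d (sortedAntichain d ((children (op d a b)).map canon)) := by
  obtain ⟨h₁, h₂⟩ := descend_spec d (op d a b) (op d a b) (.refl _ _)
  have h₃ := two_le_length_children d a b
  rw [← children_op] at h₁ h₂
  generalize children (op d a b) = l at *
  have hl : l.map zeta ≠ [] := by simpa using h₁.ne_nil
  have ho : ∀ w ∈ l.map zeta, ¬ IsOp d w := by
    rw [List.forall_mem_map]
    exact fun u hu h => h₁.not_isOp u hu (((zeta_spec u).2.2.2 d).1 h)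
  have he : Equiv (op d a b) (big d (l.map zeta)) := by
    refine .of_leD (d := d) (h₁.le_of_forall _ fun w hw => ?_) ?_
    · exact ((zeta_spec w).2.1.symm.leD d).trans (le_big (List.mem_map_of_mem hw))
    · rw [big_le_iff hl, List.forall_mem_map]
      exact fun w hw => ((zeta_spec w).2.1.leD d).trans (h₁.le w hw)
  have hzn : ZN (big d (l.map zeta)) := by
    refine .big hl ?_ ho ?_
    · rw [List.forall_mem_map]
      exact fun w _ => (zeta_spec w).1
    · rw [List.forall_mem_map]
      intro w hw hwo c hc hle
      have hzw := zeta_spec w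
      obtain ⟨p, q, rfl⟩ := (hzw.2.2.2 _).1 hwo
      have hcT := hle.trans (he.symm.leD d)
      have hn := h₂ _ hw p q rfl
      have hwc : LeD d (op (!d) p q) c :=
        (hzw.2.1.symm.leD d).trans (LeD.not_iff.1 (le_of_mem_parts hc))
      -- If a conjunct `c` of the simplified child were below the join, then either a side of the
      -- child would be below the join, against `descend_spec`, or `c` would be a disjunction with a
      -- disjunct above the simplified child, against `ZN` for it.
      rcases exists_part_of_op_not_le (not_isOp_of_mem_parts hc) hwc with h | h | ⟨hco, m, hm, h⟩
      · exact hn.1 (h.trans hcT)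
      · exact hn.2 (h.trans hcT)
      · obtain ⟨a', b', hz⟩ := hwo
        have hzn := hzw.1
        rw [hz] at hzn hc
        refine hzn.op_inv.2 c hc (by rwa [Bool.not_not]) m (by rwa [Bool.not_not]) ?_
        rw [LeD.not_iff, ← hz]
        exact (hzw.2.1.leD d).trans h
  have hop : IsOp d (big d (l.map zeta)) := isOp_big (by rwa [List.length_map])
  rw [canon, ((zeta_spec (op d a b)).2.1.trans he).eta_eq (zeta_spec _).1 hzn]
  have hparts := parts_big hl ho
  obtain ⟨a', b', hz⟩ := hop
  rw [hz] at hparts ⊢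
  rw [eta_op, hparts, List.map_map]
  rfl

theorem canon_app (b : Bool) (f : FunSym) (x : Fin f.arity → NTerm) :
    canon (.app b f x) = .app b f fun a => canon (x a) := by
  rw [canon, zeta, eta]
  rfl

theorem canon_lit (b : Bool) (x : ℕ) : canon (.lit b x) = .lit b x := by
  rw [canon, zeta, eta]

theorem canon_bot : canon .bot = .bot := by rw [canon, zeta, eta]

theorem canon_top : canon .top = .top := by rw [canon, zeta, eta]


/-! ### A small programming language on top of the machine -/

/-- Expressions over registers and arrays. -/
inductive Expr where
  | const (c : ℕ)
  | reg (x : ℕ)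
  | add (a b : Expr)
  | sub (a b : Expr)
  | load (m : ℕ) (a : Expr)

namespace Expr

/-- The value of an expression. -/
def eval (s : Config) : Expr → ℕ
  | const c => c
  | reg x => s.reg x
  | add a b => a.eval s + b.eval s
  | sub a b => a.eval s - b.eval s
  | load m a => s.mem m (a.eval s)

/-- The number of instructions for an expression. -/
def cost : Expr → ℕ
  | const _ => 1
  | reg _ => 2
  | add a b => a.cost + b.cost + 1
  | sub a b => a.cost + b.cost + 1
  | load _ a => a.cost + 1

/-- Code that leaves the value in the auxiliary register number `k`. The variable `x` of the
language is the register `2 * x`, the auxiliary register number `k` is the register `2 * k + 1`. -/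
def compile : Expr → ℕ → Prog
  | const c, k => .const (2 * k + 1) c
  | reg x, k => .seq (.const (2 * k + 1) 0) (.add (2 * k + 1) (2 * x) (2 * k + 1))
  | add a b, k => .seq (a.compile k) (.seq (b.compile (k + 1))
      (.add (2 * k + 1) (2 * k + 1) (2 * (k + 1) + 1)))
  | sub a b, k => .seq (a.compile k) (.seq (b.compile (k + 1))
      (.sub (2 * k + 1) (2 * k + 1) (2 * (k + 1) + 1)))
  | load m a, k => .seq (a.compile k) (.load (2 * k + 1) m (2 * k + 1))

end Expr

/-- The machine configuration `s₀` represents the configuration `s` of the language. -/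
def Agree (s s₀ : Config) : Prop := (∀ x, s₀.reg (2 * x) = s.reg x) ∧ s₀.mem = s.mem

/-- Auxiliary registers with numbers below `k` hold pending intermediate results and have to
survive. Odd registers are never seen by `Agree`, so all of them are free for this use. -/
theorem Expr.exec_compile (e : Expr) (k : ℕ) {s s₀ : Config} (h : Agree s s₀) :
    ∃ s₁, Exec (e.compile k) s₀ e.cost s₁ ∧ Agree s s₁ ∧ s₁.reg (2 * k + 1) = e.eval s ∧
      ∀ j < k, s₁.reg (2 * j + 1) = s₀.reg (2 * j + 1) := by
  have upd : ∀ {s₀ : Config} (k c : ℕ), Agree s s₀ → Agree s (s₀.setReg (2 * k + 1) c) :=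
    fun k c h => ⟨fun x => by
      rw [← h.1 x]
      exact Function.update_of_ne (by omega) _ _, h.2⟩
  induction e generalizing k s₀ with
  | const c =>
    exact ⟨_, .const _ _ _, upd _ _ h, by simp [Config.setReg, eval], fun j hj => by
      simp [Config.setReg, Function.update_of_ne (show 2 * j + 1 ≠ 2 * k + 1 by omega)]⟩
  | reg x =>
    refine ⟨_, .seq (.const _ _ _) (.add _ _ _ _), upd _ _ (upd _ _ h), ?_, fun j hj => ?_⟩
    · simp [Config.setReg, eval, ← h.1 x, show 2 * x ≠ 2 * k + 1 by omega]
    · simp [Config.setReg, Function.update_of_ne (show 2 * j + 1 ≠ 2 * k + 1 by omega)]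
  | add a b iha ihb =>
    obtain ⟨s₁, e₁, h₁, v₁, f₁⟩ := iha k h
    obtain ⟨s₂, e₂, h₂, v₂, f₂⟩ := ihb (k + 1) h₁
    refine ⟨s₂.setReg (2 * k + 1) (s₂.reg (2 * k + 1) + s₂.reg (2 * (k + 1) + 1)), ?_,
      upd k _ h₂, ?_, fun j hj => ?_⟩
    · rw [cost, Nat.add_assoc]
      exact .seq e₁ (.seq e₂ (.add _ _ _ _))
    · simp [Config.setReg, eval, v₂, f₂ k (by omega), v₁]
    · simp [Config.setReg, Function.update_of_ne (show 2 * j + 1 ≠ 2 * k + 1 by omega),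
        f₂ j (by omega), f₁ j hj]
  | sub a b iha ihb =>
    obtain ⟨s₁, e₁, h₁, v₁, f₁⟩ := iha k h
    obtain ⟨s₂, e₂, h₂, v₂, f₂⟩ := ihb (k + 1) h₁
    refine ⟨s₂.setReg (2 * k + 1) (s₂.reg (2 * k + 1) - s₂.reg (2 * (k + 1) + 1)), ?_,
      upd k _ h₂, ?_, fun j hj => ?_⟩
    · rw [cost, Nat.add_assoc]
      exact .seq e₁ (.seq e₂ (.sub _ _ _ _))
    · simp [Config.setReg, eval, v₂, f₂ k (by omega), v₁]
    · simp [Config.setReg, Function.update_of_ne (show 2 * j + 1 ≠ 2 * k + 1 by omega),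
        f₂ j (by omega), f₁ j hj]
  | load m a iha =>
    obtain ⟨s₁, e₁, h₁, v₁, f₁⟩ := iha k h
    refine ⟨_, .seq e₁ (.load _ _ _ _), upd k _ h₁, ?_, fun j hj => ?_⟩
    · simp [Config.setReg, eval, v₁, h₁.2]
    · simp [Config.setReg, Function.update_of_ne (show 2 * j + 1 ≠ 2 * k + 1 by omega),
        f₁ j hj]

/-- Commands. -/
inductive Cmd where
  | skip
  | set (x : ℕ) (e : Expr)
  | write (m : ℕ) (i e : Expr)
  | seq (p q : Cmd)
  | ite (e : Expr) (p q : Cmd)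
  | whileDo (e : Expr) (p : Cmd)

namespace Cmd

/-- The machine code of a command. -/
def compile : Cmd → Prog
  | skip => .const 1 0
  | set x e => .seq (e.compile 0) (.seq (.const 3 0) (.add (2 * x) 1 3))
  | write m i e => .seq (i.compile 0) (.seq (e.compile 1) (.store m 1 3))
  | seq p q => .seq p.compile q.compile
  | ite e p q => .seq (e.compile 0) (.ite 1 p.compile q.compile)
  | .whileDo e p => .seq (e.compile 0) (.loop 1 (.seq p.compile (e.compile 0)))

/-- The variables that a command may change. -/
def regs : Cmd → List ℕ
  | skip => []
  | set x _ => [x]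
  | write _ _ _ => []
  | seq p q => p.regs ++ q.regs
  | ite _ p q => p.regs ++ q.regs
  | .whileDo _ p => p.regs

/-- The arrays that a command may change. -/
def arrs : Cmd → List ℕ
  | skip => []
  | set _ _ => []
  | write m _ _ => [m]
  | seq p q => p.arrs ++ q.arrs
  | ite _ p q => p.arrs ++ q.arrs
  | .whileDo _ p => p.arrs

/-- The command contains no loop. -/
def loopFree : Cmd → Bool
  | skip => true
  | set _ _ => true
  | write _ _ _ => true
  | seq p q => p.loopFree && q.loopFree
  | ite _ p q => p.loopFree && q.loopFree
  | .whileDo _ _ => false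

/-- The effect of a command without loops. -/
def run : Cmd → Config → Config
  | skip, s => s
  | set x e, s => s.setReg x (e.eval s)
  | write m i e, s => s.setMem m (i.eval s) (e.eval s)
  | seq p q, s => q.run (p.run s)
  | ite e p q, s => if e.eval s = 0 then q.run s else p.run s
  | .whileDo _ _, s => s

/-- A bound for the number of steps of a command without loops. -/
def cost : Cmd → ℕ
  | skip => 1
  | set _ e => e.cost + 2
  | write _ i e => i.cost + (e.cost + 1)
  | seq p q => p.cost + q.cost
  | ite e p q => e.cost + (max p.cost q.cost + 1)
  | .whileDo _ _ => 0

end Cmd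

/-! ### Hoare triples with step bounds. -/

/-- Started in `s`, the command `c` halts after at most `t` steps in a configuration that satisfies
`Q`. -/
def Tri (c : Cmd) (s : Config) (t : ℕ) (Q : Config → Prop) : Prop :=
  ∀ s₀, Agree s s₀ → ∃ n s₁ s', Exec c.compile s₀ n s₁ ∧ n ≤ t ∧ Agree s' s₁ ∧ Q s'

namespace Tri

theorem mono {c : Cmd} {s : Config} {t t' : ℕ} {Q Q' : Config → Prop} (h : Tri c s t Q)
    (ht : t ≤ t') (hQ : ∀ s', Q s' → Q' s') : Tri c s t' Q' := fun s₀ hs => by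
  obtain ⟨n, s₁, s', h₁, h₂, h₃, h₄⟩ := h s₀ hs
  exact ⟨n, s₁, s', h₁, h₂.trans ht, h₃, hQ _ h₄⟩

theorem seq {p q : Cmd} {s : Config} {t₁ t₂ : ℕ} {R Q : Config → Prop} (hp : Tri p s t₁ R)
    (hq : ∀ s', R s' → Tri q s' t₂ Q) : Tri (.seq p q) s (t₁ + t₂) Q := fun s₀ hs => by
  obtain ⟨n₁, s₁, s₁', h₁, h₂, h₃, h₄⟩ := hp s₀ hs
  obtain ⟨n₂, s₂, s₂', h₅, h₆, h₇, h₈⟩ := hq _ h₄ s₁ h₃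
  exact ⟨_, s₂, s₂', .seq h₁ h₅, add_le_add h₂ h₆, h₇, h₈⟩

theorem ite {e : Expr} {p q : Cmd} {s : Config} {t : ℕ} {Q : Config → Prop}
    (hp : e.eval s ≠ 0 → Tri p s t Q) (hq : e.eval s = 0 → Tri q s t Q) :
    Tri (.ite e p q) s (e.cost + (t + 1)) Q := fun s₀ hs => by
  obtain ⟨s₁, h₁, h₂, h₃, -⟩ := e.exec_compile 0 hs
  by_cases h : e.eval s = 0
  · obtain ⟨n, s₂, s', h₄, h₅, h₆⟩ := hq h s₁ h₂
    exact ⟨_, s₂, s', .seq h₁ (.ite_false (h₃.trans h) h₄), by omega, h₆⟩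
  · obtain ⟨n, s₂, s', h₄, h₅, h₆⟩ := hp h s₁ h₂
    exact ⟨_, s₂, s', .seq h₁ (.ite_true (h₃.trans_ne h) h₄), by omega, h₆⟩

theorem of_run {c : Cmd} (hc : c.loopFree = true) (s : Config) :
    Tri c s c.cost fun s' => s' = c.run s := by
  induction c generalizing s with
  | skip =>
    exact fun s₀ hs => ⟨1, _, s, .const _ _ _, le_rfl, ⟨fun x => by
      rw [← hs.1 x]
      exact Function.update_of_ne (by omega) _ _, hs.2⟩, rfl⟩
  | set x e =>
    intro s₀ hs
    obtain ⟨s₁, h₁, h₂, h₃, -⟩ := e.exec_compile 0 hs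
    refine ⟨_, _, _, .seq h₁ (.seq (.const _ _ _) (.add _ _ _ _)), le_rfl, ⟨fun y => ?_, ?_⟩, rfl⟩
    · by_cases hy : y = x
      · subst hy
        simpa [Config.setReg, Cmd.run] using h₃
      · have : 2 * y ≠ 2 * x := by omega
        simp [Config.setReg, Cmd.run, Function.update_of_ne this, Function.update_of_ne hy,
          show 2 * y ≠ 3 by omega, h₂.1 y]
    · exact h₂.2
  | write m i e =>
    intro s₀ hs
    obtain ⟨s₁, h₁, h₂, h₃, -⟩ := i.exec_compile 0 hs
    obtain ⟨s₂, h₄, h₅, h₆, h₇⟩ := e.exec_compile 1 h₂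
    refine ⟨_, _, _, .seq h₁ (.seq h₄ (.store _ _ _ _)), le_rfl, ⟨fun y => ?_, ?_⟩, rfl⟩
    · exact h₅.1 y
    -- The index waits in the auxiliary register `0` while the value is computed into number `1`.
    · have h₈ := h₇ 0 (by omega)
      simp only [mul_zero, zero_add] at h₈ h₃
      simp only [Config.setMem, Cmd.run, h₅.2, h₈, h₃]
      rw [← h₆]
  | seq p q ihp ihq =>
    simp only [Cmd.loopFree, Bool.and_eq_true] at hc
    refine (ihp hc.1 s).seq fun s' h => ?_
    subst h
    exact ihq hc.2 _
  | ite e p q ihp ihq =>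
    simp only [Cmd.loopFree, Bool.and_eq_true] at hc
    refine ite (fun h => ?_) fun h => ?_
    · exact (ihp hc.1 s).mono (le_max_left _ _) fun s' hs => by rw [hs, Cmd.run, if_neg h]
    · exact (ihq hc.2 s).mono (le_max_right _ _) fun s' hs => by rw [hs, Cmd.run, if_pos h]
  | whileDo e p => simp [Cmd.loopFree] at hc

theorem block {c : Cmd} {s : Config} {t : ℕ} {Q : Config → Prop} (hc : c.loopFree = true)
    (ht : c.cost ≤ t) (hQ : Q (c.run s)) : Tri c s t Q :=
  (of_run hc s).mono ht fun s' h => by rwa [h]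

/-- A loop with an invariant `I t s`: in the configuration `s`, the remaining budget is `t`. -/
theorem while_of {e : Expr} {p : Cmd} {Q : Config → Prop} (I : ℕ → Config → Prop)
    (step : ∀ t s, I t s → e.eval s ≠ 0 →
      ∃ t₁ t₂, t₁ + t₂ + (e.cost + 1) ≤ t ∧ Tri p s t₁ (I t₂))
    (last : ∀ t s, I t s → e.eval s = 0 → Q s) {t : ℕ} {s : Config} (h : I t s) :
    Tri (.whileDo e p) s (t + (e.cost + 1)) Q := by
  -- The machine tests register `1`, which holds the value of `e` whenever the loop is entered. The
  -- budget strictly decreases because every round pays for at least one evaluation of `e`.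
  have key : ∀ t s s₀, I t s → Agree s s₀ → s₀.reg 1 = e.eval s →
      ∃ n s₁ s', Exec (.loop 1 (.seq p.compile (e.compile 0))) s₀ n s₁ ∧ n ≤ t + 1 ∧
        Agree s' s₁ ∧ Q s' := by
    intro t
    induction t using Nat.strong_induction_on with
    | _ t ih =>
      intro s s₀ hI hs hv
      by_cases he : e.eval s = 0
      · exact ⟨1, s₀, s, .loop_false (hv.trans he), by omega, hs, last t s hI he⟩
      · obtain ⟨t₁, t₂, ht, hp⟩ := step t s hI he
        obtain ⟨n₁, s₁, s', h₁, h₂, h₃, h₄⟩ := hp s₀ hs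
        obtain ⟨s₂, h₅, h₆, h₇, -⟩ := e.exec_compile 0 h₃
        obtain ⟨n₂, s₃, s'', h₈, h₉, h₁₀⟩ := ih t₂ (by omega) s' s₂ h₄ h₆ h₇
        exact ⟨_, s₃, s'', .loop_true (hv.trans_ne he) (.seq h₁ h₅) h₈, by omega, h₁₀⟩
  intro s₀ hs
  obtain ⟨s₁, h₁, h₂, h₃, -⟩ := e.exec_compile 0 hs
  obtain ⟨n, s₂, s', h₄, h₅, h₆⟩ := key t s s₁ h h₂ h₃
  exact ⟨_, s₂, s', .seq h₁ h₄, by omega, h₆⟩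

end Tri

/-! ### Frame properties. -/

theorem Expr.exec_frame (e : Expr) (k : ℕ) {s₀ s₁ : Config} {n : ℕ}
    (h : Exec (e.compile k) s₀ n s₁) :
    (∀ x, s₁.reg (2 * x) = s₀.reg (2 * x)) ∧ s₁.mem = s₀.mem := by
  have upd : ∀ (s₀ : Config) (k c x : ℕ),
      (s₀.setReg (2 * k + 1) c).reg (2 * x) = s₀.reg (2 * x) := fun s₀ k c x =>
    Function.update_of_ne (by omega) _ _
  induction e generalizing k s₀ s₁ n with
  | const c =>
    cases h
    exact ⟨fun x => upd _ _ _ _, rfl⟩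
  | reg x =>
    cases h with
    | seq h₁ h₂ =>
      cases h₁
      cases h₂
      exact ⟨fun x => (upd _ _ _ _).trans (upd _ _ _ _), rfl⟩
  | add a b iha ihb =>
    cases h with
    | seq h₁ h₂ =>
      cases h₂ with
      | seq h₂ h₃ =>
        cases h₃
        have h₁ := iha _ h₁
        have h₂ := ihb _ h₂
        exact ⟨fun x => (upd _ _ _ _).trans ((h₂.1 x).trans (h₁.1 x)), h₂.2.trans h₁.2⟩
  | sub a b iha ihb =>
    cases h with
    | seq h₁ h₂ =>
      cases h₂ with
      | seq h₂ h₃ =>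
        cases h₃
        have h₁ := iha _ h₁
        have h₂ := ihb _ h₂
        exact ⟨fun x => (upd _ _ _ _).trans ((h₂.1 x).trans (h₁.1 x)), h₂.2.trans h₁.2⟩
  | load m a iha =>
    cases h with
    | seq h₁ h₂ =>
      cases h₂
      have h₁ := iha _ h₁
      exact ⟨fun x => (upd _ _ _ _).trans (h₁.1 x), h₁.2⟩

/-- The property belongs to the code and not to a specification, so it can be added to any triple
afterwards and postconditions need not list what stays unchanged. -/
theorem Cmd.exec_frame (c : Cmd) {s₀ s₁ : Config} {n : ℕ} (h : Exec c.compile s₀ n s₁) :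
    (∀ x ∉ c.regs, s₁.reg (2 * x) = s₀.reg (2 * x)) ∧ ∀ m ∉ c.arrs, s₁.mem m = s₀.mem m := by
  induction c generalizing s₀ s₁ n with
  | skip =>
    cases h
    exact ⟨fun x _ => Function.update_of_ne (by omega) _ _, fun _ _ => rfl⟩
  | set y e =>
    cases h with
    | seq h₁ h₂ =>
      cases h₂ with
      | seq h₂ h₃ =>
        cases h₂
        cases h₃
        have h₁ := e.exec_frame _ h₁
        refine ⟨fun x hx => ?_, fun m _ => congrFun h₁.2 m⟩
        rw [Cmd.regs, List.mem_singleton] at hx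
        rw [← h₁.1 x]
        exact (Function.update_of_ne (by omega) _ _).trans (Function.update_of_ne (by omega) _ _)
  | write a i e =>
    cases h with
    | seq h₁ h₂ =>
      cases h₂ with
      | seq h₂ h₃ =>
        cases h₃
        have h₁ := i.exec_frame _ h₁
        have h₂ := e.exec_frame _ h₂
        refine ⟨fun x _ => (h₂.1 x).trans (h₁.1 x), fun m hm => ?_⟩
        rw [Cmd.arrs, List.mem_singleton] at hm
        rw [← h₁.2, ← h₂.2]
        exact Function.update_of_ne hm _ _
  | seq p q ihp ihq =>
    cases h with
    | seq h₁ h₂ =>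
      have h₁ := ihp h₁
      have h₂ := ihq h₂
      simp only [Cmd.regs, Cmd.arrs, List.mem_append, not_or]
      exact ⟨fun x hx => (h₂.1 x hx.2).trans (h₁.1 x hx.1),
        fun m hm => (h₂.2 m hm.2).trans (h₁.2 m hm.1)⟩
  | ite e p q ihp ihq =>
    cases h with
    | seq h₁ h₂ =>
      have h₁ := e.exec_frame _ h₁
      simp only [Cmd.regs, Cmd.arrs, List.mem_append, not_or]
      cases h₂ with
      | ite_true _ h₂ =>
        have h₂ := ihp h₂
        exact ⟨fun x hx => (h₂.1 x hx.1).trans (h₁.1 x),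
          fun m hm => (h₂.2 m hm.1).trans (congrFun h₁.2 m)⟩
      | ite_false _ h₂ =>
        have h₂ := ihq h₂
        exact ⟨fun x hx => (h₂.1 x hx.2).trans (h₁.1 x),
          fun m hm => (h₂.2 m hm.2).trans (congrFun h₁.2 m)⟩
  | whileDo e p ihp =>
    cases h with
    | seq h₁ h₂ =>
      have h₁ := e.exec_frame _ h₁
      rename_i s₂ n₁ n₂ he
      have key : (∀ x ∉ p.regs, s₁.reg (2 * x) = s₂.reg (2 * x)) ∧
          ∀ m ∉ p.arrs, s₁.mem m = s₂.mem m := by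
        clear h₁ he
        generalize hl : Prog.loop 1 (.seq p.compile (e.compile 0)) = l at h₂
        induction h₂ with
        | loop_false => exact ⟨fun _ _ => rfl, fun _ _ => rfl⟩
        | loop_true _ h₃ _ _ ih =>
          obtain ⟨rfl, rfl⟩ := Prog.loop.inj hl
          have ih := ih rfl
          cases h₃ with
          | seq h₃ h₄ =>
            have h₃ := ihp h₃
            have h₄ := e.exec_frame _ h₄
            exact ⟨fun x hx => (ih.1 x hx).trans ((h₄.1 x).trans (h₃.1 x hx)),
              fun m hm => (ih.2 m hm).trans ((congrFun h₄.2 m).trans (h₃.2 m hm))⟩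
        | _ => cases hl
      exact ⟨fun x hx => (key.1 x hx).trans (h₁.1 x),
        fun m hm => (key.2 m hm).trans (congrFun h₁.2 m)⟩

/-- `s'` arises from `s` by changes of the given variables and arrays only. -/
structure Frame (R M : List ℕ) (s s' : Config) : Prop where
  reg : ∀ x ∉ R, s'.reg x = s.reg x
  mem : ∀ m ∉ M, s'.mem m = s.mem m

theorem Tri.frame {c : Cmd} {s : Config} {t : ℕ} {Q : Config → Prop} (h : Tri c s t Q) :
    Tri c s t fun s' => Q s' ∧ Frame c.regs c.arrs s s' := fun s₀ hs => by
  obtain ⟨n, s₁, s', h₁, h₂, h₃, h₄⟩ := h s₀ hs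
  have hf := c.exec_frame h₁
  refine ⟨n, s₁, s', h₁, h₂, h₃, h₄, fun x hx => ?_, fun m hm => ?_⟩
  · rw [← h₃.1 x, hf.1 x hx, hs.1 x]
  · rw [← h₃.2, hf.2 m hm, hs.2]

theorem Tri.step {p q : Cmd} {s : Config} {t : ℕ} (t₂ : ℕ) {Q : Config → Prop}
    (hp : p.loopFree = true) (hq : Tri q (p.run s) t₂ Q) (ht : p.cost + t₂ ≤ t) :
    Tri (.seq p q) s t Q :=
  ((Tri.of_run hp s).seq (R := fun s' => s' = p.run s) fun s' h => by rwa [h]).mono ht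
    fun _ h => h

theorem Tri.seqFrame {p q : Cmd} {s : Config} {t t₁ : ℕ} (t₂ : ℕ) {R Q : Config → Prop}
    (hp : Tri p s t₁ R) (hq : ∀ s', R s' → Frame p.regs p.arrs s s' → Tri q s' t₂ Q)
    (ht : t₁ + t₂ ≤ t) : Tri (.seq p q) s t Q :=
  (hp.frame.seq fun s' h => hq s' h.1 h.2).mono ht fun _ h => h

/-! ### Derived expressions and commands -/

namespace Expr

/-- `1` if the value is `0`, and `0` otherwise. -/
abbrev not (a : Expr) : Expr := .sub (.const 1) a

/-- `1` if both values are nonzero, and `0` otherwise. -/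
abbrev and (a b : Expr) : Expr := .sub (.const 1) (.add a.not b.not)

/-- Nonzero if one of the values is nonzero. -/
abbrev or (a b : Expr) : Expr := .add a b

/-- `1` if the values are equal, and `0` otherwise. -/
abbrev eq (a b : Expr) : Expr := .sub (.const 1) (.add (.sub a b) (.sub b a))

/-- Nonzero if the first value is less than the second. -/
abbrev lt (a b : Expr) : Expr := .sub b a

variable (s : Config) (a b : Expr)

theorem eval_not : a.not.eval s ≠ 0 ↔ a.eval s = 0 := by
  simp only [eval]
  omega

theorem eval_and : (a.and b).eval s ≠ 0 ↔ a.eval s ≠ 0 ∧ b.eval s ≠ 0 := by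
  simp only [eval]
  omega

theorem eval_or : (a.or b).eval s ≠ 0 ↔ a.eval s ≠ 0 ∨ b.eval s ≠ 0 := by
  simp only [eval]
  omega

theorem eval_eq : (a.eq b).eval s ≠ 0 ↔ a.eval s = b.eval s := by
  simp only [eval]
  omega

theorem eval_lt : (a.lt b).eval s ≠ 0 ↔ a.eval s < b.eval s := by
  simp only [eval]
  omega

theorem eval_lt_eq_zero : (a.lt b).eval s = 0 ↔ b.eval s ≤ a.eval s := by
  simp only [eval]
  omega

end Expr

/-! ### Counting loops. -/

/-- `x := x + 1`. -/
abbrev Cmd.incr (x : ℕ) : Cmd := .set x (.add (.reg x) (.const 1))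

/-- Repeat `p` while `x` is less than `e`, and increase `x` after each round. -/
abbrev Cmd.upTo (x : ℕ) (e : Expr) (p : Cmd) : Cmd := .whileDo (.lt (.reg x) e) (.seq p (.incr x))

/-- A bound for the number of steps of `Cmd.upTo` that do not belong to its body. -/
def Cmd.upToCost (e : Expr) : ℕ := e.cost + 10

/-- The cost of a round may depend on its index, so that sums of text lengths can be used as time
bounds. -/
theorem Tri.upTo {x : ℕ} {e : Expr} {p : Cmd} {I : ℕ → Config → Prop} {n : ℕ} {f : ℕ → ℕ}
    (hx : ∀ i s, I i s → s.reg x = i) (he : ∀ i s, I i s → e.eval s = n)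
    (step : ∀ i s, i < n → I i s →
      Tri p s (f i) fun s' => s'.reg x = i ∧ I (i + 1) (s'.setReg x (i + 1)))
    {i : ℕ} {s : Config} (hi : i ≤ n) (h : I i s) :
    Tri (.upTo x e p) s (∑ j ∈ Finset.Ico i n, (f j + Cmd.upToCost e) + Cmd.upToCost e)
      (I n) := by
  refine (while_of (Q := I n) (fun t s => ∃ i, i ≤ n ∧ I i s ∧
    ∑ j ∈ Finset.Ico i n, (f j + Cmd.upToCost e) ≤ t) ?_ ?_ ⟨i, hi, h, le_rfl⟩).mono ?_ fun _ h => h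
  · rintro t s ⟨i, -, hI, ht⟩ hlt
    rw [Expr.eval_lt, he i s hI, Expr.eval, hx i s hI] at hlt
    rw [Finset.sum_eq_sum_Ico_succ_bot hlt] at ht
    refine ⟨f i + (Cmd.incr x).cost, ∑ j ∈ Finset.Ico (i + 1) n, (f j + Cmd.upToCost e), ?_, ?_⟩
    · simp only [Cmd.upToCost, Cmd.cost, Expr.cost] at ht ⊢
      omega
    · refine (step i s hlt hI).seq fun s' h => block rfl le_rfl ⟨i + 1, hlt, ?_, le_rfl⟩
      simpa [Cmd.run, Expr.eval, h.1] using h.2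
  · rintro t s ⟨i, hi, hI, -⟩ h
    have h' := mt (Expr.eval_lt s (.reg x) e).2 (not_not.2 h)
    rw [he i s hI, Expr.eval, hx i s hI] at h'
    rwa [le_antisymm hi (not_lt.1 h')] at hI
  · simp only [Cmd.upToCost, Expr.cost]
    omega

theorem Tri.upTo_const {x : ℕ} {e : Expr} {p : Cmd} {I : ℕ → Config → Prop} {n t : ℕ}
    (hx : ∀ i s, I i s → s.reg x = i) (he : ∀ i s, I i s → e.eval s = n)
    (step : ∀ i s, i < n → I i s →
      Tri p s t fun s' => s'.reg x = i ∧ I (i + 1) (s'.setReg x (i + 1)))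
    {s : Config} (h : I 0 s) :
    Tri (.upTo x e p) s (n * (t + Cmd.upToCost e) + Cmd.upToCost e) (I n) := by
  refine (Tri.upTo hx he step (Nat.zero_le _) h).mono ?_ fun _ h => h
  simp

section Update

variable (s : Config) (x y m m' i j c : ℕ)

@[simp] theorem Config.reg_setReg :
    (s.setReg x c).reg y = if y = x then c else s.reg y := by
  simp [Config.setReg, Function.update_apply]

@[simp] theorem Config.mem_setReg : (s.setReg x c).mem = s.mem := rfl

@[simp] theorem Config.reg_setMem : (s.setMem m i c).reg = s.reg := rfl

@[simp] theorem Config.mem_setMem :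
    (s.setMem m i c).mem m' = if m' = m then Function.update (s.mem m) i c else s.mem m' := by
  simp only [Config.setMem, Function.update_apply]

end Update


theorem Tri.while_count {e : Expr} {p : Cmd} {n t : ℕ} (I : ℕ → Config → Prop)
    (step : ∀ i s, i < n → I i s → e.eval s ≠ 0 ∧ Tri p s t (I (i + 1)))
    (last : ∀ s, I n s → e.eval s = 0) {s : Config} (h : I 0 s) :
    Tri (.whileDo e p) s (n * (t + (e.cost + 1)) + (e.cost + 1)) (I n) := by
  refine while_of (fun b s => ∃ i, i ≤ n ∧ I i s ∧ (n - i) * (t + (e.cost + 1)) ≤ b) ?_ ?_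
    ⟨0, Nat.zero_le _, h, le_rfl⟩
  · rintro b s ⟨i, hi, hI, hb⟩ he
    have hlt : i < n := lt_of_le_of_ne hi fun h => he (last s (h ▸ hI))
    refine ⟨t, (n - (i + 1)) * (t + (e.cost + 1)), ?_, ((step i s hlt hI).2).mono le_rfl
      fun s' h => ⟨i + 1, hlt, h, le_rfl⟩⟩
    obtain ⟨k, hk⟩ : ∃ k, n - i = k + 1 := ⟨n - i - 1, by omega⟩
    rw [hk, Nat.succ_mul] at hb
    rw [show n - (i + 1) = k by omega]
    omega
  · rintro b s ⟨i, hi, hI, -⟩ he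
    rcases hi.lt_or_eq with h | rfl
    · exact absurd he (step i s h hI).1
    · exact hI

/-! ### Words in an array -/

/-- The list `l` is stored in the array `m` from position `p` on. -/
def Holds {α : Type*} (m : ℕ → α) (p : ℕ) (l : List α) : Prop := ∀ (i : ℕ) (h : i < l.length), m (p + i) = l[i]

namespace Holds

variable {α : Type*} {m m' : ℕ → α} {p : ℕ} {a : α} {l l' : List α}

theorem nil : Holds m p [] := fun i h => absurd h (Nat.not_lt_zero i)

theorem cons_iff : Holds m p (a :: l) ↔ m p = a ∧ Holds m (p + 1) l := by
  refine ⟨fun h => ⟨h 0 (by simp), fun i hi => ?_⟩, fun h i hi => ?_⟩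
  · have := h (i + 1) (by simpa using hi)
    rwa [show p + (i + 1) = p + 1 + i by omega, List.getElem_cons_succ] at this
  · cases i with
    | zero => simpa using h.1
    | succ i =>
      have := h.2 i (by simpa using hi)
      rwa [show p + (i + 1) = p + 1 + i by omega, List.getElem_cons_succ]

theorem append_iff : Holds m p (l ++ l') ↔ Holds m p l ∧ Holds m (p + l.length) l' := by
  induction l generalizing p with
  | nil => simp [nil]
  | cons a l ih =>
    rw [List.cons_append, cons_iff, cons_iff, ih, List.length_cons,
      show p + (l.length + 1) = p + 1 + l.length by omega, and_assoc]

theorem congr (h : Holds m p l) (hm : ∀ i, p ≤ i → i < p + l.length → m' i = m i) :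
    Holds m' p l := fun i hi => by
  rw [hm (p + i) (by omega) (by omega), h i hi]

theorem update_of_le (h : Holds m p l) {i : ℕ} {c : α} (hi : p + l.length ≤ i) :
    Holds (Function.update m i c) p l :=
  h.congr fun j _ hj => Function.update_of_ne (by omega) _ _

theorem snoc (h : Holds m p l) {c : α} :
    Holds (Function.update m (p + l.length) c) p (l ++ [c]) :=
  append_iff.2 ⟨h.update_of_le le_rfl, cons_iff.2 ⟨by simp, nil⟩⟩

end Holds

/-! ### Tokens -/

/-- The nodes of a term. -/
inductive Tok where
  | var (x : ℕ)
  | bot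
  | top
  | neg
  | meet
  | join
  | app (f : FunSym)

/-- The numbers that encode a node. -/
def Tok.encode : Tok → List ℕ
  | .var x => [0, x]
  | .bot => [1]
  | .top => [2]
  | .neg => [3]
  | .meet => [4]
  | .join => [5]
  | .app f => [6, f.name, f.i, f.j, f.k]

/-- The nodes of a term in prefix order. -/
def Term.toks : Term → List Tok
  | .var x => [.var x]
  | .bot => [.bot]
  | .top => [.top]
  | .neg t => .neg :: t.toks
  | .meet s t => .meet :: (s.toks ++ t.toks)
  | .join s t => .join :: (s.toks ++ t.toks)
  | .app f x => .app f :: (List.ofFn fun a => (x a).toks).flatten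

theorem Term.encode_eq (t : Term) : t.encode = t.toks.flatMap Tok.encode := by
  induction t with
  | app f x ih =>
    simp only [Term.encode, Term.toks, ih, List.flatMap_def, List.map_cons, List.flatten_cons,
      Tok.encode, List.cons_append, List.nil_append, List.map_flatten, List.flatten_flatten,
      List.map_ofFn, Function.comp_def]
  | _ => simp_all [Term.encode, Term.toks, Tok.encode, List.flatMap_cons]

theorem Term.length_toks (t : Term) : t.toks.length = t.nodes := by
  induction t with
  | app f x ih =>
    simp [Term.toks, Term.nodes, List.length_flatten, List.map_ofFn, Function.comp_def, ih,
      List.sum_ofFn]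
  | _ => simp_all [Term.toks, Term.nodes]

theorem Tok.length_encode_pos (t : Tok) : 0 < t.encode.length := by
  cases t <;> simp [Tok.encode]

/-- The position of the token number `q`. -/
def tokPos (l : List Tok) (q : ℕ) : ℕ := ((l.take q).flatMap Tok.encode).length

theorem tokPos_succ {l : List Tok} {q : ℕ} (h : q < l.length) :
    tokPos l (q + 1) = tokPos l q + l[q].encode.length := by
  rw [tokPos, tokPos, List.take_add_one, List.getElem?_eq_getElem h, Option.toList_some,
    List.flatMap_append, List.length_append, List.flatMap_singleton]

theorem tokPos_length (l : List Tok) : tokPos l l.length = (l.flatMap Tok.encode).length := by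
  rw [tokPos, List.take_length]

theorem tokPos_lt {l : List Tok} {q : ℕ} (h : q < l.length) :
    tokPos l q < (l.flatMap Tok.encode).length := by
  conv_rhs => rw [← List.take_append_drop q l, List.drop_eq_getElem_cons h]
  rw [List.flatMap_append, List.flatMap_cons, List.length_append, List.length_append, tokPos]
  have := l[q].length_encode_pos
  omega

theorem Holds.tok {m : ℕ → ℕ} {l : List Tok} (h : Holds m 0 (l.flatMap Tok.encode)) {q : ℕ}
    (hq : q < l.length) : Holds m (tokPos l q) l[q].encode := by
  rw [← List.take_append_drop q l, List.drop_eq_getElem_cons hq, List.flatMap_append,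
    List.flatMap_cons] at h
  have := (append_iff.1 (append_iff.1 h).2).1
  rwa [zero_add] at this

/-! ### Finding the tokens, and multiples of the width of the table -/

/-- The arrays of the program. -/
notation "aIn" => (0 : ℕ)
notation "aOut" => (1 : ℕ)
notation "aTok" => (2 : ℕ)
notation "aK" => (3 : ℕ)
notation "aA" => (4 : ℕ)
notation "aB" => (5 : ℕ)
notation "aC" => (6 : ℕ)
notation "aArg" => (7 : ℕ)
notation "aBase" => (8 : ℕ)
notation "aTab" => (9 : ℕ)
notation "aStack" => (10 : ℕ)
notation "aNeg" => (11 : ℕ)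
notation "aQueue" => (12 : ℕ)
notation "aStart" => (13 : ℕ)
notation "aPos" => (15 : ℕ)
notation "aLen" => (16 : ℕ)
notation "aText" => (17 : ℕ)
notation "aFlag" => (18 : ℕ)
notation "aSort" => (19 : ℕ)

/-- The variables of the program. -/
notation "rLen" => (0 : ℕ)
notation "rTok" => (1 : ℕ)
notation "rPos" => (2 : ℕ)
notation "rWidth" => (3 : ℕ)
notation "rNodes" => (4 : ℕ)
notation "rSp" => (5 : ℕ)
notation "rX" => (7 : ℕ)
notation "rY" => (8 : ℕ)
notation "rRes" => (9 : ℕ)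
notation "rAll" => (10 : ℕ)
notation "rJ" => (11 : ℕ)
notation "rP" => (12 : ℕ)
notation "rQ" => (13 : ℕ)
notation "rRow" => (14 : ℕ)
notation "rOff" => (15 : ℕ)
notation "rArg" => (16 : ℕ)
notation "rQn" => (17 : ℕ)
notation "rU" => (18 : ℕ)
notation "rW" => (19 : ℕ)
notation "rTp" => (20 : ℕ)
notation "rI" => (21 : ℕ)
notation "rG" => (22 : ℕ)
notation "rS" => (23 : ℕ)
notation "rT" => (24 : ℕ)
notation "rV" => (25 : ℕ)
notation "rM" => (26 : ℕ)

/-- Store the positions of the tokens. -/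
def tokenize : Cmd :=
  .whileDo (.lt (.reg rPos) (.reg rLen)) <|
    .seq (.write aTok (.reg rTok) (.reg rPos)) <|
    .seq (.incr rTok) <|
    .set rPos (.add (.reg rPos) (.add (.const 1)
      (.add (.eq (.load aIn (.reg rPos)) (.const 0))
        (.add (.eq (.load aIn (.reg rPos)) (.const 6))
          (.add (.eq (.load aIn (.reg rPos)) (.const 6))
            (.add (.eq (.load aIn (.reg rPos)) (.const 6))
              (.eq (.load aIn (.reg rPos)) (.const 6))))))))

/-- Nodes take up one, two or five numbers, so the word cannot be read from right to left without a
list of their starting positions. -/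
theorem tokenize_spec : ∃ C, ∀ (l : List Tok) (s : Config),
    Holds (s.mem aIn) 0 (l.flatMap Tok.encode) → s.reg rLen = (l.flatMap Tok.encode).length →
    s.reg rTok = 0 → s.reg rPos = 0 →
    Tri tokenize s (C * (l.length + 1)) fun s' => s'.reg rTok = l.length ∧
      ∀ q < l.length, s'.mem aTok q = tokPos l q := by
  -- Numbers such as this one are generous bounds for the cost of a fixed piece of code, here and in
  -- all later specifications.
  refine ⟨1000, fun l s hm hL hT hP => ?_⟩
  refine (Tri.while_count (n := l.length) (t := 500) (fun q s => s.reg rTok = q ∧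
    s.reg rPos = tokPos l q ∧ (∀ j < q, s.mem aTok j = tokPos l j) ∧
    s.reg rLen = (l.flatMap Tok.encode).length ∧ Holds (s.mem aIn) 0 (l.flatMap Tok.encode))
    ?_ ?_ ?_).mono ?_ ?_
  · rintro q s hq ⟨h₁, h₂, h₃, h₄, h₅⟩
    refine ⟨?_, Tri.block rfl (by decide) ?_⟩
    · rw [Expr.eval_lt, Expr.eval, Expr.eval, h₂, h₄]
      exact tokPos_lt hq
    · have h₆ := h₅.tok hq
      refine ⟨by simp [Cmd.run, Expr.eval, h₁], ?_, ?_, by simpa [Cmd.run] using h₄,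
        by simpa [Cmd.run] using h₅⟩
      · rw [tokPos_succ hq]
        cases ht : l[q] <;> rw [ht, Tok.encode, Holds.cons_iff] at h₆ <;>
          simp [Cmd.run, Expr.eval, h₂, h₆.1, Tok.encode]
      · intro j hj
        by_cases hjq : j = q
        · simp [Cmd.run, Expr.eval, h₁, h₂, hjq]
        · simp [Cmd.run, Expr.eval, h₁, h₂, Function.update_of_ne hjq,
            h₃ j (by omega)]
  · rintro s ⟨-, h₂, -, h₄, -⟩
    simp [Expr.eval, h₂, h₄, tokPos_length]
  · exact ⟨hT, by simpa [tokPos] using hP, by simp, hL, hm⟩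
  · simp only [Expr.cost]
    omega
  · rintro s' ⟨h₁, -, h₃, -⟩
    exact ⟨h₁, h₃⟩

/-- Store the multiples of the width of the table. -/
def multiples : Cmd :=
  .seq (.seq (.set rWidth (.add (.reg rLen) (.reg rLen))) (.set rJ (.const 0))) <|
    .upTo rJ (.reg rWidth) (.write aBase (.add (.reg rJ) (.const 1))
      (.add (.load aBase (.reg rJ)) (.reg rWidth)))

/-- The machine cannot multiply. Storing the starting positions of all rows of the table makes the
cell of a pair accessible in constant time. -/
theorem multiples_spec : ∃ C, ∀ s : Config, s.mem aBase 0 = 0 →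
    Tri multiples s (C * (s.reg rLen + 1)) fun s' => s'.reg rWidth = 2 * s.reg rLen ∧
      ∀ x ≤ 2 * s.reg rLen, s'.mem aBase x = x * (2 * s.reg rLen) := by
  refine ⟨1000, fun s h₀ => Tri.step (2 * s.reg rLen * (20 + 20) + 40) rfl ?_ ?_⟩
  · refine (Tri.upTo_const (n := 2 * s.reg rLen) (t := 20)
      (I := fun i s' => s'.reg rJ = i ∧ s'.reg rWidth = 2 * s.reg rLen ∧
        ∀ x ≤ i, s'.mem aBase x = x * (2 * s.reg rLen)) ?_ ?_ ?_ ?_).mono ?_ ?_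
    · exact fun i s h => h.1
    · exact fun i s h => h.2.1
    · rintro i s hi ⟨h₁, h₂, h₃⟩
      refine Tri.block rfl (by decide) ⟨by simp [Cmd.run, h₁], by simp, by simp [Cmd.run, h₂],
        fun x hx => ?_⟩
      by_cases hx' : x = i + 1
      · simp [Cmd.run, Expr.eval, h₁, h₂, h₃ i le_rfl, hx']
        ring
      · simp [Cmd.run, Expr.eval, h₁, Function.update_of_ne hx', h₃ x (by omega)]
    · simp [Cmd.run, Expr.eval, h₀]
      omega
    · simp [Cmd.upToCost, Expr.cost]
      omega
    · exact fun s' h => h.2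
  · simp [Cmd.cost, Expr.cost]
    omega


/-! ### Comparison of two nodes -/

/-- The premises of the rule for function symbols. -/
def AppLe (p : Bool) (f : FunSym) (x y : Fin f.arity → NTerm) : Prop :=
  (∀ a, (f.variance a).Fwd p → Le (x a) (y a)) ∧ ∀ a, (f.variance a).Fwd (!p) → Le (y a) (x a)

/-- One step of the recursion that fills the table: every premise concerns a comparison in which at
least one side is a proper subterm and the other is not larger. -/
theorem Le.iff_rules {s t : NTerm} : Le s t ↔
    s = .bot ∨ t = .top ∨ (∃ a b, s = .join a b ∧ Le a t ∧ Le b t) ∨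
      (∃ a b, t = .meet a b ∧ Le s a ∧ Le s b) ∨ (∃ a b, s = .meet a b ∧ (Le a t ∨ Le b t)) ∨
      (∃ a b, t = .join a b ∧ (Le s a ∨ Le s b)) ∨ (∃ b x, s = .lit b x ∧ t = .lit b x) ∨
      ∃ p f x y, s = .app p f x ∧ t = .app p f y ∧ AppLe p f x y := by
  constructor
  · intro h
    cases h with
    | bot => exact .inl rfl
    | top => exact .inr (.inl rfl)
    | join_left h₁ h₂ => exact .inr (.inr (.inl ⟨_, _, rfl, h₁, h₂⟩))
    | meet_right h₁ h₂ => exact .inr (.inr (.inr (.inl ⟨_, _, rfl, h₁, h₂⟩)))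
    | meet_left₁ h => exact .inr (.inr (.inr (.inr (.inl ⟨_, _, rfl, .inl h⟩))))
    | meet_left₂ h => exact .inr (.inr (.inr (.inr (.inl ⟨_, _, rfl, .inr h⟩))))
    | join_right₁ h => exact .inr (.inr (.inr (.inr (.inr (.inl ⟨_, _, rfl, .inl h⟩)))))
    | join_right₂ h => exact .inr (.inr (.inr (.inr (.inr (.inl ⟨_, _, rfl, .inr h⟩)))))
    | lit b x => exact .inr (.inr (.inr (.inr (.inr (.inr (.inl ⟨b, x, rfl, rfl⟩))))))
    | app p f h₁ h₂ =>
      exact .inr (.inr (.inr (.inr (.inr (.inr (.inr ⟨p, f, _, _, rfl, rfl, h₁, h₂⟩))))))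
  · rintro (rfl | rfl | ⟨a, b, rfl, h₁, h₂⟩ | ⟨a, b, rfl, h₁, h₂⟩ | ⟨a, b, rfl, h | h⟩ |
      ⟨a, b, rfl, h | h⟩ | ⟨b, x, rfl, rfl⟩ | ⟨p, f, x, y, rfl, rfl, h₁, h₂⟩)
    · exact .bot _
    · exact .top _
    · exact .join_left h₁ h₂
    · exact .meet_right h₁ h₂
    · exact .meet_left₁ h
    · exact .meet_left₂ h
    · exact .join_right₁ h
    · exact .join_right₂ h
    · exact .lit _ _
    · exact .app p f h₁ h₂

theorem FunSym.fwd_true_iff (f : FunSym) (a : Fin f.arity) :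
    (f.variance a).Fwd true ↔ a.1 < f.i + f.j := by
  unfold FunSym.variance
  split_ifs <;> simp [Variance.Fwd] <;> omega

theorem FunSym.fwd_false_iff (f : FunSym) (a : Fin f.arity) :
    (f.variance a).Fwd false ↔ a.1 < f.i ∨ f.i + f.j ≤ a.1 := by
  unfold FunSym.variance
  split_ifs <;> simp [Variance.Fwd] <;> omega

/-- The arity of the outermost symbol. -/
def NTerm.arity : NTerm → ℕ
  | .app _ f _ => f.arity
  | _ => 0

/-- The number `y` belongs to an earlier node than `x`, for the term `t`. -/
def Child (D : ℕ → NTerm) (x y : ℕ) (t : NTerm) : Prop := y / 2 < x / 2 ∧ D y = t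

/-- The arrays hold the node `x` for the given term. Each node of the input has an even and an odd
number, for a term and its dual; the numbers of the arguments of function symbols are stored in the
first `n` cells of the array `aArg`. -/
def NodeOK (m : ℕ → ℕ → ℕ) (n : ℕ) (D : ℕ → NTerm) (x : ℕ) : NTerm → Prop
  | .lit b v => m aK x = 0 ∧ m aA x = b.toNat ∧ m aB x = v
  | .bot => m aK x = 1
  | .top => m aK x = 2
  | .meet s t => m aK x = 4 ∧ Child D x (m aA x) s ∧ Child D x (m aB x) t
  | .join s t => m aK x = 5 ∧ Child D x (m aA x) s ∧ Child D x (m aB x) t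
  | .app b f y => m aK x = 6 ∧ m aA x = b.toNat ∧
      Holds (m aIn) (m aB x) (Tok.app f).encode ∧ m aC x + f.arity ≤ n ∧
      ∀ a : Fin f.arity, Child D x (m aArg (m aC x + a)) (y a)

/-- The table holds the comparison of `x` and `y`. -/
def Entry (m : ℕ → ℕ → ℕ) (D : ℕ → NTerm) (x y : ℕ) : Prop :=
  m aTab (m aBase x + y) ≠ 0 ↔ Le (D x) (D y)

namespace Expr

/-- The entry of the table for two nodes. -/
abbrev tab (x y : Expr) : Expr := .load aTab (.add (.load aBase x) y)

/-- The kind of a node. -/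
abbrev kind (x : Expr) : Expr := .load aK x

/-- The first component of a node. -/
abbrev fst (x : Expr) : Expr := .load aA x

/-- The second component of a node. -/
abbrev snd (x : Expr) : Expr := .load aB x

/-- A number in the encoding of the function symbol of a node. -/
abbrev symbol (x : Expr) (i : ℕ) : Expr := .load aIn (.add x.snd (.const i))

end Expr

open OrthoPlus.Expr in
/-- The rules for all nodes except for function symbols. -/
def cmpRules (x y : Expr) : Expr :=
  or (eq x.kind (const 1)) <|
  or (eq y.kind (const 2)) <|
  or (and (eq x.kind (const 5)) (and (tab x.fst y) (tab x.snd y))) <|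
  or (and (eq y.kind (const 4)) (and (tab x y.fst) (tab x y.snd))) <|
  or (and (eq x.kind (const 4)) (or (tab x.fst y) (tab x.snd y))) <|
  or (and (eq y.kind (const 5)) (or (tab x y.fst) (tab x y.snd))) <|
  and (eq x.kind (const 0)) (and (eq y.kind (const 0))
    (and (eq x.fst y.fst) (eq x.snd y.snd)))

open OrthoPlus.Expr in
/-- Whether both nodes are applications of the same symbol. -/
def cmpApp (x y : Expr) : Expr :=
  and (eq x.kind (const 6)) <| and (eq y.kind (const 6)) <| and (eq x.fst y.fst) <|
  and (eq (x.symbol 1) (y.symbol 1)) <| and (eq (x.symbol 2) (y.symbol 2)) <|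
  and (eq (x.symbol 3) (y.symbol 3)) (eq (x.symbol 4) (y.symbol 4))

section

variable {m : ℕ → ℕ → ℕ} {n x y : ℕ} {D : ℕ → NTerm}

theorem NodeOK.kind_one (h : NodeOK m n D x (D x)) : m aK x = 1 ↔ D x = .bot := by
  generalize D x = t at *
  cases t <;> simp [NodeOK] at h <;> simp [h]

theorem NodeOK.kind_two (h : NodeOK m n D x (D x)) : m aK x = 2 ↔ D x = .top := by
  generalize D x = t at *
  cases t <;> simp [NodeOK] at h <;> simp [h]

theorem NodeOK.kind_four (h : NodeOK m n D x (D x)) : m aK x = 4 ↔ ∃ a b, D x = .meet a b := by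
  generalize D x = t at *
  cases t <;> simp [NodeOK] at h <;> simp [h]

theorem NodeOK.kind_five (h : NodeOK m n D x (D x)) : m aK x = 5 ↔ ∃ a b, D x = .join a b := by
  generalize D x = t at *
  cases t <;> simp [NodeOK] at h <;> simp [h]

theorem NodeOK.kind_zero (h : NodeOK m n D x (D x)) : m aK x = 0 ↔ ∃ b v, D x = .lit b v := by
  generalize D x = t at *
  cases t <;> simp [NodeOK] at h <;> simp [h]

theorem NodeOK.kind_six (h : NodeOK m n D x (D x)) :
    m aK x = 6 ↔ ∃ b f z, D x = .app b f z := by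
  generalize D x = t at *
  cases t <;> simp [NodeOK] at h <;> simp [h]

theorem Bool.toNat_inj' {a b : Bool} : a.toNat = b.toNat ↔ a = b := by
  cases a <;> cases b <;> simp

/-- Each premise is an entry in which one node is replaced by a component, and components have
strictly smaller pair numbers. So a bounded number of table lookups decides all rules but the one
for function symbols. -/
theorem cmpRules_iff {s : Config} {ex ey : Expr} (hex : ex.eval s = x) (hey : ey.eval s = y)
    (hx : NodeOK s.mem n D x (D x)) (hy : NodeOK s.mem n D y (D y))
    (h₁ : ∀ x', x' / 2 < x / 2 → Entry s.mem D x' y)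
    (h₂ : ∀ y', y' / 2 < y / 2 → Entry s.mem D x y') :
    (cmpRules ex ey).eval s ≠ 0 ↔
      D x = .bot ∨ D y = .top ∨ (∃ a b, D x = .join a b ∧ Le a (D y) ∧ Le b (D y)) ∨
      (∃ a b, D y = .meet a b ∧ Le (D x) a ∧ Le (D x) b) ∨
      (∃ a b, D x = .meet a b ∧ (Le a (D y) ∨ Le b (D y))) ∨
      (∃ a b, D y = .join a b ∧ (Le (D x) a ∨ Le (D x) b)) ∨
      ∃ b v, D x = .lit b v ∧ D y = .lit b v := by
  simp only [cmpRules, Expr.eval_or, Expr.eval_and, Expr.eval_eq]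
  simp only [Expr.eval, hex, hey]
  refine or_congr hx.kind_one (or_congr hy.kind_two (or_congr ?_ (or_congr ?_ (or_congr ?_
    (or_congr ?_ ?_)))))
  · rw [hx.kind_five]
    constructor
    · rintro ⟨⟨a, b, h⟩, h₃, h₄⟩
      rw [h, NodeOK] at hx
      have h₅ := (h₁ _ hx.2.1.1).1 h₃
      have h₆ := (h₁ _ hx.2.2.1).1 h₄
      rw [hx.2.1.2] at h₅
      rw [hx.2.2.2] at h₆
      exact ⟨a, b, h, h₅, h₆⟩
    · rintro ⟨a, b, h, h₅, h₆⟩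
      have hx' := hx
      rw [h, NodeOK] at hx
      exact ⟨⟨a, b, h⟩, (h₁ _ hx.2.1.1).2 (by rwa [hx.2.1.2]),
        (h₁ _ hx.2.2.1).2 (by rwa [hx.2.2.2])⟩
  · rw [hy.kind_four]
    constructor
    · rintro ⟨⟨a, b, h⟩, h₃, h₄⟩
      rw [h, NodeOK] at hy
      have h₅ := (h₂ _ hy.2.1.1).1 h₃
      have h₆ := (h₂ _ hy.2.2.1).1 h₄
      rw [hy.2.1.2] at h₅
      rw [hy.2.2.2] at h₆
      exact ⟨a, b, h, h₅, h₆⟩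
    · rintro ⟨a, b, h, h₅, h₆⟩
      rw [h, NodeOK] at hy
      exact ⟨⟨a, b, h⟩, (h₂ _ hy.2.1.1).2 (by rwa [hy.2.1.2]),
        (h₂ _ hy.2.2.1).2 (by rwa [hy.2.2.2])⟩
  · rw [hx.kind_four]
    constructor
    · rintro ⟨⟨a, b, h⟩, h₃⟩
      rw [h, NodeOK] at hx
      refine ⟨a, b, h, h₃.imp (fun h₃ => ?_) fun h₃ => ?_⟩
      · rw [← hx.2.1.2]; exact (h₁ _ hx.2.1.1).1 h₃
      · rw [← hx.2.2.2]; exact (h₁ _ hx.2.2.1).1 h₃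
    · rintro ⟨a, b, h, h₃⟩
      rw [h, NodeOK] at hx
      exact ⟨⟨a, b, h⟩, h₃.imp (fun h₃ => (h₁ _ hx.2.1.1).2 (by rwa [hx.2.1.2])) fun h₃ =>
        (h₁ _ hx.2.2.1).2 (by rwa [hx.2.2.2])⟩
  · rw [hy.kind_five]
    constructor
    · rintro ⟨⟨a, b, h⟩, h₃⟩
      rw [h, NodeOK] at hy
      refine ⟨a, b, h, h₃.imp (fun h₃ => ?_) fun h₃ => ?_⟩
      · rw [← hy.2.1.2]; exact (h₂ _ hy.2.1.1).1 h₃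
      · rw [← hy.2.2.2]; exact (h₂ _ hy.2.2.1).1 h₃
    · rintro ⟨a, b, h, h₃⟩
      rw [h, NodeOK] at hy
      exact ⟨⟨a, b, h⟩, h₃.imp (fun h₃ => (h₂ _ hy.2.1.1).2 (by rwa [hy.2.1.2])) fun h₃ =>
        (h₂ _ hy.2.2.1).2 (by rwa [hy.2.2.2])⟩
  · rw [hx.kind_zero, hy.kind_zero]
    constructor
    · rintro ⟨⟨b, v, h⟩, ⟨b', v', h'⟩, h₃, h₄⟩
      rw [h, NodeOK] at hx
      rw [h', NodeOK] at hy
      rw [hx.2.1, hy.2.1, Bool.toNat_inj'] at h₃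
      rw [hx.2.2, hy.2.2] at h₄
      subst h₃ h₄
      exact ⟨b, v, h, h'⟩
    · rintro ⟨b, v, h, h'⟩
      rw [h, NodeOK] at hx
      rw [h', NodeOK] at hy
      exact ⟨⟨b, v, h⟩, ⟨b, v, h'⟩, hx.2.1.trans hy.2.1.symm, hx.2.2.trans hy.2.2.symm⟩

theorem holds_app {m : ℕ → ℕ} {p : ℕ} {f : FunSym} (h : Holds m p (Tok.app f).encode) :
    m (p + 1) = f.name ∧ m (p + 2) = f.i ∧ m (p + 3) = f.j ∧ m (p + 4) = f.k :=
  ⟨h 1 (by simp [Tok.encode]), h 2 (by simp [Tok.encode]), h 3 (by simp [Tok.encode]),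
    h 4 (by simp [Tok.encode])⟩

theorem cmpApp_iff {s : Config} {ex ey : Expr} (hex : ex.eval s = x) (hey : ey.eval s = y)
    (hx : NodeOK s.mem n D x (D x)) (hy : NodeOK s.mem n D y (D y)) :
    (cmpApp ex ey).eval s ≠ 0 ↔ ∃ p f z w, D x = .app p f z ∧ D y = .app p f w := by
  simp only [cmpApp, Expr.eval_and, Expr.eval_eq]
  simp only [Expr.eval, hex, hey]
  rw [hx.kind_six, hy.kind_six]
  constructor
  · rintro ⟨⟨p, f, z, h⟩, ⟨p', f', w, h'⟩, h₁, h₂, h₃, h₄, h₅⟩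
    rw [h, NodeOK] at hx
    rw [h', NodeOK] at hy
    have hf := holds_app hx.2.2.1
    have hf' := holds_app hy.2.2.1
    rw [hx.2.1, hy.2.1, Bool.toNat_inj'] at h₁
    rw [hf.1, hf'.1] at h₂
    rw [hf.2.1, hf'.2.1] at h₃
    rw [hf.2.2.1, hf'.2.2.1] at h₄
    rw [hf.2.2.2, hf'.2.2.2] at h₅
    obtain ⟨a, b, c, d⟩ := f
    obtain ⟨a', b', c', d'⟩ := f'
    subst h₁ h₂ h₃ h₄ h₅
    exact ⟨_, _, z, w, h, h'⟩
  · rintro ⟨p, f, z, w, h, h'⟩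
    rw [h, NodeOK] at hx
    rw [h', NodeOK] at hy
    have hf := holds_app hx.2.2.1
    have hf' := holds_app hy.2.2.1
    rw [hf.1, hf'.1, hf.2.1, hf'.2.1, hf.2.2.1, hf'.2.2.1, hf.2.2.2, hf'.2.2.2, hx.2.1, hy.2.1]
    exact ⟨⟨p, f, z, h⟩, ⟨p, f, w, h'⟩, rfl, rfl, rfl, rfl, rfl⟩

end

/-! ### Comparing applications of the same function symbol. -/

open OrthoPlus.Expr in
/-- Compare the arguments of two applications of the same symbol. -/
def cmpArgs : Cmd :=
  .upTo rJ (.add (symbol (reg rX) 2) (.add (symbol (reg rX) 3) (symbol (reg rX) 4))) <|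
    .set rAll <| and (reg rAll) <| and
      (or (tab (load aArg (add (reg rP) (reg rJ))) (load aArg (add (reg rQ) (reg rJ))))
        (not (lt (reg rJ) (add (symbol (reg rX) 2) (symbol (reg rX) 3)))))
      (or (tab (load aArg (add (reg rQ) (reg rJ))) (load aArg (add (reg rP) (reg rJ))))
        (and (not (lt (reg rJ) (symbol (reg rX) 2)))
          (lt (reg rJ) (add (symbol (reg rX) 2) (symbol (reg rX) 3)))))

theorem cmpArgs_spec : ∃ C, ∀ (s : Config) (f : FunSym) (F G : ℕ → Prop), s.reg rJ = 0 →
    s.reg rAll = 1 → Holds (s.mem aIn) (s.mem aB (s.reg rX)) (Tok.app f).encode →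
    (∀ a < f.arity, s.mem aTab (s.mem aBase (s.mem aArg (s.reg rP + a)) +
      s.mem aArg (s.reg rQ + a)) ≠ 0 ↔ F a) →
    (∀ a < f.arity, s.mem aTab (s.mem aBase (s.mem aArg (s.reg rQ + a)) +
      s.mem aArg (s.reg rP + a)) ≠ 0 ↔ G a) →
    Tri cmpArgs s (C * (f.arity + 1)) fun s' => s'.reg rAll ≠ 0 ↔
      ∀ a < f.arity, (a < f.i + f.j → F a) ∧ (a < f.i ∨ f.i + f.j ≤ a → G a) := by
  refine ⟨1000, fun s f F G h₁ h₂ h₃ h₄ h₅ => ?_⟩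
  have hf := holds_app h₃
  refine (Tri.upTo_const (n := f.arity) (t := 500) (I := fun i s' => s'.reg rJ = i ∧
    s'.reg rX = s.reg rX ∧ s'.reg rP = s.reg rP ∧ s'.reg rQ = s.reg rQ ∧ s'.mem = s.mem ∧
    (s'.reg rAll ≠ 0 ↔
      ∀ a < i, (a < f.i + f.j → F a) ∧ (a < f.i ∨ f.i + f.j ≤ a → G a))) ?_ ?_ ?_ ?_).mono ?_ ?_
  · exact fun i s h => h.1
  · rintro i s' ⟨k₁, k₂, k₃, k₄, k₅, k₆⟩
    simp only [Expr.eval, k₂, k₅, hf, FunSym.arity]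
    omega
  · rintro i s' hi ⟨k₁, k₂, k₃, k₄, k₅, k₆⟩
    refine Tri.block rfl (by decide) ⟨by simp [Cmd.run, k₁], by simp, by simp [Cmd.run, k₂],
      by simp [Cmd.run, k₃], by simp [Cmd.run, k₄], by simp [Cmd.run, k₅], ?_⟩
    have he : ∀ c, ((Cmd.run (.set rAll c) s').setReg rJ (i + 1)).reg rAll = c.eval s' := by
      simp [Cmd.run]
    rw [he, Expr.eval_and, Expr.eval_and, Expr.eval_or, Expr.eval_or, Expr.eval_not,
      Expr.eval_and, Expr.eval_not, Expr.eval_lt_eq_zero, Expr.eval_lt_eq_zero, Expr.eval_lt]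
    simp only [Expr.eval, k₁, k₂, k₃, k₄, k₅, hf]
    rw [k₆, h₄ i hi, h₅ i hi]
    constructor
    · rintro ⟨q₁, q₂, q₃⟩ a ha
      rcases Nat.lt_succ_iff_lt_or_eq.1 ha with ha | rfl
      · exact q₁ a ha
      · exact ⟨fun h => q₂.resolve_right (by omega), fun h => q₃.resolve_right (by omega)⟩
    · intro q
      refine ⟨fun a ha => q a (by omega), ?_, ?_⟩
      · by_cases hlt : i < f.i + f.j
        · exact .inl ((q i (by omega)).1 hlt)
        · exact .inr (by omega)
      · by_cases hlt : i < f.i ∨ f.i + f.j ≤ i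
        · exact .inl ((q i (by omega)).2 hlt)
        · exact .inr (by omega)
  · exact ⟨h₁, rfl, rfl, rfl, rfl, by simp [h₂]⟩
  · simp [Cmd.upToCost, Expr.cost]
    omega
  · exact fun s' h => h.2.2.2.2.2

open OrthoPlus.Expr in
/-- Compare the nodes in `rX` and `rY`. -/
def cmp : Cmd :=
  .seq (.set rRes (cmpRules (reg rX) (reg rY))) <|
  .seq (.ite (cmpApp (reg rX) (reg rY))
    (.seq (.seq (.set rAll (const 1)) (.seq (.set rJ (const 0))
        (.ite (fst (reg rX))
          (.seq (.set rP (load aC (reg rX))) (.set rQ (load aC (reg rY))))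
          (.seq (.set rP (load aC (reg rY))) (.set rQ (load aC (reg rX)))))))
      (.seq cmpArgs (.set rRes (or (reg rRes) (reg rAll)))))
    .skip) <|
  .write aTab (add (load aBase (reg rX)) (reg rY)) (reg rRes)

/-- For the barred symbol the covariant and contravariant arguments are exchanged. Swapping the two
argument lists achieves the same, so one loop serves both signs. -/
theorem appLe_iff (p : Bool) (f : FunSym) (z w : Fin f.arity → NTerm) {F G : ℕ → Prop}
    (hF : ∀ a : Fin f.arity, F a ↔ if p then Le (z a) (w a) else Le (w a) (z a))
    (hG : ∀ a : Fin f.arity, G a ↔ if p then Le (w a) (z a) else Le (z a) (w a)) :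
    (∀ a < f.arity, (a < f.i + f.j → F a) ∧ (a < f.i ∨ f.i + f.j ≤ a → G a)) ↔
      AppLe p f z w := by
  have h : (∀ a < f.arity, (a < f.i + f.j → F a) ∧ (a < f.i ∨ f.i + f.j ≤ a → G a)) ↔
      ∀ a : Fin f.arity, ((f.variance a).Fwd true → F a) ∧ ((f.variance a).Fwd false → G a) := by
    simp only [FunSym.fwd_true_iff, FunSym.fwd_false_iff]
    exact ⟨fun h a => h a a.2, fun h a ha => h ⟨a, ha⟩⟩
  rw [h, AppLe]
  simp only [hF, hG]
  cases p
  · exact ⟨fun h => ⟨fun a => (h a).2, fun a => (h a).1⟩, fun h a => ⟨h.2 a, h.1 a⟩⟩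
  · exact ⟨fun h => ⟨fun a => (h a).1, fun a => (h a).2⟩, fun h a => ⟨h.1 a, h.2 a⟩⟩

theorem cmp_spec : ∃ C, ∀ (s : Config) (n x y : ℕ) (D : ℕ → NTerm), s.reg rX = x → s.reg rY = y →
    NodeOK s.mem n D x (D x) → NodeOK s.mem n D y (D y) →
    (∀ x', x' / 2 < x / 2 → Entry s.mem D x' y) → (∀ y', y' / 2 < y / 2 → Entry s.mem D x y') →
    (∀ x' y', x' / 2 < x / 2 → y' / 2 < y / 2 → Entry s.mem D x' y' ∧ Entry s.mem D y' x') →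
    Tri cmp s (C * (min (D x).arity (D y).arity + 1)) fun s' => ∃ r, (r ≠ 0 ↔ Le (D x) (D y)) ∧
      s'.mem aTab = Function.update (s.mem aTab) (s.mem aBase x + y) r := by
  obtain ⟨C, hC⟩ := cmpArgs_spec
  refine ⟨C + 2000, fun s n x y D hrx hry hx hy h₁ h₂ h₃ => ?_⟩
  refine Tri.step (C * (min (D x).arity (D y).arity + 1) + 1000) rfl ?_ ?_
  · set s₁ := (Cmd.set rRes (cmpRules (.reg rX) (.reg rY))).run s with hs₁
    have hr : s₁.reg rRes ≠ 0 ↔ _ := cmpRules_iff (s := s) (ex := .reg rX) (ey := .reg rY)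
      hrx hry hx hy h₁ h₂
    have hm : s₁.mem = s.mem := rfl
    have hrx₁ : s₁.reg rX = x := hrx
    have hry₁ : s₁.reg rY = y := hry
    clear_value s₁
    refine Tri.seqFrame 100 (R := fun s' => (s'.reg rRes ≠ 0 ↔ Le (D x) (D y)))
      (t₁ := C * (min (D x).arity (D y).arity + 1) + 900) ?_ ?_ ?_
    · refine (Tri.ite (t := C * (min (D x).arity (D y).arity + 1) + 400) ?_ ?_).mono ?_
        fun _ h => h
      · rw [cmpApp_iff (n := n) (D := D) (x := x) (y := y)
          (s := s₁) (ex := .reg rX) (ey := .reg rY) hrx₁ hry₁ (by rwa [hm]) (by rwa [hm])]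
        rintro ⟨p, f, z, w, hz, hw⟩
        have har : min (D x).arity (D y).arity = f.arity := by simp [hz, hw, NTerm.arity]
        rw [har]
        have hx' := hx
        have hy' := hy
        rw [hz, NodeOK] at hx'
        rw [hw, NodeOK] at hy'
        have e₁ : ∀ a : Fin f.arity, (s.mem aTab (s.mem aBase (s.mem aArg (s.mem aC x + a)) +
            s.mem aArg (s.mem aC y + a)) ≠ 0 ↔ Le (z a) (w a)) ∧
            (s.mem aTab (s.mem aBase (s.mem aArg (s.mem aC y + a)) +
            s.mem aArg (s.mem aC x + a)) ≠ 0 ↔ Le (w a) (z a)) := fun a => by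
          have hz := hx'.2.2.2.2 a
          have hw := hy'.2.2.2.2 a
          rw [← hz.2, ← hw.2]
          exact h₃ _ _ hz.1 hw.1
        have key : ∀ s₂ : Config, s₂.mem = s.mem → s₂.reg rX = x → s₂.reg rY = y →
            s₂.reg rRes = s₁.reg rRes → s₂.reg rAll = 1 → s₂.reg rJ = 0 →
            s₂.reg rP = (if p then s.mem aC x else s.mem aC y) →
            s₂.reg rQ = (if p then s.mem aC y else s.mem aC x) →
            Tri (.seq cmpArgs (.set rRes (.or (.reg rRes) (.reg rAll)))) s₂
              (C * (f.arity + 1) + 100) fun s' => (s'.reg rRes ≠ 0 ↔ Le (D x) (D y)) := by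
          intro s₂ k₁ k₂ k₃ k₄ k₅ k₆ k₇ k₈
          refine Tri.seqFrame 100 (hC s₂ f
            (fun a => s₂.mem aTab (s₂.mem aBase (s₂.mem aArg (s₂.reg rP + a)) +
              s₂.mem aArg (s₂.reg rQ + a)) ≠ 0)
            (fun a => s₂.mem aTab (s₂.mem aBase (s₂.mem aArg (s₂.reg rQ + a)) +
              s₂.mem aArg (s₂.reg rP + a)) ≠ 0) k₆ k₅ (by rw [k₁, k₂]; exact hx'.2.2.1)
            (fun _ _ => Iff.rfl) (fun _ _ => Iff.rfl)) ?_ le_rfl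
          intro s₃ h₄ hfr
          rw [appLe_iff p f z w (fun a => by rw [k₁, k₇, k₈]; cases p <;> simp [e₁ a])
            (fun a => by rw [k₁, k₇, k₈]; cases p <;> simp [e₁ a])] at h₄
          refine Tri.block rfl (by decide) ?_
          have : ((Cmd.set rRes (.or (.reg rRes) (.reg rAll))).run s₃).reg rRes ≠ 0 ↔
              s₃.reg rRes ≠ 0 ∨ s₃.reg rAll ≠ 0 := Expr.eval_or s₃ _ _
          rw [this, h₄, hfr.reg _ (by decide), k₄, hr, Le.iff_rules]
          -- The symbol and the arguments are determined by the two nodes, so the existential rule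
          -- becomes a statement about the arguments at hand.
          have : (∃ p' f' z' w', D x = .app p' f' z' ∧ D y = .app p' f' w' ∧ AppLe p' f' z' w') ↔
              AppLe p f z w := by
            refine ⟨?_, fun h => ⟨p, f, z, w, hz, hw, h⟩⟩
            rintro ⟨p', f', z', w', e, e', h⟩
            rw [hz] at e
            rw [hw] at e'
            cases e
            cases e'
            exact h
          rw [this]
          simp [hz, hw]
        refine Tri.step (C * (f.arity + 1) + 100) rfl ?_ (by
          simp [Cmd.cost, Expr.cost]
          omega)
        have ha := hx'.2.1
        refine key _ ?_ ?_ ?_ ?_ ?_ ?_ ?_ ?_ <;>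
          cases p <;> simp [Cmd.run, Expr.eval, hrx₁, hry₁, hm, ha]
      · intro h
        refine Tri.block rfl (by simp [Cmd.cost]) ?_
        have h' := mt (cmpApp_iff (n := n) (D := D) (x := x) (y := y)
          (s := s₁) (ex := .reg rX) (ey := .reg rY) hrx₁ hry₁
          (by rwa [hm]) (by rwa [hm])).2 (not_not.2 h)
        rw [Cmd.run, hr, Le.iff_rules]
        refine or_congr_right (or_congr_right (or_congr_right (or_congr_right (or_congr_right
          (or_congr_right ?_)))))
        refine (or_iff_left ?_).symm
        rintro ⟨p, f, z, w, hz, hw, -⟩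
        exact h' ⟨p, f, z, w, hz, hw⟩
      · simp [cmpApp, Expr.cost]
        omega
    · intro s₂ h₄ hfr
      refine Tri.block rfl (by decide) ⟨s₂.reg rRes, h₄, ?_⟩
      have hx₂ : s₂.reg rX = x := (hfr.reg _ (by decide)).trans hrx₁
      have hy₂ : s₂.reg rY = y := (hfr.reg _ (by decide)).trans hry₁
      have hb₂ : s₂.mem aBase = s.mem aBase := (hfr.mem _ (by decide)).trans (congrFun hm _)
      have ht₂ : s₂.mem aTab = s.mem aTab := (hfr.mem _ (by decide)).trans (congrFun hm _)
      simp [Cmd.run, Expr.eval, hx₂, hy₂, hb₂, ht₂]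
    · omega
  · simp [Cmd.cost, cmpRules, Expr.cost]
    rw [Nat.add_mul C]
    omega


/-! ### Rows of the table -/

theorem NodeOK.congr {m m' : ℕ → ℕ → ℕ} {n n' x : ℕ} {D D' : ℕ → NTerm} {t : NTerm}
    (h : NodeOK m n D x t) (hm : ∀ a ∈ [aK, aA, aB, aC], m' a x = m a x) (hi : m' aIn = m aIn)
    (ha : ∀ j < n, m' aArg j = m aArg j) (hn : n ≤ n') (hD : ∀ y, y / 2 < x / 2 → D' y = D y) :
    NodeOK m' n' D' x t := by
  simp only [List.forall_mem_cons, List.not_mem_nil, false_imp_iff, implies_true, and_true] at hm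
  obtain ⟨h₁, h₂, h₃, h₄⟩ := hm
  have hc : ∀ {y t}, Child D x y t → Child D' x y t := fun h => ⟨h.1, (hD _ h.1).trans h.2⟩
  cases t with
  | app b f z =>
    simp only [NodeOK, h₁, h₂, h₃, h₄, hi] at h ⊢
    refine ⟨h.1, h.2.1, h.2.2.1, h.2.2.2.1.trans hn, fun a => ?_⟩
    rw [ha _ (by omega)]
    exact hc (h.2.2.2.2 a)
  | meet a b =>
    simp only [NodeOK, h₁, h₂, h₃] at h ⊢
    exact ⟨h.1, hc h.2.1, hc h.2.2⟩
  | join a b =>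
    simp only [NodeOK, h₁, h₂, h₃] at h ⊢
    exact ⟨h.1, hc h.2.1, hc h.2.2⟩
  | _ => simpa only [NodeOK, h₁, h₂, h₃] using h

/-- The arrays hold the nodes with numbers less than `N`, and the comparisons of the pairs in `S`,
in a table of width `W`. -/
structure Table (m : ℕ → ℕ → ℕ) (n : ℕ) (D : ℕ → NTerm) (W N : ℕ) (S : ℕ → ℕ → Prop) : Prop where
  node : ∀ x < N, NodeOK m n D x (D x)
  base : ∀ x ≤ W, m aBase x = x * W
  entry : ∀ x y, x < N → y < N → S x y → Entry m D x y

theorem Table.mono {m : ℕ → ℕ → ℕ} {n W N : ℕ} {D : ℕ → NTerm} {S S' : ℕ → ℕ → Prop}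
    (h : Table m n D W N S) (hS : ∀ x y, x < N → y < N → S' x y → S x y) : Table m n D W N S' :=
  ⟨h.node, h.base, fun x y hx hy hxy => h.entry x y hx hy (hS x y hx hy hxy)⟩

/-- The smaller of the two arities bounds the time. Hence comparing one node with all others costs
no more than its own arity permits, however large the other arities are. -/
theorem cmp_table : ∃ C, ∀ (s : Config) (n x y W N : ℕ) (D : ℕ → NTerm) (S : ℕ → ℕ → Prop),
    s.reg rX = x → s.reg rY = y → x < N → y < N → N ≤ W → Table s.mem n D W N S → N % 2 = 0 →
    (∀ x', x' / 2 < x / 2 → S x' y) → (∀ y', y' / 2 < y / 2 → S x y') →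
    (∀ x' y', x' / 2 < x / 2 → y' / 2 < y / 2 → S x' y' ∧ S y' x') →
    Tri cmp s (C * (min (D x).arity (D y).arity + 1)) fun s' =>
      Table s'.mem n D W N fun x' y' => S x' y' ∨ x' = x ∧ y' = y := by
  obtain ⟨C, hC⟩ := cmp_spec
  refine ⟨C, fun s n x y W N D S hrx hry hx hy hN hT hp h₁ h₂ h₃ => ?_⟩
  refine (hC s n x y D hrx hry (hT.node x hx) (hT.node y hy)
    (fun x' h => hT.entry _ _ (by omega) hy (h₁ x' h))
    (fun y' h => hT.entry _ _ hx (by omega) (h₂ y' h))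
    fun x' y' h h' => ⟨hT.entry _ _ (by omega) (by omega) (h₃ x' y' h h').1,
      hT.entry _ _ (by omega) (by omega) (h₃ x' y' h h').2⟩).frame.mono le_rfl ?_
  rintro s' ⟨⟨r, hr, ht⟩, hf⟩
  have hm : ∀ a ∉ [aTab], s'.mem a = s.mem a := fun a ha => hf.mem a fun h => ha (by
    simpa [cmp, cmpArgs, Cmd.arrs] using h)
  refine ⟨fun x' h => (hT.node x' h).congr (fun a ha => ?_) (hm _ (by decide))
    (fun j _ => by rw [hm _ (by decide)]) le_rfl fun _ _ => rfl, fun x' h => ?_,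
    fun x' y' hx' hy' h => ?_⟩
  · rw [hm a fun h => ?_]
    rw [List.mem_singleton] at h
    subst h
    revert ha
    decide
  · rw [hm _ (by decide), hT.base x' h]
  · rw [Entry, hm aBase (by decide), ht, hT.base x' (by omega), hT.base x (by omega)]
    by_cases he : x' = x ∧ y' = y
    · rw [he.1, he.2, Function.update_self, hr]
    · rw [Function.update_of_ne]
      · have := hT.entry x' y' hx' hy' (h.resolve_right he)
        rwa [Entry, hT.base x' (by omega)] at this
      · intro h
        -- Different pairs have different cells, since division by `W` with remainder recovers the
        -- pair from `x * W + y` for `y < W`.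
        have e₁ : (x' * W + y') / W = (x * W + y) / W := by rw [h]
        have e₂ : (x' * W + y') % W = (x * W + y) % W := by rw [h]
        have hW : 0 < W := by omega
        rw [Nat.add_div_of_dvd_right (Dvd.intro_left _ rfl),
          Nat.add_div_of_dvd_right (Dvd.intro_left _ rfl), Nat.mul_div_cancel _ hW,
          Nat.mul_div_cancel _ hW, Nat.div_eq_of_lt (by omega), Nat.div_eq_of_lt (by omega)] at e₁
        rw [Nat.mul_add_mod_self_right, Nat.mul_add_mod_self_right, Nat.mod_eq_of_lt (by omega),
          Nat.mod_eq_of_lt (by omega)] at e₂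
        exact he ⟨e₁, e₂⟩

/-- Compare the nodes `rRow` and `rRow + 1` with all nodes up to these, in both directions. -/
def row : Cmd :=
  .seq (.set rOff (.const 0)) <|
  .upTo rOff (.add (.reg rRow) (.const 2)) <|
    .seq (.seq (.set rX (.reg rRow)) (.set rY (.reg rOff))) <| .seq cmp <|
    .seq (.set rX (.add (.reg rRow) (.const 1))) <| .seq cmp <|
    .seq (.seq (.set rX (.reg rOff)) (.set rY (.reg rRow))) <| .seq cmp <|
    .seq (.set rY (.add (.reg rRow) (.const 1))) cmp

-- A new pair of nodes is compared with all pairs up to itself in time proportional to its arity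
-- plus one, times the number of pairs.
set_option maxHeartbeats 1000000 in
theorem row_spec : ∃ C, ∀ (s : Config) (n i a W : ℕ) (D : ℕ → NTerm), s.reg rRow = 2 * i →
    2 * i + 2 ≤ W → (D (2 * i)).arity ≤ a → (D (2 * i + 1)).arity ≤ a →
    Table s.mem n D W (2 * i + 2) (fun x y => x < 2 * i ∧ y < 2 * i) →
    Tri row s (C * ((a + 1) * (i + 1))) fun s' =>
      Table s'.mem n D W (2 * i + 2) fun _ _ => True := by
  obtain ⟨C, hC⟩ := cmp_table
  -- Four comparisons in each of `2 * (i + 1)` rounds.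
  refine ⟨8 * C + 400, fun s n i a W D hr hW ha₀ ha₁ hT => ?_⟩
  have cmp' : ∀ (s : Config) (x y : ℕ) (S : ℕ → ℕ → Prop), s.reg rX = x → s.reg rY = y →
      x < 2 * i + 2 → y < 2 * i + 2 → 2 * i ≤ x ∨ 2 * i ≤ y → Table s.mem n D W (2 * i + 2) S →
      (∀ x', x' / 2 < x / 2 → S x' y) → (∀ y', y' / 2 < y / 2 → S x y') →
      (∀ x' y', x' / 2 < x / 2 → y' / 2 < y / 2 → S x' y' ∧ S y' x') →
      Tri cmp s (C * (a + 1)) fun s' =>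
        Table s'.mem n D W (2 * i + 2) fun x' y' => S x' y' ∨ x' = x ∧ y' = y := by
    intro s x y S hx hy hx' hy' hxy h h₁ h₂ h₃
    refine (hC s n x y W (2 * i + 2) D S hx hy hx' hy' hW h (by omega) h₁ h₂ h₃).mono
      (Nat.mul_le_mul_left _ (Nat.succ_le_succ ?_)) fun _ h => h
    rcases hxy with h | h
    · refine (min_le_left _ _).trans ?_
      obtain rfl | rfl : x = 2 * i ∨ x = 2 * i + 1 := by omega
      exacts [ha₀, ha₁]
    · refine (min_le_right _ _).trans ?_
      obtain rfl | rfl : y = 2 * i ∨ y = 2 * i + 1 := by omega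
      exacts [ha₀, ha₁]
  refine Tri.step ((2 * i + 2) * (4 * (C * (a + 1)) + 60 + 20) + 20) rfl ?_ ?_
  -- After `w` rounds all pairs of a new node with a node less than `w` are known, in both
  -- directions. A comparison in round `w` needs only pairs of old nodes and pairs from earlier
  -- rounds, even when `w` is one of the new nodes.
  · refine (Tri.upTo_const (n := 2 * i + 2) (t := 4 * (C * (a + 1)) + 60)
      (I := fun w s' => s'.reg rOff = w ∧ s'.reg rRow = 2 * i ∧
        Table s'.mem n D W (2 * i + 2) fun x y =>
          x < 2 * i ∧ y < 2 * i ∨ 2 * i ≤ x ∧ y < w ∨ 2 * i ≤ y ∧ x < w) ?_ ?_ ?_ ?_).mono ?_ ?_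
    · exact fun w s h => h.1
    · exact fun w s h => by simp [Expr.eval, h.2.1]
    · rintro w s' hw ⟨h₁, h₂, h₃⟩
      refine Tri.step (4 * (C * (a + 1)) + 40) rfl ?_ (by simp [Cmd.cost, Expr.cost]; omega)
      refine Tri.seqFrame (3 * (C * (a + 1)) + 40) (cmp' _ (2 * i) w _ (by simp [Cmd.run, Expr.eval, h₂])
        (by simp [Cmd.run, Expr.eval, h₁]) (by omega) hw (by omega)
        (by simpa [Cmd.run] using h₃) ?_ ?_ ?_) ?_ (by omega)
      · intro x' h; omega
      · intro x' h; omega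
      · intro x' y' h; omega
      intro s₁ h₄ hf
      have e₁ : s₁.reg rOff = w := by rw [hf.reg _ (by decide)]; simp [Cmd.run, Expr.eval, h₁]
      have e₂ : s₁.reg rRow = 2 * i := by rw [hf.reg _ (by decide)]; simp [Cmd.run, Expr.eval, h₂]
      have e₃ : s₁.reg rY = w := by rw [hf.reg _ (by decide)]; simp [Cmd.run, Expr.eval, h₁]
      clear hf
      refine Tri.step (3 * (C * (a + 1)) + 30) rfl ?_ (by simp [Cmd.cost, Expr.cost]; omega)
      refine Tri.seqFrame (2 * (C * (a + 1)) + 30) (cmp' _ (2 * i + 1) w _ (by simp [Cmd.run, Expr.eval, e₂])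
        (by simp [Cmd.run, e₃]) (by omega) hw (by omega)
        (by simpa [Cmd.run] using h₄) ?_ ?_ ?_) ?_ (by omega)
      · intro x' h; omega
      · intro x' h; omega
      · intro x' y' h; omega
      intro s₂ h₅ hf
      have e₄ : s₂.reg rOff = w := by rw [hf.reg _ (by decide)]; simp [Cmd.run, e₁]
      have e₅ : s₂.reg rRow = 2 * i := by rw [hf.reg _ (by decide)]; simp [Cmd.run, e₂]
      clear hf
      refine Tri.step (2 * (C * (a + 1)) + 15) rfl ?_ (by simp [Cmd.cost, Expr.cost]; omega)
      refine Tri.seqFrame (C * (a + 1) + 15) (cmp' _ w (2 * i) _ (by simp [Cmd.run, Expr.eval, e₄])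
        (by simp [Cmd.run, Expr.eval, e₅]) hw (by omega) (by omega)
        (by simpa [Cmd.run] using h₅) ?_ ?_ ?_) ?_ (by omega)
      · intro x' h; omega
      · intro x' h; omega
      · intro x' y' h; omega
      intro s₃ h₆ hf
      have e₆ : s₃.reg rOff = w := by rw [hf.reg _ (by decide)]; simp [Cmd.run, e₄]
      have e₇ : s₃.reg rRow = 2 * i := by rw [hf.reg _ (by decide)]; simp [Cmd.run, e₅]
      have e₈ : s₃.reg rX = w := by rw [hf.reg _ (by decide)]; simp [Cmd.run, Expr.eval, e₄]
      clear hf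
      refine Tri.step (C * (a + 1)) rfl ?_ (by simp [Cmd.cost, Expr.cost]; omega)
      refine (cmp' _ w (2 * i + 1) _ (by simp [Cmd.run, e₈])
        (by simp [Cmd.run, Expr.eval, e₇]) hw (by omega) (by omega)
        (by simpa [Cmd.run] using h₆) ?_ ?_ ?_).frame.mono le_rfl ?_
      · intro x' h; omega
      · intro x' h; omega
      · intro x' y' h; omega
      rintro s₄ ⟨h₇, hf⟩
      have e₉ : s₄.reg rOff = w := by rw [hf.reg _ (by decide)]; simp [Cmd.run, e₆]
      have e₁₀ : s₄.reg rRow = 2 * i := by rw [hf.reg _ (by decide)]; simp [Cmd.run, e₇]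
      refine ⟨e₉, by simp, by simpa using e₁₀, ?_⟩
      simp only [Config.mem_setReg]
      exact h₇.mono fun x y hx hy h => by omega
    · exact ⟨by simp [Cmd.run, Expr.eval], by simpa [Cmd.run] using hr,
        by simpa [Cmd.run] using hT⟩
    · simp only [Cmd.upToCost, Expr.cost]
      gcongr <;> omega
    · exact fun s' h => h.2.2.mono fun x y hx hy _ => by omega
  · simp [Cmd.cost, Expr.cost]
    have h₁ : i + 1 ≤ (a + 1) * (i + 1) := Nat.le_mul_of_pos_left _ (by omega)
    have h₂ : (2 * i + 2) * (4 * (C * (a + 1)) + 60 + 20) =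
      8 * C * ((a + 1) * (i + 1)) + 160 * (i + 1) := by ring
    rw [h₂, Nat.add_mul (8 * C)]
    omega


/-! ### Processing the nodes of the input from right to left -/

open Classical in
/-- A conjunction that contains complementary parts is replaced by `⊥`. -/
noncomputable def NTerm.fix : NTerm → NTerm
  | .meet a b => if Le (.meet a b) a.neg ∨ Le (.meet a b) b.neg then .bot else .meet a b
  | t => t

theorem beta_meet_eq_fix (s t : NTerm) : beta (.meet s t) = (NTerm.meet (beta s) (beta t)).fix := by
  classical
  rw [beta, NTerm.fix]
  exact if_congr (by simp only [delta_neg_toTerm, ble_iff]) rfl rfl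

/-- A join is built as the dual of a meet of duals, so complementary parts have to be looked for in
meets only. -/
theorem beta_join_eq_fix (s t : NTerm) :
    beta (.join s t) = (NTerm.meet (beta s).neg (beta t).neg).fix.neg := by
  have h := beta_meet_eq_fix s.neg t.neg
  rw [beta_neg, beta_neg] at h
  rw [← h, ← beta_neg]
  simp [NTerm.neg]

/-- One node of the input changes the stack of terms. -/
inductive Step : Tok → List NTerm → List NTerm → Prop
  | var (x : ℕ) (σ : List NTerm) : Step (.var x) σ (.lit true x :: σ)
  | bot (σ : List NTerm) : Step .bot σ (.bot :: σ)
  | top (σ : List NTerm) : Step .top σ (.top :: σ)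
  | neg (t : NTerm) (σ : List NTerm) : Step .neg (t :: σ) (t.neg :: σ)
  | meet (a b : NTerm) (σ : List NTerm) : Step .meet (a :: b :: σ) ((NTerm.meet a b).fix :: σ)
  | join (a b : NTerm) (σ : List NTerm) :
      Step .join (a :: b :: σ) ((NTerm.meet a.neg b.neg).fix.neg :: σ)
  | app (f : FunSym) (x : Fin f.arity → NTerm) (σ : List NTerm) :
      Step (.app f) (List.ofFn x ++ σ) (.app true f x :: σ)

/-- The nodes of a list, processed from right to left, change the stack of terms. -/
def Steps : List Tok → List NTerm → List NTerm → Prop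
  | [], σ, σ' => σ = σ'
  | a :: l, σ, σ' => ∃ τ, Steps l σ τ ∧ Step a τ σ'

theorem steps_append {l l' : List Tok} {σ σ' : List NTerm} :
    Steps (l ++ l') σ σ' ↔ ∃ τ, Steps l' σ τ ∧ Steps l τ σ' := by
  induction l generalizing σ' with
  | nil => simp [Steps]
  | cons a l ih =>
    simp only [List.cons_append, Steps, ih]
    exact ⟨fun ⟨τ, ⟨ρ, h₁, h₂⟩, h₃⟩ => ⟨ρ, h₁, τ, h₂, h₃⟩,
      fun ⟨ρ, h₁, τ, h₂, h₃⟩ => ⟨τ, ⟨ρ, h₁, h₂⟩, h₃⟩⟩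

/-- Reading prefix notation from right to left makes every operator find its evaluated arguments on
top of the stack, the first one uppermost. A negation merely passes to the dual and creates no node.
-/
theorem steps_toks (t : Term) (σ : List NTerm) : Steps t.toks σ (beta (delta t) :: σ) := by
  induction t generalizing σ with
  | var x => exact ⟨σ, rfl, by simpa [delta, deltaAux, beta] using .var x σ⟩
  | bot => exact ⟨σ, rfl, by simpa [delta, deltaAux, beta] using .bot σ⟩
  | top => exact ⟨σ, rfl, by simpa [delta, deltaAux, beta] using .top σ⟩
  | neg t ih =>
    refine ⟨_, ih σ, ?_⟩
    have h : beta (delta (.neg t)) = (beta (delta t)).neg := by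
      rw [← beta_neg, delta, delta, ← deltaAux_neg]
      rfl
    rw [h]
    exact .neg _ _
  | meet s t hs ht =>
    refine ⟨_, steps_append.2 ⟨_, ht σ, hs _⟩, ?_⟩
    have h : beta (delta (.meet s t)) = (NTerm.meet (beta (delta s)) (beta (delta t))).fix := by
      rw [← beta_meet_eq_fix]
      rfl
    rw [h]
    exact .meet _ _ _
  | join s t hs ht =>
    refine ⟨_, steps_append.2 ⟨_, ht σ, hs _⟩, ?_⟩
    have h : beta (delta (.join s t)) =
        (NTerm.meet (beta (delta s)).neg (beta (delta t)).neg).fix.neg := by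
      rw [← beta_join_eq_fix]
      rfl
    rw [h]
    exact .join _ _ _
  | app f x ih =>
    have key : ∀ (l : List Term) (σ : List NTerm),
        (∀ u ∈ l, ∀ σ, Steps u.toks σ (beta (delta u) :: σ)) →
        Steps (l.map Term.toks).flatten σ (l.map (fun u => beta (delta u)) ++ σ) := by
      intro l
      induction l with
      | nil => exact fun σ _ => rfl
      | cons u l ih =>
        intro σ h
        rw [List.forall_mem_cons] at h
        simp only [List.map_cons, List.flatten_cons, List.cons_append]
        exact steps_append.2 ⟨_, ih σ h.2, h.1 _⟩
    have h := key (List.ofFn x) σ (by simpa [List.forall_mem_ofFn_iff] using ih)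
    rw [List.map_ofFn, List.map_ofFn] at h
    refine ⟨_, h, ?_⟩
    have h : beta (delta (.app f x)) = .app true f fun a => beta (delta (x a)) := by
      simp [delta, deltaAux, beta]
    rw [h]
    exact .app _ _ _

/-! ### The stack of node numbers, and pairs of dual nodes. -/

/-- The `p` lowest cells of the array `m` hold the numbers of the nodes on the stack, all less than
`M`. -/
def Stack (m : ℕ → ℕ) (D : ℕ → NTerm) (M : ℕ) : ℕ → List NTerm → Prop
  | p, [] => p = 0
  | p, t :: σ => ∃ p', p = p' + 1 ∧ (m p' < M ∧ D (m p') = t) ∧ Stack m D M p' σ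

namespace Stack

variable {m m' : ℕ → ℕ} {D D' : ℕ → NTerm} {M M' p : ℕ} {l σ : List NTerm}

theorem congr (h : Stack m D M p σ) (hm : ∀ j < p, m' j = m j) (hM : M ≤ M')
    (hD : ∀ x < M, D' x = D x) : Stack m' D' M' p σ := by
  induction σ generalizing p with
  | nil => exact h
  | cons t σ ih =>
    obtain ⟨p, rfl, ⟨h₁, h₂⟩, h₃⟩ := h
    have hp := hm p (by omega)
    exact ⟨p, rfl, ⟨hp ▸ h₁.trans_le hM, by rw [hp, hD _ h₁, h₂]⟩,
      ih h₃ fun j hj => hm j (by omega)⟩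

/-- The list begins at the top of the stack while the array grows upwards, hence the index `p - 1 -
j`. -/
theorem append (h : Stack m D M p (l ++ σ)) : ∃ p', p = p' + l.length ∧ Stack m D M p' σ ∧
    ∀ (j : ℕ) (hj : j < l.length), m (p - 1 - j) < M ∧ D (m (p - 1 - j)) = l[j] := by
  induction l generalizing p with
  | nil => exact ⟨p, rfl, h, by simp⟩
  | cons t l ih =>
    obtain ⟨p, rfl, h₁, h₂⟩ := h
    obtain ⟨p', h₃, h₄, h₅⟩ := ih h₂
    refine ⟨p', by rw [List.length_cons]; omega, h₄, fun j hj => ?_⟩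
    cases j with
    | zero => simpa using h₁
    | succ j =>
      rw [List.length_cons] at hj
      have := h₅ j (by omega)
      rwa [show p - 1 - j = p + 1 - 1 - (j + 1) by omega] at this

end Stack


/-- A further pair of nodes. -/
noncomputable def extend (D : ℕ → NTerm) (N : ℕ) (t : NTerm) : ℕ → NTerm :=
  fun x => if x = 2 * N then t else if x = 2 * N + 1 then t.neg else D x

section

variable (D : ℕ → NTerm) (N : ℕ) (t : NTerm)

theorem extend_even : extend D N t (2 * N) = t := if_pos rfl

theorem extend_odd : extend D N t (2 * N + 1) = t.neg := by
  rw [extend, if_neg (by omega), if_pos rfl]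

theorem extend_of_lt {x : ℕ} (hx : x < 2 * N) : extend D N t x = D x := by
  rw [extend, if_neg (by omega), if_neg (by omega)]

end

/-- The array `aNeg` holds the number of the dual of each node. -/
def NegOK (m : ℕ → ℕ → ℕ) (D : ℕ → NTerm) (M : ℕ) : Prop :=
  ∀ x < M, m aNeg x / 2 = x / 2 ∧ D (m aNeg x) = (D x).neg

/-- The memory holds `N` pairs of nodes, all comparisons between them, and the stack `σ`. -/
structure Store (s : Config) (D : ℕ → NTerm) (L N : ℕ) (σ : List NTerm) : Prop where
  nodes : s.reg rNodes = 2 * N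
  table : Table s.mem (s.reg rArg) D (2 * L) (2 * N) fun _ _ => True
  neg : NegOK s.mem D (2 * N)
  stack : Stack (s.mem aStack) D (2 * N) (s.reg rSp) σ

/-- The memory holds `N` pairs of nodes, all comparisons between them, and the new pair of the node
`t`, such that the stack is `σ` when `t` is replaced by `t.fix`. -/
structure Pending (s : Config) (D : ℕ → NTerm) (L N : ℕ) (t : NTerm) (σ : List NTerm) : Prop where
  nodes : s.reg rNodes = 2 * N
  row : s.reg rRow = 2 * N
  table : Table s.mem (s.reg rArg) (extend D N t) (2 * L) (2 * N + 2)
    fun x y => x < 2 * N ∧ y < 2 * N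
  neg : NegOK s.mem (extend D N t.fix) (2 * N + 2)
  stack : Stack (s.mem aStack) (extend D N t.fix) (2 * N + 2) (s.reg rSp) σ

/-- What the commands that create nodes have in common. The offset `b` tells which of the two new
numbers is put on the stack, the term or its dual. -/
theorem Store.pending {s s' : Config} {D : ℕ → NTerm} {L N : ℕ} {σ τ : List NTerm} {p b : ℕ}
    (t u : NTerm) (h : Store s D L N σ)
    (hn : s'.reg rNodes = 2 * N) (hr : s'.reg rRow = 2 * N)
    (hin : ∀ a ∈ [aIn, aBase, aTab], s'.mem a = s.mem a)
    (hm : ∀ a ∈ [aK, aA, aB, aC, aNeg], ∀ x < 2 * N, s'.mem a x = s.mem a x)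
    (h₀ : s'.mem aNeg (2 * N) = 2 * N + 1) (h₁ : s'.mem aNeg (2 * N + 1) = 2 * N)
    (ha : ∀ j < s.reg rArg, s'.mem aArg j = s.mem aArg j) (ha' : s.reg rArg ≤ s'.reg rArg)
    (k₀ : NodeOK s'.mem (s'.reg rArg) (extend D N t) (2 * N) t)
    (k₁ : NodeOK s'.mem (s'.reg rArg) (extend D N t) (2 * N + 1) t.neg)
    (hp : s'.reg rSp = p + 1) (hb : s'.mem aStack p = 2 * N + b)
    (hu : b = 0 ∧ u = t.fix ∨ b = 1 ∧ u = t.fix.neg) (hs : Stack (s'.mem aStack) D (2 * N) p τ) :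
    Pending s' D L N t (u :: τ) := by
  have hlt := fun t x hx => extend_of_lt D N t (x := x) hx
  refine ⟨hn, hr, ⟨fun x hx => ?_, fun x hx => ?_, fun x y hx hy hxy => ?_⟩, fun x hx => ?_,
    ⟨p, hp, ?_, hs.congr (fun _ _ => rfl) (by omega) (hlt _)⟩⟩
  · obtain hx | rfl | rfl : x < 2 * N ∨ x = 2 * N ∨ x = 2 * N + 1 := by omega
    · rw [hlt _ _ hx]
      refine (h.table.node x hx).congr (fun a ha => hm a ?_ x hx) (hin _ (by decide)) ha ha'
        fun y hy => hlt _ _ (by omega)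
      revert ha
      simp only [List.mem_cons, List.not_mem_nil]
      tauto
    · rwa [extend_even]
    · rwa [extend_odd]
  · rw [hin _ (by decide), h.table.base x hx]
  · have := h.table.entry x y hxy.1 hxy.2 trivial
    rwa [Entry, hin aTab (by decide), hin aBase (by decide), hlt _ _ hxy.1, hlt _ _ hxy.2]
  · obtain hx | rfl | rfl : x < 2 * N ∨ x = 2 * N ∨ x = 2 * N + 1 := by omega
    · have := h.neg x hx
      rw [hm _ (by decide) x hx, hlt _ _ hx, hlt _ _ (by omega)]
      exact this
    · rw [h₀, extend_even, extend_odd]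
      exact ⟨by omega, rfl⟩
    · rw [h₁, extend_even, extend_odd, NTerm.neg_neg]
      exact ⟨by omega, rfl⟩
  · rw [hb]
    rcases hu with ⟨rfl, rfl⟩ | ⟨rfl, rfl⟩
    · exact ⟨by omega, extend_even _ _ _⟩
    · exact ⟨by omega, extend_odd _ _ _⟩

/-! ### Creating a pair of nodes. -/

open OrthoPlus.Expr in
/-- The numbers of the new pair of nodes. -/
def newNeg : Cmd :=
  .seq (.write aNeg (reg rRow) (add (reg rRow) (const 1)))
    (.write aNeg (add (reg rRow) (const 1)) (reg rRow))

open OrthoPlus.Expr in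
/-- Put a number on the stack. -/
def push (e : Expr) : Cmd := .seq (.write aStack (reg rSp) e) (.incr rSp)

open OrthoPlus.Expr in
/-- New nodes for a variable. -/
def newVar : Cmd :=
  .seq (.write aK (reg rRow) (const 0)) <|
  .seq (.write aA (reg rRow) (const 1)) <|
  .seq (.write aB (reg rRow) (load aIn (add (reg rPos) (const 1)))) <|
  .seq (.write aK (add (reg rRow) (const 1)) (const 0)) <|
  .seq (.write aA (add (reg rRow) (const 1)) (const 0)) <|
  .seq (.write aB (add (reg rRow) (const 1)) (load aIn (add (reg rPos) (const 1)))) <|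
  .seq newNeg (push (reg rRow))

open OrthoPlus.Expr in
/-- New nodes for `⊥` or `⊤`. -/
def newConst : Cmd :=
  .seq (.write aK (reg rRow) (const 1)) <|
  .seq (.write aK (add (reg rRow) (const 1)) (const 2)) <|
  .seq newNeg (push (add (reg rRow) (sub (load aIn (reg rPos)) (const 1))))

open OrthoPlus.Expr in
/-- New nodes for a conjunction or a disjunction. -/
def newOp : Cmd :=
  .seq (.set rS (load aStack (sub (reg rSp) (const 1)))) <|
  .seq (.set rT (load aStack (sub (reg rSp) (const 2)))) <|
  .seq (.ite (eq (load aIn (reg rPos)) (const 5))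
    (.seq (.set rS (load aNeg (reg rS))) (.set rT (load aNeg (reg rT)))) .skip) <|
  .seq (.write aK (reg rRow) (const 4)) <|
  .seq (.write aA (reg rRow) (reg rS)) <|
  .seq (.write aB (reg rRow) (reg rT)) <|
  .seq (.write aK (add (reg rRow) (const 1)) (const 5)) <|
  .seq (.write aA (add (reg rRow) (const 1)) (load aNeg (reg rS))) <|
  .seq (.write aB (add (reg rRow) (const 1)) (load aNeg (reg rT))) <|
  .seq newNeg <|
  .seq (.set rSp (sub (reg rSp) (const 2)))
    (push (add (reg rRow) (sub (load aIn (reg rPos)) (const 4))))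

open OrthoPlus.Expr in
/-- New nodes for an application of a function symbol. -/
def newApp : Cmd :=
  .seq (.seq (.write aK (reg rRow) (const 6)) <|
    .seq (.write aA (reg rRow) (const 1)) <|
    .seq (.write aB (reg rRow) (reg rPos)) <|
    .seq (.write aC (reg rRow) (reg rArg)) <|
    .seq (.write aK (add (reg rRow) (const 1)) (const 6)) <|
    .seq (.write aA (add (reg rRow) (const 1)) (const 0)) <|
    .seq (.write aB (add (reg rRow) (const 1)) (reg rPos)) <|
    .seq (.write aC (add (reg rRow) (const 1)) (reg rArg)) <|
    .seq newNeg (.set rI (const 0))) <|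
  .seq (.upTo rI (add (load aIn (add (reg rPos) (const 2)))
      (add (load aIn (add (reg rPos) (const 3))) (load aIn (add (reg rPos) (const 4))))) <|
    .write aArg (add (reg rArg) (reg rI))
      (load aStack (sub (sub (reg rSp) (const 1)) (reg rI)))) <|
  .seq (.set rSp (sub (reg rSp) (reg rI))) <|
  .seq (.set rArg (add (reg rArg) (reg rI))) (push (reg rRow))

section

variable {s : Config} {D : ℕ → NTerm} {L N : ℕ} {σ : List NTerm}

theorem newVar_pending (h : Store s D L N σ) (hr : s.reg rRow = 2 * N) {x : ℕ}
    (hx : Holds (s.mem aIn) (s.reg rPos) (Tok.var x).encode) :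
    Pending (newVar.run s) D L N (.lit true x) (.lit true x :: σ) := by
  have hn := h.nodes
  have hx' : s.mem aIn (s.reg rPos + 1) = x := hx 1 (by simp [Tok.encode])
  refine h.pending (p := s.reg rSp) (b := 0) (.lit true x) (.lit true x) ?_ ?_ ?_ ?_ ?_ ?_ ?_ ?_ ?_ ?_ ?_ ?_
    (.inl ⟨rfl, rfl⟩) (h.stack.congr ?_ le_rfl fun _ _ => rfl)
  all_goals simp [newVar, newNeg, push, Cmd.run, Expr.eval, hr, hn, hx', NodeOK, NTerm.neg,
    Function.update_apply]
  all_goals grind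

/-- Both constants create the same pair `⊥`, `⊤`; the code of the constant minus `1` selects the
member that goes on the stack. -/
theorem newConst_pending (h : Store s D L N σ) (hr : s.reg rRow = 2 * N) {b : Bool}
    (hx : s.mem aIn (s.reg rPos) = b.toNat + 1) :
    Pending (newConst.run s) D L N .bot ((if b then .top else .bot) :: σ) := by
  have hn := h.nodes
  refine h.pending (p := s.reg rSp) (b := b.toNat) .bot _ ?_ ?_ ?_ ?_ ?_ ?_ ?_ ?_ ?_ ?_ ?_ ?_
    (by cases b <;> simp [NTerm.fix, NTerm.neg]) (h.stack.congr ?_ le_rfl fun _ _ => rfl)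
  all_goals simp [newConst, newNeg, push, Cmd.run, Expr.eval, hr, hn, hx, NodeOK, NTerm.neg,
    Function.update_apply]
  all_goals grind

end


section

variable {s : Config} {D : ℕ → NTerm} {L N : ℕ} {σ : List NTerm}

/-- The new even number is always a meet. For a join its components `x`, `y` are the duals of the
two terms on the stack, and the odd number of the pair is pushed. -/
theorem newOp_pending_aux {u w : NTerm} (h : Store s D L N (u :: w :: σ))
    (hr : s.reg rRow = 2 * N) {b : ℕ} (hb : b < 2) {x y : ℕ} {t v : NTerm}
    (hx : s.mem aIn (s.reg rPos) = 4 + b) {p : ℕ} (hp : s.reg rSp = p + 2)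
    (hx₁ : x = if b = 0 then s.mem aStack (p + 1) else s.mem aNeg (s.mem aStack (p + 1)))
    (hy₁ : y = if b = 0 then s.mem aStack p else s.mem aNeg (s.mem aStack p))
    (hx₂ : x < 2 * N) (hy₂ : y < 2 * N) (hx₃ : D x = t) (hy₃ : D y = v)
    (hσ : Stack (s.mem aStack) D (2 * N) p σ) :
    Pending (newOp.run s) D L N (.meet t v)
      ((if b = 0 then (NTerm.meet t v).fix else (NTerm.meet t v).fix.neg) :: σ) := by
  have hn := h.nodes
  have hx₄ := h.neg x hx₂
  have hy₄ := h.neg y hy₂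
  have ex₁ : extend D N (.meet t v) x = t := by rw [extend_of_lt _ _ _ hx₂, hx₃]
  have ey₁ : extend D N (.meet t v) y = v := by rw [extend_of_lt _ _ _ hy₂, hy₃]
  have ex₂ : extend D N (.meet t v) (s.mem aNeg x) = t.neg := by
    rw [extend_of_lt _ _ _ (by omega), hx₄.2, hx₃]
  have ey₂ : extend D N (.meet t v) (s.mem aNeg y) = v.neg := by
    rw [extend_of_lt _ _ _ (by omega), hy₄.2, hy₃]
  have hK : (2 * N + 1) / 2 = N := by omega
  refine h.pending (p := p) (b := b) (.meet t v) _ ?_ ?_ ?_ ?_ ?_ ?_ ?_ ?_ ?_ ?_ ?_ ?_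
    (by obtain rfl | rfl : b = 0 ∨ b = 1 := by omega
        · simp
        · simp) (hσ.congr ?_ le_rfl fun _ _ => rfl)
  all_goals
    obtain rfl | rfl : b = 0 ∨ b = 1 := by omega
    all_goals
      simp only [↓reduceIte, one_ne_zero] at hx₁ hy₁
      simp [newOp, newNeg, push, Cmd.run, Expr.eval, hr, hn, hx, hp, NodeOK, NTerm.neg,
        Function.update_apply, Child, ← hx₁, ← hy₁, ex₁, ey₁, ex₂, ey₂, hK]
      try grind

theorem newOp_pending {u w : NTerm} (h : Store s D L N (u :: w :: σ))
    (hr : s.reg rRow = 2 * N) {b : Bool} (hx : s.mem aIn (s.reg rPos) = 4 + b.toNat) :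
    Pending (newOp.run s) D L N (.meet (if b then u.neg else u) (if b then w.neg else w))
      ((if b then (NTerm.meet u.neg w.neg).fix.neg else (NTerm.meet u w).fix) :: σ) := by
  obtain ⟨_, hp, ⟨h₁, h₂⟩, p, rfl, ⟨h₃, h₄⟩, h₅⟩ := h.stack
  have h₆ := h.neg _ h₁
  have h₇ := h.neg _ h₃
  cases b
  · exact newOp_pending_aux h hr (b := 0) (by omega) hx hp rfl rfl h₁ h₃ h₂ h₄ h₅
  · exact newOp_pending_aux h hr (b := 1) (by omega) hx hp rfl rfl
      (by simp only [↓reduceIte, one_ne_zero]; omega) (by simp only [↓reduceIte, one_ne_zero]; omega)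
      (by simp [h₆.2, h₂]) (by simp [h₇.2, h₄]) h₅

/-- A node and its dual share one list of arguments, since the dual only changes the sign of the
symbol; so an application uses up exactly its arity in cells of `aArg`. -/
theorem newApp_pending : ∃ C, ∀ (s : Config) (D : ℕ → NTerm) (L N : ℕ) (f : FunSym)
    (z : Fin f.arity → NTerm) (σ : List NTerm), Store s D L N (List.ofFn z ++ σ) →
    s.reg rRow = 2 * N → Holds (s.mem aIn) (s.reg rPos) (Tok.app f).encode →
    Tri newApp s (C * (f.arity + 1)) fun s' => s'.reg rArg = s.reg rArg + f.arity ∧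
      Pending s' D L N (.app true f z) (.app true f z :: σ) := by
  refine ⟨1000, fun s D L N f z σ h hr hf => ?_⟩
  obtain ⟨p, hp, hσ, hz⟩ := h.stack.append
  rw [List.length_ofFn] at hp
  simp only [List.length_ofFn, List.getElem_ofFn] at hz
  have hn := h.nodes
  obtain ⟨-, f₂, f₃, f₄⟩ := holds_app hf
  refine Tri.step (f.arity * (100 + 100) + 300) rfl ?_ (by simp [Cmd.cost, newNeg, Expr.cost]; omega)
  set s₁ := Cmd.run _ s with hs₁
  refine Tri.seqFrame 150 (Tri.upTo_const (n := f.arity) (t := 50) (I := fun i s' => s'.reg rI = i ∧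
    (∀ x ≠ rI, s'.reg x = s₁.reg x) ∧ (∀ a ≠ aArg, s'.mem a = s₁.mem a) ∧
    (∀ j < s.reg rArg, s'.mem aArg j = s.mem aArg j) ∧
    ∀ j < i, s'.mem aArg (s.reg rArg + j) = s.mem aStack (s.reg rSp - 1 - j)) ?_ ?_ ?_ ?_) ?_ ?_
  · exact fun i s h => h.1
  · rintro i s' ⟨-, h₂, h₃, -⟩
    simp only [Expr.eval, h₂ _ (show rPos ≠ rI by decide), h₃ _ (show aIn ≠ aArg by decide)]
    simp [hs₁, Cmd.run, newNeg, f₂, f₃, f₄, FunSym.arity, Nat.add_assoc]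
  · rintro i s' hi ⟨h₁, h₂, h₃, h₄, h₅⟩
    have e₁ : s'.reg rArg = s.reg rArg := (h₂ _ (by decide)).trans (by simp [hs₁, Cmd.run, newNeg])
    have e₂ : s'.reg rSp = s.reg rSp := (h₂ _ (by decide)).trans (by simp [hs₁, Cmd.run, newNeg])
    have e₃ : s'.mem aStack = s.mem aStack :=
      (h₃ _ (by decide)).trans (by simp [hs₁, Cmd.run, newNeg])
    refine Tri.block rfl (by decide) ⟨by simp [Cmd.run, h₁], by simp, ?_, ?_, ?_, ?_⟩
    · intro x hx
      simp [Cmd.run, hx, h₂ x hx]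
    · intro a ha
      simp [Cmd.run, ha, h₃ a ha]
    · intro j hj
      simp [Cmd.run, Expr.eval, e₁, h₁, h₄ j hj, Function.update_of_ne (show j ≠ s.reg rArg + i by omega)]
    · intro j hj
      by_cases hji : j = i
      · simp [Cmd.run, Expr.eval, e₁, e₂, e₃, h₁, hji]
      · simp [Cmd.run, Expr.eval, e₁, h₁, h₅ j (by omega),
          Function.update_of_ne (show s.reg rArg + j ≠ s.reg rArg + i by omega)]
  · simp [hs₁, Cmd.run, newNeg, Expr.eval]
  · rintro s₂ ⟨h₁, h₂, h₃, h₄, h₅⟩ -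
    have e₁ : s₂.reg rArg = s.reg rArg := (h₂ _ (by decide)).trans (by simp [hs₁, Cmd.run, newNeg])
    have e₂ : s₂.reg rSp = s.reg rSp := (h₂ _ (by decide)).trans (by simp [hs₁, Cmd.run, newNeg])
    have e₃ : s₂.reg rRow = 2 * N := (h₂ _ (by decide)).trans (by simp [hs₁, Cmd.run, newNeg, hr])
    have e₄ : s₂.reg rNodes = 2 * N := (h₂ _ (by decide)).trans (by simp [hs₁, Cmd.run, newNeg, hn])
    have e₅ : s₂.mem aStack = s.mem aStack :=
      (h₃ _ (by decide)).trans (by simp [hs₁, Cmd.run, newNeg])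
    have hfin : ((Cmd.seq (.set rSp (.sub (.reg rSp) (.reg rI))) <|
        .seq (.set rArg (.add (.reg rArg) (.reg rI))) (push (.reg rRow))).run s₂).mem =
        Function.update s₂.mem aStack (Function.update (s.mem aStack) p (2 * N)) := by
      funext a
      by_cases ha : a = aStack
      · subst ha
        simp [Cmd.run, push, Expr.eval, e₁, e₂, e₃, e₅, h₁, hp]
      · simp [Cmd.run, push, ha]
    refine Tri.block rfl (by decide) ⟨by simp [Cmd.run, push, Expr.eval, e₁, h₁], ?_⟩
    have hK : (2 * N + 1) / 2 = N := by omega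
    have hc : ∀ (D' : ℕ → NTerm), (∀ x < 2 * N, D' x = D x) → ∀ x, x / 2 = N → ∀ a : Fin f.arity,
        Child D' x (s₂.mem aArg (s.reg rArg + a)) (z a) := fun D' hD x hx a => by
      rw [h₅ a a.2]
      have := hz a a.2
      exact ⟨by omega, (hD _ this.1).trans this.2⟩
    have hc := hc (extend D N (.app true f z)) fun x hx => extend_of_lt _ _ _ hx
    have hin : s₂.mem aIn = s.mem aIn := (h₃ _ (by decide)).trans (by simp [hs₁, Cmd.run, newNeg])
    refine h.pending (p := p) (b := 0) (.app true f z) (.app true f z) ?_ ?_ ?_ ?_ ?_ ?_ ?_ ?_ ?_ ?_ ?_ ?_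
      (.inl ⟨rfl, rfl⟩) (hσ.congr ?_ le_rfl fun _ _ => rfl)
    all_goals try rw [hfin]
    · simp [Cmd.run, push, e₄]
    · simp [Cmd.run, push, e₃]
    · simp [h₃]
      simp [hs₁, Cmd.run, newNeg]
    · simp [h₃]
      simp [hs₁, Cmd.run, newNeg, Expr.eval, hr, Function.update_apply]
      grind
    · simp [h₃]
      simp [hs₁, Cmd.run, newNeg, Expr.eval, hr]
    · simp [h₃]
      simp [hs₁, Cmd.run, newNeg, Expr.eval, hr]
    · simpa using h₄
    · simp [Cmd.run, push, Expr.eval, e₁]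
    · simp only [NodeOK, Cmd.run, push, Expr.eval, Config.reg_setReg, Config.reg_setMem, e₁, h₁]
      simp [h₃]
      simp [hs₁, Cmd.run, newNeg, Expr.eval, hr]
      exact ⟨hf, hc _ (by omega)⟩
    · simp only [NTerm.neg, NodeOK, Cmd.run, push, Expr.eval, Config.reg_setReg, Config.reg_setMem, e₁, h₁]
      simp [h₃]
      simp [hs₁, Cmd.run, newNeg, Expr.eval, hr]
      exact ⟨hf, hc _ (by omega)⟩
    · simp [Cmd.run, push, Expr.eval, e₂, h₁, hp]
    · simp
    · intro j hj
      simp [Function.update_of_ne hj.ne]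
  · simp only [Cmd.upToCost, Expr.cost]
    omega

end


/-! ### Completing the table, and the test of β. -/

open OrthoPlus.Expr in
/-- Compare the new nodes with all others, and replace the new conjunction by `⊥` if necessary. -/
def finish : Cmd :=
  .seq row <|
  .seq (.ite (and (eq (kind (reg rRow)) (const 4))
      (or (tab (reg rRow) (fst (add (reg rRow) (const 1))))
        (tab (reg rRow) (snd (add (reg rRow) (const 1))))))
    (.seq (.seq (.write aK (reg rRow) (const 1)) (.write aK (add (reg rRow) (const 1)) (const 2)))
      row) .skip)
  (.set rNodes (add (reg rNodes) (const 2)))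

theorem Pending.store {s s' : Config} {D : ℕ → NTerm} {L N : ℕ} {t : NTerm} {σ : List NTerm}
    (h : Pending s D L N t σ) (hn : s'.reg rNodes = 2 * N + 2)
    (ht : Table s'.mem (s'.reg rArg) (extend D N t.fix) (2 * L) (2 * N + 2) fun _ _ => True)
    (hneg : s'.mem aNeg = s.mem aNeg) (hst : s'.mem aStack = s.mem aStack)
    (hsp : s'.reg rSp = s.reg rSp) : Store s' (extend D N t.fix) L (N + 1) σ := by
  refine ⟨hn, ht, fun x hx => ?_, ?_⟩
  · rw [hneg]
    exact h.neg x hx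
  · rw [hst, hsp]
    exact h.stack

theorem NTerm.arity_neg (t : NTerm) : t.neg.arity = t.arity := by
  cases t <;> rfl

theorem Table.congr {m m' : ℕ → ℕ → ℕ} {n W N : ℕ} {D : ℕ → NTerm} {S : ℕ → ℕ → Prop}
    (h : Table m n D W N S)
    (hm : ∀ a ∈ [aIn, aK, aA, aB, aC, aArg, aBase, aTab], m' a = m a) : Table m' n D W N S := by
  refine ⟨fun x hx => (h.node x hx).congr (fun a ha => ?_) (hm _ (by decide))
    (fun j _ => by rw [hm aArg (by decide)]) le_rfl fun _ _ => rfl, fun x hx => ?_,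
    fun x y hx hy hxy => ?_⟩
  · rw [hm]
    revert ha
    simp only [List.mem_cons, List.not_mem_nil]
    tauto
  · rw [hm aBase (by decide), h.base x hx]
  · rw [Entry, hm aBase (by decide), hm aTab (by decide)]
    exact h.entry x y hx hy hxy

/-- The dual node has the duals of the two sides as components. Once the row is known, the test of
`β` for a new meet is therefore two table lookups. -/
theorem finish_spec : ∃ C, ∀ (s : Config) (D : ℕ → NTerm) (L N : ℕ) (t : NTerm) (σ : List NTerm),
    Pending s D L N t σ → N < L → Tri finish s (C * ((t.arity + 1) * L)) fun s' =>
      Store s' (extend D N t.fix) L (N + 1) σ := by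
  obtain ⟨C, hC⟩ := row_spec
  refine ⟨2 * C + 400, fun s D L N t σ h hN => ?_⟩
  have hcost : (t.arity + 1) * (N + 1) ≤ (t.arity + 1) * L := Nat.mul_le_mul_left _ hN
  have hL : 1 ≤ (t.arity + 1) * L := Nat.mul_pos (by omega) (by omega)
  have hC' := Nat.mul_le_mul_left C hcost
  refine Tri.seqFrame (C * ((t.arity + 1) * L) + 300) (hC s _ N t.arity (2 * L) _ h.row (by omega)
    (by rw [extend_even]) (by rw [extend_odd, NTerm.arity_neg]) h.table) ?_
    (by rw [Nat.add_mul (2 * C), Nat.mul_assoc 2 C]; omega)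
  intro s₁ h₁ hf
  have hm : ∀ a ≠ aTab, s₁.mem a = s.mem a := fun a ha => hf.mem a fun h => ha (by
    simpa [row, cmp, cmpArgs, Cmd.arrs] using h)
  have e₁ : s₁.reg rRow = 2 * N := (hf.reg _ (by decide)).trans h.row
  have e₂ : s₁.reg rNodes = 2 * N := (hf.reg _ (by decide)).trans h.nodes
  have e₃ : s₁.reg rArg = s.reg rArg := hf.reg _ (by decide)
  have e₄ : s₁.reg rSp = s.reg rSp := hf.reg _ (by decide)
  rw [← e₃] at h₁
  refine Tri.seqFrame 20 (R := fun s' => Table s'.mem (s'.reg rArg) (extend D N t.fix) (2 * L)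
    (2 * N + 2) fun _ _ => True) (t₁ := C * ((t.arity + 1) * L) + 200) ?_ ?_ (by omega)
  · have hnode := h₁.node (2 * N) (by omega)
    have hk := hnode.kind_four
    have hcond : (Expr.and (.eq (.kind (.reg rRow)) (.const 4))
        (.or (.tab (.reg rRow) (.fst (.add (.reg rRow) (.const 1))))
        (.tab (.reg rRow) (.snd (.add (.reg rRow) (.const 1)))))).eval s₁ ≠ 0 ↔
        ∃ a b, t = .meet a b ∧ (Le t a.neg ∨ Le t b.neg) := by
      rw [Expr.eval_and, Expr.eval_eq, Expr.eval_or]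
      simp only [Expr.eval, e₁]
      rw [hk, extend_even]
      have key : ∀ a b, t = .meet a b → ((s₁.mem aTab (s₁.mem aBase (2 * N) + s₁.mem aA (2 * N + 1)) ≠ 0 ↔
          Le t a.neg) ∧ (s₁.mem aTab (s₁.mem aBase (2 * N) + s₁.mem aB (2 * N + 1)) ≠ 0 ↔
          Le t b.neg)) := by
        intro a b hab
        have := h₁.node (2 * N + 1) (by omega)
        rw [extend_odd, hab, NTerm.neg, NodeOK] at this
        obtain ⟨-, ⟨h₂, h₃⟩, ⟨h₄, h₅⟩⟩ := this
        have h₆ := h₁.entry (2 * N) (s₁.mem aA (2 * N + 1)) (by omega) (by omega) trivial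
        have h₇ := h₁.entry (2 * N) (s₁.mem aB (2 * N + 1)) (by omega) (by omega) trivial
        rw [← hab] at h₃ h₅
        rw [Entry, h₃, extend_even] at h₆
        rw [Entry, h₅, extend_even] at h₇
        exact ⟨h₆, h₇⟩
      constructor
      · rintro ⟨⟨a, b, hab⟩, h⟩
        exact ⟨a, b, hab, h.imp (key a b hab).1.1 (key a b hab).2.1⟩
      · rintro ⟨a, b, hab, h⟩
        exact ⟨⟨a, b, hab⟩, h.imp (key a b hab).1.2 (key a b hab).2.2⟩
    refine (Tri.ite (t := C * ((t.arity + 1) * L) + 40) ?_ ?_).mono ?_ fun _ h => h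
    · rw [hcond]
      rintro ⟨a, b, hab, hle⟩
      have hfix : t.fix = .bot := by
        rw [hab] at hle
        rw [hab, NTerm.fix, if_pos hle]
      refine Tri.step (C * ((t.arity + 1) * L)) rfl ?_ (by simp [Cmd.cost, Expr.cost]; omega)
      rw [hfix]
      -- After the replacement by `⊥` and `⊤` the row is computed afresh with arity `0`. Older
      -- entries stay valid because no older node refers to the new pair.
      refine (hC _ (s₁.reg rArg) N 0 (2 * L) (extend D N .bot) (by simpa [Cmd.run] using e₁) (by omega)
        (by rw [extend_even]; rfl) (by rw [extend_odd]; rfl) ?_).frame.mono ?_ ?_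
      · refine ⟨fun x hx => ?_, fun x hx => ?_, fun x y hx hy hxy => ?_⟩
        · obtain hx | rfl | rfl : x < 2 * N ∨ x = 2 * N ∨ x = 2 * N + 1 := by omega
          · have := h₁.node x (by omega)
            rw [extend_of_lt _ _ _ hx] at this ⊢
            refine this.congr ?_ ?_ ?_ le_rfl ?_
            · simp [Cmd.run, Expr.eval, e₁, Function.update_apply]
              rw [if_neg (by omega), if_neg (by omega)]
            · simp [Cmd.run]
            · simp [Cmd.run]
            · intro y hy
              rw [extend_of_lt _ _ _ (by omega), extend_of_lt _ _ _ (by omega)]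
          · rw [extend_even]
            simp [NodeOK, Cmd.run, Expr.eval, e₁]
          · rw [extend_odd]
            simp [NodeOK, Cmd.run, Expr.eval, e₁, NTerm.neg]
        · simpa [Cmd.run] using h₁.base x hx
        · have := h₁.entry x y hx hy trivial
          rw [Entry, extend_of_lt _ _ _ hxy.1, extend_of_lt _ _ _ hxy.2] at this ⊢
          simpa [Cmd.run] using this
      · refine Nat.mul_le_mul_left _ ((Nat.mul_le_mul_right _ ?_).trans hcost)
        omega
      · rintro s₂ ⟨h₂, hf₂⟩
        rw [hf₂.reg _ (by decide)]
        simpa [Cmd.run] using h₂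
    · intro he
      have hc := mt hcond.2 (not_not.2 he)
      have hfix : t.fix = t := by
        unfold NTerm.fix
        split
        · rename_i a b
          exact if_neg fun h => hc ⟨a, b, rfl, h⟩
        · rfl
      rw [hfix]
      exact Tri.block rfl (by simp [Cmd.cost]) h₁
    · simp [Expr.cost]
      omega
  · intro s₂ h₂ hf₂
    refine Tri.block rfl (by decide) (h.store ?_ ?_ ?_ ?_ ?_)
    · simp [Cmd.run, Expr.eval, hf₂.reg rNodes (by decide), e₂]
    · simpa [Cmd.run] using h₂
    · simp only [Cmd.run, Config.mem_setReg]
      rw [hf₂.mem aNeg (by decide), hm aNeg (by decide)]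
    · simp only [Cmd.run, Config.mem_setReg]
      rw [hf₂.mem aStack (by decide), hm aStack (by decide)]
    · simp [Cmd.run, Expr.eval, hf₂.reg rSp (by decide), e₄]

/-! ### One node of the input. -/

open OrthoPlus.Expr in
/-- Process the last one of the remaining nodes of the input. -/
def process : Cmd :=
  .seq (.seq (.set rTok (sub (reg rTok) (const 1))) (.seq (.set rPos (load aTok (reg rTok)))
    (.set rRow (reg rNodes)))) <|
  .ite (eq (load aIn (reg rPos)) (const 3))
    (.write aStack (sub (reg rSp) (const 1))
      (load aNeg (load aStack (sub (reg rSp) (const 1)))))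
    (.seq (.ite (eq (load aIn (reg rPos)) (const 6)) newApp
      (.ite (not (load aIn (reg rPos))) newVar
        (.ite (lt (load aIn (reg rPos)) (const 3)) newConst newOp))) finish)

/-- The number of arguments if the node is a function symbol. -/
def Tok.arity : Tok → ℕ
  | .app f => f.arity
  | _ => 0

theorem process_spec : ∃ C, ∀ (s : Config) (D : ℕ → NTerm) (L N q : ℕ) (a : Tok)
    (σ τ : List NTerm), Store s D L N σ → N < L → s.reg rTok = q + 1 →
    Holds (s.mem aIn) (s.mem aTok q) a.encode → Step a σ τ →
    Tri process s (C * ((a.arity + 1) * L)) fun s' => s'.reg rTok = q ∧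
      s'.reg rArg = s.reg rArg + a.arity ∧ ∃ D' N', N' ≤ N + 1 ∧ Store s' D' L N' τ := by
  obtain ⟨C₁, hC₁⟩ := newApp_pending
  obtain ⟨C₂, hC₂⟩ := finish_spec
  refine ⟨C₁ + C₂ + 2000, fun s D L N q a σ τ h hN hq ha hstep => ?_⟩
  have hL : a.arity + 1 ≤ (a.arity + 1) * L := Nat.le_mul_of_pos_right _ (by omega)
  have hL' := Nat.mul_le_mul_left C₁ hL
  refine Tri.step (C₁ * ((a.arity + 1) * L) + C₂ * ((a.arity + 1) * L) + 1500) rfl ?_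
    (by simp only [Cmd.cost, Expr.cost, Nat.add_mul]; rw [Nat.add_mul] at hL; omega)
  set s₁ := Cmd.run _ s with hs₁
  have hs : Store s₁ D L N σ := ⟨by simpa [hs₁, Cmd.run] using h.nodes,
    by simpa [hs₁, Cmd.run] using h.table, by simpa [hs₁, Cmd.run] using h.neg,
    by simpa [hs₁, Cmd.run] using h.stack⟩
  have hr : s₁.reg rRow = 2 * N := by simpa [hs₁, Cmd.run, Expr.eval] using h.nodes
  have hp : s₁.reg rPos = s.mem aTok q := by simp [hs₁, Cmd.run, Expr.eval, hq]
  have ht : s₁.reg rTok = q := by simp [hs₁, Cmd.run, Expr.eval, hq]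
  have harg : s₁.reg rArg = s.reg rArg := by simp [hs₁, Cmd.run]
  have ha' : Holds (s₁.mem aIn) (s₁.reg rPos) a.encode := by rwa [hp]
  clear_value s₁
  clear h ha hq hp
  have fin : ∀ (c : Cmd) (t : ℕ), Tri c s₁ t (fun s' => s'.reg rArg = s₁.reg rArg + a.arity ∧
      ∃ T, T.arity = a.arity ∧ Pending s' D L N T τ) → rTok ∉ c.regs →
      Tri (.seq c finish) s₁ (t + C₂ * ((a.arity + 1) * L)) fun s' => s'.reg rTok = q ∧
      s'.reg rArg = s.reg rArg + a.arity ∧ ∃ D' N', N' ≤ N + 1 ∧ Store s' D' L N' τ := by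
    intro c t hc hreg
    refine Tri.seqFrame _ hc ?_ le_rfl
    rintro s₂ ⟨h₁, T, hT, h₂⟩ hf
    rw [← hT]
    refine (hC₂ s₂ D L N T τ h₂ hN).frame.mono le_rfl ?_
    rintro s₃ ⟨h₃, hf'⟩
    refine ⟨?_, ?_, _, _, le_rfl, h₃⟩
    · rw [hf'.reg _ (by decide), hf.reg _ hreg, ht]
    · rw [hf'.reg _ (by decide), h₁, harg, hT]
  have create : a ≠ .neg → Tri (.ite (.eq (.load aIn (.reg rPos)) (.const 6)) newApp
      (.ite (.not (.load aIn (.reg rPos))) newVar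
        (.ite (.lt (.load aIn (.reg rPos)) (.const 3)) newConst newOp))) s₁
      (C₁ * (a.arity + 1) + 1200) fun s' => s'.reg rArg = s₁.reg rArg + a.arity ∧
      ∃ T, T.arity = a.arity ∧ Pending s' D L N T τ := by
    intro hneg
    have hk : ∀ b l, a.encode = b :: l → s₁.mem aIn (s₁.reg rPos) = b := fun b l hb => by
      rw [hb] at ha'
      exact (Holds.cons_iff.1 ha').1
    by_cases happ : ∃ f, a = .app f
    · obtain ⟨f, rfl⟩ := happ
      have hk := hk 6 _ rfl
      cases hstep with
      | app f z σ =>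
        refine (Tri.ite (t := C₁ * (f.arity + 1)) (fun _ => ?_) fun h => ?_).mono ?_ fun _ h => h
        · exact (hC₁ s₁ D L N f z σ hs hr ha').mono le_rfl fun s' h => ⟨h.1, _, rfl, h.2⟩
        · simp [Expr.eval, hk] at h
        · simp only [Expr.cost, Tok.arity]
          omega
    · refine (Tri.ite (t := 1000) (fun h => ?_) fun _ => ?_).mono ?_ fun _ h => h
      · cases a <;> first
          | exact absurd ⟨_, rfl⟩ happ
          | (have hk := hk _ _ rfl; simp [Expr.eval, hk] at h)
      · refine Tri.block rfl (by decide) ?_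
        cases hstep with
        | var x =>
          have hk := hk _ _ rfl
          simp only [Cmd.run, Expr.eval, hk, Nat.sub_zero, one_ne_zero, ↓reduceIte]
          exact ⟨by simp [newVar, newNeg, push, Cmd.run, Tok.arity], _, rfl,
            newVar_pending hs hr ha'⟩
        | bot =>
          have hk := hk _ _ rfl
          simp only [Cmd.run, Expr.eval, hk, Nat.sub_self, ↓reduceIte, Nat.reduceSub, OfNat.ofNat_ne_zero]
          exact ⟨by simp [newConst, newNeg, push, Cmd.run, Tok.arity], _, rfl,
            newConst_pending (b := false) hs hr hk⟩
        | top =>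
          have hk := hk _ _ rfl
          simp only [Cmd.run, Expr.eval, hk, one_ne_zero, ↓reduceIte, Nat.reduceSub]
          exact ⟨by simp [newConst, newNeg, push, Cmd.run, Tok.arity], _, rfl,
            newConst_pending (b := true) hs hr hk⟩
        | neg => exact absurd rfl hneg
        | meet u w =>
          have hk := hk _ _ rfl
          simp only [Cmd.run, Expr.eval, hk, ↓reduceIte, Nat.reduceSub]
          exact ⟨by simp [newOp, newNeg, push, Cmd.run, Tok.arity, Expr.eval, hk], _, rfl,
            newOp_pending (b := false) hs hr hk⟩
        | join u w =>
          have hk := hk _ _ rfl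
          simp only [Cmd.run, Expr.eval, hk, ↓reduceIte, Nat.reduceSub]
          exact ⟨by simp [newOp, newNeg, push, Cmd.run, Tok.arity, Expr.eval, hk], _, rfl,
            newOp_pending (b := true) hs hr hk⟩
        | app f => exact absurd ⟨_, rfl⟩ happ
      · simp only [Expr.cost]
        omega
  refine (Tri.ite (t := C₁ * (a.arity + 1) + 1200 + C₂ * ((a.arity + 1) * L)) (fun h => ?_)
    fun h => ?_).mono ?_ fun _ h => h
  · obtain rfl : a = .neg := by
      cases a <;> first
        | rfl
        | (rw [Tok.encode, Holds.cons_iff] at ha'; simp [Expr.eval, ha'.1] at h)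
    cases hstep with
    | neg t σ =>
      obtain ⟨p, hp, ⟨h₁, h₂⟩, h₃⟩ := hs.stack
      refine Tri.block rfl (by simp only [Cmd.cost, Expr.cost]; omega)
        ⟨ht, harg, D, N, by omega, hs.nodes, hs.table.congr (by simp [Cmd.run]), hs.neg, p, hp, ?_,
        h₃.congr ?_ le_rfl fun _ _ => rfl⟩
      · have := hs.neg _ h₁
        simp only [Cmd.run, Expr.eval, hp, Config.mem_setMem, Nat.add_sub_cancel, ↓reduceIte,
          Function.update_self]
        exact ⟨by omega, by rw [this.2, h₂]⟩
      · intro j hj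
        simp [Cmd.run, Expr.eval, hp, Function.update_of_ne hj.ne]
  · refine fin _ _ (create ?_) (by decide)
    rintro rfl
    rw [Tok.encode, Holds.cons_iff] at ha'
    simp [Expr.eval, ha'.1] at h
  · simp only [Expr.cost]
    omega


/-! ### Amortized cost of the table. -/

/-- Process all nodes of the input. -/
def processAll : Cmd := .whileDo (.reg rTok) process

/-- Cells for arguments are paid for by entries taken from the stack, and each node of the input
adds at most one entry. This bounds the sum of all arities by the number of nodes. -/
theorem Step.length_le {a : Tok} {σ τ : List NTerm} (h : Step a σ τ) :
    τ.length + a.arity ≤ σ.length + 1 ∧ a.arity ≤ σ.length := by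
  cases h <;> simp [Tok.arity]
  omega

theorem processAll_spec : ∃ C, ∀ (s : Config) (l : List Tok) (u : NTerm), s.reg rTok = l.length →
    s.reg rNodes = 0 → s.reg rArg = 0 → s.reg rSp = 0 →
    (∀ x ≤ 2 * l.length, s.mem aBase x = x * (2 * l.length)) →
    Holds (s.mem aIn) 0 (l.flatMap Tok.encode) → (∀ q < l.length, s.mem aTok q = tokPos l q) →
    Steps l [] [u] → Tri processAll s (C * (l.length * l.length) + 3) fun s' =>
      ∃ D N, N ≤ l.length ∧ Store s' D l.length N [u] := by
  obtain ⟨C, hC⟩ := process_spec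
  refine ⟨2 * (C + 3), fun s l u hT hN hA hS hB hin htok hl => ?_⟩
  have hf : ∀ a ∈ [aIn, aTok], a ∉ process.arrs := by decide
  set L := l.length with hL
  -- The potential is the number `q` of nodes still to be read plus the number of argument cells
  -- still free. Processing a node of arity `a` costs `O((a + 1) L)` and lowers the potential by `a
  -- + 1`. The inequality for `rArg`, the stack and `q` guarantees that the cells suffice.
  refine (Tri.while_of (Q := fun s' => ∃ D N, N ≤ L ∧ Store s' D L N [u]) (fun t s' => ∃ q σ D N, s'.reg rTok = q ∧ q ≤ L ∧ Store s' D L N σ ∧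
    N + q ≤ L ∧ s'.reg rArg + σ.length + q ≤ L ∧ Steps (l.take q) σ [u] ∧
    s'.mem aIn = s.mem aIn ∧ s'.mem aTok = s.mem aTok ∧
    (C + 3) * (L * (q + (L - s'.reg rArg))) ≤ t) ?_ ?_ (t := (C + 3) * (L * (L + L)))
    ⟨L, [], fun _ => .bot, 0, hT, le_rfl, ⟨hN, ⟨fun x hx => absurd hx (by omega), hB,
      fun x y hx => absurd hx (by omega)⟩, fun x hx => absurd hx (by omega), hS⟩, by omega,
      by simp [hA], by rwa [hL, List.take_length], rfl, rfl, by rw [hA, Nat.sub_zero]⟩).mono ?_ ?_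
  · rintro t s' ⟨q, σ, D, N, h₁, h₂, h₃, h₄, h₅, h₆, h₇, h₈, h₉⟩ he
    obtain ⟨q, rfl⟩ : ∃ q', q = q' + 1 := Nat.exists_eq_succ_of_ne_zero (h₁ ▸ he)
    have hq : q < l.length := by omega
    rw [List.take_add_one, List.getElem?_eq_getElem hq, Option.toList_some, steps_append] at h₆
    obtain ⟨τ, ⟨_, rfl, h₁₀⟩, h₁₁⟩ := h₆
    have hlen := h₁₀.length_le
    refine ⟨C * ((l[q].arity + 1) * L),
      (C + 3) * (L * (q + (L - (s'.reg rArg + l[q].arity)))), ?_, ?_⟩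
    · generalize hK : q + (L - (s'.reg rArg + l[q].arity)) = K
      have e : q + 1 + (L - s'.reg rArg) = K + (l[q].arity + 1) := by omega
      rw [e] at h₉
      refine le_trans ?_ h₉
      have hpos : 1 ≤ (l[q].arity + 1) * L := Nat.mul_pos (by omega) (by omega)
      rw [Nat.mul_add L, Nat.mul_add (C + 3), Nat.mul_comm L (l[q].arity + 1),
        Nat.add_mul C 3 ((l[q].arity + 1) * L)]
      simp only [Expr.cost]
      omega
    · refine (hC s' D L N q l[q] σ τ h₃ (by omega) h₁ ?_ h₁₀).frame.mono le_rfl ?_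
      · rw [h₇, h₈, htok q hq]
        exact hin.tok hq
      · rintro s'' ⟨⟨h₁₂, h₁₃, D', N', h₁₄, h₁₅⟩, hfr⟩
        exact ⟨q, τ, D', N', h₁₂, by omega, h₁₅, by omega, by omega, h₁₁,
          (hfr.mem _ (hf _ (by decide))).trans h₇, (hfr.mem _ (hf _ (by decide))).trans h₈,
          by rw [h₁₃]⟩
  · rintro t s' ⟨q, σ, D, N, h₁, h₂, h₃, h₄, h₅, h₆, h₇, h₈, h₉⟩ he
    obtain rfl : q = 0 := h₁.symm.trans he
    rw [List.take_zero] at h₆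
    obtain rfl : σ = [u] := h₆
    exact ⟨D, N, by omega, h₃⟩
  · simp only [Expr.cost]
    refine Nat.add_le_add ?_ le_rfl
    exact le_of_eq (by ring)
  · exact fun s' h => h


/-! ### The tree of the simplified term, in breadth-first order -/

section

variable {m : ℕ → ℕ → ℕ} {n x : ℕ} {D : ℕ → NTerm}

theorem NodeOK.of_op {d : Bool} {a b : NTerm} (h : NodeOK m n D x (D x)) (hx : D x = op d a b) :
    m aK x = 4 + d.toNat ∧ Child D x (m aA x) a ∧ Child D x (m aB x) b := by
  rw [hx] at h
  cases d <;> simpa [op, NodeOK] using h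

theorem NodeOK.of_atom (h : NodeOK m n D x (D x)) (hx : ∀ d, ¬ IsOp d (D x)) :
    m aK x ≠ 4 ∧ m aK x ≠ 5 := by
  rw [Ne, Ne, h.kind_four, h.kind_five]
  exact ⟨fun ⟨a, b, h⟩ => hx false ⟨a, b, h⟩, fun ⟨a, b, h⟩ => hx true ⟨a, b, h⟩⟩

end

open OrthoPlus.Expr in
/-- Whether `x` is below `y`, for the order that belongs to the kind `rS`. -/
def leExpr (x y : Expr) : Expr :=
  or (and (eq (reg rS) (const 5)) (tab x y)) (and (eq (reg rS) (const 4)) (tab y x))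

/-- Put a number into the queue. -/
def enqueue (e : Expr) : Cmd := .seq (.write aQueue (.reg rQn) e) (.incr rQn)

open OrthoPlus.Expr in
/-- One step of the computation of the members of the join or meet `rU`. -/
def expandStep : Cmd :=
  .seq (.set rSp (sub (reg rSp) (const 1))) <|
  .seq (.set rW (load aStack (reg rSp))) <|
  .ite (eq (kind (reg rW)) (reg rS)) (.seq (push (snd (reg rW))) (push (fst (reg rW)))) <|
  .ite (eq (add (kind (reg rW)) (reg rS)) (const 9))
    (.ite (leExpr (fst (reg rW)) (reg rU)) (push (fst (reg rW)))
      (.ite (leExpr (snd (reg rW)) (reg rU)) (push (snd (reg rW))) (enqueue (reg rW))))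
    (enqueue (reg rW))

/-- The members of the join or meet `rU` are put into the queue. -/
def expandOp : Cmd := .whileDo (.reg rSp) expandStep

/-- The nodes of the terms `l` have been put into the queue since `s₀`. -/
structure Enqueued (s₀ : Config) (D : ℕ → NTerm) (M : ℕ) (l : List NTerm) (s : Config) : Prop where
  qn : s.reg rQn = s₀.reg rQn + l.length
  holds : Holds (fun j => D (s.mem aQueue j)) (s₀.reg rQn) l
  lt : ∀ j < s.reg rQn, s.mem aQueue j < M
  old : ∀ j < s₀.reg rQn, s.mem aQueue j = s₀.mem aQueue j
  mem : ∀ a ∈ [aIn, aK, aA, aB, aC, aArg, aBase, aTab], s.mem a = s₀.mem a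
  u : s.reg rU = s₀.reg rU

/-- The state during the computation of the members of a join or meet. -/
structure Expanding (s₀ : Config) (D : ℕ → NTerm) (M : ℕ) (d : Bool) (τ l : List NTerm)
    (s : Config) : Prop extends Enqueued s₀ D M l s where
  stack : Stack (s.mem aStack) D M (s.reg rSp) τ
  kind : s.reg rS = 4 + d.toNat

section

variable {s₀ s : Config} {D : ℕ → NTerm} {M : ℕ} {d : Bool} {τ l : List NTerm}

theorem Expanding.push {s' : Config} {p x : ℕ} {v : NTerm} (h : Expanding s₀ D M d τ l s)
    (hp : s'.reg rSp = p + 1) (hx : s'.mem aStack p = x) (hx' : x < M) (hv : D x = v)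
    (hs : Stack (s'.mem aStack) D M p τ) (hq : s'.reg rQn = s.reg rQn)
    (hu : s'.reg rU = s.reg rU) (hk : s'.reg rS = s.reg rS)
    (hm : ∀ a ≠ aStack, s'.mem a = s.mem a) : Expanding s₀ D M d (v :: τ) l s' := by
  have hQ := hm aQueue (by decide)
  refine ⟨⟨hq.trans h.qn, by simpa only [hQ] using h.holds, ?_, ?_, fun a ha => ?_, hu.trans h.u⟩,
    ⟨p, hp, ⟨hx ▸ hx', hx ▸ hv⟩, hs⟩, hk.trans h.kind⟩
  · rw [hq, hQ]
    exact h.lt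
  · rw [hQ]
    exact h.old
  · rw [hm a, h.mem a ha]
    rintro rfl
    revert ha
    decide

theorem Enqueued.enqueue {x : ℕ} {v : NTerm} (h : Enqueued s₀ D M l s) {e : Expr}
    (he : e.eval s = x) (hx : x < M) (hv : D x = v) :
    Enqueued s₀ D M (l ++ [v]) ((OrthoPlus.enqueue e).run s) := by
  have hm : ∀ a ≠ aQueue, ((OrthoPlus.enqueue e).run s).mem a = s.mem a := fun a ha => by
    simp [OrthoPlus.enqueue, Cmd.run, ha]
  have hQ : ((OrthoPlus.enqueue e).run s).mem aQueue =
      Function.update (s.mem aQueue) (s₀.reg rQn + l.length) x := by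
    simp [OrthoPlus.enqueue, Cmd.run, Expr.eval, he, h.qn]
  refine ⟨?_, ?_, ?_, ?_, fun a ha => ?_, ?_⟩
  · simp [OrthoPlus.enqueue, Cmd.run, Expr.eval, h.qn, Nat.add_assoc]
  · refine Holds.append_iff.2 ⟨h.holds.congr fun i _ hi => ?_, Holds.cons_iff.2 ⟨?_, .nil⟩⟩
    · rw [hQ, Function.update_of_ne (by omega)]
    · rw [hQ, Function.update_self, hv]
  · intro j hj
    rw [hQ]
    by_cases hj' : j = s₀.reg rQn + l.length
    · rwa [hj', Function.update_self]
    · rw [Function.update_of_ne hj']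
      refine h.lt j ?_
      simp [OrthoPlus.enqueue, Cmd.run, Expr.eval, h.qn] at hj
      have := h.qn
      omega
  · intro j hj
    rw [hQ, Function.update_of_ne (by omega), h.old j hj]
  · rw [hm a, h.mem a ha]
    rintro rfl
    revert ha
    decide
  · simpa [OrthoPlus.enqueue, Cmd.run] using h.u

theorem Expanding.enqueue {x : ℕ} {v : NTerm} (h : Expanding s₀ D M d τ l s) {e : Expr}
    (he : e.eval s = x) (hx : x < M) (hv : D x = v) :
    Expanding s₀ D M d τ (l ++ [v]) ((OrthoPlus.enqueue e).run s) :=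
  ⟨h.toEnqueued.enqueue he hx hv, by simpa [OrthoPlus.enqueue, Cmd.run] using h.stack,
    by simpa [OrthoPlus.enqueue, Cmd.run] using h.kind⟩

theorem leExpr_iff {n W : ℕ} (hT : Table s.mem n D W M fun _ _ => True) {e e' : Expr} {x y : ℕ}
    (hx : e.eval s = x) (hy : e'.eval s = y) (hxM : x < M) (hyM : y < M)
    (hk : s.reg rS = 4 + d.toNat) : (leExpr e e').eval s ≠ 0 ↔ LeD d (D x) (D y) := by
  have h₁ := hT.entry x y hxM hyM trivial
  have h₂ := hT.entry y x hyM hxM trivial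
  rw [Entry] at h₁ h₂
  rw [leExpr, Expr.eval_or, Expr.eval_and, Expr.eval_and, Expr.eval_eq, Expr.eval_eq]
  simp only [Expr.eval, hx, hy, hk, h₁, h₂]
  cases d <;> simp [LeD]

/-- The list already in the queue, followed by what `descend` yields on the stack, does not change,
and the total size on the stack drops. The first gives correctness, the second a linear bound. -/
theorem expandStep_spec {n W u : ℕ} {w : NTerm} (hT : Table s₀.mem n D W M fun _ _ => True)
    (hM : M % 2 = 0) (hu : s₀.reg rU = u) (huM : u < M) (h : Expanding s₀ D M d (w :: τ) l s) :
    ∃ τ' l', Expanding s₀ D M d τ' l' (expandStep.run s) ∧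
      l' ++ τ'.flatMap (descend d (D u)) = l ++ (w :: τ).flatMap (descend d (D u)) ∧
      (τ'.map NTerm.size).sum < ((w :: τ).map NTerm.size).sum := by
  obtain ⟨p, hp, ⟨hw, hD⟩, hτ⟩ := h.stack
  set x := s.mem aStack p with hx
  set s₁ := (Cmd.seq (.set rSp (.sub (.reg rSp) (.const 1)))
    (.set rW (.load aStack (.reg rSp)))).run s with hs₁
  have hp₁ : s₁.reg rSp = p := by simp [hs₁, Cmd.run, Expr.eval, hp]
  have hx₁ : s₁.reg rW = x := by simp [hs₁, Cmd.run, Expr.eval, hp, hx]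
  have hm₁ : s₁.mem = s.mem := rfl
  have h₁ : Expanding s₀ D M d τ l s₁ := by
    refine ⟨⟨by simpa [hs₁, Cmd.run] using h.qn, h.holds, ?_, h.old, h.mem,
      by simpa [hs₁, Cmd.run] using h.u⟩, ?_, by simpa [hs₁, Cmd.run] using h.kind⟩
    · simpa [hs₁, Cmd.run] using h.lt
    · rw [hp₁]
      exact hτ
  have hT₁ : Table s₁.mem n D W M fun _ _ => True := hT.congr h₁.mem
  have hk := h₁.kind
  have hu₁ : s₁.reg rU = u := h₁.u.trans hu
  have hst : Stack (s₁.mem aStack) D M p τ := hτ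
  have hnode : NodeOK s₁.mem n D x (D x) := hT₁.node x hw
  have hrun : expandStep.run s = (Cmd.ite (.eq (.kind (.reg rW)) (.reg rS))
      (.seq (OrthoPlus.push (.snd (.reg rW))) (OrthoPlus.push (.fst (.reg rW)))) <|
      .ite (.eq (.add (.kind (.reg rW)) (.reg rS)) (.const 9))
        (.ite (leExpr (.fst (.reg rW)) (.reg rU)) (OrthoPlus.push (.fst (.reg rW)))
          (.ite (leExpr (.snd (.reg rW)) (.reg rU)) (OrthoPlus.push (.snd (.reg rW)))
            (OrthoPlus.enqueue (.reg rW))))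
        (OrthoPlus.enqueue (.reg rW))).run s₁ := rfl
  rw [hrun]
  clear_value s₁
  clear hrun
  have hpush : ∀ (e : Expr) (s : Config) (τ : List NTerm) (y : ℕ) (v : NTerm), e.eval s = y →
      y < M → D y = v → Expanding s₀ D M d τ l s →
      Expanding s₀ D M d (v :: τ) l ((OrthoPlus.push e).run s) := by
    intro e s τ y v he hy hv hs
    refine hs.push (p := s.reg rSp) (x := y) ?_ ?_ hy hv (hs.stack.congr ?_ le_rfl fun _ _ => rfl)
      ?_ ?_ ?_ ?_
    · simp [OrthoPlus.push, Cmd.run, Expr.eval]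
    · simp [OrthoPlus.push, Cmd.run, Expr.eval, he]
    · intro j hj
      simp [OrthoPlus.push, Cmd.run, Expr.eval, Function.update_of_ne hj.ne]
    · simp [OrthoPlus.push, Cmd.run]
    · simp [OrthoPlus.push, Cmd.run]
    · simp [OrthoPlus.push, Cmd.run]
    · intro a ha
      simp [OrthoPlus.push, Cmd.run, ha]
  have hdone : descend d (D u) w = [w] → ∃ τ' l', Expanding s₀ D M d τ' l'
      ((OrthoPlus.enqueue (.reg rW)).run s₁) ∧
      l' ++ τ'.flatMap (descend d (D u)) = l ++ (w :: τ).flatMap (descend d (D u)) ∧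
      (τ'.map NTerm.size).sum < ((w :: τ).map NTerm.size).sum := fun hw' => by
    refine ⟨τ, l ++ [w], h₁.enqueue hx₁ hw hD, by simp [hw'], ?_⟩
    rw [List.map_cons, List.sum_cons]
    exact Nat.lt_add_of_pos_left (by cases w <;> simp [NTerm.size])
  rcases w.isOp_or with ⟨e, a, b, rfl⟩ | hatom
  · obtain ⟨k₁, ⟨k₂, k₃⟩, ⟨k₄, k₅⟩⟩ := hnode.of_op hD
    have hA : s₁.mem aA x < M := by omega
    have hB : s₁.mem aB x < M := by omega
    by_cases hde : e = d
    · subst hde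
      have hc : (Expr.eq (.kind (.reg rW)) (.reg rS)).eval s₁ ≠ 0 := by
        rw [Expr.eval_eq]
        simp only [Expr.eval, hx₁, k₁, hk]
      rw [Cmd.run, if_neg hc, Cmd.run]
      refine ⟨a :: b :: τ, l, hpush _ _ _ (s₁.mem aA x) a ?_ hA k₃ (hpush _ _ _ (s₁.mem aB x) b ?_ hB k₅ h₁), ?_, ?_⟩
      · simp [Expr.eval, OrthoPlus.push, Cmd.run, hx₁]
      · simp [Expr.eval, hx₁]
      · simp [descend_op]
      · simp
        omega
    · obtain rfl : e = !d := by
        cases e <;> cases d <;> first | rfl | exact absurd rfl hde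
      have hc : (Expr.eq (.kind (.reg rW)) (.reg rS)).eval s₁ = 0 := by
        by_contra hc
        rw [← ne_eq, Expr.eval_eq] at hc
        simp only [Expr.eval, hx₁, k₁, hk] at hc
        cases d <;> simp at hc
      -- Meets and joins have the kinds `4` and `5`, so the sum `9` means that the two operations
      -- are opposite.
      have hc' : (Expr.eq (.add (.kind (.reg rW)) (.reg rS)) (.const 9)).eval s₁ ≠ 0 := by
        rw [Expr.eval_eq]
        simp only [Expr.eval, hx₁, k₁, hk]
        cases d <;> rfl
      have hbA : (leExpr (.fst (.reg rW)) (.reg rU)).eval s₁ ≠ 0 ↔ LeD d a (D u) := by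
        rw [← k₃]
        exact leExpr_iff hT₁ (by simp [Expr.eval, hx₁]) hu₁ hA huM hk
      have hbB : (leExpr (.snd (.reg rW)) (.reg rU)).eval s₁ ≠ 0 ↔ LeD d b (D u) := by
        rw [← k₅]
        exact leExpr_iff hT₁ (by simp [Expr.eval, hx₁]) hu₁ hB huM hk
      rw [Cmd.run, if_pos hc, Cmd.run, if_neg hc', Cmd.run]
      by_cases ha : LeD d a (D u)
      · rw [if_neg (hbA.2 ha)]
        refine ⟨a :: τ, l, hpush _ _ _ (s₁.mem aA x) a (by simp [Expr.eval, hx₁]) hA k₃ h₁, ?_, ?_⟩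
        · simp [descend_op_not, ha]
        · simp
      rw [if_pos (not_not.1 (mt hbA.1 ha)), Cmd.run]
      by_cases hb : LeD d b (D u)
      · rw [if_neg (hbB.2 hb)]
        refine ⟨b :: τ, l, hpush _ _ _ (s₁.mem aB x) b (by simp [Expr.eval, hx₁]) hB k₅ h₁, ?_, ?_⟩
        · simp [descend_op_not, ha, hb]
        · simp
      rw [if_pos (not_not.1 (mt hbB.1 hb))]
      exact hdone (by simp [descend_op_not, ha, hb])
  · have hk' := hnode.of_atom (by rwa [hD])
    have hc : (Expr.eq (.kind (.reg rW)) (.reg rS)).eval s₁ = 0 := by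
      by_contra hc
      rw [← ne_eq, Expr.eval_eq] at hc
      simp only [Expr.eval, hx₁, hk] at hc
      cases d <;> simp at hc <;> omega
    have hc' : (Expr.eq (.add (.kind (.reg rW)) (.reg rS)) (.const 9)).eval s₁ = 0 := by
      by_contra hc
      rw [← ne_eq, Expr.eval_eq] at hc
      simp only [Expr.eval, hx₁, hk] at hc
      cases d <;> simp at hc <;> omega
    rw [Cmd.run, if_pos hc, Cmd.run, if_pos hc']
    exact hdone (descend_atom _ _ _ hatom)

theorem expandOp_spec {n W u : ℕ} (hT : Table s₀.mem n D W M fun _ _ => True)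
    (hM : M % 2 = 0) (hu : s₀.reg rU = u) (huM : u < M) (hd : IsOp d (D u))
    (h : Expanding s₀ D M d [D u] [] s) :
    Tri expandOp s (1000 * ((D u).size + 1)) (Expanding s₀ D M d [] (children (D u))) := by
  refine (Tri.while_of (fun t s => ∃ τ l, Expanding s₀ D M d τ l s ∧
    l ++ τ.flatMap (descend d (D u)) = children (D u) ∧ 1000 * (τ.map NTerm.size).sum ≤ t)
    ?_ ?_ (t := 1000 * (D u).size) ⟨[D u], [], h, ?_, by simp⟩).mono ?_ fun _ h => h
  · rintro t s ⟨τ, l, h₁, h₂, h₃⟩ he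
    cases τ with
    | nil => exact absurd h₁.stack he
    | cons w τ =>
      obtain ⟨τ', l', h₄, h₅, h₆⟩ := expandStep_spec hT hM hu huM h₁
      refine ⟨900, 1000 * (τ'.map NTerm.size).sum, ?_, Tri.block rfl (by decide)
        ⟨τ', l', h₄, h₅.trans h₂, le_rfl⟩⟩
      simp only [Expr.cost]
      omega
  · rintro t s ⟨τ, l, h₁, h₂, h₃⟩ he
    cases τ with
    | nil =>
      rw [List.flatMap_nil, List.append_nil] at h₂
      rwa [h₂] at h₁
    | cons w τ =>
      obtain ⟨p, hp, -⟩ := h₁.stack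
      simp [Expr.eval, hp] at he
  · obtain ⟨a, b, hab⟩ := hd
    simp [hab, children_op]
  · simp only [Expr.cost]
    omega

end


open OrthoPlus.Expr in
/-- The number of arguments of the function symbol of a node. -/
def arityExpr (x : Expr) : Expr := add (x.symbol 2) (add (x.symbol 3) (x.symbol 4))

open OrthoPlus.Expr in
/-- The arguments of the function symbol `rU` are put into the queue. -/
def expandApp : Cmd :=
  .seq (.set rI (const 0)) <|
  .upTo rI (arityExpr (reg rU)) <|
    enqueue (load aArg (add (load aC (reg rU)) (reg rI)))

theorem eval_arityExpr {s : Config} {e : Expr} {x : ℕ} (he : e.eval s = x) {f : FunSym}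
    (h : Holds (s.mem aIn) (s.mem aB x) (Tok.app f).encode) : (arityExpr e).eval s = f.arity := by
  have hf := holds_app h
  simp [arityExpr, Expr.eval, he, hf, FunSym.arity, Nat.add_assoc]

theorem Enqueued.refl {s₀ s : Config} {D : ℕ → NTerm} {M : ℕ} (hq : s.reg rQn = s₀.reg rQn)
    (hu : s.reg rU = s₀.reg rU) (hm : s.mem = s₀.mem)
    (h : ∀ j < s₀.reg rQn, s₀.mem aQueue j < M) : Enqueued s₀ D M [] s :=
  ⟨hq, .nil, by rwa [hq, hm], by simp [hm], by simp [hm], hu⟩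

theorem expandApp_spec {s : Config} {D : ℕ → NTerm} {M n W u : ℕ} {b : Bool} {f : FunSym}
    {z : Fin f.arity → NTerm} (hT : Table s.mem n D W M fun _ _ => True) (hM : M % 2 = 0)
    (hu : s.reg rU = u) (huM : u < M) (hz : D u = .app b f z)
    (hq : ∀ j < s.reg rQn, s.mem aQueue j < M) :
    Tri expandApp s (1000 * (f.arity + 1)) (Enqueued s D M (children (D u))) := by
  have hnode := hT.node u huM
  rw [hz, NodeOK] at hnode
  obtain ⟨-, -, h₃, -, h₅⟩ := hnode
  refine Tri.step (f.arity * (100 + 100) + 100) rfl ?_ (by simp [Cmd.cost, Expr.cost]; omega)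
  refine (Tri.upTo_const (n := f.arity) (t := 50) (I := fun i s' => s'.reg rI = i ∧
    Enqueued s D M ((List.ofFn z).take i) s') ?_ ?_ ?_ ?_).mono ?_ ?_
  · exact fun i s h => h.1
  · rintro i s' ⟨-, h⟩
    have e : Expr.eval s' (.reg rU) = u := h.u.trans hu
    exact eval_arityExpr e (by rwa [h.mem aIn (by decide), h.mem aB (by decide)])
  · rintro i s' hi ⟨h₁, h₂⟩
    have hc := h₅ ⟨i, hi⟩
    refine Tri.block rfl (by decide) ⟨by simp [enqueue, Cmd.run, h₁], by simp, ?_⟩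
    rw [List.take_add_one, List.getElem?_eq_getElem (by rwa [List.length_ofFn]), Option.toList_some,
      List.getElem_ofFn]
    have := h₂.enqueue (e := .load aArg (.add (.load aC (.reg rU)) (.reg rI)))
      (x := s.mem aArg (s.mem aC u + i)) (v := z ⟨i, hi⟩) ?_ ?_ hc.2
    · exact ⟨by simpa using this.qn, this.holds, by simpa using this.lt, this.old, this.mem,
        by simpa using this.u⟩
    · simp [Expr.eval, h₂.mem aArg (by decide), h₂.mem aC (by decide), h₂.u, hu, h₁]
    · have := hc.1
      simp only at this
      omega
  · exact ⟨by simp [Cmd.run, Expr.eval], Enqueued.refl (by simp [Cmd.run]) (by simp [Cmd.run]) rfl hq⟩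
  · simp only [Cmd.upToCost, Expr.cost, arityExpr]
    omega
  · rintro s' ⟨-, h⟩
    rw [List.take_of_length_le (by rw [List.length_ofFn])] at h
    rwa [hz, children]

open OrthoPlus.Expr in
/-- The children of the node number `rG` of the queue are put into the queue. -/
def expandNode : Cmd :=
  .seq (.seq (.set rU (load aQueue (reg rG))) (.set rS (kind (reg rU)))) <|
  .seq (.ite (eq (reg rS) (const 6)) expandApp <|
    .ite (lt (reg rS) (const 4)) .skip <|
      .seq (.seq (.write aStack (const 0) (reg rU)) (.set rSp (const 1))) expandOp) <|
  .seq (.incr rG) (.write aStart (reg rG) (reg rQn))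

theorem NTerm.size_pos (t : NTerm) : 0 < t.size := by
  cases t <;> simp [NTerm.size]

theorem length_le_sum_size (l : List NTerm) : l.length ≤ (l.map NTerm.size).sum := by
  induction l with
  | nil => simp
  | cons t l ih =>
    have := t.size_pos
    rw [List.length_cons, List.map_cons, List.sum_cons]
    omega

theorem expandNode_spec {s : Config} {D : ℕ → NTerm} {M n W u q : ℕ}
    (hT : Table s.mem n D W M fun _ _ => True) (hM : M % 2 = 0) (hq : s.reg rG = q)
    (hu : s.mem aQueue q = u) (hqn : q < s.reg rQn) (h : ∀ j < s.reg rQn, s.mem aQueue j < M) :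
    Tri expandNode s (1000 * (D u).size + 3000) fun s' =>
      Enqueued (s.setReg rU u) D M (children (D u)) s' ∧
      s'.reg rG = q + 1 ∧ s'.mem aStart = Function.update (s.mem aStart) (q + 1) (s'.reg rQn) := by
  have huM : u < M := hu ▸ h q hqn
  refine Tri.step (1000 * (D u).size + 2000) rfl ?_ (by simp [Cmd.cost, Expr.cost]; omega)
  set s₁ := (Cmd.seq (.set rU (.load aQueue (.reg rG))) (.set rS (.kind (.reg rU)))).run s with hs₁
  have e₁ : s₁.reg rU = u := by simp [hs₁, Cmd.run, Expr.eval, hq, hu]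
  have e₂ : s₁.reg rS = s₁.mem aK u := by simp [hs₁, Cmd.run, Expr.eval, hq, hu]
  have e₃ : s₁.reg rG = q := by simp [hs₁, Cmd.run, hq]
  have e₄ : s₁.mem = s.mem := rfl
  have e₅ : s₁.reg rQn = s.reg rQn := by simp [hs₁, Cmd.run]
  clear_value s₁
  have hT₁ : Table s₁.mem n D W M fun _ _ => True := by rwa [e₄]
  have hnode := hT₁.node u huM
  refine Tri.seqFrame 50 (R := Enqueued s₁ D M (children (D u))) (t₁ := 1000 * (D u).size + 1500)
    ?_ ?_ (by omega)
  · refine (Tri.ite (t := 1000 * (D u).size + 1300) (fun h₁ => ?_) fun h₁ => ?_).mono ?_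
      fun _ h => h
    · rw [Expr.eval_eq] at h₁
      simp only [Expr.eval, e₂] at h₁
      obtain ⟨b, f, z, hz⟩ := hnode.kind_six.1 h₁
      refine (expandApp_spec hT₁ hM e₁ huM hz (by rwa [e₄, e₅])).mono ?_ fun _ h => h
      have h₁ := length_le_sum_size (children (D u))
      have h₂ := sum_size_children_lt (D u)
      rw [hz, children, List.length_ofFn] at h₁
      rw [hz, children] at h₂
      rw [hz]
      omega
    · have h₁ := mt (Expr.eval_eq s₁ _ _).2 (not_not.2 h₁)
      simp only [Expr.eval, e₂] at h₁
      refine (Tri.ite (t := 1000 * (D u).size + 1200) (fun h₂ => ?_) fun h₂ => ?_).mono ?_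
        fun _ h => h
      · rw [Expr.eval_lt] at h₂
        simp only [Expr.eval, e₂] at h₂
        refine Tri.block rfl (by simp [Cmd.cost]) ?_
        have : children (D u) = [] := by
          generalize D u = t at *
          cases t <;> simp [NodeOK] at hnode <;> simp [children] <;> omega
        rw [this]
        exact Enqueued.refl rfl rfl rfl (by rwa [e₄, e₅])
      · rw [Expr.eval_lt_eq_zero] at h₂
        simp only [Expr.eval, e₂] at h₂
        have : ∃ d, IsOp d (D u) := by
          generalize D u = t at *
          cases t with
          | meet a b => exact ⟨false, a, b, rfl⟩
          | join a b => exact ⟨true, a, b, rfl⟩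
          | _ =>
            simp [NodeOK] at hnode
            omega
        obtain ⟨d, hd⟩ := this
        have hkind : s₁.mem aK u = 4 + d.toNat := by
          obtain ⟨a, b, hab⟩ := hd
          exact (hnode.of_op hab).1
        refine Tri.step (1000 * ((D u).size + 1)) rfl ?_ (by simp [Cmd.cost, Expr.cost]; omega)
        refine (expandOp_spec hT₁ hM e₁ huM hd ⟨⟨?_, .nil, ?_, ?_, ?_, ?_⟩, ?_, ?_⟩).mono le_rfl
          fun _ h => h.toEnqueued
        · simp [Cmd.run]
        · simpa [Cmd.run, e₄, e₅] using h
        · simp [Cmd.run]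
        · simp [Cmd.run]
        · simp [Cmd.run]
        · exact ⟨0, by simp [Cmd.run, Expr.eval], by simpa [Cmd.run, Expr.eval, e₁] using huM, rfl⟩
        · simpa [Cmd.run, e₂] using hkind
      · simp only [Expr.cost]
        omega
    · simp only [Expr.cost]
      omega
  · rintro s₂ h₂ hf
    have e₆ : s₂.reg rG = q := (hf.reg _ (by decide)).trans e₃
    refine Tri.block rfl (by decide) ⟨⟨?_, ?_, ?_, ?_, ?_, ?_⟩, ?_, ?_⟩
    · simp [Cmd.run, h₂.qn, e₅]
    · simpa [Cmd.run, e₅] using h₂.holds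
    · simpa [Cmd.run] using h₂.lt
    · simpa [Cmd.run, e₅, e₄] using h₂.old
    · simpa [Cmd.run, e₄] using h₂.mem
    · simp [Cmd.run, h₂.u, e₁]
    · simp [Cmd.run, Expr.eval, e₆]
    · simp [Cmd.run, Expr.eval, e₆, hf.mem aStart (by decide), e₄]

/-! ### The breadth-first queue. -/

/-- The queue holds the tree of the simplified term in breadth-first order; the children of the
first `c` of the `n` entries have been found. -/
structure QueueOK (m : ℕ → ℕ → ℕ) (D : ℕ → NTerm) (M c n : ℕ) (t : NTerm) : Prop where
  lt : ∀ j < n, m aQueue j < M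
  root : D (m aQueue 0) = t
  first : m aStart 0 = 1
  last : m aStart c = n
  before : ∀ j < c, j < m aStart j
  start : ∀ j < c, m aStart (j + 1) = m aStart j + (children (D (m aQueue j))).length ∧
    m aStart (j + 1) ≤ n
  child : ∀ j < c, Holds (fun i => D (m aQueue i)) (m aStart j) (children (D (m aQueue j)))
  le : c ≤ n
  size : ∀ j < n, (D (m aQueue j)).size ≤ t.size

theorem Holds.sum_Ico {α : Type*} {f : ℕ → α} {p : ℕ} {l : List α} (h : Holds f p l) (g : α → ℕ) :
    ∑ j ∈ Finset.Ico p (p + l.length), g (f j) = (l.map g).sum := by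
  induction l generalizing p with
  | nil => simp
  | cons a l ih =>
    rw [cons_iff] at h
    rw [Finset.sum_eq_sum_Ico_succ_bot (by simp), List.length_cons,
      show p + (l.length + 1) = p + 1 + l.length by omega, ih h.2, h.1, List.map_cons,
      List.sum_cons]

open OrthoPlus.Expr in
/-- Compute the tree of the simplified term. -/
def buildQueue : Cmd :=
  .seq (.seq (.write aQueue (const 0) (load aStack (const 0))) <| .seq (.set rQn (const 1)) <|
    .seq (.set rG (const 0)) (.write aStart (const 0) (const 1))) <|
  .whileDo (lt (reg rG) (reg rQn)) expandNode

/-- Each entry is expanded in time linear in its size, which is at most the size of the root, and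
there are at most that many entries. -/
theorem buildQueue_spec {s : Config} {D : ℕ → NTerm} {L N : ℕ} {t : NTerm}
    (h : Store s D L N [t]) : Tri buildQueue s (10000 * ((t.size + 1) * (t.size + 1))) fun s' =>
      ∃ n ≤ t.size, 0 < n ∧ s'.reg rQn = n ∧ QueueOK s'.mem D (2 * N) n n t ∧
        Table s'.mem (s.reg rArg) D (2 * L) (2 * N) fun _ _ => True := by
  obtain ⟨_, hp, ⟨h₁, h₂⟩, rfl⟩ := h.stack
  refine Tri.step (5000 * (t.size * (t.size + 1)) + 50) rfl ?_ ?_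
  -- The sizes of the unexpanded entries plus the number `c` of expanded ones never exceed `t.size`,
  -- because the children of a node have a smaller total size than the node. This bounds the length
  -- of the queue.
  · refine (Tri.while_of (Q := fun s' => ∃ n ≤ t.size, 0 < n ∧ s'.reg rQn = n ∧
      QueueOK s'.mem D (2 * N) n n t ∧
        Table s'.mem (s.reg rArg) D (2 * L) (2 * N) fun _ _ => True)
      (fun b s' => ∃ c n, s'.reg rG = c ∧ s'.reg rQn = n ∧ 0 < n ∧
        QueueOK s'.mem D (2 * N) c n t ∧
        (Table s'.mem (s.reg rArg) D (2 * L) (2 * N) fun _ _ => True) ∧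
        ∑ j ∈ Finset.Ico c n, (D (s'.mem aQueue j)).size + c ≤ t.size ∧
        5000 * ((t.size - c) * (t.size + 1)) ≤ b) ?_ ?_ (t := 5000 * (t.size * (t.size + 1)))
      ⟨0, 1, ?_, ?_, by omega, ⟨?_, ?_, ?_, ?_, ?_, ?_, ?_, ?_, ?_⟩, ?_, ?_, ?_⟩).mono ?_ fun _ h => h
    · rintro b s' ⟨c, n, k₁, k₂, k₃, k₄, k₅, k₆, k₇⟩ he
      rw [Expr.eval_lt] at he
      simp only [Expr.eval, k₁, k₂] at he
      have hsz := (D (s'.mem aQueue c)).size_pos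
      rw [Finset.sum_eq_sum_Ico_succ_bot he] at k₆
      refine ⟨1000 * t.size + 3000, 5000 * ((t.size - (c + 1)) * (t.size + 1)), ?_,
        (expandNode_spec k₅ (by omega) k₁ rfl (by omega) (by rw [k₂]; exact k₄.lt)).mono (by omega) ?_⟩
      · obtain ⟨k, hk⟩ : ∃ k, t.size - c = k + 1 := ⟨t.size - c - 1, by omega⟩
        rw [hk, Nat.add_mul, Nat.mul_add 5000] at k₇
        rw [show t.size - (c + 1) = k by omega]
        simp only [Expr.cost]
        omega
      · rintro s'' ⟨hE, hG, hS⟩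
        have hq := hE.qn
        have hH := hE.holds
        have hO := hE.old
        simp only [Config.reg_setReg, Config.mem_setReg, Nat.reduceEqDiff, ↓reduceIte, k₂] at hq hH hO
        have hc := k₄.before
        have hQc := hO c he
        have hS' : ∀ j ≤ c, s''.mem aStart j = s'.mem aStart j := fun j hj => by
          rw [hS, Function.update_of_ne (by omega)]
        have hsum := sum_size_children_lt (D (s'.mem aQueue c))
        refine ⟨c + 1, n + (children (D (s'.mem aQueue c))).length, hG, hq, by omega,
          ⟨by rw [← hq]; exact hE.lt, ?_, ?_, ?_, ?_, ?_, ?_, by omega, ?_⟩, k₅.congr hE.mem, ?_, le_rfl⟩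
        · rw [hO 0 (by omega)]
          exact k₄.root
        · rw [hS' 0 (by omega)]
          exact k₄.first
        · rw [hS, Function.update_self, hq]
        · intro j hj
          rw [hS' j (by omega)]
          obtain hj | rfl : j < c ∨ j = c := by omega
          · exact hc j hj
          · rw [k₄.last]
            exact he
        · intro j hj
          rw [hS' j (by omega)]
          obtain hj | rfl : j < c ∨ j = c := by omega
          · have := k₄.start j hj
            rw [hS' _ (by omega), hO j (by omega)]
            exact ⟨this.1, by omega⟩
          · rw [hS, Function.update_self, hq, k₄.last, hO j he]
            exact ⟨rfl, le_rfl⟩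
        · intro j hj
          rw [hS' j (by omega)]
          obtain hj | rfl : j < c ∨ j = c := by omega
          · have := k₄.start j hj
            rw [hO j (by omega)]
            exact (k₄.child j hj).congr fun i _ hi => by rw [hO i (by omega)]
          · rw [k₄.last, hO j he]
            exact hH
        · intro j hj
          by_cases hjn : j < n
          · rw [hO j hjn]
            exact k₄.size j hjn
          · obtain ⟨i, rfl⟩ := Nat.exists_eq_add_of_le (not_lt.1 hjn)
            have hi := hH i (by omega)
            simp only at hi
            rw [hi]
            have h₃ := List.single_le_sum (fun _ _ => Nat.zero_le _) _
              (List.mem_map_of_mem (f := NTerm.size) (List.getElem_mem (n := i)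
                (l := children (D (s'.mem aQueue c))) (by omega)))
            have := k₄.size c he
            omega
        · rw [← Finset.sum_Ico_consecutive _ (show c + 1 ≤ n by omega) (Nat.le_add_right _ _),
            hH.sum_Ico NTerm.size]
          have : ∑ i ∈ Finset.Ico (c + 1) n, (D (s''.mem aQueue i)).size =
              ∑ i ∈ Finset.Ico (c + 1) n, (D (s'.mem aQueue i)).size :=
            Finset.sum_congr rfl fun i hi => by rw [hO i (Finset.mem_Ico.1 hi).2]
          omega
    · rintro b s' ⟨c, n, k₁, k₂, k₃, k₄, k₅, k₆, k₇⟩ he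
      rw [Expr.eval_lt_eq_zero] at he
      simp only [Expr.eval, k₁, k₂] at he
      obtain rfl : c = n := le_antisymm k₄.le he
      exact ⟨c, by omega, k₃, k₂, k₄, k₅⟩
    · simp [Cmd.run, Expr.eval]
    · simp [Cmd.run, Expr.eval]
    · simpa [Cmd.run, Expr.eval] using h₁
    · simpa [Cmd.run, Expr.eval] using h₂
    · simp [Cmd.run, Expr.eval]
    · simp [Cmd.run, Expr.eval]
    · simp
    · simp
    · simp
    · simp
    · simp [Cmd.run, Expr.eval, h₂]
    · exact h.table.congr (by simp [Cmd.run])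
    · simp [Cmd.run, Expr.eval, h₂]
    · simp
    · simp only [Expr.cost]
      omega
  · simp only [Cmd.cost, Expr.cost]
    nlinarith [t.size_pos]


/-! ### Texts -/

/-- The text with the number `j` is `w`. -/
def TextAt (m : ℕ → ℕ → ℕ) (j : ℕ) (w : List ℕ) : Prop :=
  Holds (m aText) (m aPos j) w ∧ m aLen j = w.length

open OrthoPlus.Expr in
/-- The letter number `rOff` of a text. -/
def letter (x : Expr) : Expr := load aText (add (load aPos x) (reg rOff))

open OrthoPlus.Expr in
/-- Whether the text `rX` is smaller than the text `rY`. -/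
def textLt : Cmd :=
  .seq (.set rOff (const 0)) <|
  .seq (.whileDo (and (lt (reg rOff) (load aLen (reg rX))) (and (lt (reg rOff) (load aLen (reg rY)))
      (eq (letter (reg rX)) (letter (reg rY))))) (.incr rOff)) <|
  .set rRes (and (lt (reg rOff) (load aLen (reg rY)))
    (or (not (lt (reg rOff) (load aLen (reg rX)))) (lt (letter (reg rX)) (letter (reg rY)))))

theorem TextAt.letter {s : Config} {j p : ℕ} {w : List ℕ} (h : TextAt s.mem j w) {x : Expr}
    (hx : x.eval s = j) (hp : s.reg rOff = p) (hlt : p < w.length) :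
    (letter x).eval s = w[p] := by
  simp [OrthoPlus.letter, Expr.eval, hx, hp, h.1 p hlt]

/-- The scan stops at the end of either text, so its time can be charged to the second text alone.
When ranks are computed, that is the text held fixed. -/
theorem textLt_spec : ∃ C, ∀ (s : Config) (x y : ℕ) (w v : List ℕ), s.reg rX = x → s.reg rY = y →
    TextAt s.mem x w → TextAt s.mem y v →
    Tri textLt s (C * (v.length + 1)) fun s' => (s'.reg rRes ≠ 0 ↔ w < v) ∧ s'.mem = s.mem := by
  refine ⟨1000, fun s x y w v hx hy hw hv => ?_⟩
  refine Tri.step (500 * v.length + 500) rfl ?_ (by simp only [Cmd.cost, Expr.cost]; omega)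
  set e : Expr := .and (.lt (.reg rOff) (.load aLen (.reg rX)))
    (.and (.lt (.reg rOff) (.load aLen (.reg rY))) (.eq (letter (.reg rX)) (letter (.reg rY))))
    with he
  refine Tri.seqFrame 100 (R := fun s' => ∃ p, s'.reg rOff = p ∧ p ≤ w.length ∧ p ≤ v.length ∧
      (w < v ↔ w.drop p < v.drop p) ∧ s'.mem = s.mem ∧ s'.reg rX = x ∧ s'.reg rY = y ∧
      e.eval s' = 0) (t₁ := 500 * v.length + 300) ?_ ?_ (by omega)
  · refine (Tri.while_of (Q := fun s' => ∃ p, s'.reg rOff = p ∧ p ≤ w.length ∧ p ≤ v.length ∧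
      (w < v ↔ w.drop p < v.drop p) ∧ s'.mem = s.mem ∧ s'.reg rX = x ∧ s'.reg rY = y ∧
      e.eval s' = 0) (fun t s' => ∃ p, s'.reg rOff = p ∧ p ≤ w.length ∧ p ≤ v.length ∧
      (w < v ↔ w.drop p < v.drop p) ∧ s'.mem = s.mem ∧ s'.reg rX = x ∧ s'.reg rY = y ∧
      500 * (v.length - p) ≤ t) ?_ ?_ (t := 500 * v.length)
      ⟨0, ?_, Nat.zero_le _, Nat.zero_le _, Iff.rfl, ?_, ?_, ?_, le_rfl⟩).mono ?_ fun _ h => h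
    · rintro t s' ⟨p, h₁, h₂, h₃, h₄, h₅, h₆, h₇, h₈⟩ hc
      rw [he, Expr.eval_and, Expr.eval_and, Expr.eval_lt, Expr.eval_lt, Expr.eval_eq] at hc
      simp only [Expr.eval, h₁, h₅, h₆, h₇, hw.2, hv.2] at hc
      obtain ⟨hpw, hpv, hc⟩ := hc
      rw [← h₅] at hw hv
      rw [hw.letter (x := .reg rX) h₆ h₁ hpw, hv.letter (x := .reg rY) h₇ h₁ hpv] at hc
      refine ⟨20, 500 * (v.length - (p + 1)), ?_, Tri.block rfl (by decide)
        ⟨p + 1, by simp [Cmd.run, Expr.eval, h₁], hpw, hpv, ?_, h₅, by simpa [Cmd.run] using h₆,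
          by simpa [Cmd.run] using h₇, le_rfl⟩⟩
      · simp only [he, Expr.cost, letter]
        omega
      · rw [h₄, List.drop_eq_getElem_cons hpw, List.drop_eq_getElem_cons hpv, hc,
          List.cons_lt_cons_self]
    · rintro t s' ⟨p, h₁, h₂, h₃, h₄, h₅, h₆, h₇, h₈⟩ hc
      exact ⟨p, h₁, h₂, h₃, h₄, h₅, h₆, h₇, hc⟩
    · simp [Cmd.run, Expr.eval]
    · simp [Cmd.run]
    · simpa [Cmd.run] using hx
    · simpa [Cmd.run] using hy
    · simp only [he, Expr.cost, letter]
      omega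
  · rintro s' ⟨p, h₁, h₂, h₃, h₄, h₅, h₆, h₇, hc⟩ -
    refine Tri.block rfl (by decide) ⟨?_, h₅⟩
    have hc' := mt (Expr.eval_and s' _ _).2 (not_not.2 hc)
    rw [Expr.eval_and, Expr.eval_lt, Expr.eval_lt, Expr.eval_eq] at hc'
    rw [Cmd.run, Config.reg_setReg, if_pos rfl, Expr.eval_and, Expr.eval_lt, Expr.eval_or,
      Expr.eval_not, Expr.eval_lt_eq_zero, Expr.eval_lt, h₄]
    have hlw : Expr.eval s' (.load aLen (.reg rX)) = w.length := by
      simp only [Expr.eval, h₅, h₆, hw.2]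
    have hlv : Expr.eval s' (.load aLen (.reg rY)) = v.length := by
      simp only [Expr.eval, h₅, h₇, hv.2]
    have hp : Expr.eval s' (.reg rOff) = p := h₁
    rw [hlw, hlv, hp] at hc' ⊢
    rw [← h₅] at hw hv
    rcases h₃.lt_or_eq with hpv | rfl
    · rcases h₂.lt_or_eq with hpw | rfl
      · rw [hw.letter (x := .reg rX) h₆ h₁ hpw, hv.letter (x := .reg rY) h₇ h₁ hpv] at hc' ⊢
        rw [List.drop_eq_getElem_cons hpw, List.drop_eq_getElem_cons hpv, List.cons_lt_cons_iff]
        have : w[p] ≠ v[p] := fun h => hc' ⟨hpw, hpv, h⟩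
        exact ⟨fun h => .inl (h.2.resolve_left (by omega)),
          fun h => ⟨hpv, .inr (h.resolve_right fun h => this h.1)⟩⟩
      · have : [] < v.drop w.length := by
          rw [List.drop_eq_getElem_cons hpv]
          exact List.nil_lt_cons _ _
        simpa [hpv] using this
    · simp

/-! ### Output of texts -/

open OrthoPlus.Expr in
/-- Append a letter to the text under construction. -/
def emit (e : Expr) : Cmd := .seq (.write aText (reg rTp) e) (.incr rTp)

open OrthoPlus.Expr in
/-- Append the text `rV` to the text under construction. -/
def copyText : Cmd :=
  .seq (.set rOff (const 0)) <| .upTo rOff (load aLen (reg rV)) (emit (letter (reg rV)))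

/-- The letters `w` have been written since `s₀`. -/
structure Emitted (s₀ : Config) (w : List ℕ) (s : Config) : Prop where
  tp : s.reg rTp = s₀.reg rTp + w.length
  holds : Holds (s.mem aText) (s₀.reg rTp) w
  old : ∀ j < s₀.reg rTp, s.mem aText j = s₀.mem aText j
  mem : ∀ a ≠ aText, s.mem a = s₀.mem a

namespace Emitted

variable {s₀ s s' : Config} {w v : List ℕ}

theorem of_eq (ht : s.reg rTp = s₀.reg rTp) (hm : s.mem = s₀.mem) : Emitted s₀ [] s :=
  ⟨ht, .nil, fun _ _ => by rw [hm], fun _ _ => by rw [hm]⟩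

theorem congr (h : Emitted s₀ w s) (ht : s'.reg rTp = s.reg rTp) (hm : s'.mem = s.mem) :
    Emitted s₀ w s' :=
  ⟨ht.trans h.tp, by rw [hm]; exact h.holds, by rw [hm]; exact h.old, by rw [hm]; exact h.mem⟩

theorem emit (h : Emitted s₀ w s) {e : Expr} {c : ℕ} (he : e.eval s = c) :
    Emitted s₀ (w ++ [c]) ((emit e).run s) := by
  have hm : ((OrthoPlus.emit e).run s).mem aText =
      Function.update (s.mem aText) (s₀.reg rTp + w.length) c := by
    simp [OrthoPlus.emit, Cmd.run, Expr.eval, he, h.tp]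
  refine ⟨?_, ?_, fun j hj => ?_, fun a ha => ?_⟩
  · simp [OrthoPlus.emit, Cmd.run, Expr.eval, h.tp, Nat.add_assoc]
  · rw [hm]
    exact h.holds.snoc
  · rw [hm, Function.update_of_ne (by omega), h.old j hj]
  · simp [OrthoPlus.emit, Cmd.run, ha, h.mem a ha]

theorem trans (h : Emitted s₀ w s) (h' : Emitted s v s') : Emitted s₀ (w ++ v) s' := by
  have ht := h.tp
  refine ⟨?_, Holds.append_iff.2 ⟨h.holds.congr fun i _ hi => h'.old i (by omega), ?_⟩,
    fun j hj => (h'.old j (by omega)).trans (h.old j hj),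
    fun a ha => (h'.mem a ha).trans (h.mem a ha)⟩
  · rw [h'.tp, ht, List.length_append, Nat.add_assoc]
  · rw [← ht]
    exact h'.holds

theorem textAt (h : Emitted s₀ w s) {j : ℕ} (ht : TextAt s₀.mem j v)
    (hj : s₀.mem aPos j + s₀.mem aLen j ≤ s₀.reg rTp) : TextAt s.mem j v := by
  rw [TextAt, h.mem aPos (by decide), h.mem aLen (by decide)]
  refine ⟨ht.1.congr fun i _ hi => h.old i ?_, ht.2⟩
  rw [ht.2] at hj
  omega

end Emitted

theorem copyText_spec : ∃ C, ∀ (s : Config) (j : ℕ) (v : List ℕ), s.reg rV = j →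
    TextAt s.mem j v → s.mem aPos j + s.mem aLen j ≤ s.reg rTp →
    Tri copyText s (C * (v.length + 1)) (Emitted s v) := by
  refine ⟨300, fun s j v hj hv hle => ?_⟩
  refine Tri.step (v.length * (100 + 100) + 100) rfl ?_ (by simp only [Cmd.cost, Expr.cost]; omega)
  refine (Tri.upTo_const (n := v.length) (t := 100) (I := fun i s' => s'.reg rOff = i ∧
    s'.reg rV = j ∧ Emitted s (v.take i) s') ?_ ?_ ?_ ?_).mono ?_ ?_
  · exact fun i s h => h.1
  · rintro i s' ⟨-, h₂, h₃⟩
    simp only [Expr.eval, h₂, h₃.mem aLen (by decide), hv.2]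
  · rintro i s' hi ⟨h₁, h₂, h₃⟩
    refine Tri.block rfl (by decide) ⟨by simp [emit, Cmd.run, h₁], by simp,
      by simp [emit, Cmd.run, h₂], ?_⟩
    rw [List.take_add_one, List.getElem?_eq_getElem hi, Option.toList_some]
    refine (h₃.emit ((h₃.textAt hv hle).letter (x := .reg rV) h₂ h₁ hi)).congr ?_ rfl
    simp
  · exact ⟨by simp [Cmd.run, Expr.eval], by simpa [Cmd.run] using hj,
      Emitted.of_eq (by simp [Cmd.run]) rfl⟩
  · simp only [Cmd.upToCost, Expr.cost]
    omega
  · rintro s' ⟨-, -, h⟩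
    rwa [List.take_length] at h


/-! ### Sorting -/

-- The antichain is defined with indices of a list, whereas the program marks offsets in the queue;
-- this translates between the two.
open Classical in
theorem antichain_map_range (le : NTerm → NTerm → Prop) (g : ℕ → NTerm) (k : ℕ)
    (P : ℕ → Bool) (hP : ∀ i < k, P i = true ↔
      ¬ ∃ j < k, le (g i) (g j) ∧ (¬ le (g j) (g i) ∨ j < i)) :
    antichain le ((List.range k).map g) = ((List.range k).filter P).map g := by
  have h : ∀ i : Fin ((List.range k).map g).length,
      decide (¬ ∃ j : Fin ((List.range k).map g).length,
        le (((List.range k).map g).get i) (((List.range k).map g).get j) ∧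
        (¬ le (((List.range k).map g).get j) (((List.range k).map g).get i) ∨ j < i)) = P i := by
    intro i
    have hi : i.1 < k := by simpa using i.2
    rw [Bool.eq_iff_iff, decide_eq_true_iff, hP i hi]
    refine not_congr ⟨?_, ?_⟩
    · rintro ⟨j, h₁, h₂⟩
      exact ⟨j, by simpa using j.2, by simpa using h₁, by simpa using h₂⟩
    · rintro ⟨j, hj, h₁, h₂⟩
      exact ⟨⟨j, by simpa using hj⟩, by simpa using h₁, by simpa [Fin.lt_def] using h₂⟩
  have hr : List.range k = (List.finRange ((List.range k).map g).length).map (↑·) := by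
    rw [List.map_coe_finRange_eq_range]
    simp
  rw [antichain, List.filter_congr fun i _ => h i]
  conv_rhs => rw [hr]
  rw [List.filter_map, List.map_map]
  refine List.map_congr_left fun i _ => ?_
  simp

/-- In a strictly increasing list, the members smaller than a given one are exactly those in front
of it. -/
theorem countP_lt_getElem {α β : Type*} [LinearOrder β] (g : α → β) {l : List α}
    (h : l.Pairwise fun x y => g x < g y) {r : ℕ} (hr : r < l.length) :
    l.countP (fun x => g x < g l[r]) = r := by
  induction l generalizing r with
  | nil => simp at hr
  | cons a l ih =>
    rw [List.pairwise_cons] at h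
    cases r with
    | zero =>
      simp only [List.getElem_cons_zero, List.countP_eq_zero, decide_eq_true_eq, not_lt]
      exact List.forall_mem_cons.2 ⟨le_rfl, fun x hx => (h.1 x hx).le⟩
    | succ r =>
      rw [List.getElem_cons_succ, List.countP_cons_of_pos, ih h.2]
      exact decide_eq_true (h.1 _ (List.getElem_mem _))

/-- The position of the member number `i` in the sorted list. -/
def rank (F : List ℕ) (w : ℕ → List ℕ) (i : ℕ) : ℕ := F.countP fun j => w j < w i

/-- Distinct terms have distinct texts, so the sorted list is strictly increasing and counting
smaller texts gives the position in it. -/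
theorem rank_spec {F : List ℕ} {g : ℕ → NTerm} (hn : (F.map g).Nodup) {r : ℕ}
    (hr : r < (sortTerms (F.map g)).length) :
    ∃ i ∈ F, rank F (fun i => (g i).toTerm.encode) i = r ∧ g i = (sortTerms (F.map g))[r] := by
  have hp := sortTerms_perm (F.map g)
  obtain ⟨i, hi, hgi⟩ := List.mem_map.1 (hp.mem_iff.1 (List.getElem_mem hr))
  refine ⟨i, hi, ?_, hgi⟩
  have hlt : (sortTerms (F.map g)).Pairwise fun s t => s.toTerm.encode < t.toTerm.encode :=
    (List.Pairwise.and (pairwise_sortTerms _) (hp.nodup_iff.2 hn)).imp fun h =>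
      lt_of_le_of_ne h.1 fun h' => h.2 (toTerm_injective (encode_injective h'))
  have h := countP_lt_getElem (fun t : NTerm => t.toTerm.encode) hlt hr
  rw [hp.countP_eq, List.countP_map, ← hgi] at h
  exact (List.countP_congr (by simp)).trans h

theorem rank_inj {F : List ℕ} {g : ℕ → NTerm} (hn : (F.map g).Nodup) {i j : ℕ} (hi : i ∈ F)
    (hj : j ∈ F) (h : rank F (fun i => (g i).toTerm.encode) i =
      rank F (fun i => (g i).toTerm.encode) j) : i = j := by
  have hp := sortTerms_perm (F.map g)
  have key : ∀ i ∈ F, ∃ r, ∃ hr : r < (sortTerms (F.map g)).length,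
      (sortTerms (F.map g))[r] = g i ∧ rank F (fun i => (g i).toTerm.encode) i = r := by
    intro i hi
    obtain ⟨r, hr, h⟩ := List.getElem_of_mem (hp.mem_iff.2 (List.mem_map_of_mem hi))
    obtain ⟨i', hi', h₁, h₂⟩ := rank_spec hn hr
    obtain rfl := List.inj_on_of_nodup_map hn hi' hi (h₂.trans h)
    exact ⟨r, hr, h, h₁⟩
  obtain ⟨r, hr, h₁, h₂⟩ := key i hi
  obtain ⟨r', hr', h₃, h₄⟩ := key j hj
  obtain rfl : r = r' := by omega
  exact List.inj_on_of_nodup_map hn hi hj (h₁.symm.trans h₃)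

/-- The words of a list with the letter `c` before each of them but the last. -/
def joinText (c : ℕ) : List (List ℕ) → List ℕ
  | [] => []
  | w :: l => (if l = [] then [] else [c]) ++ (w ++ joinText c l)

/-- Bracketing to the right puts one operation sign in front of every member except the last. -/
theorem encode_big (d : Bool) {l : List NTerm} (hl : l ≠ []) :
    (big d l).toTerm.encode = joinText (4 + d.toNat) (l.map fun t => t.toTerm.encode) := by
  induction l with
  | nil => exact absurd rfl hl
  | cons t l ih =>
    cases l with
    | nil => simp [big_singleton, joinText]
    | cons u l =>
      rw [big_cons_cons, List.map_cons, joinText, ← ih (List.cons_ne_nil _ _)]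
      cases d <;> simp [op, NTerm.toTerm, Term.encode]


/-! ### Joins and meets in normal form -/

open OrthoPlus.Expr in
/-- The node number `e` among the children under consideration. -/
def childExpr (e : Expr) : Expr := load aQueue (add (reg rP) e)

open OrthoPlus.Expr in
/-- Mark the children that belong to the antichain. -/
def flagAll : Cmd :=
  .seq (.set rI (const 0)) <|
  .upTo rI (reg rQ) <|
    .seq (.seq (.write aFlag (reg rI) (const 1)) (.set rJ (const 0))) <|
    .upTo rJ (reg rQ) <|
      .ite (and (leExpr (childExpr (reg rI)) (childExpr (reg rJ)))
          (or (not (leExpr (childExpr (reg rJ)) (childExpr (reg rI)))) (lt (reg rJ) (reg rI))))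
        (.write aFlag (reg rI) (const 0)) .skip

theorem flagAll_spec : ∃ C, ∀ (s : Config) (D : ℕ → NTerm) (n W M p k : ℕ) (d : Bool),
    (Table s.mem n D W M fun _ _ => True) → s.reg rP = p → s.reg rQ = k →
    s.reg rS = 4 + d.toNat → (∀ i < k, s.mem aQueue (p + i) < M) →
    Tri flagAll s (C * ((k + 1) * (k + 1))) fun s' => ∀ i < k, s'.mem aFlag i ≠ 0 ↔
      ¬ ∃ j < k, LeD d (D (s.mem aQueue (p + i))) (D (s.mem aQueue (p + j))) ∧
        (¬ LeD d (D (s.mem aQueue (p + j))) (D (s.mem aQueue (p + i))) ∨ j < i) := by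
  refine ⟨2000, fun s D n W M p k d hT hp hk hd hM => ?_⟩
  set B : ℕ → ℕ → Prop := fun i j => LeD d (D (s.mem aQueue (p + i))) (D (s.mem aQueue (p + j))) ∧
    (¬ LeD d (D (s.mem aQueue (p + j))) (D (s.mem aQueue (p + i))) ∨ j < i) with hB
  set J : Config → Prop := fun s' => s'.reg rP = p ∧ s'.reg rQ = k ∧ s'.reg rS = 4 + d.toNat ∧
    ∀ a ≠ aFlag, s'.mem a = s.mem a with hJ
  refine Tri.step (k * (k * 700 + 700 + 100) + 100) rfl ?_ (by
    simp only [Cmd.cost, Expr.cost]; nlinarith)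
  refine (Tri.upTo_const (n := k) (t := k * 700 + 700) (I := fun i s' => s'.reg rI = i ∧ J s' ∧
    ∀ i' < i, s'.mem aFlag i' ≠ 0 ↔ ¬ ∃ j < k, B i' j) ?_ ?_ ?_ ?_).mono ?_ ?_
  · exact fun i s h => h.1
  · exact fun i s h => h.2.1.2.1
  · rintro i s₁ hi ⟨h₁, ⟨h₂, h₃, h₄, h₅⟩, h₆⟩
    refine Tri.step (k * 700 + 600) rfl ?_ (by simp only [Cmd.cost, Expr.cost]; omega)
    refine (Tri.upTo_const (n := k) (t := 600) (I := fun jj s' => s'.reg rJ = jj ∧ s'.reg rI = i ∧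
      J s' ∧ (∀ i' < i, s'.mem aFlag i' ≠ 0 ↔ ¬ ∃ j < k, B i' j) ∧
      (s'.mem aFlag i ≠ 0 ↔ ¬ ∃ j < jj, B i j)) ?_ ?_ ?_ ?_).mono ?_ ?_
    · exact fun i s h => h.1
    · exact fun i s h => h.2.2.1.2.1
    · rintro jj s₂ hjj ⟨k₁, k₂, ⟨k₃, k₄, k₅, k₆⟩, k₇, k₈⟩
      refine Tri.block rfl (by decide) ?_
      have hT₂ : Table s₂.mem n D W M fun _ _ => True := hT.congr fun a ha => k₆ a (by
        rintro rfl
        revert ha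
        decide)
      have eI : (childExpr (.reg rI)).eval s₂ = s.mem aQueue (p + i) := by
        simp [childExpr, Expr.eval, k₂, k₃, k₆ aQueue (by decide)]
      have eJ : (childExpr (.reg rJ)).eval s₂ = s.mem aQueue (p + jj) := by
        simp [childExpr, Expr.eval, k₁, k₃, k₆ aQueue (by decide)]
      have hc : (Expr.and (leExpr (childExpr (.reg rI)) (childExpr (.reg rJ)))
          (.or (.not (leExpr (childExpr (.reg rJ)) (childExpr (.reg rI))))
            (.lt (.reg rJ) (.reg rI)))).eval s₂ ≠ 0 ↔ B i jj := by
        have e := leExpr_iff hT₂ eI eJ (hM i hi) (hM jj hjj) k₅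
        have e' := leExpr_iff hT₂ eJ eI (hM jj hjj) (hM i hi) k₅
        have e'' := not_iff_not.2 e'
        rw [ne_eq, not_not] at e''
        rw [Expr.eval_and, Expr.eval_or, Expr.eval_not, Expr.eval_lt, e, e'']
        simp only [Expr.eval, k₁, k₂]
        exact Iff.rfl
      have hsucc : (∃ j < jj + 1, B i j) ↔ (∃ j < jj, B i j) ∨ B i jj := by
        simp only [Nat.lt_succ_iff_lt_or_eq, or_and_right, exists_or, exists_eq_left]
      rw [Cmd.run]
      by_cases hb : B i jj
      · rw [if_neg (hc.2 hb)]
        refine ⟨by simp [Cmd.run, k₁], by simp, by simp [Cmd.run, k₂], ?_, ?_, ?_⟩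
        · refine ⟨by simp [Cmd.run, k₃], by simp [Cmd.run, k₄], by simp [Cmd.run, k₅], ?_⟩
          intro a ha
          simp [Cmd.run, ha, k₆ a ha]
        · intro i' hi'
          simp only [Cmd.run, Expr.eval, k₂, Config.mem_setReg, Config.mem_setMem, ↓reduceIte]
          rw [Function.update_of_ne hi'.ne, k₇ i' hi']
        · rw [hsucc]
          simp [Cmd.run, Expr.eval, k₂, hb]
      · rw [if_pos (not_not.1 (mt hc.1 hb))]
        refine ⟨by simp [Cmd.run, k₁], by simp, by simp [Cmd.run, k₂], ?_, k₇, ?_⟩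
        · exact ⟨by simp [Cmd.run, k₃], by simp [Cmd.run, k₄], by simp [Cmd.run, k₅], k₆⟩
        · rw [hsucc, or_iff_left hb]
          exact k₈
    · refine ⟨by simp [Cmd.run, Expr.eval], by simp [Cmd.run, h₁], ?_, ?_, ?_⟩
      · refine ⟨by simp [Cmd.run, h₂], by simp [Cmd.run, h₃], by simp [Cmd.run, h₄], ?_⟩
        intro a ha
        simp [Cmd.run, ha, h₅ a ha]
      · intro i' hi'
        simp only [Cmd.run, Expr.eval, h₁, Config.mem_setReg, Config.mem_setMem, ↓reduceIte]
        rw [Function.update_of_ne hi'.ne, h₆ i' hi']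
      · simp [Cmd.run, Expr.eval, h₁]
    · simp only [Cmd.upToCost, Expr.cost]
      omega
    · rintro s₂ ⟨k₁, k₂, k₃, k₄, k₅⟩
      refine ⟨k₂, by simp, ?_, ?_⟩
      · exact ⟨by simp [k₃.1], by simp [k₃.2.1], by simp [k₃.2.2.1], k₃.2.2.2⟩
      · intro i' hi'
        obtain hi' | rfl : i' < i ∨ i' = i := by omega
        · exact k₄ i' hi'
        · exact k₅
  · refine ⟨by simp [Cmd.run, Expr.eval], ?_, by simp⟩
    exact ⟨by simpa [Cmd.run] using hp, by simpa [Cmd.run] using hk, by simpa [Cmd.run] using hd,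
      fun _ _ => rfl⟩
  · simp only [Cmd.upToCost, Expr.cost]
    gcongr <;> omega
  · exact fun s' h => h.2.2

/-! ### Sorting by counting smaller texts. -/

open OrthoPlus.Expr in
/-- Compute the position of the child `rI` in the sorted list. -/
def rankOne : Cmd :=
  .seq (.seq (.set rM (const 0)) (.seq (.set rJ (const 0)) (.set rY (add (reg rP) (reg rI))))) <|
  .upTo rJ (reg rQ) <|
    .ite (load aFlag (reg rJ))
      (.seq (.set rX (add (reg rP) (reg rJ))) (.seq textLt (.ite (reg rRes) (.incr rM) .skip)))
      .skip

open OrthoPlus.Expr in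
/-- Sort the marked children by their texts. -/
def rankAll : Cmd :=
  .seq (.seq (.set rI (const 0)) (.set rW (const 0))) <|
  .upTo rI (reg rQ) <|
    .ite (load aFlag (reg rI))
      (.seq rankOne (.seq (.write aSort (reg rM) (reg rI)) (.incr rW))) .skip

theorem rankOne_spec : ∃ C, ∀ (s : Config) (p k i : ℕ) (w : ℕ → List ℕ), s.reg rP = p →
    s.reg rQ = k → s.reg rI = i → i < k → (∀ j < k, TextAt s.mem (p + j) (w j)) →
    Tri rankOne s (C * ((k + 1) * ((w i).length + 1))) fun s' => s'.mem = s.mem ∧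
      s'.reg rM = rank ((List.range k).filter fun j => s.mem aFlag j ≠ 0) w i := by
  obtain ⟨C, hC⟩ := textLt_spec
  refine ⟨C + 500, fun s p k i w hp hk hi hik hw => ?_⟩
  refine Tri.step (k * (C * ((w i).length + 1) + 200 + 100) + 100) rfl ?_ (by
    simp only [Cmd.cost, Expr.cost]
    nlinarith [Nat.zero_le (k * (w i).length), Nat.zero_le (C * (w i).length)])
  refine (Tri.upTo_const (n := k) (t := C * ((w i).length + 1) + 200) (I := fun jj s' =>
    s'.reg rJ = jj ∧ s'.reg rY = p + i ∧ s'.reg rP = p ∧ s'.reg rQ = k ∧ s'.mem = s.mem ∧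
    s'.reg rM = rank ((List.range jj).filter fun j => s.mem aFlag j ≠ 0) w i) ?_ ?_ ?_ ?_).mono ?_ ?_
  · exact fun i s h => h.1
  · exact fun i s h => h.2.2.2.1
  · rintro jj s₁ hjj ⟨h₁, h₂, h₃, h₄, h₅, h₆⟩
    refine (Tri.ite (t := C * ((w i).length + 1) + 150) (fun hf => ?_) fun hf => ?_).mono ?_
      fun _ h => h
    · simp only [Expr.eval, h₁, h₅] at hf
      refine Tri.step (C * ((w i).length + 1) + 50) rfl ?_ (by simp only [Cmd.cost, Expr.cost]; omega)
      refine Tri.seqFrame 50 (hC _ (p + jj) (p + i) (w jj) (w i)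
        (by simp [Cmd.run, Expr.eval, h₁, h₃]) (by simp [Cmd.run, h₂])
        (by simpa [Cmd.run, h₅] using hw jj hjj) (by simpa [Cmd.run, h₅] using hw i hik)) ?_ le_rfl
      rintro s₂ ⟨h₇, h₈⟩ hfr
      have e₁ : s₂.reg rJ = jj := (hfr.reg _ (by decide)).trans (by simp [Cmd.run, h₁])
      have e₂ : s₂.reg rY = p + i := (hfr.reg _ (by decide)).trans (by simp [Cmd.run, h₂])
      have e₃ : s₂.reg rP = p := (hfr.reg _ (by decide)).trans (by simp [Cmd.run, h₃])
      have e₄ : s₂.reg rQ = k := (hfr.reg _ (by decide)).trans (by simp [Cmd.run, h₄])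
      have e₅ : s₂.reg rM = _ := (hfr.reg _ (by decide)).trans (by simpa [Cmd.run] using h₆)
      have e₆ : s₂.mem = s.mem := h₈.trans h₅
      refine Tri.block rfl (by decide) ?_
      by_cases hlt : w jj < w i
      · have hr : Expr.eval s₂ (.reg rRes) ≠ 0 := h₇.2 hlt
        rw [Cmd.run, if_neg hr]
        refine ⟨by simp [Cmd.run, e₁], by simp, by simp [Cmd.run, e₂], by simp [Cmd.run, e₃],
          by simp [Cmd.run, e₄], e₆, ?_⟩
        simp [Cmd.run, Expr.eval, e₅, rank, List.range_succ, List.filter_append, hf, hlt]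
      · have hr : Expr.eval s₂ (.reg rRes) = 0 := not_not.1 (mt h₇.1 hlt)
        rw [Cmd.run, if_pos hr]
        refine ⟨by simp [Cmd.run, e₁], by simp, by simp [Cmd.run, e₂], by simp [Cmd.run, e₃],
          by simp [Cmd.run, e₄], e₆, ?_⟩
        simp [Cmd.run, e₅, rank, List.range_succ, List.filter_append, hf, hlt]
    · simp only [Expr.eval, h₁, h₅] at hf
      refine Tri.block rfl (by simp only [Cmd.cost]; omega) ⟨by simp [Cmd.run, h₁], by simp,
        by simp [Cmd.run, h₂], by simp [Cmd.run, h₃], by simp [Cmd.run, h₄], h₅, ?_⟩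
      simp [Cmd.run, h₆, rank, List.range_succ, List.filter_append, hf]
    · simp only [Expr.cost]
      omega
  · exact ⟨by simp [Cmd.run, Expr.eval], by simp [Cmd.run, Expr.eval, hp, hi],
      by simp [Cmd.run, hp], by simp [Cmd.run, hk], rfl, by simp [Cmd.run, Expr.eval, rank]⟩
  · simp only [Cmd.upToCost, Expr.cost]
    gcongr <;> omega
  · exact fun s' h => h.2.2.2.2

/-- Each text is compared with all others at a cost charged to its own length, so the time is the
number of children times the total length of their texts. Injectivity of the ranks keeps the program
from overwriting a position. -/
theorem rankAll_spec : ∃ C, ∀ (s : Config) (p k : ℕ) (w : ℕ → List ℕ), s.reg rP = p →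
    s.reg rQ = k → (∀ j < k, TextAt s.mem (p + j) (w j)) →
    (∀ i < k, ∀ j < k, s.mem aFlag i ≠ 0 → s.mem aFlag j ≠ 0 →
      rank ((List.range k).filter fun j => s.mem aFlag j ≠ 0) w i =
      rank ((List.range k).filter fun j => s.mem aFlag j ≠ 0) w j → i = j) →
    Tri rankAll s (C * ((k + 1) * (∑ i ∈ Finset.Ico 0 k, ((w i).length + 1) + 1))) fun s' =>
      s'.reg rW = ((List.range k).filter fun j => s.mem aFlag j ≠ 0).length ∧
      ∀ i < k, s.mem aFlag i ≠ 0 →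
        s'.mem aSort (rank ((List.range k).filter fun j => s.mem aFlag j ≠ 0) w i) = i := by
  obtain ⟨C, hC⟩ := rankOne_spec
  refine ⟨C + 500, fun s p k w hp hk hw hinj => ?_⟩
  set F := (List.range k).filter fun j => s.mem aFlag j ≠ 0 with hF
  refine Tri.step (∑ i ∈ Finset.Ico 0 k, ((C * ((k + 1) * ((w i).length + 1)) + 100) + 100) + 100)
    rfl ?_ ?_
  · refine (Tri.upTo (n := k) (f := fun i => C * ((k + 1) * ((w i).length + 1)) + 100)
      (I := fun i s' => s'.reg rI = i ∧ s'.reg rP = p ∧ s'.reg rQ = k ∧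
        (∀ a ≠ aSort, s'.mem a = s.mem a) ∧
        s'.reg rW = ((List.range i).filter fun j => s.mem aFlag j ≠ 0).length ∧
        ∀ j < i, s.mem aFlag j ≠ 0 → s'.mem aSort (rank F w j) = j) ?_ ?_ ?_ (Nat.zero_le _) ?_).mono
      ?_ ?_
    · exact fun i s h => h.1
    · exact fun i s h => h.2.2.1
    · rintro i s₁ hi ⟨h₁, h₂, h₃, h₄, h₅, h₆⟩
      refine (Tri.ite (t := C * ((k + 1) * ((w i).length + 1)) + 60) (fun hf => ?_) fun hf => ?_).mono
        ?_ fun _ h => h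
      · simp only [Expr.eval, h₁, h₄ aFlag (by decide)] at hf
        refine Tri.seqFrame 50 (hC s₁ p k i w h₂ h₃ h₁ hi fun j hj => ?_) ?_ (by omega)
        · rw [TextAt, h₄ _ (by decide), h₄ _ (by decide), h₄ _ (by decide)]
          exact hw j hj
        rintro s₂ ⟨h₇, h₈⟩ hfr
        rw [h₄ aFlag (by decide)] at h₈
        have e₁ : s₂.reg rI = i := (hfr.reg _ (by decide)).trans h₁
        have e₂ : s₂.reg rP = p := (hfr.reg _ (by decide)).trans h₂
        have e₃ : s₂.reg rQ = k := (hfr.reg _ (by decide)).trans h₃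
        have e₄ : s₂.reg rW = _ := (hfr.reg _ (by decide)).trans h₅
        refine Tri.block rfl (by decide) ⟨by simp [Cmd.run, e₁], by simp, by simp [Cmd.run, e₂],
          by simp [Cmd.run, e₃], ?_, ?_, ?_⟩
        · intro a ha
          simp [Cmd.run, ha, h₇, h₄ a ha]
        · simp [Cmd.run, Expr.eval, e₄, List.range_succ, List.filter_append, hf]
        · intro j hj hfj
          by_cases hji : j = i
          · simp [Cmd.run, Expr.eval, hji, h₈, e₁, hF]
          · have hne : rank F w j ≠ s₂.reg rM := fun h =>
              hji (hinj j (by omega) i hi hfj hf (h.trans h₈))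
            simp [Cmd.run, Expr.eval, Function.update_of_ne hne, h₇, h₆ j (by omega) hfj]
      · simp only [Expr.eval, h₁, h₄ aFlag (by decide)] at hf
        refine Tri.block rfl (by simp only [Cmd.cost]; omega) ⟨by simp [Cmd.run, h₁], by simp,
          by simp [Cmd.run, h₂], by simp [Cmd.run, h₃], h₄, ?_, ?_⟩
        · simp [Cmd.run, h₅, List.range_succ, List.filter_append, hf]
        · intro j hj hfj
          refine h₆ j (lt_of_le_of_ne (Nat.lt_succ_iff.1 hj) ?_) hfj
          rintro rfl
          exact hfj hf
      · simp only [Expr.cost]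
        omega
    · exact ⟨by simp [Cmd.run, Expr.eval], by simp [Cmd.run, hp], by simp [Cmd.run, hk],
        fun _ _ => rfl, by simp [Cmd.run, Expr.eval], by simp⟩
    · refine Nat.add_le_add (Finset.sum_le_sum fun i _ => ?_) ?_ <;>
        simp only [Cmd.upToCost, Expr.cost] <;> omega
    · exact fun s' h => h.2.2.2.2
  · simp only [Cmd.cost, Expr.cost]
    have h₁ : ∑ i ∈ Finset.Ico 0 k, (C * ((k + 1) * ((w i).length + 1)) + 100 + 100) =
        C * ((k + 1) * ∑ i ∈ Finset.Ico 0 k, ((w i).length + 1)) + 200 * k := by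
      simp only [Nat.add_assoc, Finset.sum_add_distrib, ← Finset.mul_sum]
      simp
      ring
    rw [h₁]
    nlinarith [Nat.zero_le (k * ∑ i ∈ Finset.Ico 0 k, ((w i).length + 1)),
      Nat.zero_le (C * k), Nat.zero_le (∑ i ∈ Finset.Ico 0 k, ((w i).length + 1))]

/-! ### Writing a sorted join or meet. -/

open OrthoPlus.Expr in
/-- Write the join or meet of the sorted children. -/
def emitOp : Cmd :=
  .seq (.set rI (const 0)) <|
  .upTo rI (reg rW) <|
    .seq (.seq (.ite (lt (add (reg rI) (const 1)) (reg rW)) (emit (reg rS)) .skip)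
      (.set rV (add (reg rP) (load aSort (reg rI))))) copyText

theorem emitOp_spec : ∃ C, ∀ (s : Config) (p B c : ℕ) (l : List (List ℕ)), s.reg rP = p →
    s.reg rS = c → s.reg rW = l.length →
    (∀ (r : ℕ) (hr : r < l.length), TextAt s.mem (p + s.mem aSort r) l[r] ∧
      s.mem aPos (p + s.mem aSort r) + s.mem aLen (p + s.mem aSort r) ≤ s.reg rTp ∧
      l[r].length ≤ B) →
    Tri emitOp s (C * ((l.length + 1) * (B + 1))) (Emitted s (joinText c l)) := by
  obtain ⟨C, hC⟩ := copyText_spec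
  refine ⟨C + 500, fun s p B c l hp hc hl h => ?_⟩
  refine Tri.step (l.length * (C * (B + 1) + 100 + 100) + 100) rfl ?_ (by
    simp only [Cmd.cost, Expr.cost]
    nlinarith [Nat.zero_le (l.length * B), Nat.zero_le (C * B)])
  refine (Tri.upTo_const (n := l.length) (t := C * (B + 1) + 100) (I := fun i s' => s'.reg rI = i ∧
    s'.reg rP = p ∧ s'.reg rS = c ∧ s'.reg rW = l.length ∧ ∃ v, Emitted s v s' ∧
    v ++ joinText c (l.drop i) = joinText c l) ?_ ?_ ?_ ?_).mono ?_ ?_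
  · exact fun i s h => h.1
  · exact fun i s h => h.2.2.2.1
  · rintro i s₁ hi ⟨h₁, h₂, h₃, h₄, v, h₅, h₆⟩
    obtain ⟨k₁, k₂, k₃⟩ := h i hi
    refine Tri.step (C * (B + 1)) rfl ?_ (by
      simp only [Cmd.cost, Expr.cost, emit]
      omega)
    set s₂ := Cmd.run _ s₁ with hs₂
    have hv : Emitted s (v ++ if l.drop (i + 1) = [] then [] else [c]) s₂ := by
      by_cases hlt : i + 1 < l.length
      · have hne : l.drop (i + 1) ≠ [] := by
          rw [List.drop_eq_getElem_cons hlt]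
          exact List.cons_ne_nil _ _
        rw [if_neg hne]
        refine (h₅.emit (e := .reg rS) h₃).congr ?_ ?_ <;>
          simp [hs₂, Cmd.run, Expr.eval, h₁, h₄, Nat.sub_ne_zero_of_lt hlt]
      · rw [if_pos (List.drop_eq_nil_of_le (by omega)), List.append_nil]
        refine h₅.congr ?_ ?_ <;>
          simp [hs₂, Cmd.run, Expr.eval, h₁, h₄, Nat.sub_eq_zero_of_le (not_lt.1 hlt)]
    have e₁ : s₂.reg rI = i := by
      simp only [hs₂, Cmd.run, emit]; split_ifs <;> simp [h₁]
    have e₂ : s₂.reg rP = p := by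
      simp only [hs₂, Cmd.run, emit]; split_ifs <;> simp [h₂]
    have e₃ : s₂.reg rS = c := by
      simp only [hs₂, Cmd.run, emit]; split_ifs <;> simp [h₃]
    have e₄ : s₂.reg rW = l.length := by
      simp only [hs₂, Cmd.run, emit]; split_ifs <;> simp [h₄]
    have e₅ : s₂.reg rV = p + s.mem aSort i := by
      simp only [hs₂, Cmd.run, emit]
      split_ifs <;> simp [Expr.eval, h₁, h₂, h₅.mem aSort (by decide)]
    clear_value s₂
    refine (hC s₂ _ l[i] e₅ (hv.textAt k₁ k₂) ?_).frame.mono ?_ ?_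
    · rw [hv.mem aPos (by decide), hv.mem aLen (by decide), hv.tp]
      omega
    · gcongr
    · rintro s₃ ⟨h₇, hfr⟩
      have f₁ : s₃.reg rI = i := (hfr.reg _ (by decide)).trans e₁
      have f₂ : s₃.reg rP = p := (hfr.reg _ (by decide)).trans e₂
      have f₃ : s₃.reg rS = c := (hfr.reg _ (by decide)).trans e₃
      have f₄ : s₃.reg rW = l.length := (hfr.reg _ (by decide)).trans e₄
      refine ⟨f₁, by simp, by simpa using f₂, by simpa using f₃, by simpa using f₄, _,
        (hv.trans h₇).congr (by simp) rfl, ?_⟩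
      rw [← h₆, List.drop_eq_getElem_cons hi, joinText]
      simp only [List.append_assoc]
  · exact ⟨by simp [Cmd.run, Expr.eval], by simpa [Cmd.run] using hp, by simpa [Cmd.run] using hc,
      by simpa [Cmd.run] using hl, [], Emitted.of_eq (by simp [Cmd.run]) rfl, by simp⟩
  · simp only [Cmd.upToCost, Expr.cost]
    gcongr <;> omega
  · rintro s' ⟨-, -, -, -, v, h₁, h₂⟩
    rw [List.drop_length, joinText, List.append_nil] at h₂
    rwa [← h₂]


/-! ### The text of a node -/

/-- The worst case is a negated function symbol: one number for the sign and five for the symbol. -/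
theorem NTerm.length_encode_le (t : NTerm) : t.toTerm.encode.length ≤ 6 * t.size := by
  induction t with
  | lit b x => cases b <;> simp [NTerm.toTerm, Term.encode, NTerm.size]
  | bot => simp [NTerm.toTerm, Term.encode, NTerm.size]
  | top => simp [NTerm.toTerm, Term.encode, NTerm.size]
  | meet s t ihs iht =>
    simp only [NTerm.toTerm, Term.encode, NTerm.size, List.length_cons, List.length_append]
    omega
  | join s t ihs iht =>
    simp only [NTerm.toTerm, Term.encode, NTerm.size, List.length_cons, List.length_append]
    omega
  | app b f x ih =>
    have h : ∑ a, (x a).toTerm.encode.length ≤ 6 * ∑ a, (x a).size := by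
      rw [Finset.mul_sum]
      exact Finset.sum_le_sum fun a _ => ih a
    cases b <;>
    · simp only [NTerm.toTerm, Term.encode, NTerm.size, List.length_cons, List.length_flatten,
        List.map_ofFn, Function.comp_def, List.sum_ofFn]
      omega

/-- The prefix notation of the normal form. -/
noncomputable def NTerm.text (t : NTerm) : List ℕ := (canon t).toTerm.encode

theorem NTerm.length_text_le (t : NTerm) : t.text.length ≤ 6 * t.size := by
  have h₁ := (canon t).length_encode_le
  have h₂ := size_canon_le t
  rw [text]
  omega

/-- The letters `w` have been written since `s₀`, with the help of auxiliary arrays. -/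
structure Written (s₀ : Config) (w : List ℕ) (s : Config) : Prop where
  tp : s.reg rTp = s₀.reg rTp + w.length
  holds : Holds (s.mem aText) (s₀.reg rTp) w
  old : ∀ j < s₀.reg rTp, s.mem aText j = s₀.mem aText j
  mem : ∀ a ∉ [aText, aFlag, aSort], s.mem a = s₀.mem a

theorem Emitted.written {s₀ s : Config} {w : List ℕ} (h : Emitted s₀ w s) : Written s₀ w s :=
  ⟨h.tp, h.holds, h.old, fun a ha => h.mem a fun h => ha (h ▸ List.mem_cons_self)⟩

open OrthoPlus.Expr in
/-- Write the leaf `rU` of kind `rS`. -/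
def emitLeaf : Cmd :=
  .ite (reg rS) (emit (reg rS)) <|
    .seq (.ite (reg rU).fst .skip (emit (const 3))) (.seq (emit (const 0)) (emit (reg rU).snd))

theorem emitLeaf_spec {s : Config} {n u : ℕ} {D : ℕ → NTerm} (hu : s.reg rU = u)
    (hs : s.reg rS = s.mem aK u) (hn : NodeOK s.mem n D u (D u)) (hlt : s.mem aK u < 4) :
    Tri emitLeaf s 100 (Emitted s (D u).text) := by
  refine Tri.block rfl (by decide) ?_
  rw [emitLeaf, Cmd.run]
  have e : Expr.eval s (.reg rS) = s.mem aK u := hs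
  have he : Emitted s [] s := Emitted.of_eq rfl rfl
  rw [e]
  generalize D u = t at *
  cases t with
  | lit b v =>
    obtain ⟨h₁, h₂, h₃⟩ := hn
    rw [if_pos h₁, Cmd.run, Cmd.run]
    have key : ∀ {w : List ℕ} {s' : Config}, Emitted s w s' → s'.reg rU = u →
        Emitted s (w ++ [0] ++ [v]) ((emit (.snd (.reg rU))).run ((emit (.const 0)).run s')) := by
      intro w s' h hu'
      refine (h.emit (e := .const 0) rfl).emit ?_
      simp [Expr.eval, emit, Cmd.run, hu', h.mem aB (by decide), h₃]
    cases b with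
    | false =>
      rw [Cmd.run, if_pos (by simp [Expr.eval, hu, h₂])]
      have := key (he.emit (e := .const 3) (c := 3) rfl) (by simp [emit, Cmd.run, hu])
      simpa [NTerm.text, canon_lit, NTerm.toTerm, Term.encode] using this
    | true =>
      rw [Cmd.run, if_neg (by simp [Expr.eval, hu, h₂])]
      simpa [NTerm.text, canon_lit, NTerm.toTerm, Term.encode, Cmd.run] using key he hu
  | bot =>
    have h : s.mem aK u = 1 := hn
    rw [if_neg (by omega)]
    simpa [NTerm.text, canon_bot, NTerm.toTerm, Term.encode] using he.emit (e.trans h)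
  | top =>
    have h : s.mem aK u = 2 := hn
    rw [if_neg (by omega)]
    simpa [NTerm.text, canon_top, NTerm.toTerm, Term.encode] using he.emit (e.trans h)
  | _ =>
    simp only [NodeOK] at hn
    omega

open OrthoPlus.Expr in
/-- Write the function symbol of the node `rU`. -/
def emitSymbol : Cmd :=
  .seq (.ite (reg rU).fst .skip (emit (const 3))) <| .seq (emit (const 6)) <|
  .seq (emit ((reg rU).symbol 1)) <| .seq (emit ((reg rU).symbol 2)) <|
  .seq (emit ((reg rU).symbol 3)) (emit ((reg rU).symbol 4))

open OrthoPlus.Expr in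
/-- Write the application `rU` of a function symbol. -/
def emitApp : Cmd :=
  .seq (.seq emitSymbol (.set rI (const 0))) <|
  .upTo rI (reg rQ) <| .seq (.set rV (add (reg rP) (reg rI))) copyText

theorem emitApp_spec : ∃ C, ∀ (s : Config) (n u p B : ℕ) (D : ℕ → NTerm) (b : Bool) (f : FunSym)
    (z : Fin f.arity → NTerm), s.reg rU = u → s.reg rP = p → s.reg rQ = f.arity →
    D u = .app b f z → NodeOK s.mem n D u (D u) →
    (∀ i : Fin f.arity, TextAt s.mem (p + i) (z i).text ∧
      s.mem aPos (p + i) + s.mem aLen (p + i) ≤ s.reg rTp ∧ (z i).text.length ≤ B) →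
    Tri emitApp s (C * ((f.arity + 1) * (B + 1))) (Emitted s (D u).text) := by
  obtain ⟨C, hC⟩ := copyText_spec
  refine ⟨C + 500, fun s n u p B D b f z hu hp hq hz hn h => ?_⟩
  rw [hz] at hn ⊢
  obtain ⟨-, h₂, h₃, -, -⟩ := hn
  obtain ⟨f₁, f₂, f₃, f₄⟩ := holds_app h₃
  set pre : List ℕ := (if b then [] else [3]) ++ [6] ++ [f.name] ++ [f.i] ++ [f.j] ++ [f.k] with hpre
  set l : List (List ℕ) := List.ofFn fun a => (z a).text with hl
  have hlen : l.length = f.arity := List.length_ofFn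
  have htext : (NTerm.app b f z).text = pre ++ l.flatten := by
    cases b <;> simp [NTerm.text, canon_app, NTerm.toTerm, Term.encode, hpre, hl]
  have hsym : Emitted s pre (emitSymbol.run s) ∧ (emitSymbol.run s).reg rP = p ∧
      (emitSymbol.run s).reg rQ = f.arity := by
    have he : Emitted s [] s := Emitted.of_eq rfl rfl
    have key : ∀ {w : List ℕ} {s' : Config} {e : Expr} {c : ℕ}, (Emitted s w s' ∧ s'.reg rU = u ∧
        s'.reg rP = p ∧ s'.reg rQ = f.arity) → e.eval s' = c →
        Emitted s (w ++ [c]) ((emit e).run s') ∧ ((emit e).run s').reg rU = u ∧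
        ((emit e).run s').reg rP = p ∧ ((emit e).run s').reg rQ = f.arity :=
      fun h hc => ⟨h.1.emit hc, by simp [emit, Cmd.run, h.2.1], by simp [emit, Cmd.run, h.2.2.1],
        by simp [emit, Cmd.run, h.2.2.2]⟩
    have sym : ∀ {w : List ℕ} {s' : Config} {i c : ℕ}, (Emitted s w s' ∧ s'.reg rU = u ∧
        s'.reg rP = p ∧ s'.reg rQ = f.arity) → s.mem aIn (s.mem aB u + i) = c →
        ((Expr.reg rU).symbol i).eval s' = c := fun h hc => by
      simp [Expr.eval, h.1.mem aIn (by decide), h.1.mem aB (by decide), h.2.1, hc]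
    have k₁ : Emitted s (if b then [] else [3])
        ((Cmd.ite (Expr.fst (.reg rU)) .skip (emit (.const 3))).run s) ∧
        ((Cmd.ite (Expr.fst (.reg rU)) .skip (emit (.const 3))).run s).reg rU = u ∧
        ((Cmd.ite (Expr.fst (.reg rU)) .skip (emit (.const 3))).run s).reg rP = p ∧
        ((Cmd.ite (Expr.fst (.reg rU)) .skip (emit (.const 3))).run s).reg rQ = f.arity := by
      cases b with
      | false =>
        have e : (Expr.fst (.reg rU)).eval s = 0 := by simp [Expr.eval, hu, h₂]
        rw [Cmd.run, if_pos e]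
        exact key ⟨he, hu, hp, hq⟩ (e := .const 3) (c := 3) rfl
      | true =>
        have e : (Expr.fst (.reg rU)).eval s ≠ 0 := by simp [Expr.eval, hu, h₂]
        rw [Cmd.run, if_neg e]
        exact ⟨he, hu, hp, hq⟩
    have k₂ := key k₁ (e := .const 6) rfl
    have k₃ := key k₂ (sym k₂ f₁)
    have k₄ := key k₃ (sym k₃ f₂)
    have k₅ := key k₄ (sym k₄ f₃)
    have k₆ := key k₅ (sym k₅ f₄)
    exact ⟨k₆.1, k₆.2.2⟩
  refine Tri.step (f.arity * (C * (B + 1) + 50 + 100) + 100) rfl ?_ ?_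
  · refine (Tri.upTo_const (n := f.arity) (t := C * (B + 1) + 50) (I := fun i s' => s'.reg rI = i ∧
      s'.reg rP = p ∧ s'.reg rQ = f.arity ∧ Emitted s (pre ++ (l.take i).flatten) s')
      ?_ ?_ ?_ ?_).mono ?_ ?_
    · exact fun i s h => h.1
    · exact fun i s h => h.2.2.1
    · rintro i s₁ hi ⟨k₁, k₂, k₃, k₄⟩
      obtain ⟨h₄, h₅, h₆⟩ := h ⟨i, hi⟩
      refine Tri.step (C * (B + 1)) rfl ?_ (by simp only [Cmd.cost, Expr.cost]; omega)
      set s₂ := Cmd.run _ s₁ with hs₂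
      have hv : Emitted s (pre ++ (l.take i).flatten) s₂ := k₄.congr (by simp [hs₂, Cmd.run]) rfl
      have e₁ : s₂.reg rI = i := by simp [hs₂, Cmd.run, k₁]
      have e₂ : s₂.reg rP = p := by simp [hs₂, Cmd.run, k₂]
      have e₃ : s₂.reg rQ = f.arity := by simp [hs₂, Cmd.run, k₃]
      have e₄ : s₂.reg rV = p + i := by simp [hs₂, Cmd.run, Expr.eval, k₁, k₂]
      clear_value s₂
      refine (hC s₂ _ _ e₄ (hv.textAt h₄ h₅) ?_).frame.mono ?_ ?_
      · rw [hv.mem aPos (by decide), hv.mem aLen (by decide), hv.tp]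
        simp only at h₅
        omega
      · gcongr
      · rintro s₃ ⟨h₇, hfr⟩
        refine ⟨(hfr.reg _ (by decide)).trans e₁, by simp,
          by simpa using (hfr.reg rP (by decide)).trans e₂,
          by simpa using (hfr.reg rQ (by decide)).trans e₃, ?_⟩
        rw [List.take_add_one, List.getElem?_eq_getElem (by omega), Option.toList_some,
          List.flatten_append, ← List.append_assoc, List.flatten_singleton, List.getElem_ofFn]
        exact (hv.trans h₇).congr (by simp) rfl
    · refine ⟨by simp [Cmd.run, Expr.eval], by simp [Cmd.run, hsym], by simp [Cmd.run, hsym], ?_⟩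
      rw [List.take_zero, List.flatten_nil, List.append_nil]
      exact hsym.1.congr (by simp [Cmd.run]) rfl
    · simp only [Cmd.upToCost, Expr.cost]
      gcongr <;> omega
    · rintro s' ⟨-, -, -, h₄⟩
      rwa [← hlen, List.take_length, ← htext] at h₄
  · have hcost : (Cmd.seq emitSymbol (.set rI (.const 0))).cost ≤ 200 := by decide
    nlinarith [Nat.zero_le (f.arity * B), Nat.zero_le (C * B), Nat.zero_le (C * f.arity)]

/-- Write a join or meet. -/
def emitBig : Cmd := .seq flagAll (.seq rankAll emitOp)

/-- With `k` children of total size less than `B`, marking costs `O(k²)`, and sorting and copying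
cost `O(k B)`; since `k ≤ B`, all of this is `O((k + 1) (B + 1))`. -/
theorem emitBig_spec : ∃ C, ∀ (s : Config) (D : ℕ → NTerm) (n W M u p B : ℕ) (d : Bool)
    (a b : NTerm), (Table s.mem n D W M fun _ _ => True) → s.reg rP = p →
    s.reg rQ = (children (D u)).length → s.reg rS = 4 + d.toNat → D u = op d a b →
    Holds (fun i => D (s.mem aQueue i)) p (children (D u)) → (D u).size ≤ B →
    (∀ i < (children (D u)).length, s.mem aQueue (p + i) < M ∧
      TextAt s.mem (p + i) (D (s.mem aQueue (p + i))).text ∧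
      s.mem aPos (p + i) + s.mem aLen (p + i) ≤ s.reg rTp) →
    Tri emitBig s (C * (((children (D u)).length + 1) * (B + 1))) (Written s (D u).text) := by
  obtain ⟨C₁, hC₁⟩ := flagAll_spec
  obtain ⟨C₂, hC₂⟩ := rankAll_spec
  obtain ⟨C₃, hC₃⟩ := emitOp_spec
  -- A text of a term of size `a` plus one letter has length at most `7 * a`. So the sum for the
  -- ranks is at most `7 * B + 1 ≤ 8 * (B + 1)`, and copying uses `6 * B + 1 ≤ 7 * (B + 1)`.
  refine ⟨C₁ + 8 * C₂ + 7 * C₃, fun s D n W M u p B d a b hT hp hq hd hu hl hB h => ?_⟩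
  set k := (children (D u)).length with hk
  set g : ℕ → NTerm := fun i => canon (D (s.mem aQueue (p + i))) with hg
  have hmap : (children (D u)).map canon = (List.range k).map g := by
    refine List.ext_getElem (by simp [hk]) fun i h₁ h₂ => ?_
    have := hl i (by simpa using h₁)
    simp only [List.getElem_map, List.getElem_range, hg, ← this]
  have hsum : ((children (D u)).map NTerm.size).sum < B := by
    have := sum_size_children_lt (D u)
    omega
  have hkB : k ≤ B := (length_le_sum_size _).trans hsum.le
  have hsz : ∑ i ∈ Finset.Ico 0 k, ((D (s.mem aQueue (p + i))).text.length + 1) ≤ 7 * B := by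
    have h₁ := hl.sum_Ico NTerm.size
    rw [← hk, Finset.sum_Ico_eq_sum_range, Nat.add_sub_cancel_left] at h₁
    rw [Finset.sum_Ico_eq_sum_range, Nat.sub_zero]
    calc _ ≤ ∑ i ∈ Finset.range k, 7 * (D (s.mem aQueue (p + i))).size :=
          Finset.sum_le_sum fun i _ => by
            have := (D (s.mem aQueue (p + i))).length_text_le
            have := (D (s.mem aQueue (p + i))).size_pos
            rw [Nat.zero_add]
            omega
      _ ≤ 7 * B := by
        rw [← Finset.mul_sum, h₁]
        omega
  refine Tri.seqFrame (8 * C₂ * ((k + 1) * (B + 1)) + 7 * C₃ * ((k + 1) * (B + 1)))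
    (hC₁ s D n W M p k d hT hp hq hd fun i hi => (h i hi).1) ?_
    (t₁ := C₁ * ((k + 1) * (k + 1))) ?_
  swap
  · nlinarith [Nat.mul_le_mul_left C₁ (Nat.mul_le_mul_left (k + 1) (Nat.succ_le_succ hkB))]
  rintro s₁ hflag hf₁
  set F := (List.range k).filter fun j => s₁.mem aFlag j ≠ 0 with hF
  have hanti : antichain (LeD d) ((children (D u)).map canon) = F.map g := by
    rw [hmap]
    refine antichain_map_range _ _ _ _ fun i hi => ?_
    -- `η` compares normalized children, while the table knows the original ones; normalization
    -- preserves equivalence, so the answers agree.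
    have hle : ∀ i j, LeD d (g i) (g j) ↔
        LeD d (D (s.mem aQueue (p + i))) (D (s.mem aQueue (p + j))) := fun i j =>
      ⟨fun h => ((canon_equiv _).symm.leD d).trans (h.trans ((canon_equiv _).leD d)),
        fun h => ((canon_equiv _).leD d).trans (h.trans ((canon_equiv _).symm.leD d))⟩
    rw [decide_eq_true_iff, hflag i hi]
    simp only [hle]
  have hsort : sortedAntichain d ((children (D u)).map canon) = sortTerms (F.map g) := by
    rw [sortedAntichain, hanti]
  have hnd : (F.map g).Nodup := by
    have := nodup_sortedAntichain d ((children (D u)).map canon)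
    rw [hsort] at this
    exact (sortTerms_perm _).nodup_iff.1 this
  have htext₁ : ∀ i < k, TextAt s₁.mem (p + i) (D (s.mem aQueue (p + i))).text := fun i hi => by
    rw [TextAt, hf₁.mem aPos (by decide), hf₁.mem aText (by decide), hf₁.mem aLen (by decide)]
    exact (h i hi).2.1
  have hmemF : ∀ i, i ∈ F ↔ i < k ∧ s₁.mem aFlag i ≠ 0 := fun i => by simp [hF]
  refine Tri.seqFrame (7 * C₃ * ((k + 1) * (B + 1)))
    (hC₂ s₁ p k (fun i => (g i).toTerm.encode) ((hf₁.reg _ (by decide)).trans hp)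
      ((hf₁.reg _ (by decide)).trans hq) htext₁ fun i hi j hj h₁ h₂ h₃ =>
        rank_inj hnd ((hmemF i).2 ⟨hi, h₁⟩) ((hmemF j).2 ⟨hj, h₂⟩) h₃) ?_
    ?_
  swap
  · rw [Nat.mul_assoc, Nat.mul_assoc, Nat.mul_comm 8]
    refine Nat.add_le_add_right ?_ _
    refine (Nat.mul_le_mul_left C₂ (Nat.mul_le_mul_left (k + 1) (Nat.succ_le_succ hsz))).trans ?_
    nlinarith [Nat.zero_le (C₂ * k * B), Nat.zero_le (C₂ * k), Nat.zero_le C₂, Nat.zero_le (C₂ * B)]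
  rintro s₂ ⟨hW, hS⟩ hf₂
  set l := (sortTerms (F.map g)).map fun t => t.toTerm.encode with hl'
  have hlen : l.length = F.length := by
    rw [hl', List.length_map, (sortTerms_perm _).length_eq, List.length_map]
  have hFk : F.length ≤ k := by
    have := List.length_filter_le (fun j => decide (s₁.mem aFlag j ≠ 0)) (List.range k)
    rwa [List.length_range] at this
  have htext : (D u).text = joinText (4 + d.toNat) l := by
    rw [NTerm.text, hu, canon_op, encode_big, ← hu, hsort]
    refine sortedAntichain_ne_nil d fun h => ?_
    have := two_le_length_children d a b
    rw [← List.length_map (f := canon), h] at this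
    simp at this
  have hreg : ∀ x ∉ flagAll.regs ++ rankAll.regs, s₂.reg x = s.reg x := fun x hx => by
    rw [List.mem_append, not_or] at hx
    rw [hf₂.reg x hx.2, hf₁.reg x hx.1]
  have hmem : ∀ a ∉ [aFlag, aSort], s₂.mem a = s.mem a := fun a ha => by
    rw [List.mem_cons, List.mem_singleton, not_or] at ha
    rw [hf₂.mem a (by simpa [rankAll, rankOne, textLt, Cmd.arrs] using ha.2),
      hf₁.mem a (by simpa [flagAll, Cmd.arrs] using ha.1)]
  refine (hC₃ s₂ p (6 * B) (4 + d.toNat) l ((hreg _ (by decide)).trans hp)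
    ((hreg _ (by decide)).trans hd) (hW.trans hlen.symm) fun r hr => ?_).mono ?_ ?_
  · obtain ⟨i, hi, h₁, h₂⟩ := rank_spec hnd (r := r) (by simpa only [hl', List.length_map] using hr)
    obtain ⟨hik, hfi⟩ := (hmemF i).1 hi
    have hSr : s₂.mem aSort r = i := by
      rw [← h₁]
      exact hS i hik hfi
    have hlr : l[r] = (D (s.mem aQueue (p + i))).text :=
      (List.getElem_map _).trans (congrArg (fun t : NTerm => t.toTerm.encode) h₂.symm)
    rw [hSr, hlr, TextAt, hmem aPos (by decide), hmem aLen (by decide),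
      hmem aText (by decide), hreg _ (by decide)]
    refine ⟨(h i hik).2.1, (h i hik).2.2, (NTerm.length_text_le _).trans ?_⟩
    have h₃ := List.single_le_sum (fun _ _ => Nat.zero_le _) _
      (List.mem_map_of_mem (f := NTerm.size) (List.getElem_mem (n := i) (l := children (D u)) hik))
    have h₄ : D (s.mem aQueue (p + i)) = (children (D u))[i] := hl i hik
    rw [h₄]
    omega
  · rw [hlen]
    nlinarith [Nat.mul_le_mul_left C₃ (Nat.mul_le_mul (Nat.succ_le_succ hFk)
      (show 6 * B + 1 ≤ 7 * (B + 1) by omega))]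
  · intro s₃ h₃
    rw [← htext] at h₃
    have htp : s₂.reg rTp = s.reg rTp := hreg _ (by decide)
    refine ⟨by rw [h₃.tp, htp], by rw [← htp]; exact h₃.holds, fun j hj => ?_, fun a ha => ?_⟩
    · rw [h₃.old j (by omega), hmem aText (by decide)]
    · rw [List.mem_cons, not_or] at ha
      rw [h₃.mem a ha.1, hmem a ha.2]


/-! ### The texts of all nodes -/

open OrthoPlus.Expr in
/-- Write the normal form of the node number `rG` of the queue. -/
def emitNode : Cmd :=
  .seq (.seq (.set rU (load aQueue (reg rG))) <| .seq (.set rS (kind (reg rU))) <|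
    .seq (.set rP (load aStart (reg rG))) <|
    .seq (.set rQ (sub (load aStart (add (reg rG) (const 1))) (reg rP)))
      (.write aPos (reg rG) (reg rTp))) <|
  .seq (.ite (eq (reg rS) (const 6)) emitApp (.ite (lt (reg rS) (const 4)) emitLeaf emitBig)) <|
  .write aLen (reg rG) (sub (reg rTp) (load aPos (reg rG)))

/-- The nodes of the queue from number `q` on have been written since `s₀`. -/
structure Emission (s₀ : Config) (D : ℕ → NTerm) (n q : ℕ) (s : Config) : Prop where
  mem : ∀ a ∉ [aText, aFlag, aSort, aPos, aLen], s.mem a = s₀.mem a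
  text : ∀ j, q ≤ j → j < n → TextAt s.mem j (D (s₀.mem aQueue j)).text ∧
    s.mem aPos j + s.mem aLen j ≤ s.reg rTp

/-- In breadth-first order children come after their parent. If all later entries have been written,
the texts of the children are available. -/
theorem emitNode_spec : ∃ C, ∀ (s₀ s : Config) (D : ℕ → NTerm) (N W M n q : ℕ) (t : NTerm),
    (Table s₀.mem N D W M fun _ _ => True) → QueueOK s₀.mem D M n n t → q < n → s.reg rG = q →
    Emission s₀ D n (q + 1) s →
    Tri emitNode s (C * (((children (D (s₀.mem aQueue q))).length + 1) * (t.size + 1)))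
      (Emission s₀ D n q) := by
  obtain ⟨C₁, hC₁⟩ := emitApp_spec
  obtain ⟨C₂, hC₂⟩ := emitBig_spec
  refine ⟨6 * C₁ + C₂ + 500, fun s₀ s D N W M n q t hT hQ hqn hq hE => ?_⟩
  obtain ⟨hstart, hle⟩ := hQ.start q hqn
  have hbef := hQ.before q hqn
  have hch := hQ.child q hqn
  set u := s₀.mem aQueue q with hu
  have huM : u < M := hQ.lt q hqn
  set k := (children (D u)).length with hk
  set p := s₀.mem aStart q with hp
  have hnode := hT.node u huM
  have hsize : (D u).size ≤ t.size := hQ.size q hqn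
  have hpos : 1 ≤ (k + 1) * (t.size + 1) := Nat.mul_pos (Nat.succ_pos _) (Nat.succ_pos _)
  have hcost : (6 * C₁ + C₂ + 500) * ((k + 1) * (t.size + 1)) =
      C₁ * (6 * ((k + 1) * (t.size + 1))) + C₂ * ((k + 1) * (t.size + 1)) +
        500 * ((k + 1) * (t.size + 1)) := by ring
  refine Tri.step (C₁ * (6 * ((k + 1) * (t.size + 1))) + C₂ * ((k + 1) * (t.size + 1)) + 400) rfl ?_
    (by simp only [Cmd.cost, Expr.cost]; omega)
  set s₁ := Cmd.run _ s with hs₁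
  have e₁ : s₁.reg rU = u := by simp [hs₁, Cmd.run, Expr.eval, hq, hE.mem aQueue (by decide), hu]
  have e₂ : s₁.reg rS = s₀.mem aK u := by
    simp [hs₁, Cmd.run, Expr.eval, hq, hE.mem aQueue (by decide), hE.mem aK (by decide), hu]
  have e₃ : s₁.reg rP = p := by simp [hs₁, Cmd.run, Expr.eval, hq, hE.mem aStart (by decide), hp]
  have e₄ : s₁.reg rQ = k := by
    simp [hs₁, Cmd.run, Expr.eval, hq, hE.mem aStart (by decide), hp, hstart]
  have e₅ : s₁.reg rTp = s.reg rTp := by simp [hs₁, Cmd.run]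
  have e₆ : s₁.reg rG = q := by simp [hs₁, Cmd.run, hq]
  have e₇ : ∀ a ≠ aPos, s₁.mem a = s.mem a := fun a ha => by simp [hs₁, Cmd.run, ha]
  have e₈ : s₁.mem aPos = Function.update (s.mem aPos) q (s.reg rTp) := by
    simp [hs₁, Cmd.run, Expr.eval, hq]
  clear_value s₁
  have hmem : ∀ a ∉ [aText, aFlag, aSort, aPos, aLen], s₁.mem a = s₀.mem a := fun a ha => by
    rw [e₇ a (by rintro rfl; exact ha (by decide)), hE.mem a ha]
  have htext : ∀ j, q < j → j < n → TextAt s₁.mem j (D (s₀.mem aQueue j)).text ∧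
      s₁.mem aPos j + s₁.mem aLen j ≤ s₁.reg rTp := fun j hj hjn => by
    rw [TextAt, e₈, Function.update_of_ne hj.ne', e₇ aText (by decide), e₇ aLen (by decide), e₅]
    exact hE.text j hj hjn
  have hT₁ : Table s₁.mem N D W M fun _ _ => True := hT.congr fun a ha => hmem a (by
    revert ha a
    decide)
  have hnode₁ := hT₁.node u huM
  have key : ∀ i < k, s₁.mem aQueue (p + i) = s₀.mem aQueue (p + i) ∧
      D (s₀.mem aQueue (p + i)) ∈ children (D u) ∧ s₀.mem aQueue (p + i) < M ∧
      TextAt s₁.mem (p + i) (D (s₀.mem aQueue (p + i))).text ∧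
      s₁.mem aPos (p + i) + s₁.mem aLen (p + i) ≤ s₁.reg rTp := fun i hi =>
    ⟨by rw [hmem aQueue (by decide)], by
      have := hch i hi
      simp only at this
      rw [this]
      exact List.getElem_mem _, hQ.lt _ (by omega), htext _ (by omega) (by omega)⟩
  refine Tri.seqFrame 50 (R := Written s₁ (D u).text)
    (t₁ := C₁ * (6 * ((k + 1) * (t.size + 1))) + C₂ * ((k + 1) * (t.size + 1)) + 300) ?_ ?_ (by omega)
  · refine (Tri.ite (t := C₁ * (6 * ((k + 1) * (t.size + 1))) + C₂ * ((k + 1) * (t.size + 1)) + 200)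
      (fun h₁ => ?_) fun h₁ => ?_).mono ?_ fun _ h => h
    · rw [Expr.eval_eq] at h₁
      simp only [Expr.eval, e₂] at h₁
      obtain ⟨b, f, z, hz⟩ := hnode.kind_six.1 h₁
      have hkf : k = f.arity := by rw [hk, hz, children, List.length_ofFn]
      refine (hC₁ s₁ N u p (6 * t.size) D b f z e₁ e₃ (e₄.trans hkf) hz hnode₁ fun i => ?_).mono ?_
        fun _ h => h.written
      · obtain ⟨-, h₂, -, h₃⟩ := key i (by omega)
        have h₄ := hch i (by omega)
        simp only [hz, children, List.getElem_ofFn] at h₄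
        rw [h₄] at h₃
        refine ⟨h₃.1, h₃.2, (NTerm.length_text_le _).trans (Nat.mul_le_mul_left _ ?_)⟩
        have h₅ := List.single_le_sum (fun _ _ => Nat.zero_le _) _
          (List.mem_map_of_mem (f := NTerm.size) h₂)
        have h₆ := sum_size_children_lt (D u)
        rw [h₄] at h₅
        exact h₅.trans (h₆.le.trans hsize)
      · rw [← hkf]
        have : (k + 1) * (6 * t.size + 1) ≤ 6 * ((k + 1) * (t.size + 1)) := by nlinarith
        have := Nat.mul_le_mul_left C₁ this
        omega
    · have h₁ := mt (Expr.eval_eq s₁ _ _).2 (not_not.2 h₁)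
      simp only [Expr.eval, e₂] at h₁
      refine (Tri.ite (t := C₁ * (6 * ((k + 1) * (t.size + 1))) + C₂ * ((k + 1) * (t.size + 1)) + 100)
        (fun h₂ => ?_) fun h₂ => ?_).mono ?_ fun _ h => h
      · rw [Expr.eval_lt] at h₂
        simp only [Expr.eval, e₂] at h₂
        have hK : s₁.mem aK u = s₀.mem aK u := by rw [hmem aK (by decide)]
        exact (emitLeaf_spec e₁ (e₂.trans hK.symm) hnode₁ (by rwa [hK])).mono (by omega)
          fun _ h => h.written
      · rw [Expr.eval_lt_eq_zero] at h₂
        simp only [Expr.eval, e₂] at h₂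
        have : ∃ d, IsOp d (D u) := by
          generalize D u = t at *
          cases t with
          | meet a b => exact ⟨false, a, b, rfl⟩
          | join a b => exact ⟨true, a, b, rfl⟩
          | _ =>
            simp [NodeOK] at hnode
            omega
        obtain ⟨d, a, b, hab⟩ := this
        have hmap : Holds (fun i => D (s₁.mem aQueue i)) p (children (D u)) := by
          rwa [hmem aQueue (by decide)]
        refine (hC₂ s₁ D N W M u p t.size d a b hT₁ e₃ e₄ (e₂.trans (hnode.of_op hab).1) hab hmap
          hsize fun i hi => ?_).mono (by rw [← hk]; omega) fun _ h => h
        obtain ⟨h₃, -, h₄⟩ := key i hi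
        rwa [h₃]
      · simp only [Expr.cost]
        omega
    · simp only [Expr.cost]
      omega
  · rintro s₂ h₂ hf
    have e₉ : s₂.reg rG = q := (hf.reg _ (by decide)).trans e₆
    have hpos₂ : s₂.mem aPos = s₁.mem aPos := h₂.mem _ (by decide)
    have hlen₂ : s₂.mem aLen = s₁.mem aLen := h₂.mem _ (by decide)
    have htp := h₂.tp
    refine Tri.block rfl (by decide) ⟨fun a ha => ?_, fun j hj hjn => ?_⟩
    · have h₃ : a ≠ aLen := by rintro rfl; exact ha (by decide)
      simp only [List.mem_cons, List.not_mem_nil, or_false, not_or] at ha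
      rw [Cmd.run, Config.mem_setMem, if_neg h₃, h₂.mem a (by simp [ha]), hmem a (by simp [ha])]
    · obtain rfl | hj := hj.eq_or_lt
      · have h₄ := h₂.holds
        simp [TextAt, Cmd.run, Expr.eval, e₉, hpos₂, e₈, ← hu, htp, e₅, e₅ ▸ h₄]
      · obtain ⟨⟨h₃, h₄⟩, h₅⟩ := htext j hj hjn
        simp only [TextAt, Cmd.run, Expr.eval, e₉, hpos₂, hlen₂, Config.mem_setMem, ↓reduceIte,
          Nat.reduceEqDiff, Config.reg_setMem, Function.update_of_ne hj.ne']
        exact ⟨⟨h₃.congr fun i _ hi => h₂.old i (by omega), h₄⟩, by omega⟩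

open OrthoPlus.Expr in
/-- Write the normal forms of all nodes. -/
def emitAll : Cmd :=
  .seq (.set rG (reg rQn)) <|
  .whileDo (reg rG) (.seq (.set rG (sub (reg rG) (const 1))) emitNode)

theorem emitAll_spec : ∃ C, ∀ (s : Config) (D : ℕ → NTerm) (N W M n : ℕ) (t : NTerm),
    (Table s.mem N D W M fun _ _ => True) → QueueOK s.mem D M n n t → n ≤ t.size → 0 < n →
    s.reg rQn = n →
    Tri emitAll s (C * ((t.size + 1) * (t.size + 1))) fun s' => TextAt s'.mem 0 t.text := by
  obtain ⟨C, hC⟩ := emitNode_spec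
  refine ⟨3 * (C + 50) + 50, fun s D N W M n t hT hQ hnt hn hq => ?_⟩
  refine Tri.step ((C + 50) * ((s.mem aStart n + 2 * n) * (t.size + 1)) + 10) rfl ?_ ?_
  -- `aStart q` is one more than the number of children of all entries before `q`. Going from `q +
  -- 1` to `q` therefore releases `k + 2` units of budget for a node with `k` children, and `aStart
  -- n = n` bounds the total by `3 * n`.
  · refine (Tri.while_of (Q := fun s' => TextAt s'.mem 0 t.text) (fun b s' => ∃ q ≤ n,
      s'.reg rG = q ∧ Emission s D n q s' ∧
      (C + 50) * ((s.mem aStart q + 2 * q) * (t.size + 1)) ≤ b) ?_ ?_ ⟨n, le_rfl, ?_, ⟨?_, ?_⟩,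
      le_rfl⟩).mono ?_ fun _ h => h
    · rintro b s' ⟨q, hqn, h₁, h₂, h₃⟩ he
      obtain ⟨q, rfl⟩ : ∃ q', q = q' + 1 := ⟨q - 1, by simp only [Expr.eval] at he; omega⟩
      have hst := (hQ.start q hqn).1
      rw [hst] at h₃
      set k := (children (D (s.mem aQueue q))).length
      have hpos : 1 ≤ (k + 1) * (t.size + 1) := Nat.mul_pos (Nat.succ_pos _) (Nat.succ_pos _)
      refine ⟨C * ((k + 1) * (t.size + 1)) + 40,
        (C + 50) * ((s.mem aStart q + 2 * q) * (t.size + 1)), le_trans ?_ h₃, ?_⟩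
      · have h₄ : (C + 50) * ((s.mem aStart q + k + 2 * (q + 1)) * (t.size + 1)) =
            C * ((k + 1) * (t.size + 1)) + (C * (t.size + 1) + 50 * ((k + 1) * (t.size + 1)) +
              50 * (t.size + 1)) + (C + 50) * ((s.mem aStart q + 2 * q) * (t.size + 1)) := by ring
        rw [h₄]
        simp only [Expr.cost]
        omega
      · refine Tri.step (C * ((k + 1) * (t.size + 1))) rfl ?_ (by
          simp only [Cmd.cost, Expr.cost]; omega)
        refine (hC s _ D N W M n q t hT hQ hqn (by simp [Cmd.run, Expr.eval, h₁]) ⟨?_, ?_⟩).frame.mono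
          le_rfl fun s'' h => ⟨q, by omega, (h.2.reg _ (by decide)).trans (by
            simp [Cmd.run, Expr.eval, h₁]), h.1, le_rfl⟩
        · exact h₂.mem
        · simpa [Cmd.run] using h₂.text
    · rintro b s' ⟨q, hqn, h₁, h₂, h₃⟩ he
      obtain rfl : q = 0 := h₁.symm.trans he
      have := (h₂.text 0 le_rfl hn).1
      rwa [hQ.root] at this
    · simp [Cmd.run, Expr.eval, hq]
    · exact fun _ _ => rfl
    · exact fun j h₁ h₂ => absurd h₂ (by omega)
    · simp only [Expr.cost]
      omega
  · rw [hQ.last]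
    simp only [Cmd.cost, Expr.cost]
    have h₁ : (n + 2 * n) * (t.size + 1) ≤ 3 * ((t.size + 1) * (t.size + 1)) := by nlinarith
    have h₂ := Nat.mul_le_mul_left (C + 50) h₁
    have h₃ : 1 ≤ (t.size + 1) * (t.size + 1) := Nat.mul_pos (Nat.succ_pos _) (Nat.succ_pos _)
    have h₄ : (3 * (C + 50) + 50) * ((t.size + 1) * (t.size + 1)) =
      (C + 50) * (3 * ((t.size + 1) * (t.size + 1))) + 50 * ((t.size + 1) * (t.size + 1)) := by ring
    omega

open OrthoPlus.Expr in
/-- Copy the text of the root to the output. -/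
def copyOut : Cmd :=
  .seq (.set rI (const 0)) <|
  .upTo rI (load aLen (const 0)) <|
    .write aOut (reg rI) (load aText (add (load aPos (const 0)) (reg rI)))

theorem copyOut_spec {s : Config} {w : List ℕ} (h : TextAt s.mem 0 w) :
    Tri copyOut s (200 * (w.length + 1)) fun s' => s'.reg rI = w.length ∧
      Holds (s'.mem aOut) 0 w := by
  refine Tri.step (w.length * (50 + 50) + 100) rfl ?_ (by simp only [Cmd.cost, Expr.cost]; omega)
  refine (Tri.upTo_const (n := w.length) (t := 50) (I := fun i s' => s'.reg rI = i ∧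
    (∀ a ≠ aOut, s'.mem a = s.mem a) ∧ Holds (s'.mem aOut) 0 (w.take i)) ?_ ?_ ?_ ?_).mono ?_ ?_
  · exact fun i s h => h.1
  · rintro i s' ⟨-, h₂, -⟩
    simp only [Expr.eval, h₂ aLen (by decide), h.2]
  · rintro i s' hi ⟨h₁, h₂, h₃⟩
    refine Tri.block rfl (by decide) ⟨by simp [Cmd.run, h₁], by simp, fun a ha => ?_, ?_⟩
    · simp [Cmd.run, ha, h₂ a ha]
    · have h₄ := h.1 i hi
      have h₅ := h₃.snoc (c := w[i])
      rw [List.length_take_of_le hi.le, Nat.zero_add] at h₅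
      rw [List.take_add_one, List.getElem?_eq_getElem hi, Option.toList_some]
      simpa [Cmd.run, Expr.eval, h₁, h₂ aText (by decide), h₂ aPos (by decide), h₄] using h₅
  · exact ⟨by simp [Cmd.run, Expr.eval], fun _ _ => rfl, by simpa using Holds.nil⟩
  · simp only [Cmd.upToCost, Expr.cost]
    omega
  · rintro s' ⟨h₁, -, h₃⟩
    rw [List.take_length] at h₃
    exact ⟨h₁, h₃⟩


/-! ### The whole program -/

/-- Compute the normal form of the input. -/
def normalize : Cmd :=
  .seq tokenize <| .seq (.set rLen (.reg rTok)) <| .seq multiples <| .seq processAll <|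
  .seq buildQueue <| .seq emitAll copyOut

theorem Term.nodes_pos (t : Term) : 0 < t.nodes := by
  cases t <;> simp [Term.nodes]

theorem Term.size_le_nodes (t : Term) : t.size ≤ t.nodes := by
  induction t with
  | app f x ih =>
    simp only [Term.size, Term.nodes]
    exact Nat.succ_le_succ (Finset.sum_le_sum fun a _ => ih a)
  | _ => simp only [Term.size, Term.nodes]; omega

theorem holds_input (w : List ℕ) : Holds ((Config.input w).mem aIn) 0 w := fun i hi => by
  simp [Config.input, hi]

theorem agree_input (w : List ℕ) : Agree (Config.input w) (Config.input w) :=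
  ⟨fun x => by simp [Config.input], rfl⟩

theorem normalize_spec : ∃ C, ∀ t : Term,
    Tri normalize (Config.input t.encode) (C * (t.nodes * t.nodes)) fun s' =>
      s'.reg rI = (beta (delta t)).text.length ∧
      Holds (s'.mem aOut) 0 (beta (delta t)).text := by
  obtain ⟨C₁, hC₁⟩ := tokenize_spec
  obtain ⟨C₂, hC₂⟩ := multiples_spec
  obtain ⟨C₃, hC₃⟩ := processAll_spec
  obtain ⟨C₄, hC₄⟩ := emitAll_spec
  -- One summand for each phase. The factors `2` and `4` come from `N + 1 ≤ 2 * N` and `(u.size +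
  -- 1)² ≤ 4 * N²`, and `1400` is `200 * 7`, as the output has at most `6 * N` numbers.
  refine ⟨2 * C₁ + (10 + (2 * C₂ + ((C₃ + 3) + (40000 + (4 * C₄ + 1400))))), fun t => ?_⟩
  set l := t.toks with hl
  set u := beta (delta t) with hu
  set s := Config.input t.encode with hs
  have hn : l.length = t.nodes := t.length_toks
  have hsz : u.size ≤ t.nodes := by
    have h₁ := size_beta_le (delta t)
    have h₂ : (delta t).size = t.size := size_deltaAux t true
    have h₃ := t.size_le_nodes
    rw [← hu] at h₁
    omega
  have hpos := t.nodes_pos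
  set N := t.nodes with hN
  have hNN : N ≤ N * N := Nat.le_mul_self N
  have hsq : (u.size + 1) * (u.size + 1) ≤ 4 * (N * N) := by nlinarith
  have hin : Holds (s.mem aIn) 0 (l.flatMap Tok.encode) := by
    rw [hl, ← t.encode_eq]
    exact holds_input _
  have hlen : s.reg rLen = (l.flatMap Tok.encode).length := by
    rw [hl, ← t.encode_eq]
    simp [hs, Config.input]
  have hreg : ∀ x ≠ rLen, s.reg x = 0 := fun x hx => by simp [hs, Config.input, hx]
  have hmem : ∀ a ≠ aIn, ∀ i, s.mem a i = 0 := fun a ha i => by simp [hs, Config.input, ha]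
  have hadd : ∀ a b, (a + b) * (N * N) = a * (N * N) + b * (N * N) := fun a b => Nat.add_mul _ _ _
  rw [hadd]
  refine Tri.seqFrame _ (hC₁ l s hin hlen (hreg _ (by decide)) (hreg _ (by decide)))
    (fun s₁ h₁ hf₁ => ?_) (Nat.add_le_add_right (by
      rw [hn, Nat.mul_comm 2, Nat.mul_assoc]
      exact Nat.mul_le_mul_left _ (by omega)) _)
  obtain ⟨h₁, htok⟩ := h₁
  rw [hadd]
  refine Tri.step _ rfl ?_ (Nat.add_le_add_right (by simp only [Cmd.cost, Expr.cost]; omega) _)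
  set s₂ := Cmd.run _ s₁ with hs₂
  have e₁ : s₂.reg rLen = N := by simp [hs₂, Cmd.run, Expr.eval, h₁, hn]
  have e₂ : s₂.mem = s₁.mem := rfl
  have e₃ : ∀ x ≠ rLen, s₂.reg x = s₁.reg x := fun x hx => by simp [hs₂, Cmd.run, hx]
  clear_value s₂
  rw [hadd]
  refine Tri.seqFrame _ (hC₂ s₂ (by rw [e₂, hf₁.mem _ (by decide), hmem _ (by decide)]))
    (fun s₃ h₃ hf₃ => ?_) (Nat.add_le_add_right (by
      rw [e₁, Nat.mul_comm 2, Nat.mul_assoc]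
      exact Nat.mul_le_mul_left _ (by omega)) _)
  have hreg₃ : ∀ x ∉ tokenize.regs ++ rLen :: multiples.regs, s₃.reg x = s.reg x := fun x hx => by
    rw [List.mem_append, List.mem_cons, not_or, not_or] at hx
    rw [hf₃.reg x hx.2.2, e₃ x hx.2.1, hf₁.reg x hx.1]
  rw [hadd]
  refine Tri.seqFrame _ (hC₃ s₃ l u ?_ ?_ ?_ ?_ ?_ ?_ ?_ (steps_toks t []))
    (fun s₄ h₄ hf₄ => ?_) (Nat.add_le_add_right (by rw [hn, Nat.add_mul]; omega) _)
  · rw [hf₃.reg _ (by decide), e₃ _ (by decide), h₁]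
  · rw [hreg₃ _ (by decide), hreg _ (by decide)]
  · rw [hreg₃ _ (by decide), hreg _ (by decide)]
  · rw [hreg₃ _ (by decide), hreg _ (by decide)]
  · rw [hn, ← e₁]
    exact h₃.2
  · rw [hf₃.mem _ (by decide), e₂, hf₁.mem _ (by decide)]
    exact hin
  · rw [hf₃.mem _ (by decide), e₂]
    exact htok
  obtain ⟨D, M, hM, hst⟩ := h₄
  rw [hadd]
  refine Tri.seqFrame _ (buildQueue_spec hst) (fun s₅ h₅ hf₅ => ?_)
    (Nat.add_le_add_right (by omega) _)
  obtain ⟨n, hnu, hn₀, hq, hQ, hT⟩ := h₅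
  rw [hadd]
  refine Tri.seqFrame _ (hC₄ s₅ D _ _ _ n u hT hQ hnu hn₀ hq) (fun s₆ h₆ hf₆ => ?_)
    (Nat.add_le_add_right ?_ _)
  · refine (copyOut_spec h₆).mono ?_ fun _ h => h
    have := u.length_text_le
    omega
  · rw [Nat.mul_comm 4, Nat.mul_assoc]
    exact Nat.mul_le_mul_left _ hsq

theorem computableInQuadraticTime_canon :
    ComputableInQuadraticTime fun t => (canon (beta (delta t))).toTerm := by
  obtain ⟨C, hC⟩ := normalize_spec
  -- The length of the output ends up in the variable `rI`, that is in register `2 * rI`; two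
  -- further instructions copy it to register `1`, which serves as auxiliary register until then.
  refine ⟨.seq normalize.compile (.seq (.const 1 0) (.add 1 (2 * rI) 1)), C + 2, fun t => ?_⟩
  obtain ⟨n, s₁, s', h₁, h₂, h₃, h₄, h₅⟩ := hC t _ (agree_input _)
  refine ⟨_, _, .seq h₁ (.seq (.const _ _ _) (.add _ _ _ _)), ⟨?_, fun i hi => ?_⟩, ?_⟩
  · rw [← NTerm.text, ← h₄, ← h₃.1 rI]
    simp
  · have := h₅ i hi
    rw [Nat.zero_add, ← h₃.2] at this
    exact this
  · have := t.nodes_pos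
    have : 1 ≤ t.nodes ^ 2 := Nat.one_le_pow _ _ this
    rw [Nat.add_mul, sq] at *
    omega


end OrthoPlus

theorem mainTheorem3 :
    OrthoPlus.IsNormalFormFunction (fun t : OrthoPlus.Term =>
      (OrthoPlus.eta (OrthoPlus.zeta (OrthoPlus.beta (OrthoPlus.delta t)))).toTerm) ∧
    OrthoPlus.ComputableInQuadraticTime (fun t : OrthoPlus.Term =>
      (OrthoPlus.eta (OrthoPlus.zeta (OrthoPlus.beta (OrthoPlus.delta t)))).toTerm) := by
  exact ⟨OrthoPlus.isNormalFormFunction_canon, OrthoPlus.computableInQuadraticTime_canon⟩
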